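/- Let $R$ be a commutative ring in which $2$ is not a zero divisor, let $d\ge 1$, let $l\ge 1$ be odd, and let $f\in R[x]$ be monic of degree $l$ such that only powers of $x$ of odd exponent occur in $f$. **The algebra.** The affine Sergeev superalgebra $\mathcal S_d$ is the $R$-algebra generated by the group algebra $R\Sigma_d$ (with simple transpositions $\hat s_i=(i\ i{+}1)$), by commuting elements $\hat x_1,\dots,\hat x_d$, and by elements $\hat c_1,\dots,\hat c_d$ with $\hat c_i^2=1$ and $\hat c_i\hat c_j=-\hat c_j\hat c_i$ for $i\ne j$, subject to $\hat x_i\hat c_i=-\hat c_i\hat x_i$; $\hat x_i\hat c_j=\hat c_j\hat x_i$ for $j\neq i$; $\hat s_i\hat c_i=\hat c_{i+1}\hat s_i$; $\hat s_i\hat x_i=\hat x_{i+1}\hat s_i-1-\hat c_i\hat c_{i+1}$; and $\hat s_i\hat c_j=\hat c_j\hat s_i$, $\hat s_i\hat x_j=\hat x_j\hat s_i$ for $j\ne i,i+1$. The $\hat c_i$ are odd and the other generators are even. Let $\mathcal S_d^f=\mathcal S_d/(f(\hat x_1))$, filtered by letting $F_k\mathcal S^f_d$ be the span of the words in the generators containing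 at most $k$ factors $\hat x_i$, and let $\operatorname{gr}\mathcal S_d^f=\bigoplus_k F_k/F_{k-1}$ be the associated graded superalgebra, generated by the symbols $x_i$ (degree $1$), $c_i$ and $w\in\Sigma_d$ (degree $0$). Let $Z(\operatorname{gr}\mathcal S^f_d)$ be its (even) center, i.e. the $R$-module of even elements that commute with all elements. **CX-cycles.** For an ordered subset $A=\{i_1,\dots,i_a\}$ of $\{1,\dots,d\}$ write $\sigma_A=(i_1\ \dots\ i_a)\in\Sigma_d$, and for $\alpha\in\{0,1\}^a$ put $|\alpha|=\sum_j\alpha_j$, $c_\alpha(A)=c_{i_1}^{\alpha_1}\cdots c_{i_a}^{\alpha_a}$ and $\epsilon^\alpha_j=\prod_{k<j}(-1)^{\alpha_k}$. For $r\ge 0$ put $$h_r^\alpha(A)=\sum_{r_1+\dots+r_a=(a-1)(l-1)+r}(\epsilon^\alpha_1x_{i_1})^{r_1}\cdots(\epsilon^\alpha_ax_{i_a})^{r_a},\qquad A^{(r)}=\sum_{|\alpha|\text{ even}}(-1)^{\frac12|\alpha|+\sum_j j\alpha_j}\,h_r^\alpha(A)\,\sigma_A\,c_\alpha(A).$$ Call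 $A^{(r)}$ a CX-cycle if $(a-1)l+r$ is even. Consider products $A_1^{(r_1)}\cdots A_m^{(r_m)}$ of CX-cycles with $0\le r_i<l$ such that the (nonempty) $A_i$ partition $\{1,\dots,d\}$. The cycle type of such a product is the $l$-multipartition $\lambda=(\lambda^{(1)},\dots,\lambda^{(l)})$ of $d$ in which the parts of $\lambda^{(r)}$ are the $|A_i|$ with $r_i=r-1$. Let $\mathcal M^{\rm ev}_d(l)$ be the set of all $l$-multipartitions of $d$ that occur in this way, and for $\lambda\in\mathcal M_d^{\rm ev}(l)$ let $z_d(\lambda)\in\operatorname{gr}\mathcal S_d^f$ be the sum of all (distinct) such products of cycle type $\lambda$. **Theorem.** (1) The elements $z_d(\lambda)$, $\lambda\in\mathcal M^{\rm ev}_d(l)$, form a basis of the $R$-module $Z(\operatorname{gr}\mathcal S_d^f)$. (2) Let $A$ be an ordered subset of $\{1,\dots,d\}$ and let $z=p\,\sigma_A\,c$ be an odd skew cycle on $A$: $p$ is a polynomial in the $x_i$ with $i\in A$, $c$ lies in the subalgebra generated by the $c_i$ with $i\in A$, and $z$ is odd, commutes with $x_1,\dots,x_d$ and satisfies $c_iz=-zc_i$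 for $i=1,\dots,d$. Then $\sum_{\tau}\tau z\tau^{-1}=0$, both when $\tau$ runs over the permutations in $\Sigma_d$ that fix every point outside $A$ and when $\tau$ runs over all of $\Sigma_d$. -/

import Mathlib

open scoped DirectSum

/-! ## The associated graded algebra of a filtered algebra -/

/-- An increasing algebra filtration `F 0 ≤ F 1 ≤ ...` of an `R`-algebra by submodules. -/
structure AlgFiltration (R S : Type*) [CommRing R] [Ring S] [Algebra R S] where
  F : ℕ → Submodule R S
  mono : Monotone F
  one_mem : (1 : S) ∈ F 0
  mul_mem : ∀ {i j : ℕ} {a b : S}, a ∈ F i → b ∈ F j → a * b ∈ F (i + j)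

namespace AlgFiltration

variable {R S : Type*} [CommRing R] [Ring S] [Algebra R S] (W : AlgFiltration R S)

/-- The previous step of the filtration: `F (k - 1)`, which is `0` for `k = 0`. -/
def prev : ℕ → Submodule R S
  | 0 => ⊥
  | k + 1 => W.F k

theorem prev_mul_mem {i j : ℕ} {a b : S} (ha : a ∈ W.prev i) (hb : b ∈ W.F j) :
    a * b ∈ W.prev (i + j) := by
  cases i with
  | zero =>
    have h0 : a = 0 := by simpa [prev] using ha
    subst h0
    simp
  | succ i =>
    rw [Nat.succ_add]
    exact W.mul_mem (i := i) ha hb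

theorem mul_prev_mem {i j : ℕ} {a b : S} (ha : a ∈ W.F i) (hb : b ∈ W.prev j) :
    a * b ∈ W.prev (i + j) := by
  cases j with
  | zero =>
    have h0 : b = 0 := by simpa [prev] using hb
    subst h0
    simp
  | succ j => exact W.mul_mem (j := j) ha hb

/-- The `k`-th graded piece `F k / F (k - 1)`. -/
def Piece (k : ℕ) : Type _ := W.F k ⧸ (W.prev k).submoduleOf (W.F k)

instance instPieceAddCommGroup (k : ℕ) : AddCommGroup (W.Piece k) :=
  inferInstanceAs (AddCommGroup (W.F k ⧸ (W.prev k).submoduleOf (W.F k)))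

instance instPieceModule (k : ℕ) : Module R (W.Piece k) :=
  inferInstanceAs (Module R (W.F k ⧸ (W.prev k).submoduleOf (W.F k)))

/-- The class of `a ∈ F k` in `F k / F (k - 1)`. -/
def toPiece (k : ℕ) (a : S) (ha : a ∈ W.F k) : W.Piece k :=
  Submodule.Quotient.mk ⟨a, ha⟩

theorem toPiece_congr {k : ℕ} {a b : S} (ha : a ∈ W.F k) (hb : b ∈ W.F k) (h : a = b) :
    W.toPiece k a ha = W.toPiece k b hb := by
  subst h
  rfl

theorem toPiece_add {k : ℕ} {a b : S} (ha : a ∈ W.F k) (hb : b ∈ W.F k) :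
    W.toPiece k (a + b) ((W.F k).add_mem ha hb) = W.toPiece k a ha + W.toPiece k b hb := rfl

theorem toPiece_smul {k : ℕ} {a : S} (r : R) (ha : a ∈ W.F k) :
    W.toPiece k (r • a) ((W.F k).smul_mem r ha) = r • W.toPiece k a ha := rfl

theorem exists_toPiece {k : ℕ} (p : W.Piece k) :
    ∃ (a : S) (ha : a ∈ W.F k), p = W.toPiece k a ha := by
  obtain ⟨⟨a, ha⟩, rfl⟩ := Submodule.Quotient.mk_surjective _ p
  exact ⟨a, ha, rfl⟩

/-- Multiplication `F i × F j → F (i + j) / F (i + j - 1)`. -/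
def mulAux (i j : ℕ) : W.F i →ₗ[R] W.F j →ₗ[R] W.Piece (i + j) :=
  LinearMap.mk₂ R (fun a b => W.toPiece (i + j) (a.1 * b.1) (W.mul_mem a.2 b.2))
    (fun a a' b => W.toPiece_congr _ _ (add_mul a.1 a'.1 b.1))
    (fun r a b => W.toPiece_congr _ _ (smul_mul_assoc r a.1 b.1))
    (fun a b b' => W.toPiece_congr _ _ (mul_add a.1 b.1 b'.1))
    (fun r a b => W.toPiece_congr _ _ (mul_smul_comm r a.1 b.1))

/-- Multiplication of graded pieces, induced by the multiplication of `S`. -/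
def pieceMul (i j : ℕ) : W.Piece i →ₗ[R] W.Piece j →ₗ[R] W.Piece (i + j) :=
  Submodule.liftQ _
    (LinearMap.flip (Submodule.liftQ _ (W.mulAux i j).flip (by
      intro b hb
      rw [LinearMap.mem_ker]
      ext a
      exact (Submodule.Quotient.mk_eq_zero _).2 (W.mul_prev_mem a.2 hb))))
    (by
      intro a ha
      rw [LinearMap.mem_ker]
      apply LinearMap.ext
      intro p
      obtain ⟨b, rfl⟩ := Submodule.Quotient.mk_surjective _ p
      exact (Submodule.Quotient.mk_eq_zero _).2 (W.prev_mul_mem ha b.2))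

theorem pieceMul_toPiece {i j : ℕ} {a b : S} (ha : a ∈ W.F i) (hb : b ∈ W.F j) :
    W.pieceMul i j (W.toPiece i a ha) (W.toPiece j b hb) =
      W.toPiece (i + j) (a * b) (W.mul_mem ha hb) := rfl

theorem sigma_toPiece_eq {i j : ℕ} {a b : S} (ha : a ∈ W.F i) (hb : b ∈ W.F j)
    (hij : i = j) (hab : a = b) :
    (⟨i, W.toPiece i a ha⟩ : GradedMonoid W.Piece) = ⟨j, W.toPiece j b hb⟩ := by
  subst hij
  subst hab
  rfl

instance instGOne : GradedMonoid.GOne W.Piece := ⟨W.toPiece 0 1 W.one_mem⟩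

instance instGMul : GradedMonoid.GMul W.Piece := ⟨fun {i j} a b => W.pieceMul i j a b⟩

noncomputable instance instGRing : DirectSum.GRing W.Piece where
  mul_zero a := map_zero _
  zero_mul b := LinearMap.map_zero₂ _ b
  mul_add a b b' := map_add _ b b'
  add_mul a a' b := LinearMap.map_add₂ _ a a' b
  one_mul := by
    rintro ⟨i, p⟩
    obtain ⟨a, ha, rfl⟩ := W.exists_toPiece p
    exact W.sigma_toPiece_eq _ _ (zero_add i) (one_mul a)
  mul_one := by
    rintro ⟨i, p⟩
    obtain ⟨a, ha, rfl⟩ := W.exists_toPiece p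
    exact W.sigma_toPiece_eq _ _ (add_zero i) (mul_one a)
  mul_assoc := by
    rintro ⟨i, p⟩ ⟨j, q⟩ ⟨k, s⟩
    obtain ⟨a, ha, rfl⟩ := W.exists_toPiece p
    obtain ⟨b, hb, rfl⟩ := W.exists_toPiece q
    obtain ⟨c, hc, rfl⟩ := W.exists_toPiece s
    exact W.sigma_toPiece_eq _ _ (add_assoc i j k) (mul_assoc a b c)
  natCast n := n • W.toPiece 0 1 W.one_mem
  natCast_zero := zero_nsmul _
  natCast_succ n := succ_nsmul _ n
  intCast n := n • W.toPiece 0 1 W.one_mem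
  intCast_ofNat n := natCast_zsmul _ n
  intCast_negSucc_ofNat n := negSucc_zsmul _ n

theorem algebraMap_mem (r : R) : algebraMap R S r ∈ W.F 0 := by
  rw [Algebra.algebraMap_eq_smul_one]
  exact (W.F 0).smul_mem r W.one_mem

noncomputable instance instGAlgebra : DirectSum.GAlgebra R W.Piece where
  toFun :=
    { toFun := fun r => W.toPiece 0 (algebraMap R S r) (W.algebraMap_mem r)
      map_zero' := (Submodule.Quotient.mk_eq_zero _).2 (by
        simp [Submodule.submoduleOf])
      map_add' := fun r s => W.toPiece_congr _ _ (map_add _ r s) }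
  map_one := W.toPiece_congr _ _ (map_one _)
  map_mul r s := W.sigma_toPiece_eq _ (W.mul_mem (W.algebraMap_mem r) (W.algebraMap_mem s))
    (zero_add 0).symm (map_mul _ r s)
  commutes := by
    rintro r ⟨i, p⟩
    obtain ⟨a, ha, rfl⟩ := W.exists_toPiece p
    exact W.sigma_toPiece_eq (W.mul_mem (W.algebraMap_mem r) ha)
      (W.mul_mem ha (W.algebraMap_mem r))
      (add_comm 0 i) (Algebra.commutes r a)
  smul_def := by
    rintro r ⟨i, p⟩
    obtain ⟨a, ha, rfl⟩ := W.exists_toPiece p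
    exact W.sigma_toPiece_eq ((W.F i).smul_mem r ha) (W.mul_mem (W.algebraMap_mem r) ha)
      (zero_add i).symm (Algebra.smul_def r a)

/-- The associated graded algebra `⨁ k, F k / F (k - 1)`. -/
abbrev Gr : Type _ := ⨁ k, W.Piece k

/-- The symbol in degree `k` of an element of `F k`. -/
noncomputable def symb (k : ℕ) (a : S) (ha : a ∈ W.F k) : W.Gr :=
  DirectSum.of W.Piece k (W.toPiece k a ha)

end AlgFiltration

/-! ## Affine and cyclotomic Sergeev superalgebras -/

/-- Generators: the elements of the symmetric group, the polynomial generators and the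
Clifford generators. -/
inductive SergeevGen (d : ℕ)
  | perm (w : Equiv.Perm (Fin d))
  | x (i : Fin d)
  | c (i : Fin d)

namespace SergeevGen

/-- The filtered degree of a generator. -/
def deg {d : ℕ} : SergeevGen d → ℕ
  | perm _ => 0
  | x _ => 1
  | c _ => 0

/-- The number of Clifford generators, which determines the parity. -/
def par {d : ℕ} : SergeevGen d → ℕ
  | perm _ => 0
  | x _ => 0
  | c _ => 1

end SergeevGen

section Sergeev

variable (R : Type*) [CommRing R] (d : ℕ)

/-- Defining relations of the affine Sergeev superalgebra. The relations `perm_one`, `perm_mul`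
say that the generators `perm w` satisfy the relations of the group algebra of the symmetric group;
the Coxeter generator `s_i` is `perm (swap i j)` with `j = i + 1`. -/
inductive SergeevRel : FreeAlgebra R (SergeevGen d) → FreeAlgebra R (SergeevGen d) → Prop
  | perm_one : SergeevRel (FreeAlgebra.ι R (.perm 1)) 1
  | perm_mul (v w : Equiv.Perm (Fin d)) :
      SergeevRel (FreeAlgebra.ι R (.perm (v * w)))
        (FreeAlgebra.ι R (.perm v) * FreeAlgebra.ι R (.perm w))
  | x_comm (i j : Fin d) :
      SergeevRel (FreeAlgebra.ι R (.x i) * FreeAlgebra.ι R (.x j))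
        (FreeAlgebra.ι R (.x j) * FreeAlgebra.ι R (.x i))
  | c_sq (i : Fin d) : SergeevRel (FreeAlgebra.ι R (.c i) * FreeAlgebra.ι R (.c i)) 1
  | c_anti (i j : Fin d) (h : i ≠ j) :
      SergeevRel (FreeAlgebra.ι R (.c i) * FreeAlgebra.ι R (.c j))
        (-(FreeAlgebra.ι R (.c j) * FreeAlgebra.ι R (.c i)))
  | x_c_self (i : Fin d) :
      SergeevRel (FreeAlgebra.ι R (.x i) * FreeAlgebra.ι R (.c i))
        (-(FreeAlgebra.ι R (.c i) * FreeAlgebra.ι R (.x i)))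
  | x_c_ne (i j : Fin d) (h : j ≠ i) :
      SergeevRel (FreeAlgebra.ι R (.x i) * FreeAlgebra.ι R (.c j))
        (FreeAlgebra.ι R (.c j) * FreeAlgebra.ι R (.x i))
  | s_c (i j : Fin d) (hij : (i : ℕ) + 1 = j) :
      SergeevRel (FreeAlgebra.ι R (.perm (Equiv.swap i j)) * FreeAlgebra.ι R (.c i))
        (FreeAlgebra.ι R (.c j) * FreeAlgebra.ι R (.perm (Equiv.swap i j)))
  | s_c_ne (i j k : Fin d) (hij : (i : ℕ) + 1 = j) (hi : k ≠ i) (hj : k ≠ j) :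
      SergeevRel (FreeAlgebra.ι R (.perm (Equiv.swap i j)) * FreeAlgebra.ι R (.c k))
        (FreeAlgebra.ι R (.c k) * FreeAlgebra.ι R (.perm (Equiv.swap i j)))
  | s_x (i j : Fin d) (hij : (i : ℕ) + 1 = j) :
      SergeevRel (FreeAlgebra.ι R (.perm (Equiv.swap i j)) * FreeAlgebra.ι R (.x i))
        (FreeAlgebra.ι R (.x j) * FreeAlgebra.ι R (.perm (Equiv.swap i j))
          - 1 - FreeAlgebra.ι R (.c i) * FreeAlgebra.ι R (.c j))
  | s_x_ne (i j k : Fin d) (hij : (i : ℕ) + 1 = j) (hi : k ≠ i) (hj : k ≠ j) :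
      SergeevRel (FreeAlgebra.ι R (.perm (Equiv.swap i j)) * FreeAlgebra.ι R (.x k))
        (FreeAlgebra.ι R (.x k) * FreeAlgebra.ι R (.perm (Equiv.swap i j)))

/-- The affine Sergeev superalgebra `S_d`. -/
def AffineSergeev : Type _ := RingQuot (SergeevRel R d)

noncomputable instance instAffineSergeevRing : Ring (AffineSergeev R d) :=
  inferInstanceAs (Ring (RingQuot (SergeevRel R d)))

noncomputable instance instAffineSergeevAlgebra : Algebra R (AffineSergeev R d) :=
  inferInstanceAs (Algebra R (RingQuot (SergeevRel R d)))

/-- The canonical projection from the free algebra. -/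
noncomputable def affMk : FreeAlgebra R (SergeevGen d) →ₐ[R] AffineSergeev R d :=
  RingQuot.mkAlgHom R (SergeevRel R d)

variable {R d}

/-- The image of a generator in the affine Sergeev superalgebra. -/
noncomputable def affGen (g : SergeevGen d) : AffineSergeev R d :=
  affMk R d (FreeAlgebra.ι R g)

/-- The relation `f(x_1) = 0`; the first index is `0 : Fin d`. -/
inductive CyclotomicRel (d : ℕ) (f : Polynomial R) : AffineSergeev R d → AffineSergeev R d → Prop
  | mk (i : Fin d) (hi : (i : ℕ) = 0) : CyclotomicRel d f (Polynomial.aeval (affGen (.x i)) f) 0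

/-- The cyclotomic Sergeev superalgebra `S_d^f`: the quotient of `S_d` by the two-sided ideal
generated by `f(x_1)`. -/
def CycSergeev (d : ℕ) (f : Polynomial R) : Type _ := RingQuot (CyclotomicRel d f)

noncomputable instance instCycSergeevRing (f : Polynomial R) : Ring (CycSergeev d f) :=
  inferInstanceAs (Ring (RingQuot (CyclotomicRel d f)))

noncomputable instance instCycSergeevAlgebra (f : Polynomial R) : Algebra R (CycSergeev d f) :=
  inferInstanceAs (Algebra R (RingQuot (CyclotomicRel d f)))

/-- The canonical projection from the affine to the cyclotomic Sergeev superalgebra. -/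
noncomputable def cycMk (f : Polynomial R) : AffineSergeev R d →ₐ[R] CycSergeev d f :=
  RingQuot.mkAlgHom R (CyclotomicRel d f)

/-- The image of a generator in the cyclotomic Sergeev superalgebra. -/
noncomputable def cycGen (f : Polynomial R) (g : SergeevGen d) : CycSergeev d f :=
  cycMk f (affGen g)

/-- `F_k S_d^f` is spanned by the words in the generators that contain at most `k` polynomial
generators. -/
noncomputable def cycFiltration (d : ℕ) (f : Polynomial R) : AlgFiltration R (CycSergeev d f) where
  F k := Submodule.span R
    {y | ∃ w : List (SergeevGen d), (w.map SergeevGen.deg).sum ≤ k ∧ y = (w.map (cycGen f)).prod}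
  mono := by
    intro i j hij
    apply Submodule.span_mono
    rintro y ⟨w, hw, rfl⟩
    exact ⟨w, hw.trans hij, rfl⟩
  one_mem := Submodule.subset_span ⟨[], by simp, by simp⟩
  mul_mem := by
    intro i j a b ha hb
    have h := Submodule.mul_mem_mul ha hb
    rw [Submodule.span_mul_span] at h
    refine Submodule.span_mono ?_ h
    rintro _ ⟨_, ⟨v, hv, rfl⟩, _, ⟨w, hw, rfl⟩, rfl⟩
    exact ⟨v ++ w, by simpa using add_le_add hv hw, by simp⟩

/-- The associated graded superalgebra `gr S_d^f`. -/
abbrev GrSergeev (d : ℕ) (f : Polynomial R) : Type _ := (cycFiltration d f).Gr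

theorem cycGen_mem (f : Polynomial R) (g : SergeevGen d) :
    cycGen f g ∈ (cycFiltration d f).F g.deg :=
  Submodule.subset_span ⟨[g], by simp, by simp⟩

/-- The generators of `gr S_d^f`: the symbols of the generators of `S_d^f`, those of the
polynomial generators being taken in degree one and all others in degree zero. -/
noncomputable def grGen (f : Polynomial R) (g : SergeevGen d) : GrSergeev d f :=
  (cycFiltration d f).symb g.deg (cycGen f g) (cycGen_mem f g)

/-- The polynomial generator `x_i` of `gr S_d^f`. -/
noncomputable def grX (f : Polynomial R) (i : Fin d) : GrSergeev d f := grGen f (.x i)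

/-- The Clifford generator `c_i` of `gr S_d^f`. -/
noncomputable def grC (f : Polynomial R) (i : Fin d) : GrSergeev d f := grGen f (.c i)

/-- The element of `gr S_d^f` given by a permutation. -/
noncomputable def grPerm (f : Polynomial R) (w : Equiv.Perm (Fin d)) : GrSergeev d f :=
  grGen f (.perm w)

/-- The even part of `gr S_d^f`: the span of words with an even number of Clifford generators. -/
noncomputable def grEven (d : ℕ) (f : Polynomial R) : Submodule R (GrSergeev d f) :=
  Submodule.span R
    {y | ∃ w : List (SergeevGen d), Even (w.map SergeevGen.par).sum ∧ y = (w.map (grGen f)).prod}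

/-- The odd part of `gr S_d^f`: the span of words with an odd number of Clifford generators. -/
noncomputable def grOdd (d : ℕ) (f : Polynomial R) : Submodule R (GrSergeev d f) :=
  Submodule.span R
    {y | ∃ w : List (SergeevGen d), Odd (w.map SergeevGen.par).sum ∧ y = (w.map (grGen f)).prod}

/-- The (even) center of `gr S_d^f`: even elements that commute with every element. -/
noncomputable def grCenter (d : ℕ) (f : Polynomial R) : Submodule R (GrSergeev d f) :=
  Subalgebra.toSubmodule (Subalgebra.center R (GrSergeev d f)) ⊓ grEven d f

/-! ## CX-cycles

An ordered subset `A = {i_1, ..., i_a}` is a list of distinct elements of `Fin d`; positions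
`1, ..., a` become `Fin A.length`, so position `j` of the text is `j - 1` here. -/

/-- The weight `|α|`. -/
def wt {a : ℕ} (α : Fin a → ZMod 2) : ℕ := ∑ j, (α j).val

/-- The exponent of the sign `ε^α_j`, namely `∑ k < j, α_k`. -/
def epsExp {a : ℕ} (α : Fin a → ZMod 2) (j : Fin a) : ℕ := ∑ k ∈ Finset.Iio j, (α k).val

/-- The exponent of the sign `τ_α`, namely `|α| / 2 + ∑ i, i α_i` with `i` running from `1`. -/
def tauExp {a : ℕ} (α : Fin a → ZMod 2) : ℕ := wt α / 2 + ∑ j : Fin a, ((j : ℕ) + 1) * (α j).val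

/-- The polynomial `h_r^α(A)`, the sum of `(ε_1 x_{i_1})^{r_1} ... (ε_a x_{i_a})^{r_a}` over
`r_1 + ... + r_a = (a - 1) (l - 1) + r`. -/
noncomputable def hPoly (f : Polynomial R) (l : ℕ) (A : List (Fin d)) (r : ℕ)
    (α : Fin A.length → ZMod 2) : GrSergeev d f :=
  ∑ e ∈ Finset.piAntidiag Finset.univ ((A.length - 1) * (l - 1) + r),
    (List.ofFn fun j : Fin A.length => ((-1) ^ epsExp α j * grX f (A.get j)) ^ e j).prod

/-- The Clifford monomial `c_α(A)`. -/
noncomputable def cliffMon (f : Polynomial R) (A : List (Fin d)) (α : Fin A.length → ZMod 2) :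
    GrSergeev d f :=
  (List.ofFn fun j : Fin A.length => grC f (A.get j) ^ (α j).val).prod

/-- The X-cycle `A^{(r, α)} = h_r^α(A) σ_A c_α(A)`, where `σ_A` is the cycle `(i_1 ... i_a)`. -/
noncomputable def xCycle (f : Polynomial R) (l : ℕ) (A : List (Fin d)) (r : ℕ)
    (α : Fin A.length → ZMod 2) : GrSergeev d f :=
  hPoly f l A r α * grPerm f A.formPerm * cliffMon f A α

/-- The element `A^{(r)}`, the sum of the `τ_α A^{(r, α)}` over all even `α`. -/
noncomputable def cxElt (f : Polynomial R) (l : ℕ) (A : List (Fin d)) (r : ℕ) : GrSergeev d f :=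
  ∑ α : Fin A.length → ZMod 2 with Even (wt α), (-1) ^ tauExp α * xCycle f l A r α

/-- `l`-multipartitions of `d`; `parts r` is the `(r + 1)`-st partition. -/
structure Multipartition (l d : ℕ) where
  parts : Fin l → Multiset ℕ
  pos : ∀ r, ∀ a ∈ parts r, 0 < a
  sum_eq : ∑ r, (parts r).sum = d

/-- `L` lists pairs `(A_i, r_i)` such that the `A_i^{(r_i)}` are disjoint CX-cycles, with
`r_i < l`, whose index sets together make up `{1, ..., d}`. -/
structure IsCXFamily (l : ℕ) (L : List (List (Fin d) × ℕ)) : Prop where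
  ne_nil : ∀ p ∈ L, p.1 ≠ []
  disjoint : (L.map Prod.fst).flatten.Nodup
  cover : ∀ i : Fin d, i ∈ (L.map Prod.fst).flatten
  lt_level : ∀ p ∈ L, p.2 < l
  even : ∀ p ∈ L, Even ((p.1.length - 1) * l + p.2)

/-- `L` has cycle type `lam`: the `r`-th partition consists of the `|A_i|` with `r_i = r`
(both counted from `0`). -/
def HasCycleType {l : ℕ} (L : List (List (Fin d) × ℕ)) (lam : Multipartition l d) : Prop :=
  ∀ r : Fin l, lam.parts r =
    (((L.filter fun p => p.2 = (r : ℕ)).map fun p => p.1.length : List ℕ) : Multiset ℕ)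

/-- The multipartitions that occur as cycle type of a product of disjoint CX-cycles. -/
def evMultipartitions (l d : ℕ) : Set (Multipartition l d) :=
  {lam | ∃ L : List (List (Fin d) × ℕ), IsCXFamily l L ∧ HasCycleType L lam}

/-- All products of disjoint CX-cycles with cycle type `lam`. -/
def cxProducts {l : ℕ} (f : Polynomial R) (lam : Multipartition l d) : Set (GrSergeev d f) :=
  {y | ∃ L : List (List (Fin d) × ℕ), IsCXFamily l L ∧ HasCycleType L lam ∧
    y = (L.map fun p => cxElt f l p.1 p.2).prod}

/-- `z_d(lam)`: the sum of all (finitely many) products of disjoint CX-cycles with cycle type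
`lam`. -/
noncomputable def zElt {l : ℕ} (f : Polynomial R) (lam : Multipartition l d) : GrSergeev d f :=
  ∑ᶠ y ∈ cxProducts f lam, y

/-! ## Odd skew cycles -/

/-- `z = p σ_A c` is an odd skew cycle on the ordered set `A`: `p` is a polynomial and `c` a
Clifford element in the variables indexed by `A`, and `z` is odd, commutes with all `x_i` and
skew-commutes with all `c_i`. -/
structure IsOddSkewCycle (f : Polynomial R) (A : List (Fin d)) (z : GrSergeev d f) : Prop where
  nodup : A.Nodup
  form : ∃ p ∈ Algebra.adjoin R {y | ∃ i ∈ A, y = grX f i},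
    ∃ c ∈ Algebra.adjoin R {y | ∃ i ∈ A, y = grC f i}, z = p * grPerm f A.formPerm * c
  comm_x : ∀ i, grX f i * z = z * grX f i
  odd : z ∈ grOdd d f
  skew_c : ∀ i, grC f i * z = -(z * grC f i)

end Sergeev

/-! In the graded algebra the relation f(x_1) = 0 becomes x_i^l = 0, permutations move the x_i and
the c_i without correction terms, and the monomials x^α w c^β with all α_i < l form a basis over R.
Central elements are studied through their coefficients in this basis.

The basis comes in three stages. The regular representation on the free module spanned by all x^α w
c^β (`exists_regular_rep`) gives a basis of the affine algebra. The conjugates F_i of f(x_1) have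
leading terms x_i^l, and their S-polynomials x_j^l F_i - x_i^l F_j reduce to lower degree
(`affX_pow_mul_affF_sub_mem`), so monomials with exponents below l stay independent in the quotient,
even modulo lower filtration steps (`reduced_independent`). This passes to symbols in
`linearIndependent_grMon`.

Upper bound for the centre: let z be even and central. On the part of z with fixed w and β,
multiplication by x_i equals multiplication by x_{w i} up to the sign (-1)^{β_i}. For β = 0 the
coefficients therefore depend only on the degree of x^α on each cycle of w, and they vanish if this
degree is below (a-1)(l-1) on some cycle of length a. Commuting with the product of the c_i over a
cycle forces the parity condition of a CX-cycle (`grCoef_eq_zero_of_odd_add`). If β is even on every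
cycle, its coefficients are determined by those at β = 0. If β is odd on some cycle, going once
around the cycle gives x_i z = -x_i z on that part, so only the exponents l-1 survive there;
conjugation by the cycle and conjugation by the Clifford elements of the cycle then differ by a
sign, and the coefficient is zero. Hence z is determined by its coefficients at β = 0
(`eq_zero_of_mem_grCenter`), and by conjugation these depend only on the cycle type.

Lower bound: CX-cycles commute with every x_i and c_i, by a pairing of the vectors α and a count of
signs (`grC_mul_cxTuple`). At β = 0 the coefficients of a product of disjoint CX-cycles are the
indicator function of the prescribed degrees on the cycles (`cxProd_leading_form`). The sums z_d(λ)
are therefore dual to suitable coefficient functionals, and the two bounds meet in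
`exists_basis_grCenter`.

For the second claim the same comparison of conjugations, now with the skew sign, shows σ_A⁻¹ z σ_A
= -z (`IsOddSkewCycle.conj_eq_neg`). The sum over τ is then its own negative, and 2 is not a zero
divisor. -/

/-! ## The Coxeter presentation of the symmetric group -/

section Coxeter

variable {H : Type*} [Group H]

/-- The product `u (n - m + 1) * ... * u n` of `m` consecutive factors. -/
def descProd (u : ℕ → H) (n : ℕ) : ℕ → H
  | 0 => 1
  | m + 1 => u (n - m) * descProd u n m

theorem descProd_comm (u : ℕ → H) (n : ℕ)
    (far : ∀ i j, i + 1 < j → j ≤ n → u i * u j = u j * u i) :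
    ∀ m j, m ≤ n → j + m < n → u j * descProd u n m = descProd u n m * u j
  | 0, j, _, _ => by simp [descProd]
  | m + 1, j, hm, hj => by
    have ih := descProd_comm u n far m j (by omega) (by omega)
    rw [descProd, ← mul_assoc, far j (n - m) (by omega) (by omega), mul_assoc, ih, mul_assoc]

/-- Under the bound on `j` both `u (j - 1)` and `u j` are factors of the product. The braid relation
at the place where they meet lowers the index by one, and all other factors commute with what passes
them. -/
theorem descProd_shift (u : ℕ → H) (n : ℕ)
    (far : ∀ i j, i + 1 < j → j ≤ n → u i * u j = u j * u i)
    (braid : ∀ i, i + 1 ≤ n → u i * u (i + 1) * u i = u (i + 1) * u i * u (i + 1)) :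
    ∀ m j, m ≤ n + 1 → n + 1 < j + m → j ≤ n →
      u j * descProd u n m = descProd u n m * u (j - 1)
  | 0, j, _, h, h' => by omega
  | m + 1, j, hm, hj, hjn => by
    by_cases h : j = n - m + 1
    · obtain ⟨k, rfl⟩ : ∃ k, m = k + 1 := ⟨m - 1, by omega⟩
      have e1 : n - k = j := by omega
      have e2 : n - (k + 1) = j - 1 := by omega
      have hc := descProd_comm u n far k (j - 1) (by omega) (by omega)
      have hb := braid (j - 1) (by omega)
      rw [show j - 1 + 1 = j by omega] at hb
      rw [descProd, descProd, e1, e2]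
      calc u j * (u (j - 1) * (u j * descProd u n k))
          = (u j * u (j - 1) * u j) * descProd u n k := by simp only [mul_assoc]
        _ = u (j - 1) * u j * (u (j - 1) * descProd u n k) := by rw [← hb]; simp only [mul_assoc]
        _ = _ := by rw [hc]; simp only [mul_assoc]
    · have ih := descProd_shift u n far braid m j (by omega) (by omega) hjn
      rw [descProd, ← mul_assoc, ← far (n - m) j (by omega) hjn, mul_assoc, ih, mul_assoc]

/-- The products `descProd u n m` with m ≤ n + 1 represent the cosets of the subgroup generated by
the earlier elements. It suffices that left multiplication by a generator respects this normal form.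
-/
theorem exists_descProd_mul (u : ℕ → H) (n : ℕ)
    (sq : ∀ i, i ≤ n → u i * u i = 1)
    (far : ∀ i j, i + 1 < j → j ≤ n → u i * u j = u j * u i)
    (braid : ∀ i, i + 1 ≤ n → u i * u (i + 1) * u i = u (i + 1) * u i * u (i + 1))
    {g : H} (hg : g ∈ Subgroup.closure {x | ∃ i, i < n + 1 ∧ x = u i}) :
    ∃ m ≤ n + 1, ∃ h ∈ Subgroup.closure {x | ∃ i, i < n ∧ x = u i}, g = descProd u n m * h := by
  induction hg using Subgroup.closure_induction_left with
  | one => exact ⟨0, by omega, 1, one_mem _, by simp [descProd]⟩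
  | mul_left x hx y hy ih =>
    obtain ⟨j, hj, rfl⟩ := hx
    obtain ⟨m, hm, h, hh, rfl⟩ := ih
    -- According to the position of j relative to the first factor `u (n - m + 1)`, the new
    -- generator passes through, lengthens the product, cancels its first factor, or emerges on the
    -- right with index j - 1.
    rcases lt_trichotomy (j + m) n with h1 | h1 | h1
    · refine ⟨m, hm, u j * h, mul_mem (Subgroup.subset_closure ⟨j, by omega, rfl⟩) hh, ?_⟩
      rw [← mul_assoc, descProd_comm u n far m j (by omega) h1, mul_assoc]
    · refine ⟨m + 1, by omega, h, hh, ?_⟩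
      rw [descProd, show n - m = j by omega, mul_assoc]
    · by_cases h2 : j + m = n + 1
      · obtain ⟨k, rfl⟩ : ∃ k, m = k + 1 := ⟨m - 1, by omega⟩
        refine ⟨k, by omega, h, hh, ?_⟩
        rw [descProd, show n - k = j by omega, ← mul_assoc, ← mul_assoc, sq j (by omega), one_mul]
      · refine ⟨m, hm, u (j - 1) * h,
          mul_mem (Subgroup.subset_closure ⟨j - 1, by omega, rfl⟩) hh, ?_⟩
        rw [← mul_assoc, descProd_shift u n far braid m j (by omega) (by omega) (by omega),
          mul_assoc]
  | inv_mul_cancel x hx y hy ih =>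
    obtain ⟨j, hj, rfl⟩ := hx
    rw [inv_eq_of_mul_eq_one_left (sq j (by omega))]
    obtain ⟨m, hm, h, hh, rfl⟩ := ih
    rcases lt_trichotomy (j + m) n with h1 | h1 | h1
    · refine ⟨m, hm, u j * h, mul_mem (Subgroup.subset_closure ⟨j, by omega, rfl⟩) hh, ?_⟩
      rw [← mul_assoc, descProd_comm u n far m j (by omega) h1, mul_assoc]
    · refine ⟨m + 1, by omega, h, hh, ?_⟩
      rw [descProd, show n - m = j by omega, mul_assoc]
    · by_cases h2 : j + m = n + 1
      · obtain ⟨k, rfl⟩ : ∃ k, m = k + 1 := ⟨m - 1, by omega⟩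
        refine ⟨k, by omega, h, hh, ?_⟩
        rw [descProd, show n - k = j by omega, ← mul_assoc, ← mul_assoc, sq j (by omega), one_mul]
      · refine ⟨m, hm, u (j - 1) * h,
          mul_mem (Subgroup.subset_closure ⟨j - 1, by omega, rfl⟩) hh, ?_⟩
        rw [← mul_assoc, descProd_shift u n far braid m j (by omega) (by omega) (by omega),
          mul_assoc]

/-- The adjacent transposition `(i, i + 1)` of `Fin (N + 1)`. -/
def adjSwap (N i : ℕ) : Equiv.Perm (Fin (N + 1)) := Equiv.swap (Fin.ofNat (N + 1) i) (Fin.ofNat (N + 1) (i + 1))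

theorem adjSwap_apply_of_lt {N i : ℕ} {k : Fin (N + 1)} (hk : i + 1 < k) :
    adjSwap N i k = k := by
  have := k.2
  apply Equiv.swap_apply_of_ne_of_ne <;>
  · intro h
    have := congrArg Fin.val h
    simp only [Fin.val_ofNat] at this
    rw [Nat.mod_eq_of_lt (by omega)] at this
    omega

theorem fst_apply_of_mem_closure {G : Type*} [Group G] {N n : ℕ} {t : ℕ → G}
    {g : Equiv.Perm (Fin (N + 1)) × G} {k : Fin (N + 1)} (hk : n < k)
    (hg : g ∈ Subgroup.closure {x | ∃ i, i < n ∧ x = (adjSwap N i, t i)}) : g.1 k = k := by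
  induction hg using Subgroup.closure_induction with
  | mem x hx =>
    obtain ⟨i, hi, rfl⟩ := hx
    exact adjSwap_apply_of_lt (by omega)
  | one => rfl
  | mul x y _ _ hx hy => simp [hx, hy]
  | inv x _ hx => 
    rw [Prod.fst_inv, Equiv.Perm.inv_eq_iff_eq, hx]

theorem descProd_fst_apply {G : Type*} [Group G] {N n : ℕ} (t : ℕ → G) (hn : n < N) :
    ∀ m ≤ n + 1, (((descProd (fun i => (adjSwap N i, t i)) n m).1 (Fin.ofNat (N + 1) (n + 1)) :
      Fin (N + 1)) : ℕ) = n + 1 - m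
  | 0, _ => by simp [descProd]; omega
  | m + 1, hm => by
    have ih := descProd_fst_apply t hn m (by omega)
    have : (descProd (fun i => (adjSwap N i, t i)) n m).1 (Fin.ofNat (N + 1) (n + 1)) =
        Fin.ofNat (N + 1) (n - m + 1) := by
      apply Fin.ext
      rw [ih, Fin.val_ofNat, Nat.mod_eq_of_lt (by omega)]
      omega
    rw [descProd, Prod.fst_mul, Equiv.Perm.mul_apply, this, adjSwap, Equiv.swap_apply_right,
      Fin.val_ofNat, Nat.mod_eq_of_lt (by omega)]
    omega

/-- The normal form is applied to the pairs (transposition, `t i`). The first component of the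
m-fold product sends the point n + 1 to n + 1 - m while the remaining factor fixes it, so a trivial
first component forces m = 0 and the rest lies in the subgroup of the previous stage. -/
theorem eq_one_of_fst_eq_one {G : Type*} [Group G] {N : ℕ} {t : ℕ → G}
    (sq : ∀ i, i < N → t i * t i = 1)
    (far : ∀ i j, i + 1 < j → j < N → t i * t j = t j * t i)
    (braid : ∀ i, i + 1 < N → t i * t (i + 1) * t i = t (i + 1) * t i * t (i + 1)) :
    ∀ n ≤ N, ∀ g ∈ Subgroup.closure {x | ∃ i, i < n ∧ x = (adjSwap N i, t i)},
      g.1 = 1 → g = 1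
  | 0, _, g, hg, _ => by simpa using hg
  | n + 1, hn, g, hg, h1 => by
    have aux : ∀ i, i ≤ n → ∀ j, (Fin.ofNat (N + 1) i = Fin.ofNat (N + 1) j ↔ i = j % (N + 1)) := by
      intro i hi j
      rw [Fin.ext_iff, Fin.val_ofNat, Fin.val_ofNat, Nat.mod_eq_of_lt (a := i) (by omega)]
    obtain ⟨m, hm, h, hh, rfl⟩ := exists_descProd_mul (fun i => (adjSwap N i, t i)) n
      (fun i hi => by
        rw [Prod.mk_mul_mk, sq i (by omega), adjSwap, Equiv.swap_mul_self]; rfl)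
      (fun i j hij hj => by
        rw [Prod.mk_mul_mk, Prod.mk_mul_mk, far i j hij (by omega)]
        congr 1
        refine Equiv.Perm.Disjoint.commute (fun k => ?_)
        by_cases hk : i + 1 < (k : ℕ)
        · exact Or.inl (adjSwap_apply_of_lt hk)
        · refine Or.inr (Equiv.swap_apply_of_ne_of_ne ?_ ?_) <;>
          · intro h
            have := congrArg Fin.val h
            simp only [Fin.val_ofNat] at this
            rw [Nat.mod_eq_of_lt (by omega)] at this
            omega)
      (fun i hi => by
        rw [Prod.mk_mul_mk, Prod.mk_mul_mk, Prod.mk_mul_mk, Prod.mk_mul_mk, braid i (by omega)]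
        congr 1
        have e1 : Fin.ofNat (N + 1) i ≠ Fin.ofNat (N + 1) (i + 1) := by
          rw [Ne, Fin.ext_iff, Fin.val_ofNat, Fin.val_ofNat, Nat.mod_eq_of_lt (by omega),
            Nat.mod_eq_of_lt (by omega)]
          omega
        have e2 : Fin.ofNat (N + 1) i ≠ Fin.ofNat (N + 1) (i + 1 + 1) := by
          rw [Ne, Fin.ext_iff, Fin.val_ofNat, Fin.val_ofNat, Nat.mod_eq_of_lt (by omega),
            Nat.mod_eq_of_lt (by omega)]
          omega
        have e3 : Fin.ofNat (N + 1) (i + 1) ≠ Fin.ofNat (N + 1) (i + 1 + 1) := by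
          rw [Ne, Fin.ext_iff, Fin.val_ofNat, Fin.val_ofNat, Nat.mod_eq_of_lt (by omega),
            Nat.mod_eq_of_lt (by omega)]
          omega
        rw [adjSwap, adjSwap]
        have a1 := Equiv.swap_mul_swap_mul_swap e1 e2
        have a2 := Equiv.swap_mul_swap_mul_swap e3.symm e2.symm
        simp_all [mul_assoc, Equiv.swap_comm]) hg
    have hx : h.1 (Fin.ofNat (N + 1) (n + 1)) = Fin.ofNat (N + 1) (n + 1) :=
      fst_apply_of_mem_closure (by rw [Fin.val_ofNat, Nat.mod_eq_of_lt (by omega)]; omega) hh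
    have h3 := congrArg (fun w : Equiv.Perm (Fin (N + 1)) => ((w (Fin.ofNat (N + 1) (n + 1)) : Fin (N + 1)) : ℕ)) h1
    simp only [Prod.fst_mul, Equiv.Perm.mul_apply, hx, Equiv.Perm.one_apply] at h3
    rw [descProd_fst_apply t (by omega) m hm, Fin.val_ofNat, Nat.mod_eq_of_lt (by omega)] at h3
    obtain rfl : m = 0 := by omega
    rw [descProd, one_mul] at h1 ⊢
    exact eq_one_of_fst_eq_one sq far braid n (by omega) h hh h1

theorem perm_closure_adjSwap (N : ℕ) {p : Equiv.Perm (Fin (N + 1)) → Prop} (h1 : p 1)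
    (hmul : ∀ i < N, ∀ w, p w → p (adjSwap N i * w)) (w : Equiv.Perm (Fin (N + 1))) : p w := by
  have hw : w ∈ Submonoid.closure (Set.range fun i : Fin N => Equiv.swap i.castSucc i.succ) := by
    rw [Equiv.Perm.mclosure_swap_castSucc_succ]; trivial
  induction hw using Submonoid.closure_induction_left with
  | one => exact h1
  | mul_left x hx y _ ih =>
    obtain ⟨i, rfl⟩ := hx
    have : Equiv.swap i.castSucc i.succ = adjSwap N i := by
      unfold adjSwap
      congr 1 <;> apply Fin.ext <;> rw [Fin.val_ofNat, Nat.mod_eq_of_lt] <;> simp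
    simp only [this]
    exact hmul i i.2 y ih

/-- A family of elements satisfying the Coxeter relations of type `A` extends to a homomorphism
from the symmetric group. -/
theorem exists_perm_hom {G : Type*} [Group G] {N : ℕ} (t : ℕ → G)
    (sq : ∀ i, i < N → t i * t i = 1)
    (far : ∀ i j, i + 1 < j → j < N → t i * t j = t j * t i)
    (braid : ∀ i, i + 1 < N → t i * t (i + 1) * t i = t (i + 1) * t i * t (i + 1)) :
    ∃ φ : Equiv.Perm (Fin (N + 1)) →* G, ∀ i < N, φ (adjSwap N i) = t i := by
  -- The subgroup generated by the pairs is the graph of the required homomorphism: its projection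
  -- to the symmetric group is bijective, and the homomorphism is the inverse projection followed by
  -- the second component.
  let Γ : Subgroup (Equiv.Perm (Fin (N + 1)) × G) :=
    Subgroup.closure {x | ∃ i, i < N ∧ x = (adjSwap N i, t i)}
  let π : Γ →* Equiv.Perm (Fin (N + 1)) := (MonoidHom.fst _ _).comp Γ.subtype
  have hinj : Function.Injective π := by
    rw [injective_iff_map_eq_one]
    rintro ⟨g, hg⟩ h
    exact Subtype.ext (eq_one_of_fst_eq_one sq far braid N le_rfl g hg h)
  have hsurj : Function.Surjective π := by
    intro w
    induction w using perm_closure_adjSwap with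
    | h1 => exact ⟨1, map_one _⟩
    | hmul i hi w ih =>
      obtain ⟨g, rfl⟩ := ih
      exact ⟨⟨_, Subgroup.subset_closure ⟨i, hi, rfl⟩⟩ * g, map_mul _ _ _⟩
  let e : Γ ≃* Equiv.Perm (Fin (N + 1)) := MulEquiv.ofBijective π ⟨hinj, hsurj⟩
  refine ⟨((MonoidHom.snd _ _).comp Γ.subtype).comp e.symm.toMonoidHom, fun i hi => ?_⟩
  have : e.symm (adjSwap N i) = ⟨_, Subgroup.subset_closure ⟨i, hi, rfl⟩⟩ := by
    rw [MulEquiv.symm_apply_eq]; rfl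
  change (e.symm (adjSwap N i)).1.2 = t i
  rw [this]

end Coxeter

/-! ## Equality up to sign -/

/-- Equality up to sign. -/
def SgnEq {A : Type*} [Neg A] (a b : A) : Prop := a = b ∨ a = -b

namespace SgnEq

section

variable {A : Type*} [InvolutiveNeg A] {a b c : A}

theorem refl (a : A) : SgnEq a a := Or.inl rfl

theorem of_eq (h : a = b) : SgnEq a b := Or.inl h

theorem neg_self (a : A) : SgnEq (-a) a := Or.inr rfl

theorem symm (h : SgnEq a b) : SgnEq b a := by
  rcases h with rfl | rfl
  · exact Or.inl rfl
  · exact Or.inr (neg_neg b).symm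

theorem trans (h : SgnEq a b) (h' : SgnEq b c) : SgnEq a c := by
  rcases h with rfl | rfl <;> rcases h' with rfl | rfl
  · exact Or.inl rfl
  · exact Or.inr rfl
  · exact Or.inr rfl
  · exact Or.inl (neg_neg c)

end

theorem map {M N F : Type*} [AddGroup M] [AddGroup N] [FunLike F M N] [AddMonoidHomClass F M N]
    (f : F) {a b : M} (h : SgnEq a b) : SgnEq (f a) (f b) := by
  rcases h with rfl | rfl
  · exact Or.inl rfl
  · exact Or.inr (map_neg f b)

theorem mem {R M : Type*} [CommRing R] [AddCommGroup M] [Module R M] {p : Submodule R M}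
    {a b : M} (h : SgnEq a b) (hb : b ∈ p) : a ∈ p := by
  rcases h with rfl | rfl
  · exact hb
  · exact p.neg_mem hb

variable {A : Type*} [Ring A] {a b c a' b' : A}

theorem mul (h : SgnEq a b) (h' : SgnEq a' b') : SgnEq (a * a') (b * b') := by
  rcases h with rfl | rfl <;> rcases h' with rfl | rfl
  · exact Or.inl rfl
  · exact Or.inr (by simp)
  · exact Or.inr (by simp)
  · exact Or.inl (by simp)

theorem mul_left (c : A) (h : SgnEq a b) : SgnEq (c * a) (c * b) := (refl c).mul h

theorem mul_right (h : SgnEq a b) (c : A) : SgnEq (a * c) (b * c) := h.mul (refl c)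

theorem pow_neg_one (k : ℕ) (a : A) : SgnEq ((-1) ^ k * a) a := by
  rcases neg_one_pow_eq_or A k with h | h <;> rw [h]
  · exact Or.inl (one_mul a)
  · exact Or.inr (neg_one_mul a)

end SgnEq

/-! ## Ordered monomials -/

section Monomials

theorem nat_fun_induction {n : ℕ} {p : (Fin n → ℕ) → Prop} (h0 : p 0)
    (hs : ∀ j α, p α → p (α + Pi.single j 1)) (α : Fin n → ℕ) : p α := by
  induction h : ∑ j, α j generalizing α with
  | zero =>
    have : α = 0 := by
      funext j
      simpa using (Finset.sum_eq_zero_iff.1 h) j (Finset.mem_univ j)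
    rwa [this]
  | succ m ih =>
    obtain ⟨j, hj⟩ : ∃ j, α j ≠ 0 := by
      by_contra! hc
      simp [hc] at h
    have e : α - Pi.single j 1 + Pi.single j 1 = α := by
      apply tsub_add_cancel_of_le
      intro k
      rcases eq_or_ne k j with rfl | hk
      · simpa using Nat.one_le_iff_ne_zero.2 hj
      · simp [hk]
    rw [← e]
    apply hs
    apply ih
    have h' := congrArg (fun β : Fin n → ℕ => ∑ k, β k) e
    simp only [Pi.add_apply, Finset.sum_add_distrib, h, Finset.sum_pi_single',
      Finset.mem_univ, if_true] at h'
    omega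

/-- The ordered monomial `X 0 ^ α 0 * X 1 ^ α 1 * ...`. -/
def xMon {A : Type*} [Monoid A] {n : ℕ} (X : Fin n → A) (α : Fin n → ℕ) : A :=
  (List.ofFn fun j => X j ^ α j).prod

theorem mul_prod_ofFn {A : Type*} [Monoid A] {n : ℕ} {y : A} {Z Z' : Fin n → A}
    (h : ∀ j, y * Z j = Z' j * y) : y * (List.ofFn Z).prod = (List.ofFn Z').prod * y := by
  induction n with
  | zero => simp
  | succ n ih =>
    rw [List.ofFn_succ, List.ofFn_succ, List.prod_cons, List.prod_cons, ← mul_assoc, h, mul_assoc,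
      ih fun j => h j.succ, mul_assoc]

section xMon

variable {A : Type*} [Monoid A] {n : ℕ} {X : Fin n → A}

theorem xMon_zero (X : Fin n → A) : xMon X 0 = 1 := by
  simp [xMon]

theorem map_xMon {B F : Type*} [Monoid B] [FunLike F A B] [MonoidHomClass F A B] (φ : F)
    (X : Fin n → A) (α : Fin n → ℕ) : φ (xMon X α) = xMon (fun j => φ (X j)) α := by
  simp [xMon, map_list_prod, List.map_ofFn, Function.comp_def]

theorem mul_xMon (hX : ∀ i j, X i * X j = X j * X i) (j : Fin n) (α : Fin n → ℕ) :
    X j * xMon X α = xMon X (α + Pi.single j 1) := by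
  induction n with
  | zero => exact j.elim0
  | succ n ih =>
    rw [xMon, xMon, List.ofFn_succ, List.ofFn_succ, List.prod_cons, List.prod_cons]
    refine Fin.cases ?_ (fun k => ?_) j
    · rw [← mul_assoc, ← pow_succ']
      simp
    · have hc : Commute (X k.succ) (X 0 ^ α 0) := (show Commute _ _ from hX k.succ 0).pow_right _
      rw [← mul_assoc, hc.eq, mul_assoc]
      have := ih (X := fun i => X i.succ) (fun i j => hX _ _) k (fun i => α i.succ)
      rw [xMon, xMon] at this
      rw [this]
      have e : ∀ i : Fin n, (Pi.single k.succ 1 : Fin (n + 1) → ℕ) i.succ =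
          (Pi.single k 1 : Fin n → ℕ) i := by
        intro i
        simp [Pi.single_apply]
      simp [e]

theorem xMon_mul_xMon (hX : ∀ i j, X i * X j = X j * X i) (α β : Fin n → ℕ) :
    xMon X α * xMon X β = xMon X (α + β) := by
  induction α using nat_fun_induction with
  | h0 => rw [xMon_zero, one_mul, zero_add]
  | hs j α ih => rw [← mul_xMon hX, mul_assoc, ih, mul_xMon hX]; congr 1; abel

theorem xMon_single (hX : ∀ i j, X i * X j = X j * X i) (j : Fin n) (k : ℕ) :
    xMon X (Pi.single j k) = X j ^ k := by
  induction k with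
  | zero => simp [xMon_zero]
  | succ k ih => rw [pow_succ', ← ih, mul_xMon hX, ← Pi.single_add]

theorem xMon_comp_perm (hX : ∀ i j, X i * X j = X j * X i) (w : Equiv.Perm (Fin n))
    (α : Fin n → ℕ) : xMon (fun j => X (w j)) α = xMon X (fun j => α (w⁻¹ j)) := by
  induction α using nat_fun_induction with
  | h0 => rw [xMon_zero]; exact (xMon_zero _).symm
  | hs j α ih =>
    rw [← mul_xMon (X := fun j => X (w j)) (fun i j => hX _ _), ih, mul_xMon hX]
    congr 1
    funext k
    simp [Pi.single_apply, Equiv.symm_apply_eq]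

theorem xMon_eq_zero {A : Type*} [MonoidWithZero A] {X : Fin n → A} (α : Fin n → ℕ) (j : Fin n)
    (h : X j ^ α j = 0) : xMon X α = 0 :=
  List.prod_eq_zero (by rw [List.mem_ofFn]; exact ⟨j, h⟩)

theorem xMon_neg_one_pow_mul {A : Type*} [Ring A] (s : Fin n → ℕ) (X : Fin n → A)
    (α : Fin n → ℕ) :
    xMon (fun j => (-1) ^ s j * X j) α = (-1) ^ (∑ j, s j * α j) * xMon X α := by
  induction n with
  | zero => simp [xMon]
  | succ n ih =>
    have := ih (fun j => s j.succ) (fun j => X j.succ) (fun j => α j.succ)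
    rw [xMon, xMon] at this ⊢
    rw [List.ofFn_succ, List.ofFn_succ, List.prod_cons, List.prod_cons, this, Fin.sum_univ_succ,
      pow_add]
    have hc : ∀ (k : ℕ) (a : A), Commute ((-1) ^ k) a := fun k a =>
      (Commute.neg_one_left a).pow_left k
    rw [(hc _ _).mul_pow, ← pow_mul]
    simp only [mul_assoc]
    congr 1
    rw [← mul_assoc, ← mul_assoc, (hc _ _).eq]

/-- This covers Clifford monomials as well: `cMon C β` is by definition `xMon C` with exponents `(β
j).val`. Most exact sign rules below are instances. -/
theorem mul_xMon_of_sign {A : Type*} [Ring A] {X Y : Fin n → A} {y : A} (s : Fin n → ℕ)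
    (h : ∀ j, y * X j = (-1) ^ s j * Y j * y) (α : Fin n → ℕ) :
    y * xMon X α = (-1) ^ (∑ j, s j * α j) * xMon Y α * y := by
  rw [← xMon_neg_one_pow_mul]
  refine mul_prod_ofFn fun j => ?_
  have : SemiconjBy y (X j) ((-1) ^ s j * Y j) := h j
  exact (this.pow_right (α j)).eq

end xMon

/-- The ordered Clifford monomial `C 0 ^ β 0 * C 1 ^ β 1 * ...`. -/
def cMon {A : Type*} [Monoid A] {n : ℕ} (C : Fin n → A) (β : Fin n → ZMod 2) : A :=
  (List.ofFn fun j => C j ^ (β j).val).prod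

/-- The elements `C j` have square one and anticommute pairwise. -/
structure IsClifford {A : Type*} [Ring A] {n : ℕ} (C : Fin n → A) : Prop where
  sq : ∀ j, C j * C j = 1
  anti : ∀ i j, i ≠ j → C i * C j = -(C j * C i)

/-- The exponent of the sign picked up by moving a Clifford generator to position `j` from the
left. -/
def leftExp {n : ℕ} (β : Fin n → ZMod 2) (j : Fin n) : ℕ := ∑ k ∈ Finset.Iio j, (β k).val

/-- The exponent of the sign picked up by moving a Clifford generator to position `j` from the
right. -/
def rightExp {n : ℕ} (β : Fin n → ZMod 2) (j : Fin n) : ℕ := ∑ k ∈ Finset.Ioi j, (β k).val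

theorem leftExp_eq {n : ℕ} (β : Fin n → ZMod 2) (j : Fin n) :
    leftExp β j = ∑ k, if k < j then (β k).val else 0 := by
  rw [leftExp, ← Finset.sum_filter]
  congr 1
  ext; simp

theorem rightExp_eq {n : ℕ} (β : Fin n → ZMod 2) (j : Fin n) :
    rightExp β j = ∑ k, if j < k then (β k).val else 0 := by
  rw [rightExp, ← Finset.sum_filter]
  congr 1
  ext; simp

theorem leftExp_succ {n : ℕ} (β : Fin (n + 1) → ZMod 2) (j : Fin n) :
    leftExp β j.succ = (β 0).val + leftExp (fun k => β k.succ) j := by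
  rw [leftExp_eq, leftExp_eq, Fin.sum_univ_succ]
  simp

theorem leftExp_zero {n : ℕ} (β : Fin (n + 1) → ZMod 2) : leftExp β 0 = 0 := by
  simp [leftExp_eq]

theorem rightExp_succ {n : ℕ} (β : Fin (n + 1) → ZMod 2) (j : Fin n) :
    rightExp β j.succ = rightExp (fun k => β k.succ) j := by
  rw [rightExp_eq, rightExp_eq, Fin.sum_univ_succ]
  simp

theorem rightExp_zero {n : ℕ} (β : Fin (n + 1) → ZMod 2) :
    rightExp β 0 = ∑ k : Fin n, (β k.succ).val := by
  rw [rightExp_eq, Fin.sum_univ_succ]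
  simp

theorem pow_val_add_one {A : Type*} [Monoid A] {c : A} (h : c * c = 1) (b : ZMod 2) :
    c * c ^ b.val = c ^ (b + 1).val := by
  fin_cases b
  · change c * c ^ 0 = c ^ 1
    simp
  · change c * c ^ 1 = c ^ 0
    simp [h]

namespace IsClifford

variable {A : Type*} [Ring A] {n : ℕ} {C : Fin n → A}

theorem mul_cMon (hC : IsClifford C) (j : Fin n) (β : Fin n → ZMod 2) :
    C j * cMon C β = (-1) ^ leftExp β j * cMon C (β + Pi.single j 1) := by
  induction n with
  | zero => exact j.elim0
  | succ n ih =>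
    rw [cMon, cMon, List.ofFn_succ, List.ofFn_succ, List.prod_cons, List.prod_cons]
    refine Fin.cases ?_ (fun k => ?_) j
    · rw [← mul_assoc, pow_val_add_one (hC.sq 0)]
      simp [leftExp_zero]
    · have hc : C k.succ * C 0 ^ (β 0).val = (-1) ^ (β 0).val * C 0 ^ (β 0).val * C k.succ := by
        rw [← (Commute.neg_one_left (C 0)).mul_pow]
        have : SemiconjBy (C k.succ) (C 0) (-1 * C 0) := by
          rw [SemiconjBy, hC.anti k.succ 0 (Fin.succ_ne_zero k)]
          simp
        exact (this.pow_right _).eq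
      have hC' : IsClifford (fun i : Fin n => C i.succ) :=
        ⟨fun i => hC.sq _, fun i j h => hC.anti _ _ fun h' => h (Fin.succ_injective _ h')⟩
      have := ih hC' k (fun i => β i.succ)
      rw [cMon, cMon] at this
      rw [← mul_assoc, hc, mul_assoc, this, leftExp_succ, pow_add]
      have e : ∀ i : Fin n, (Pi.single k.succ 1 : Fin (n + 1) → ZMod 2) i.succ =
          (Pi.single k 1 : Fin n → ZMod 2) i := by
        intro i
        simp [Pi.single_apply]
      have h2 := ((Commute.neg_one_left (C 0 ^ (β 0).val)).pow_left
        (leftExp (fun k => β k.succ) k)).eq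
      simp only [Pi.add_apply, e, mul_assoc]
      rw [← mul_assoc (C 0 ^ (β 0).val), ← h2]
      simp [mul_assoc]

theorem cMon_zero (C : Fin n → A) : cMon C 0 = 1 := by
  simp [cMon]

theorem cMon_mul (hC : IsClifford C) (j : Fin n) (β : Fin n → ZMod 2) :
    cMon C β * C j = (-1) ^ rightExp β j * cMon C (β + Pi.single j 1) := by
  induction n with
  | zero => exact j.elim0
  | succ n ih =>
    have hC' : IsClifford (fun i : Fin n => C i.succ) :=
        ⟨fun i => hC.sq _, fun i j h => hC.anti _ _ fun h' => h (Fin.succ_injective _ h')⟩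
    rw [cMon, cMon, List.ofFn_succ, List.ofFn_succ, List.prod_cons, List.prod_cons]
    refine Fin.cases ?_ (fun k => ?_) j
    · have h1 : ∀ m : Fin n → ℕ, xMon (fun i => C (Fin.succ i)) m * C 0 =
          (-1) ^ (∑ i, m i) * (C 0 * xMon (fun i => C (Fin.succ i)) m) := by
        intro m
        have := mul_xMon_of_sign (X := fun i => C (Fin.succ i)) (Y := fun i => C (Fin.succ i))
          (y := C 0) (fun _ => 1)
          (fun j => by rw [hC.anti 0 j.succ (Fin.succ_ne_zero j).symm]; simp) m
        rw [this, ← mul_assoc, ← mul_assoc, ← pow_add]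
        simp
      have h2 := h1 fun i => (β i.succ).val
      rw [xMon] at h2
      rw [mul_assoc, h2, rightExp_zero, ← mul_assoc,
        ← ((Commute.neg_one_left (C 0 ^ (β 0).val)).pow_left _).eq, mul_assoc, ← mul_assoc (_ ^ _) (C 0),
        ← pow_succ, pow_succ', pow_val_add_one (hC.sq 0)]
      simp
    · have := ih hC' k (fun i => β i.succ)
      rw [cMon, cMon] at this
      rw [mul_assoc, this, rightExp_succ, ← mul_assoc,
        ← ((Commute.neg_one_left (C 0 ^ (β 0).val)).pow_left _).eq, mul_assoc]
      have e : ∀ i : Fin n, (Pi.single k.succ 1 : Fin (n + 1) → ZMod 2) i.succ =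
          (Pi.single k 1 : Fin n → ZMod 2) i := by
        intro i
        simp [Pi.single_apply]
      simp [e]

theorem mul_cMon_sgnEq (hC : IsClifford C) (j : Fin n) (β : Fin n → ZMod 2) :
    SgnEq (C j * cMon C β) (cMon C (β + Pi.single j 1)) := by
  rw [hC.mul_cMon]
  exact SgnEq.pow_neg_one _ _

theorem cMon_mul_sgnEq (hC : IsClifford C) (j : Fin n) (β : Fin n → ZMod 2) :
    SgnEq (cMon C β * C j) (cMon C (β + Pi.single j 1)) := by
  rw [hC.cMon_mul]
  exact SgnEq.pow_neg_one _ _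

end IsClifford

theorem zmod_two_fun_induction {n : ℕ} {p : (Fin n → ZMod 2) → Prop} (h0 : p 0)
    (hs : ∀ j α, p α → p (α + Pi.single j 1)) (β : Fin n → ZMod 2) : p β := by
  have : ∀ α : Fin n → ℕ, p fun j => (α j : ZMod 2) := by
    intro α
    induction α using nat_fun_induction with
    | h0 =>
      have e : (fun j => (((0 : Fin n → ℕ) j : ℕ) : ZMod 2)) = 0 := by
        funext j
        simp
      rw [e]
      exact h0
    | hs j α ih =>
      have e : (fun k => (((α + Pi.single j 1 : Fin n → ℕ) k : ℕ) : ZMod 2)) =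
          (fun k => (α k : ZMod 2)) + Pi.single j 1 := by
        funext k
        simp [Pi.single_apply]
      rw [e]
      exact hs _ _ ih
  simpa using this fun j => (β j).val

namespace IsClifford

variable {A : Type*} [Ring A] {n : ℕ} {C : Fin n → A}

theorem cMon_mul_cMon_sgnEq (hC : IsClifford C) (β γ : Fin n → ZMod 2) :
    SgnEq (cMon C β * cMon C γ) (cMon C (β + γ)) := by
  induction γ using zmod_two_fun_induction with
  | h0 => rw [cMon_zero, mul_one, add_zero]; exact SgnEq.refl _
  | hs j γ ih =>
    refine ((hC.cMon_mul_sgnEq j γ).symm.mul_left _).trans ?_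
    rw [← mul_assoc]
    refine (ih.mul_right _).trans ?_
    rw [← add_assoc]
    exact hC.cMon_mul_sgnEq j _

/-- Moving an element that permutes the generators up to the family `C'` across a Clifford
monomial. -/
theorem mul_cMon_of_perm (hC : IsClifford C) {y : A} {w : Equiv.Perm (Fin n)}
    (h : ∀ j, y * C j = C (w j) * y) (β : Fin n → ZMod 2) :
    SgnEq (y * cMon C β) (cMon C (fun j => β (w⁻¹ j)) * y) := by
  induction β using zmod_two_fun_induction with
  | h0 =>
    refine SgnEq.of_eq ?_
    rw [cMon_zero, mul_one]
    exact (one_mul y).symm.trans (congrArg (· * y) (cMon_zero C).symm)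
  | hs j β ih =>
    refine ((hC.mul_cMon_sgnEq j β).symm.mul_left y).trans ?_
    rw [← mul_assoc, h, mul_assoc]
    refine (ih.mul_left _).trans ?_
    rw [← mul_assoc]
    refine ((hC.mul_cMon_sgnEq _ _).mul_right y).trans (SgnEq.of_eq ?_)
    congr 2
    funext k
    simp [Pi.single_apply, Equiv.symm_apply_eq]

end IsClifford

end Monomials

/-! ## The regular representation of the affine Sergeev superalgebra -/

/-- Sign identities are checked on exponents in `ZMod 2`, where `ring` and characteristic two apply.
-/
theorem neg_one_pow_eq_of_cast {A : Type*} [Ring A] {m n : ℕ}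
    (h : (m : ZMod 2) = n) : (-1 : A) ^ m = (-1) ^ n := by
  rw [neg_one_pow_eq_pow_mod_two, neg_one_pow_eq_pow_mod_two (n := n),
    (ZMod.natCast_eq_natCast_iff' m n 2).1 h]

theorem leftExp_cast {n : ℕ} (β : Fin n → ZMod 2) (j : Fin n) :
    (leftExp β j : ZMod 2) = ∑ k ∈ Finset.Iio j, β k := by
  simp [leftExp]

theorem leftExp_add_single {n : ℕ} (β : Fin n → ZMod 2) (a b : Fin n) :
    (leftExp (β + Pi.single a 1) b : ZMod 2) = leftExp β b + if a < b then 1 else 0 := by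
  simp [leftExp_cast, Finset.sum_add_distrib, Pi.single_apply, Finset.sum_ite_eq']

section AffineModule

variable (R : Type*) [CommRing R] (d : ℕ)

/-- The free module with basis indexed by the monomials `x^α w c^β`. -/
def AffMod : Type _ := ((Fin d → ℕ) × Equiv.Perm (Fin d) × (Fin d → ZMod 2)) →₀ R

noncomputable instance : AddCommGroup (AffMod R d) :=
  inferInstanceAs (AddCommGroup (((Fin d → ℕ) × Equiv.Perm (Fin d) × (Fin d → ZMod 2)) →₀ R))

noncomputable instance : Module R (AffMod R d) :=
  inferInstanceAs (Module R (((Fin d → ℕ) × Equiv.Perm (Fin d) × (Fin d → ZMod 2)) →₀ R))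

namespace AffMod

variable {R d} {M : Type*} [AddCommGroup M] [Module R M]

variable (R d) in
/-- The basis of monomials `x^α w c^β`. -/
noncomputable def basis :
    Module.Basis ((Fin d → ℕ) × Equiv.Perm (Fin d) × (Fin d → ZMod 2)) R (AffMod R d) :=
  (Finsupp.basisSingleOne :
    Module.Basis _ R (((Fin d → ℕ) × Equiv.Perm (Fin d) × (Fin d → ZMod 2)) →₀ R))

/-- The basis vector corresponding to `x^α w c^β`. -/
noncomputable def vec (α : Fin d → ℕ) (w : Equiv.Perm (Fin d)) (β : Fin d → ZMod 2) : AffMod R d :=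
  basis R d (α, w, β)

/-- Multiplication by a polynomial generator. -/
noncomputable def opX (j : Fin d) : Module.End R (AffMod R d) :=
  (basis R d).constr R fun t => vec (t.1 + Pi.single j 1) t.2.1 t.2.2

theorem opX_vec (j : Fin d) (α : Fin d → ℕ) (w : Equiv.Perm (Fin d)) (β : Fin d → ZMod 2) :
    opX j (vec α w β : AffMod R d) = vec (α + Pi.single j 1) w β := by
  simp [opX, vec, Module.Basis.constr_basis]

/-- The linear map determined by commuting operators and the images of the vectors without
polynomial part. -/
noncomputable def lift (X' : Fin d → Module.End R M)
    (φ : Equiv.Perm (Fin d) → (Fin d → ZMod 2) → M) : AffMod R d →ₗ[R] M :=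
  (basis R d).constr R fun t => xMon X' t.1 (φ t.2.1 t.2.2)

theorem lift_vec (X' : Fin d → Module.End R M) (φ : Equiv.Perm (Fin d) → (Fin d → ZMod 2) → M)
    (α : Fin d → ℕ) (w : Equiv.Perm (Fin d)) (β : Fin d → ZMod 2) :
    lift X' φ (vec α w β) = xMon X' α (φ w β) := by
  simp [lift, vec, Module.Basis.constr_basis]

theorem lift_vec_zero (X' : Fin d → Module.End R M)
    (φ : Equiv.Perm (Fin d) → (Fin d → ZMod 2) → M)
    (w : Equiv.Perm (Fin d)) (β : Fin d → ZMod 2) :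
    lift X' φ (vec 0 w β) = φ w β := by
  rw [lift_vec, xMon_zero, Module.End.one_apply]

theorem hom_ext {g g' : AffMod R d →ₗ[R] M} (h0 : ∀ w β, g (vec 0 w β) = g' (vec 0 w β))
    (hX : ∀ j n, g n = g' n → g (opX j n) = g' (opX j n)) : g = g' := by
  refine (basis R d).ext fun t => ?_
  obtain ⟨α, w, β⟩ := t
  change g (vec α w β) = g' (vec α w β)
  induction α using nat_fun_induction with
  | h0 => exact h0 w β
  | hs j α ih => rw [← opX_vec]; exact hX _ _ ih

/-- `AffMod` is a free module over the polynomial ring on the `vec 0 w β`. Commutation of the `X'`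
is the condition under which `lift` is linear over that ring. -/
theorem lift_opX {X' : Fin d → Module.End R M} (hX : ∀ i j, X' i * X' j = X' j * X' i)
    (φ : Equiv.Perm (Fin d) → (Fin d → ZMod 2) → M) (j : Fin d) (n : AffMod R d) :
    lift X' φ (opX j n) = X' j (lift X' φ n) := by
  have : lift X' φ ∘ₗ opX j = X' j ∘ₗ lift X' φ := by
    refine (basis R d).ext fun t => ?_
    obtain ⟨α, w, β⟩ := t
    change lift X' φ (opX j (vec α w β)) = X' j (lift X' φ (vec α w β))
    rw [opX_vec, lift_vec, lift_vec, ← mul_xMon hX, Module.End.mul_apply]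
  exact LinearMap.congr_fun this n

theorem opX_comm (i j : Fin d) : (opX i * opX j : Module.End R (AffMod R d)) = opX j * opX i := by
  refine (basis R d).ext fun t => ?_
  obtain ⟨α, w, β⟩ := t
  change opX i (opX j (vec α w β)) = opX j (opX i (vec α w β))
  rw [opX_vec, opX_vec, opX_vec, opX_vec]
  congr 1
  abel

/-- An operator is determined by its values on `vec 0 w β` and a rule for moving it past each `opX
j`. All relations between the operators are proved by showing that both sides follow the same rule,
with `a` the transported variable and `b` the correction. -/
theorem ext_end {g g' : Module.End R (AffMod R d)} (h0 : ∀ w β, g (vec 0 w β) = g' (vec 0 w β))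
    (hX : ∀ j, ∃ (a b : Module.End R (AffMod R d)), g * opX j = a * g + b ∧
      g' * opX j = a * g' + b) : g = g' := by
  refine hom_ext h0 fun j n h => ?_
  obtain ⟨a, b, h1, h2⟩ := hX j
  have e1 := LinearMap.congr_fun h1 n
  have e2 := LinearMap.congr_fun h2 n
  simp only [Module.End.mul_apply, LinearMap.add_apply] at e1 e2
  rw [e1, e2, h]

/-- The action of a Clifford generator. -/
noncomputable def opC (j : Fin d) : Module.End R (AffMod R d) :=
  -- The generator c_j changes sign only when it passes x_j. It passes w as c_{w⁻¹ j}, which is then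
  -- moved into its place in c^β from the left.
  lift (fun k => if k = j then -opX (R := R) k else opX k) fun w β =>
    (-1 : R) ^ leftExp β (w⁻¹ j) • vec 0 w (β + Pi.single (w⁻¹ j) 1)

theorem opC_mul_opX (j k : Fin d) :
    (opC j * opX k : Module.End R (AffMod R d)) =
      (if k = j then -opX (R := R) k else opX k) * opC j := by
  have hc : ∀ a b : Fin d, ((if a = j then -opX (R := R) a else opX a) *
      (if b = j then -opX (R := R) b else opX b) : Module.End R (AffMod R d)) =
      (if b = j then -opX (R := R) b else opX b) * (if a = j then -opX (R := R) a else opX a) := by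
    intro a b
    have := opX_comm (R := R) a b
    split_ifs
    · rw [neg_mul_neg, neg_mul_neg, this]
    · rw [neg_mul, mul_neg, this]
    · rw [neg_mul, mul_neg, this]
    · exact this
  refine LinearMap.ext fun n => ?_
  rw [Module.End.mul_apply, Module.End.mul_apply, opC, lift_opX hc]

theorem opC_mul_opX_self (j : Fin d) :
    (opC j * opX j : Module.End R (AffMod R d)) = -(opX j * opC j) := by
  rw [opC_mul_opX, if_pos rfl, neg_mul]

theorem opC_mul_opX_ne {j k : Fin d} (h : k ≠ j) :
    (opC j * opX k : Module.End R (AffMod R d)) = opX k * opC j := by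
  rw [opC_mul_opX, if_neg h]

theorem opC_vec_zero (j : Fin d) (w : Equiv.Perm (Fin d)) (β : Fin d → ZMod 2) :
    opC j (vec 0 w β : AffMod R d) =
      (-1 : R) ^ leftExp β (w⁻¹ j) • vec 0 w (β + Pi.single (w⁻¹ j) 1) :=
  lift_vec_zero _ _ _ _

theorem opC_sq (j : Fin d) : (opC j * opC j : Module.End R (AffMod R d)) = 1 := by
  refine ext_end (fun w β => ?_) fun k => ⟨opX k, 0, ?_, ?_⟩
  · rw [Module.End.mul_apply, opC_vec_zero, map_smul, opC_vec_zero, smul_smul, ← pow_add,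
      Module.End.one_apply, add_assoc, ← Pi.single_add, show (1 : ZMod 2) + 1 = 0 from rfl,
      Pi.single_zero, add_zero]
    have : (-1 : R) ^ (leftExp β (w⁻¹ j) + leftExp (β + Pi.single (w⁻¹ j) 1) (w⁻¹ j)) =
        (-1) ^ 0 := by
      apply neg_one_pow_eq_of_cast
      push_cast
      rw [leftExp_add_single, if_neg (lt_irrefl _), add_zero, CharTwo.add_self_eq_zero]
    rw [this, pow_zero, one_smul]
  · rw [add_zero, mul_assoc]
    rcases eq_or_ne k j with rfl | h
    · rw [opC_mul_opX_self, mul_neg, ← mul_assoc, opC_mul_opX_self, neg_mul, neg_neg, mul_assoc]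
    · rw [opC_mul_opX_ne h, ← mul_assoc, opC_mul_opX_ne h, mul_assoc]
  · simp

theorem opC_anti (i j : Fin d) (h : i ≠ j) :
    (opC i * opC j : Module.End R (AffMod R d)) = -(opC j * opC i) := by
  refine ext_end (fun w β => ?_) fun k =>
    ⟨if k = i ∨ k = j then -opX (R := R) k else opX k, 0, ?_, ?_⟩
  · rw [Module.End.mul_apply, opC_vec_zero, map_smul, opC_vec_zero, smul_smul, ← pow_add,
      LinearMap.neg_apply, Module.End.mul_apply, opC_vec_zero, map_smul, opC_vec_zero, smul_smul,
      ← pow_add, ← neg_smul, add_assoc, add_assoc,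
      add_comm (Pi.single (w⁻¹ j) 1) (Pi.single (w⁻¹ i) 1 : Fin d → ZMod 2)]
    congr 1
    rw [← neg_one_mul ((-1 : R) ^ _), ← pow_succ']
    apply neg_one_pow_eq_of_cast
    push_cast
    rw [leftExp_add_single, leftExp_add_single]
    have h' : w⁻¹ i ≠ w⁻¹ j := fun e => h (w⁻¹.injective e)
    rcases lt_or_gt_of_ne h' with h1 | h1
    · rw [if_neg h1.not_gt, if_pos h1]
      linear_combination -CharTwo.add_self_eq_zero (1 : ZMod 2)
    · rw [if_neg h1.not_gt, if_pos h1]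
      ring
  · rw [add_zero, mul_assoc, opC_mul_opX, ← mul_assoc]
    by_cases hi : k = i <;> by_cases hj : k = j
    · exact absurd (hi.symm.trans hj) h
    · simp [hi, h, opC_mul_opX_self, mul_assoc]
    · simp [hj, h.symm, opC_mul_opX_ne h.symm, mul_assoc]
    · simp [hi, hj, opC_mul_opX_ne hi, mul_assoc]
  · rw [add_zero, neg_mul, mul_assoc, opC_mul_opX, ← mul_assoc]
    by_cases hi : k = i <;> by_cases hj : k = j
    · exact absurd (hi.symm.trans hj) h
    · simp [hi, h, opC_mul_opX_ne h, mul_assoc]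
    · simp [hj, h.symm, opC_mul_opX_self, mul_assoc]
    · simp [hi, hj, opC_mul_opX_ne hj, mul_assoc]

/-- The correction terms in the commutation of a transposition with the polynomial generators. -/
noncomputable def opD (i j k : Fin d) : Module.End R (AffMod R d) :=
  if k = i then -(1 + opC i * opC j) else if k = j then 1 - opC i * opC j else 0

theorem opCC_mul_opX_left {i j : Fin d} (h : i ≠ j) :
    (opC i * opC j * opX i : Module.End R (AffMod R d)) = -(opX i * (opC i * opC j)) := by
  rw [mul_assoc, opC_mul_opX_ne h, ← mul_assoc, opC_mul_opX_self, neg_mul, mul_assoc]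

theorem opCC_mul_opX_right {i j : Fin d} (h : i ≠ j) :
    (opC i * opC j * opX j : Module.End R (AffMod R d)) = -(opX j * (opC i * opC j)) := by
  rw [mul_assoc, opC_mul_opX_self, mul_neg, ← mul_assoc, opC_mul_opX_ne h.symm, mul_assoc]

theorem opCC_mul_opX_ne {i j k : Fin d} (hi : k ≠ i) (hj : k ≠ j) :
    (opC i * opC j * opX k : Module.End R (AffMod R d)) = opX k * (opC i * opC j) := by
  rw [mul_assoc, opC_mul_opX_ne hj, ← mul_assoc, opC_mul_opX_ne hi, mul_assoc]

theorem opD_left (i j : Fin d) : (opD i j i : Module.End R (AffMod R d)) = -(1 + opC i * opC j) := by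
  simp [opD]

theorem opD_right {i j : Fin d} (h : i ≠ j) :
    (opD i j j : Module.End R (AffMod R d)) = 1 - opC i * opC j := by
  simp [opD, h.symm]

theorem opD_ne {i j k : Fin d} (hi : k ≠ i) (hj : k ≠ j) :
    (opD i j k : Module.End R (AffMod R d)) = 0 := by
  simp [opD, hi, hj]

/-- Integrability condition for the transposition: moving it past x_k x_m and past x_m x_k must
produce the same correction. -/
theorem opD_symm {i j : Fin d} (h : i ≠ j) (k m : Fin d) :
    (opX (Equiv.swap i j k) * opD i j m + opD i j k * opX m : Module.End R (AffMod R d)) =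
      opX (Equiv.swap i j m) * opD i j k + opD i j m * opX k := by
  have key : ∀ m : Fin d, m ≠ i → m ≠ j → ∀ k : Fin d,
      (opX (Equiv.swap i j k) * opD i j m + opD i j k * opX m : Module.End R (AffMod R d)) =
      opX (Equiv.swap i j m) * opD i j k + opD i j m * opX k := by
    intro m hi hj k
    rw [opD_ne hi hj, Equiv.swap_apply_of_ne_of_ne hi hj, mul_zero, zero_mul, zero_add, add_zero]
    by_cases ki : k = i
    · subst ki
      rw [opD_left, neg_mul, add_mul, opCC_mul_opX_ne hi hj]
      noncomm_ring
    · by_cases kj : k = j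
      · subst kj
        rw [opD_right h, sub_mul, opCC_mul_opX_ne hi hj]
        noncomm_ring
      · rw [opD_ne ki kj, zero_mul, mul_zero]
  by_cases mi : m = i
  · subst mi
    by_cases kj : k = j
    · subst kj
      rw [opD_left, opD_right h, Equiv.swap_apply_left, Equiv.swap_apply_right, sub_mul, neg_mul,
        add_mul, opCC_mul_opX_left h, opCC_mul_opX_right h]
      noncomm_ring
    · by_cases ki : k = m
      · subst ki; rfl
      · exact (key k ki kj m).symm
  · by_cases mj : m = j
    · subst mj
      by_cases ki : k = i
      · subst ki
        rw [opD_left, opD_right h, Equiv.swap_apply_left, Equiv.swap_apply_right, sub_mul, neg_mul,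
          add_mul, opCC_mul_opX_left h, opCC_mul_opX_right h]
        noncomm_ring
      · by_cases kj : k = m
        · subst kj; rfl
        · exact (key k ki kj m).symm
    · exact key m mi mj k

/-- The pair of operators used to define the action of a transposition by recursion. -/
noncomputable def pairX (i j k : Fin d) : Module.End R (AffMod R d × AffMod R d) :=
  LinearMap.prod (opX (Equiv.swap i j k) ∘ₗ LinearMap.fst _ _ _ + opD i j k ∘ₗ LinearMap.snd _ _ _)
    (opX k ∘ₗ LinearMap.snd _ _ _)

theorem pairX_apply (i j k : Fin d) (n : AffMod R d × AffMod R d) :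
    pairX i j k n = (opX (Equiv.swap i j k) n.1 + opD i j k n.2, opX k n.2) := rfl

/-- In block form `pairX i j k` is upper triangular with diagonal entries `opX (swap i j k)`, `opX
k` and corner `opD i j k`. The corner of the commutator is the condition `opD_symm`, so a twisted
derivation becomes an ordinary module map into pairs. -/
theorem pairX_comm {i j : Fin d} (h : i ≠ j) (k m : Fin d) :
    (pairX i j k * pairX i j m : Module.End R (AffMod R d × AffMod R d)) =
      pairX i j m * pairX i j k := by
  refine LinearMap.ext fun n => ?_
  rw [Module.End.mul_apply, Module.End.mul_apply, pairX_apply, pairX_apply, pairX_apply,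
    pairX_apply]
  have e1 := LinearMap.congr_fun (opX_comm (R := R) k m) n.2
  have e2 := LinearMap.congr_fun (opX_comm (R := R) (Equiv.swap i j k) (Equiv.swap i j m)) n.1
  have e3 := LinearMap.congr_fun (opD_symm (R := R) h k m) n.2
  simp only [Module.End.mul_apply, LinearMap.add_apply] at e1 e2 e3
  refine Prod.ext ?_ e1
  simp only [map_add]
  rw [e2, add_assoc, e3, add_assoc]

/-- The action of `swap i j` and the identity, as a pair. -/
noncomputable def pairT (i j : Fin d) : AffMod R d →ₗ[R] AffMod R d × AffMod R d :=
  lift (pairX i j) fun w β => (vec 0 (Equiv.swap i j * w) β, vec 0 w β)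

/-- The action of a transposition. -/
noncomputable def opT (i j : Fin d) : Module.End R (AffMod R d) := LinearMap.fst _ _ _ ∘ₗ pairT i j

theorem pairT_snd {i j : Fin d} (h : i ≠ j) (n : AffMod R d) : (pairT i j n).2 = n := by
  have : LinearMap.snd _ _ _ ∘ₗ pairT i j = (LinearMap.id : AffMod R d →ₗ[R] AffMod R d) := by
    refine hom_ext (fun w β => ?_) fun k n hn => ?_
    · simp [pairT, lift_vec_zero]
    · simp only [LinearMap.comp_apply, LinearMap.snd_apply, LinearMap.id_apply] at hn ⊢
      rw [pairT, lift_opX (pairX_comm h), ← pairT, pairX_apply, hn]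
  exact LinearMap.congr_fun this n

/-- The second component of `pairT` is the identity, so the first component of its recursion is the
rule for moving a transposition past a variable. -/
theorem opT_mul_opX {i j : Fin d} (h : i ≠ j) (k : Fin d) :
    (opT i j * opX k : Module.End R (AffMod R d)) =
      opX (Equiv.swap i j k) * opT i j + opD i j k := by
  refine LinearMap.ext fun n => ?_
  change (pairT i j (opX k n)).1 = opX (Equiv.swap i j k) (pairT i j n).1 + opD i j k n
  rw [pairT, lift_opX (pairX_comm h), ← pairT, pairX_apply, pairT_snd h]

theorem opT_vec_zero (i j : Fin d) (w : Equiv.Perm (Fin d)) (β : Fin d → ZMod 2) :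
    opT i j (vec 0 w β : AffMod R d) = vec 0 (Equiv.swap i j * w) β := by
  change (pairT i j (vec 0 w β)).1 = _
  rw [pairT, lift_vec_zero]

end AffMod

end AffineModule

section AffineModule

variable {R : Type*} [CommRing R] {d : ℕ}

namespace AffMod

theorem isClifford_opC : IsClifford (opC (R := R) (d := d)) := ⟨opC_sq, opC_anti⟩

/-- The corrections transform under Clifford generators as the variables do. This makes both sides
of `opT_mul_opC` obey the same rule past `opX m`. -/
theorem opC_mul_opD {i j : Fin d} (h : i ≠ j) (k m : Fin d) :
    (opC (Equiv.swap i j k) * opD i j m : Module.End R (AffMod R d)) =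
      (if m = k then -opD (R := R) i j m else opD i j m) * opC k := by
  have a1 := opC_anti (R := R) i j h
  have si := opC_sq (R := R) i
  have sj := opC_sq (R := R) j
  have e1 : (opC i * (opC i * opC j) : Module.End R (AffMod R d)) = opC j := by
    rw [← mul_assoc, si, one_mul]
  have e2 : (opC j * (opC i * opC j) : Module.End R (AffMod R d)) = -opC i := by
    rw [a1, mul_neg, ← mul_assoc, sj, one_mul]
  have e3 : (opC i * opC j * opC i : Module.End R (AffMod R d)) = -opC j := by
    rw [a1, neg_mul, mul_assoc, si, mul_one]
  have e4 : (opC i * opC j * opC j : Module.End R (AffMod R d)) = opC i := by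
    rw [mul_assoc, sj, mul_one]
  by_cases mi : m = i
  · subst mi
    rw [opD_left]
    by_cases ki : k = m
    · subst ki
      rw [if_pos rfl, neg_neg, Equiv.swap_apply_left, mul_neg, mul_add, add_mul, e2, e3]
      noncomm_ring
    · rw [if_neg fun e => ki e.symm]
      by_cases kj : k = j
      · subst kj
        rw [Equiv.swap_apply_right, mul_neg, mul_add, neg_mul, add_mul, e1, e4]
        noncomm_ring
      · rw [Equiv.swap_apply_of_ne_of_ne ki kj, mul_neg, mul_add, neg_mul, add_mul, ← mul_assoc,
          opC_anti k m ki, neg_mul, mul_assoc, opC_anti k j kj]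
        noncomm_ring
  · by_cases mj : m = j
    · subst mj
      rw [opD_right h]
      by_cases ki : k = i
      · subst ki
        rw [if_neg mi, Equiv.swap_apply_left, mul_sub, sub_mul, e2, e3]
        noncomm_ring
      · by_cases kj : k = m
        · subst kj
          rw [if_pos rfl, Equiv.swap_apply_right, mul_sub, neg_mul, sub_mul, e1, e4]
          noncomm_ring
        · rw [if_neg fun e => kj e.symm, Equiv.swap_apply_of_ne_of_ne ki kj, mul_sub, sub_mul,
            ← mul_assoc, opC_anti k i ki, neg_mul, mul_assoc, opC_anti k m kj]
          noncomm_ring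
    · rw [opD_ne mi mj]
      simp

theorem opT_mul_opC {i j : Fin d} (h : i ≠ j) (k : Fin d) :
    (opT i j * opC k : Module.End R (AffMod R d)) = opC (Equiv.swap i j k) * opT i j := by
  refine ext_end (fun w β => ?_) fun m =>
    ⟨if m = k then -opX (R := R) (Equiv.swap i j m) else opX (Equiv.swap i j m),
      opC (Equiv.swap i j k) * opD i j m, ?_, ?_⟩
  · rw [Module.End.mul_apply, Module.End.mul_apply, opC_vec_zero, map_smul, opT_vec_zero,
      opT_vec_zero, opC_vec_zero]
    simp
  · rw [opC_mul_opD h, mul_assoc, opC_mul_opX, ← mul_assoc]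
    split_ifs
    · rw [mul_neg, opT_mul_opX h]
      noncomm_ring
    · rw [opT_mul_opX h]
      noncomm_ring
  · rw [mul_assoc, opT_mul_opX h, mul_add, ← mul_assoc, opC_mul_opX]
    simp only [EmbeddingLike.apply_eq_iff_eq]
    split_ifs <;> noncomm_ring

/-- Corrections contain only Clifford generators, so a transposition merely permutes their indices.
In the Coxeter relations this brings the corrections from different factors to a common form. -/
theorem opT_mul_opD {i j : Fin d} (h : i ≠ j) (p q k : Fin d) :
    (opT i j * opD p q k : Module.End R (AffMod R d)) =
      opD (Equiv.swap i j p) (Equiv.swap i j q) (Equiv.swap i j k) * opT i j := by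
  have e : (opT i j * (opC p * opC q) : Module.End R (AffMod R d)) =
      opC (Equiv.swap i j p) * opC (Equiv.swap i j q) * opT i j := by
    rw [← mul_assoc, opT_mul_opC h, mul_assoc, opT_mul_opC h, mul_assoc]
  simp only [opD, EmbeddingLike.apply_eq_iff_eq]
  split_ifs
  · rw [mul_neg, mul_add, e]
    noncomm_ring
  · rw [mul_sub, e]
    noncomm_ring
  · simp

theorem opD_swap {i j : Fin d} (h : i ≠ j) (k : Fin d) :
    (opD j i k : Module.End R (AffMod R d)) = -opD i j k := by
  by_cases ki : k = i
  · subst ki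
    rw [opD_left, opD_right h.symm, opC_anti j k h.symm]
    noncomm_ring
  · by_cases kj : k = j
    · subst kj
      rw [opD_left, opD_right h, opC_anti k i ki]
      noncomm_ring
    · rw [opD_ne ki kj, opD_ne kj ki, neg_zero]

theorem opT_sq {i j : Fin d} (h : i ≠ j) : (opT i j * opT i j : Module.End R (AffMod R d)) = 1 := by
  refine ext_end (fun w β => ?_) fun k => ⟨opX k, 0, ?_, by simp⟩
  · rw [Module.End.mul_apply, opT_vec_zero, opT_vec_zero, Equiv.swap_mul_self_mul,
      Module.End.one_apply]
  -- The two factors contribute the corrections `opD j i` and `opD i j`, which cancel by `opD_swap`.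
  · rw [mul_assoc, opT_mul_opX h, mul_add, opT_mul_opD h, ← mul_assoc, opT_mul_opX h,
      Equiv.swap_apply_left, Equiv.swap_apply_right, opD_swap h, Equiv.swap_apply_self]
    noncomm_ring

theorem opT_comm {i j k l : Fin d} (hij : i ≠ j) (hkl : k ≠ l) (hik : i ≠ k) (hil : i ≠ l)
    (hjk : j ≠ k) (hjl : j ≠ l) :
    (opT i j * opT k l : Module.End R (AffMod R d)) = opT k l * opT i j := by
  have hd : Equiv.swap i j * Equiv.swap k l = Equiv.swap k l * Equiv.swap i j :=
    (Equiv.Perm.disjoint_swap_swap (by simp [*])).commute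
  refine ext_end (fun w β => ?_) fun m => ⟨opX (Equiv.swap i j (Equiv.swap k l m)),
    opD i j (Equiv.swap k l m) * opT k l + opT i j * opD k l m, ?_, ?_⟩
  · simp only [Module.End.mul_apply, opT_vec_zero, ← mul_assoc, hd]
  · rw [mul_assoc, opT_mul_opX hkl, mul_add, ← mul_assoc, opT_mul_opX hij]
    noncomm_ring
  · have e : Equiv.swap i j (Equiv.swap k l m) = Equiv.swap k l (Equiv.swap i j m) :=
      congrArg (fun w => w m) hd
    rw [mul_assoc, opT_mul_opX hij, mul_add, ← mul_assoc, opT_mul_opX hkl, opT_mul_opD hkl,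
      opT_mul_opD hij, e, Equiv.swap_apply_of_ne_of_ne hik hil,
      Equiv.swap_apply_of_ne_of_ne hjk hjl, Equiv.swap_apply_of_ne_of_ne hik.symm hjk.symm,
      Equiv.swap_apply_of_ne_of_ne hil.symm hjl.symm]
    noncomm_ring

theorem opT_braid {i j k : Fin d} (hij : i ≠ j) (hjk : j ≠ k) (hik : i ≠ k) :
    (opT i j * opT j k * opT i j : Module.End R (AffMod R d)) = opT j k * opT i j * opT j k := by
  have hd : Equiv.swap i j * Equiv.swap j k * Equiv.swap i j =
      Equiv.swap j k * Equiv.swap i j * Equiv.swap j k := by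
    have a1 := Equiv.swap_mul_swap_mul_swap hij hik
    have a2 := Equiv.swap_mul_swap_mul_swap hjk.symm hik.symm
    simp_all [mul_assoc, Equiv.swap_comm]
  have s1i : Equiv.swap j k i = i := Equiv.swap_apply_of_ne_of_ne hij hik
  have s2k : Equiv.swap i j k = k := Equiv.swap_apply_of_ne_of_ne hik.symm hjk.symm
  -- Each side moves the variable through three transpositions and collects three corrections. The
  -- middle one collapses to `opD i k m` because the transpositions around it square to one; the
  -- outer two are interchanged between the two sides.
  refine ext_end (fun w β => ?_) fun m =>
    ⟨opX (Equiv.swap i j (Equiv.swap j k (Equiv.swap i j m))),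
    opD i j (Equiv.swap j k (Equiv.swap i j m)) * opT j k * opT i j + opD i k m +
      opD j k (Equiv.swap i j (Equiv.swap j k m)) * opT i j * opT j k, ?_, ?_⟩
  · simp only [Module.End.mul_apply, opT_vec_zero, ← mul_assoc, hd]
  · have e1 : (opT i j * opD j k (Equiv.swap i j m) * opT i j : Module.End R (AffMod R d)) =
        opD i k m := by
      rw [opT_mul_opD hij, mul_assoc, opT_sq hij, mul_one, Equiv.swap_apply_right, s2k,
        Equiv.swap_apply_self]
    have e2 : (opT i j * (opT j k * opD i j m) : Module.End R (AffMod R d)) =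
        opD j k (Equiv.swap i j (Equiv.swap j k m)) * opT i j * opT j k := by
      rw [opT_mul_opD hjk, ← mul_assoc, opT_mul_opD hij, s1i, Equiv.swap_apply_left,
        Equiv.swap_apply_left, s2k]
    calc (opT i j * opT j k * opT i j * opX m : Module.End R (AffMod R d))
        = opT i j * (opT j k * (opT i j * opX m)) := by simp only [mul_assoc]
      _ = opX (Equiv.swap i j (Equiv.swap j k (Equiv.swap i j m))) * opT i j * opT j k * opT i j +
            opD i j (Equiv.swap j k (Equiv.swap i j m)) * opT j k * opT i j +
            opT i j * opD j k (Equiv.swap i j m) * opT i j +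
            opT i j * (opT j k * opD i j m) := by
        rw [opT_mul_opX hij, mul_add, ← mul_assoc, opT_mul_opX hjk, mul_add, add_mul, mul_add,
          ← mul_assoc, ← mul_assoc, opT_mul_opX hij]
        noncomm_ring
      _ = _ := by
        rw [e1, e2]
        noncomm_ring
  · have e0 : Equiv.swap i j (Equiv.swap j k (Equiv.swap i j m)) =
        Equiv.swap j k (Equiv.swap i j (Equiv.swap j k m)) := congrArg (fun w => w m) hd
    have e1 : (opT j k * opD i j (Equiv.swap j k m) * opT j k : Module.End R (AffMod R d)) =
        opD i k m := by
      rw [opT_mul_opD hjk, mul_assoc, opT_sq hjk, mul_one, Equiv.swap_apply_left, s1i,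
        Equiv.swap_apply_self]
    have e2 : (opT j k * (opT i j * opD j k m) : Module.End R (AffMod R d)) =
        opD i j (Equiv.swap j k (Equiv.swap i j m)) * opT j k * opT i j := by
      rw [opT_mul_opD hij, ← mul_assoc, opT_mul_opD hjk, s2k, Equiv.swap_apply_right,
        Equiv.swap_apply_right, s1i]
    calc (opT j k * opT i j * opT j k * opX m : Module.End R (AffMod R d))
        = opT j k * (opT i j * (opT j k * opX m)) := by simp only [mul_assoc]
      _ = opX (Equiv.swap j k (Equiv.swap i j (Equiv.swap j k m))) * opT j k * opT i j * opT j k +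
            opD j k (Equiv.swap i j (Equiv.swap j k m)) * opT i j * opT j k +
            opT j k * opD i j (Equiv.swap j k m) * opT j k +
            opT j k * (opT i j * opD j k m) := by
        rw [opT_mul_opX hjk, mul_add, ← mul_assoc, opT_mul_opX hij, mul_add, add_mul, mul_add,
          ← mul_assoc, ← mul_assoc, opT_mul_opX hjk]
        noncomm_ring
      _ = _ := by
        rw [e1, e2, e0]
        noncomm_ring

/-- The action of the symmetric group. -/
theorem exists_opW (N : ℕ) : ∃ φ : Equiv.Perm (Fin (N + 1)) →* Module.End R (AffMod R (N + 1)),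
    ∀ i j : Fin (N + 1), (i : ℕ) + 1 = j → φ (Equiv.swap i j) = opT i j := by
  let p : ℕ → Fin (N + 1) := Fin.ofNat (N + 1)
  have hp : ∀ a b, a ≤ N → b ≤ N → a ≠ b → p a ≠ p b := by
    intro a b ha hb hab h
    have := congrArg Fin.val h
    simp only [p, Fin.val_ofNat] at this
    rw [Nat.mod_eq_of_lt (by omega), Nat.mod_eq_of_lt (by omega)] at this
    exact hab this
  -- Only indices below N are used; the value 1 elsewhere makes the family total.
  let t : ℕ → (Module.End R (AffMod R (N + 1)))ˣ := fun i =>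
    if h : i < N then
      ⟨opT (p i) (p (i + 1)), opT (p i) (p (i + 1)), opT_sq (hp _ _ (by omega) (by omega) (by omega)),
        opT_sq (hp _ _ (by omega) (by omega) (by omega))⟩
    else 1
  have ht : ∀ i, i < N → (t i : Module.End R (AffMod R (N + 1))) = opT (p i) (p (i + 1)) := by
    intro i hi
    simp [t, hi]
  obtain ⟨φ, hφ⟩ := exists_perm_hom (N := N) t
    (fun i hi => by
      rw [Units.ext_iff, Units.val_mul, ht i hi]
      exact opT_sq (hp _ _ (by omega) (by omega) (by omega)))
    (fun i j hij hj => by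
      rw [Units.ext_iff, Units.val_mul, Units.val_mul, ht i (by omega), ht j hj]
      apply opT_comm <;> exact hp _ _ (by omega) (by omega) (by omega))
    (fun i hi => by
      simp only [Units.ext_iff, Units.val_mul]
      rw [ht i (by omega), ht (i + 1) hi]
      apply opT_braid <;> exact hp _ _ (by omega) (by omega) (by omega))
  refine ⟨(Units.coeHom _).comp φ, fun i j hij => ?_⟩
  have hj := j.2
  have e1 : p i = i := by
    apply Fin.ext
    simp only [p, Fin.val_ofNat]
    exact Nat.mod_eq_of_lt i.2
  have e2 : p (i + 1) = j := by
    apply Fin.ext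
    simp only [p, Fin.val_ofNat, hij]
    exact Nat.mod_eq_of_lt j.2
  have := hφ i (by omega)
  rw [adjSwap] at this
  change φ (Equiv.swap (p i) (p (i + 1))) = _ at this
  rw [e1, e2] at this
  change (φ (Equiv.swap i j) : Module.End R (AffMod R (N + 1))) = _
  rw [this, ht _ (by omega), e1, e2]

end AffMod

variable (R) in
/-- The regular representation of the affine Sergeev superalgebra and its values on monomials. -/
theorem exists_regular_rep (N : ℕ) :
    ∃ ρ : AffineSergeev R (N + 1) →ₐ[R] Module.End R (AffMod R (N + 1)), ∀ α w β,
      SgnEq (ρ (xMon (fun i => affGen (.x i)) α * affGen (.perm w) *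
        cMon (fun i => affGen (.c i)) β) (AffMod.vec 0 1 0)) (AffMod.vec α w β) := by
  obtain ⟨φ, hφ⟩ := AffMod.exists_opW (R := R) N
  have hTne : ∀ i j : Fin (N + 1), (i : ℕ) + 1 = j → i ≠ j := by
    rintro i j h rfl; omega
  let g : SergeevGen (N + 1) → Module.End R (AffMod R (N + 1)) := fun s => match s with
    | .perm w => φ w
    | .x i => AffMod.opX i
    | .c i => AffMod.opC i
  let ρ : AffineSergeev R (N + 1) →ₐ[R] Module.End R (AffMod R (N + 1)) :=
    RingQuot.liftAlgHom R ⟨FreeAlgebra.lift R g, by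
      intro a b h
      cases h with
      | perm_one => simp [g]
      | perm_mul v w => simp [g]
      | x_comm i j => simpa [g] using AffMod.opX_comm i j
      | c_sq i => simpa [g] using AffMod.opC_sq i
      | c_anti i j h => simpa [g] using AffMod.opC_anti i j h
      | x_c_self i => simp [g, AffMod.opC_mul_opX_self]
      | x_c_ne i j h => simp [g, AffMod.opC_mul_opX_ne h.symm]
      | s_c i j hij => simp [g, hφ i j hij, AffMod.opT_mul_opC (hTne i j hij)]
      | s_c_ne i j k hij hi hj =>
        simp [g, hφ i j hij, AffMod.opT_mul_opC (hTne i j hij),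
          Equiv.swap_apply_of_ne_of_ne hi hj]
      | s_x i j hij =>
        simp [g, hφ i j hij, AffMod.opT_mul_opX (hTne i j hij), AffMod.opD_left]
        abel
      | s_x_ne i j k hij hi hj =>
        simp [g, hφ i j hij, AffMod.opT_mul_opX (hTne i j hij),
          Equiv.swap_apply_of_ne_of_ne hi hj, AffMod.opD_ne hi hj]⟩
  have hρ : ∀ s, ρ (affGen s) = g s := by
    intro s
    change RingQuot.liftAlgHom R _ (RingQuot.mkAlgHom R _ (FreeAlgebra.ι R s)) = _
    rw [RingQuot.liftAlgHom_mkAlgHom_apply]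
    exact FreeAlgebra.lift_ι_apply g s
  refine ⟨ρ, fun α w β => ?_⟩
  -- The monomial is evaluated on `vec 0 1 0` from right to left. Only the Clifford factor can
  -- produce a sign.
  have hc : SgnEq (cMon (AffMod.opC (R := R)) β (AffMod.vec 0 1 0)) (AffMod.vec 0 1 β) := by
    induction β using zmod_two_fun_induction with
    | h0 => rw [IsClifford.cMon_zero]; exact SgnEq.refl _
    | hs j β ih =>
      have h1 : SgnEq (cMon (AffMod.opC (R := R)) (β + Pi.single j 1) (AffMod.vec 0 1 0))
          (AffMod.opC j (cMon AffMod.opC β (AffMod.vec 0 1 0))) :=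
        (AffMod.isClifford_opC.mul_cMon_sgnEq j β).symm.map (LinearMap.applyₗ (R := R)
          (AffMod.vec 0 1 0 : AffMod R (N + 1)))
      refine h1.trans ((ih.map _).trans ?_)
      rw [AffMod.opC_vec_zero]
      rcases neg_one_pow_eq_or R (leftExp β ((1 : Equiv.Perm (Fin (N + 1)))⁻¹ j)) with h | h <;>
        rw [h]
      · exact SgnEq.of_eq (by simp)
      · exact Or.inr (by simp)
  have hw : φ w (AffMod.vec 0 1 β) = AffMod.vec 0 w β := by
    have : ∀ v, φ w (AffMod.vec 0 v β) = AffMod.vec 0 (w * v) β := by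
      induction w using perm_closure_adjSwap with
      | h1 => simp
      | hmul i hi w ih =>
        intro v
        rw [map_mul, Module.End.mul_apply, ih, adjSwap, hφ, AffMod.opT_vec_zero, mul_assoc]
        rw [Fin.val_ofNat, Fin.val_ofNat, Nat.mod_eq_of_lt (by omega), Nat.mod_eq_of_lt (by omega)]
    simpa using this 1
  have hx : xMon (AffMod.opX (R := R)) α (AffMod.vec 0 w β) = AffMod.vec α w β := by
    induction α using nat_fun_induction with
    | h0 => rw [xMon_zero, Module.End.one_apply]
    | hs j α ih => 
      rw [← mul_xMon AffMod.opX_comm, Module.End.mul_apply, ih, AffMod.opX_vec]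
  have e : ρ (xMon (fun i => affGen (.x i)) α * affGen (.perm w) *
      cMon (fun i => affGen (.c i)) β) = xMon AffMod.opX α * φ w * cMon AffMod.opC β := by
    rw [map_mul, map_mul, map_xMon, hρ, cMon, map_list_prod, List.map_ofFn]
    simp only [Function.comp_def, map_pow, hρ]
    rfl
  rw [e, Module.End.mul_apply, Module.End.mul_apply]
  refine ((hc.map (φ w)).map _).trans (SgnEq.of_eq ?_)
  rw [hw, hx]

end AffineModule

/-! ## Monomial basis of the affine Sergeev superalgebra -/

section Affine

variable {R : Type*} [CommRing R] {N : ℕ}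

/-- The polynomial generator `x_i` of the affine Sergeev superalgebra. -/
noncomputable def affX (i : Fin (N + 1)) : AffineSergeev R (N + 1) := affGen (.x i)

/-- The Clifford generator `c_i` of the affine Sergeev superalgebra. -/
noncomputable def affC (i : Fin (N + 1)) : AffineSergeev R (N + 1) := affGen (.c i)

/-- The element of the affine Sergeev superalgebra given by a permutation. -/
noncomputable def affW (w : Equiv.Perm (Fin (N + 1))) : AffineSergeev R (N + 1) := affGen (.perm w)

theorem affMk_eq {a b : FreeAlgebra R (SergeevGen (N + 1))} (h : SergeevRel R (N + 1) a b) :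
    affMk R (N + 1) a = affMk R (N + 1) b :=
  RingQuot.mkAlgHom_rel R h

theorem affW_one : (affW 1 : AffineSergeev R (N + 1)) = 1 := by
  simpa [affW, affGen] using affMk_eq (R := R) (SergeevRel.perm_one (R := R) (d := N + 1))

theorem affW_mul (v w : Equiv.Perm (Fin (N + 1))) :
    (affW (v * w) : AffineSergeev R (N + 1)) = affW v * affW w := by
  simpa [affW, affGen] using affMk_eq (SergeevRel.perm_mul (R := R) v w)

theorem affX_comm (i j : Fin (N + 1)) :
    (affX i * affX j : AffineSergeev R (N + 1)) = affX j * affX i := by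
  simpa [affX, affGen] using affMk_eq (SergeevRel.x_comm (R := R) i j)

theorem isClifford_affC : IsClifford (affC (R := R) (N := N)) where
  sq i := by simpa [affC, affGen] using affMk_eq (SergeevRel.c_sq (R := R) i)
  anti i j h := by simpa [affC, affGen] using affMk_eq (SergeevRel.c_anti (R := R) i j h)

theorem affC_mul_affX_self (i : Fin (N + 1)) :
    (affC i * affX i : AffineSergeev R (N + 1)) = -(affX i * affC i) := by
  have := affMk_eq (SergeevRel.x_c_self (R := R) i)
  simp only [map_mul, map_neg] at this
  exact (neg_eq_iff_eq_neg.2 this).symm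

theorem affC_mul_affX_ne {i j : Fin (N + 1)} (h : j ≠ i) :
    (affC j * affX i : AffineSergeev R (N + 1)) = affX i * affC j := by
  have := affMk_eq (SergeevRel.x_c_ne (R := R) i j h)
  simp only [map_mul] at this
  exact this.symm

theorem exists_adjSwap_eq {i : ℕ} (hi : i < N) :
    ∃ a b : Fin (N + 1), (a : ℕ) + 1 = b ∧ a ≠ b ∧ (a : ℕ) = i ∧ adjSwap N i = Equiv.swap a b := by
  refine ⟨Fin.ofNat (N + 1) i, Fin.ofNat (N + 1) (i + 1), ?_, ?_, ?_, rfl⟩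
  · rw [Fin.val_ofNat, Fin.val_ofNat, Nat.mod_eq_of_lt (by omega), Nat.mod_eq_of_lt (by omega)]
  · rw [Ne, Fin.ext_iff, Fin.val_ofNat, Fin.val_ofNat, Nat.mod_eq_of_lt (by omega),
      Nat.mod_eq_of_lt (by omega)]
    omega
  · rw [Fin.val_ofNat, Nat.mod_eq_of_lt (by omega)]

theorem affW_mul_affC (w : Equiv.Perm (Fin (N + 1))) (k : Fin (N + 1)) :
    (affW w * affC k : AffineSergeev R (N + 1)) = affC (w k) * affW w := by
  induction w using perm_closure_adjSwap with
  | h1 => simp [affW_one]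
  | hmul i hi w ih =>
    obtain ⟨a, b, hab, hne, -, e⟩ := exists_adjSwap_eq hi
    have key : ∀ k, (affW (Equiv.swap a b) * affC k : AffineSergeev R (N + 1)) =
        affC (Equiv.swap a b k) * affW (Equiv.swap a b) := by
      intro k
      have h1 : (affW (Equiv.swap a b) * affC a : AffineSergeev R (N + 1)) =
          affC b * affW (Equiv.swap a b) := by
        have := affMk_eq (SergeevRel.s_c (R := R) a b hab)
        simp only [map_mul] at this
        exact this
      by_cases ka : k = a
      · rw [ka, Equiv.swap_apply_left, h1]
      · by_cases kb : k = b
        · have s1 : (affW (Equiv.swap a b) * affW (Equiv.swap a b) : AffineSergeev R (N + 1)) = 1 := by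
            rw [← affW_mul, Equiv.swap_mul_self, affW_one]
          rw [kb, Equiv.swap_apply_right]
          calc (affW (Equiv.swap a b) * affC b : AffineSergeev R (N + 1))
              = affW (Equiv.swap a b) * (affC b * affW (Equiv.swap a b)) *
                  affW (Equiv.swap a b) := by rw [mul_assoc, mul_assoc, s1, mul_one]
            _ = _ := by rw [← h1, ← mul_assoc, s1, one_mul]
        · rw [Equiv.swap_apply_of_ne_of_ne ka kb]
          have := affMk_eq (SergeevRel.s_c_ne (R := R) a b k hab ka kb)
          simp only [map_mul] at this
          exact this
    rw [affW_mul, mul_assoc, ih, ← mul_assoc, e, key, mul_assoc, ← affW_mul, Equiv.Perm.mul_apply]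

/-- The monomial `x^α w c^β`. -/
noncomputable def affMon (α : Fin (N + 1) → ℕ) (w : Equiv.Perm (Fin (N + 1)))
    (β : Fin (N + 1) → ZMod 2) : AffineSergeev R (N + 1) :=
  xMon affX α * affW w * cMon affC β

theorem affX_mul_affMon (j : Fin (N + 1)) (α : Fin (N + 1) → ℕ) (w : Equiv.Perm (Fin (N + 1)))
    (β : Fin (N + 1) → ZMod 2) :
    (affX j * affMon α w β : AffineSergeev R (N + 1)) = affMon (α + Pi.single j 1) w β := by
  rw [affMon, affMon, ← mul_xMon affX_comm]
  simp only [mul_assoc]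

/-- The span of the monomials of polynomial degree less than `m`. -/
noncomputable def affLt (R : Type*) [CommRing R] (N m : ℕ) : Submodule R (AffineSergeev R (N + 1)) :=
  Submodule.span R {y | ∃ α w β, ∑ j, α j < m ∧ y = affMon α w β}

theorem affMon_mem {m : ℕ} {α : Fin (N + 1) → ℕ} (h : ∑ j, α j < m)
    (w : Equiv.Perm (Fin (N + 1))) (β : Fin (N + 1) → ZMod 2) : affMon α w β ∈ affLt R N m :=
  Submodule.subset_span ⟨α, w, β, h, rfl⟩

theorem affLt_mono {m n : ℕ} (h : m ≤ n) : affLt R N m ≤ affLt R N n := by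
  apply Submodule.span_mono
  rintro y ⟨α, w, β, hα, rfl⟩
  exact ⟨α, w, β, hα.trans_le h, rfl⟩

/-- A bilinear form of span induction: products of spanning elements. -/
theorem mul_mem_of_span {A : Type*} [Ring A] [Algebra R A] {s t : Set A} {p : Submodule R A}
    (h : ∀ a ∈ s, ∀ b ∈ t, a * b ∈ p) {a b : A} (ha : a ∈ Submodule.span R s)
    (hb : b ∈ Submodule.span R t) : a * b ∈ p := by
  have : Submodule.span R s * Submodule.span R t ≤ p := by
    rw [Submodule.span_mul_span, Submodule.span_le]
    rintro _ ⟨a, ha, b, hb, rfl⟩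
    exact h a ha b hb
  exact this (Submodule.mul_mem_mul ha hb)

theorem mul_mem_of_span_right {A : Type*} [Ring A] [Algebra R A] {t : Set A} {p : Submodule R A}
    {a b : A} (h : ∀ b ∈ t, a * b ∈ p) (hb : b ∈ Submodule.span R t) : a * b ∈ p :=
  mul_mem_of_span (s := {a}) (by rintro _ rfl; exact h) (Submodule.mem_span_singleton_self a) hb

theorem affX_mul_mem (j : Fin (N + 1)) {m : ℕ} {a : AffineSergeev R (N + 1)}
    (ha : a ∈ affLt R N m) : affX j * a ∈ affLt R N (m + 1) := by
  refine mul_mem_of_span_right ?_ ha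
  rintro _ ⟨α, w, β, h, rfl⟩
  rw [affX_mul_affMon]
  exact affMon_mem (by simpa [Finset.sum_add_distrib] using h) _ _

theorem xMon_mul_mem (α : Fin (N + 1) → ℕ) {m : ℕ} {a : AffineSergeev R (N + 1)}
    (ha : a ∈ affLt R N m) : xMon affX α * a ∈ affLt R N (∑ j, α j + m) := by
  induction α using nat_fun_induction with
  | h0 => simpa [xMon_zero] using ha
  | hs j α ih =>
    rw [← mul_xMon affX_comm, mul_assoc]
    refine affLt_mono (le_of_eq ?_) (affX_mul_mem j ih)
    simp [Finset.sum_add_distrib]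
    ring

theorem affMon_zero (w : Equiv.Perm (Fin (N + 1))) (β : Fin (N + 1) → ZMod 2) :
    (affMon 0 w β : AffineSergeev R (N + 1)) = affW w * cMon affC β := by
  rw [affMon, xMon_zero, one_mul]

theorem affW_mul_cMon_mem (w : Equiv.Perm (Fin (N + 1))) (β : Fin (N + 1) → ZMod 2) :
    (affW w * cMon affC β : AffineSergeev R (N + 1)) ∈ affLt R N 1 := by
  rw [← affMon_zero]
  exact affMon_mem (by simp) _ _

theorem affMon_eq (α : Fin (N + 1) → ℕ) (w : Equiv.Perm (Fin (N + 1)))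
    (β : Fin (N + 1) → ZMod 2) :
    (affMon α w β : AffineSergeev R (N + 1)) = xMon affX α * (affW w * cMon affC β) :=
  mul_assoc _ _ _

theorem mem_affLt_one {p : Submodule R (AffineSergeev R (N + 1))}
    (h : ∀ w β, (affW w * cMon affC β : AffineSergeev R (N + 1)) ∈ p) : affLt R N 1 ≤ p := by
  refine Submodule.span_le.2 ?_
  rintro _ ⟨α, w, β, hα, rfl⟩
  obtain rfl : α = 0 := by
    funext j
    have := Finset.sum_eq_zero_iff.1 (Nat.lt_one_iff.1 hα) j (Finset.mem_univ j)
    simpa using this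
  rw [affMon_zero]
  exact h w β

/-- The degree zero part is a subalgebra: Clifford monomials move past permutations up to sign, and
products of Clifford monomials are again such monomials up to sign. -/
theorem affLt_one_mul_mem {a b : AffineSergeev R (N + 1)} (ha : a ∈ affLt R N 1)
    (hb : b ∈ affLt R N 1) : a * b ∈ affLt R N 1 := by
  have h0 : ∀ w β v γ, (affW w * cMon affC β * (affW v * cMon affC γ) :
      AffineSergeev R (N + 1)) ∈ affLt R N 1 := by
    intro w β v γ
    have e1 : SgnEq (cMon affC β * affW v : AffineSergeev R (N + 1))
        (affW v * cMon affC fun j => β (v j)) := by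
      have e := isClifford_affC.mul_cMon_of_perm (affW_mul_affC (R := R) v) (fun j => β (v j))
      simpa using e.symm
    have e2 : SgnEq (affW w * cMon affC β * (affW v * cMon affC γ) : AffineSergeev R (N + 1))
        (affW (w * v) * cMon affC ((fun j => β (v j)) + γ)) := by
      have a1 := (e1.mul_right (cMon affC γ)).mul_left (affW w)
      have a2 := (isClifford_affC.cMon_mul_cMon_sgnEq (fun j => β (v j)) γ).mul_left
        (affW (w * v) : AffineSergeev R (N + 1))
      rw [affW_mul] at a2 ⊢
      simp only [mul_assoc] at a1 a2 ⊢
      exact a1.trans a2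
    exact e2.mem (affW_mul_cMon_mem _ _)
  have h1 : affLt R N 1 ≤ Submodule.span R {y | ∃ w β, y = affW w * cMon affC β} :=
    mem_affLt_one fun w β => Submodule.subset_span ⟨w, β, rfl⟩
  refine mul_mem_of_span ?_ (h1 ha) (h1 hb)
  rintro _ ⟨w, β, rfl⟩ _ ⟨v, γ, rfl⟩
  exact h0 w β v γ

theorem one_mem_affLt : (1 : AffineSergeev R (N + 1)) ∈ affLt R N 1 := by
  simpa [affW_one, IsClifford.cMon_zero] using affW_mul_cMon_mem (R := R) (N := N) 1 0

theorem affW_mem (w : Equiv.Perm (Fin (N + 1))) : (affW w : AffineSergeev R (N + 1)) ∈ affLt R N 1 := by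
  simpa [IsClifford.cMon_zero] using affW_mul_cMon_mem (R := R) (N := N) w 0

theorem affC_mem (i : Fin (N + 1)) : (affC i : AffineSergeev R (N + 1)) ∈ affLt R N 1 := by
  have h := (isClifford_affC (R := R)).mul_cMon_sgnEq i 0
  rw [IsClifford.cMon_zero, mul_one, zero_add] at h
  refine h.mem ?_
  simpa [affW_one] using affW_mul_cMon_mem (R := R) (N := N) 1 (Pi.single i 1)

theorem affX_mem (i : Fin (N + 1)) : (affX i : AffineSergeev R (N + 1)) ∈ affLt R N 2 := by
  simpa using affX_mul_mem i (one_mem_affLt (R := R))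

/-- The corrections in w x_k = x_{w k} w + ... have degree zero, hence disappear in the associated
graded algebra. -/
theorem affW_mul_affX_sub_mem (w : Equiv.Perm (Fin (N + 1))) (k : Fin (N + 1)) :
    (affW w * affX k - affX (w k) * affW w : AffineSergeev R (N + 1)) ∈ affLt R N 1 := by
  induction w using perm_closure_adjSwap with
  | h1 => simp [affW_one]
  | hmul i hi w ih =>
    obtain ⟨a, b, hab, hne, -, e⟩ := exists_adjSwap_eq hi
    have hcc : (1 + affC a * affC b : AffineSergeev R (N + 1)) ∈ affLt R N 1 :=
      add_mem one_mem_affLt (affLt_one_mul_mem (affC_mem a) (affC_mem b))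
    have h1 : (affW (Equiv.swap a b) * affX a : AffineSergeev R (N + 1)) =
          affX b * affW (Equiv.swap a b) - (1 + affC a * affC b) := by
        have := affMk_eq (SergeevRel.s_x (R := R) a b hab)
        simp only [map_mul, map_sub, map_one] at this
        rw [← sub_sub]
        exact this
    have key : ∀ k, (affW (Equiv.swap a b) * affX k -
        affX (Equiv.swap a b k) * affW (Equiv.swap a b) : AffineSergeev R (N + 1)) ∈
          affLt R N 1 := by
      intro k
      by_cases ka : k = a
      · rw [ka, Equiv.swap_apply_left, h1, sub_sub_cancel_left]
        exact neg_mem hcc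
      · by_cases kb : k = b
        · have s1 : (affW (Equiv.swap a b) * affW (Equiv.swap a b) : AffineSergeev R (N + 1)) = 1 := by
            rw [← affW_mul, Equiv.swap_mul_self, affW_one]
          rw [kb, Equiv.swap_apply_right]
          -- The defining relation treats only the smaller index; multiplying it by the
          -- transposition on both sides gives the rule for the larger one.
          have e2 : (affW (Equiv.swap a b) * affX b - affX a * affW (Equiv.swap a b) :
              AffineSergeev R (N + 1)) = affW (Equiv.swap a b) * (1 + affC a * affC b) *
                affW (Equiv.swap a b) := by
            have h2 : (1 + affC a * affC b : AffineSergeev R (N + 1)) =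
                affX b * affW (Equiv.swap a b) - affW (Equiv.swap a b) * affX a := by
              rw [h1]; abel
            rw [h2, mul_sub, sub_mul, ← mul_assoc, ← mul_assoc, s1, one_mul, mul_assoc, s1, mul_one]
          rw [e2]
          exact affLt_one_mul_mem (affLt_one_mul_mem (affW_mem _) hcc) (affW_mem _)
        · rw [Equiv.swap_apply_of_ne_of_ne ka kb]
          have := affMk_eq (SergeevRel.s_x_ne (R := R) a b k hab ka kb)
          simp only [map_mul] at this
          have h2 : (affW (Equiv.swap a b) * affX k : AffineSergeev R (N + 1)) =
            affX k * affW (Equiv.swap a b) := this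
          rw [h2, sub_self]
          exact zero_mem _
    have e3 : (affW (Equiv.swap a b * w) * affX k -
        affX ((Equiv.swap a b * w) k) * affW (Equiv.swap a b * w) : AffineSergeev R (N + 1)) =
        affW (Equiv.swap a b) * (affW w * affX k - affX (w k) * affW w) +
        (affW (Equiv.swap a b) * affX (w k) -
          affX (Equiv.swap a b (w k)) * affW (Equiv.swap a b)) * affW w := by
      rw [affW_mul, Equiv.Perm.mul_apply]
      noncomm_ring
    rw [e, e3]
    exact add_mem (affLt_one_mul_mem (affW_mem _) ih) (affLt_one_mul_mem (key _) (affW_mem _))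

theorem cMon_affC_mul_affX (β : Fin (N + 1) → ZMod 2) (j : Fin (N + 1)) :
    SgnEq (cMon affC β * affX j : AffineSergeev R (N + 1)) (affX j * cMon affC β) := by
  induction β using zmod_two_fun_induction with
  | h0 => rw [IsClifford.cMon_zero, one_mul, mul_one]; exact SgnEq.refl _
  | hs k β ih =>
    have h := (isClifford_affC (R := R)).mul_cMon_sgnEq k β
    refine (h.symm.mul_right _).trans ?_
    rw [mul_assoc]
    refine (ih.mul_left _).trans (SgnEq.trans ?_ (h.mul_left _))
    rw [← mul_assoc, ← mul_assoc]
    refine SgnEq.mul_right ?_ _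
    rcases eq_or_ne k j with rfl | hk
    · rw [affC_mul_affX_self]; exact SgnEq.neg_self _
    · rw [affC_mul_affX_ne hk]; exact SgnEq.refl _

variable (R N) in
/-- The sum of the products of a polynomial generator with an element of degree zero. -/
noncomputable def affXSpan : Submodule R (AffineSergeev R (N + 1)) :=
  Submodule.span R {y | ∃ k, ∃ ψ ∈ affLt R N 1, y = affX k * ψ}

/-- A variable on the right of a degree zero element moves to the left at the cost of a degree zero
remainder. Iteration gives the straightening of arbitrary words. -/
theorem affLt_one_mul_affX {φ : AffineSergeev R (N + 1)} (hφ : φ ∈ affLt R N 1) (j : Fin (N + 1)) :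
    φ * affX j ∈ affXSpan R N ⊔ affLt R N 1 := by
  have h1 : affLt R N 1 ≤ Submodule.comap (LinearMap.mulRight R (affX j))
      (affXSpan R N ⊔ affLt R N 1) := by
    refine mem_affLt_one fun w β => ?_
    change affW w * cMon affC β * affX j ∈ affXSpan R N ⊔ affLt R N 1
    have e : SgnEq (affW w * cMon affC β * affX j : AffineSergeev R (N + 1))
        (affX (w j) * (affW w * cMon affC β) +
          (affW w * affX j - affX (w j) * affW w) * cMon affC β) := by
      have := (cMon_affC_mul_affX (R := R) β j).mul_left (affW w)
      rw [← mul_assoc] at this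
      refine this.trans (SgnEq.of_eq ?_)
      noncomm_ring
    refine e.mem (add_mem ?_ ?_)
    · exact Submodule.mem_sup_left (Submodule.subset_span ⟨_, _, affW_mul_cMon_mem _ _, rfl⟩)
    · refine Submodule.mem_sup_right (affLt_one_mul_mem (affW_mul_affX_sub_mem w j) ?_)
      simpa [affW_one] using affW_mul_cMon_mem (R := R) (N := N) 1 β
  exact h1 hφ

theorem affLt_one_mul_xMon_mul (α : Fin (N + 1) → ℕ) :
    ∀ φ ∈ affLt R N 1, ∀ ψ ∈ affLt R N 1,
    φ * (xMon affX α * ψ) ∈ affLt R N (∑ j, α j + 1) := by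
  induction α using nat_fun_induction with
  | h0 =>
    intro φ hφ ψ hψ
    simpa [xMon_zero] using affLt_one_mul_mem hφ hψ
  | hs j α ih =>
    intro φ hφ ψ hψ
    rw [← mul_xMon affX_comm, mul_assoc, ← mul_assoc]
    have e : ∑ k, (α + Pi.single j 1 : Fin (N + 1) → ℕ) k = ∑ k, α k + 1 := by
      simp [Finset.sum_add_distrib]
    rw [e]
    obtain ⟨a, ha, b, hb, hab⟩ := Submodule.mem_sup.1 (affLt_one_mul_affX hφ j)
    rw [← hab, add_mul]
    refine add_mem ?_ (affLt_mono (by omega) (ih b hb ψ hψ))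
    have : affXSpan R N ≤
        Submodule.comap (LinearMap.mulRight R (xMon affX α * ψ))
          (affLt R N (∑ k, α k + 1 + 1)) := by
      rw [affXSpan, Submodule.span_le]
      rintro _ ⟨k, χ, hχ, rfl⟩
      change affX k * χ * (xMon affX α * ψ) ∈ affLt R N (∑ k, α k + 1 + 1)
      rw [mul_assoc]
      exact affX_mul_mem k (ih χ hχ ψ hψ)
    exact this ha

theorem affLt_one_mul {m : ℕ} {φ a : AffineSergeev R (N + 1)} (hφ : φ ∈ affLt R N 1)
    (ha : a ∈ affLt R N m) : φ * a ∈ affLt R N m := by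
  refine mul_mem_of_span_right ?_ ha
  rintro _ ⟨α, w, β, h, rfl⟩
  rw [affMon_eq]
  exact affLt_mono (by omega) (affLt_one_mul_xMon_mul α φ hφ _ (affW_mul_cMon_mem w β))

/-- `affLt R N m` bounds the degree strictly. Degrees at most m - 1 and n add up to less than m + n,
whence the shift in the hypothesis on b. -/
theorem affLt_mul {m n : ℕ} {a b : AffineSergeev R (N + 1)} (ha : a ∈ affLt R N m)
    (hb : b ∈ affLt R N (n + 1)) : a * b ∈ affLt R N (m + n) := by
  have : affLt R N m ≤ Submodule.comap (LinearMap.mulRight R b) (affLt R N (m + n)) := by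
    rw [affLt, Submodule.span_le]
    rintro _ ⟨α, w, β, h, rfl⟩
    change affMon α w β * b ∈ affLt R N (m + n)
    rw [affMon_eq, mul_assoc]
    exact affLt_mono (by omega) (xMon_mul_mem α (affLt_one_mul (affW_mul_cMon_mem w β) hb))
  exact this ha

theorem affGen_mem (g : SergeevGen (N + 1)) :
    (affGen g : AffineSergeev R (N + 1)) ∈ affLt R N (g.deg + 1) := by
  cases g with
  | perm w => exact affW_mem w
  | x i => exact affX_mem i
  | c i => exact affC_mem i

theorem affGen_list_prod_mem (v : List (SergeevGen (N + 1))) :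
    ((v.map affGen).prod : AffineSergeev R (N + 1)) ∈
      affLt R N ((v.map SergeevGen.deg).sum + 1) := by
  induction v with
  | nil => simpa using one_mem_affLt
  | cons g v ih =>
    simp only [List.map_cons, List.prod_cons, List.sum_cons]
    exact affLt_mono (by omega) (affLt_mul (affGen_mem g) ih)

/-- Every element of an algebra generated by a family is a combination of words. -/
theorem exists_mem_affLt (a : AffineSergeev R (N + 1)) : ∃ m, a ∈ affLt R N m := by
  obtain ⟨a, rfl⟩ := RingQuot.mkAlgHom_surjective R (SergeevRel R (N + 1)) a
  induction a using FreeAlgebra.induction with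
  | grade0 r =>
    refine ⟨1, ?_⟩
    rw [AlgHom.commutes, Algebra.algebraMap_eq_smul_one]
    exact Submodule.smul_mem _ r one_mem_affLt
  | grade1 g => exact ⟨_, affGen_mem g⟩
  | mul a b ha hb =>
    obtain ⟨m, hm⟩ := ha
    obtain ⟨n, hn⟩ := hb
    refine ⟨m + n, ?_⟩
    rw [map_mul]
    exact affLt_mul hm (affLt_mono (Nat.le_succ n) hn)
  | add a b ha hb =>
    obtain ⟨m, hm⟩ := ha
    obtain ⟨n, hn⟩ := hb
    refine ⟨m + n, ?_⟩
    rw [map_add]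
    exact add_mem (affLt_mono (by omega) hm) (affLt_mono (by omega) hn)

-- Applying the regular representation to `vec 0 1 0` sends the monomials, up to sign, to distinct
-- basis vectors of `AffMod`.
variable (R N) in
theorem linearIndependent_affMon : LinearIndependent R
    (fun t : (Fin (N + 1) → ℕ) × Equiv.Perm (Fin (N + 1)) × (Fin (N + 1) → ZMod 2) =>
      (affMon t.1 t.2.1 t.2.2 : AffineSergeev R (N + 1))) := by
  obtain ⟨ρ, hρ⟩ := exists_regular_rep R N
  let ev : AffineSergeev R (N + 1) →ₗ[R] AffMod R (N + 1) :=
    (LinearMap.applyₗ (AffMod.vec 0 1 0)) ∘ₗ ρ.toLinearMap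
  have h : ∀ t : (Fin (N + 1) → ℕ) × Equiv.Perm (Fin (N + 1)) × (Fin (N + 1) → ZMod 2),
      ∃ u : Rˣ, ev (affMon t.1 t.2.1 t.2.2) = u • AffMod.basis R (N + 1) t := by
    intro t
    rcases hρ t.1 t.2.1 t.2.2 with h | h
    · exact ⟨1, by rw [one_smul]; exact h⟩
    · exact ⟨-1, by rw [Units.neg_smul, one_smul]; exact h⟩
  choose u hu using h
  refine LinearIndependent.of_comp ev ?_
  have := (AffMod.basis R (N + 1)).linearIndependent.units_smul u
  convert this using 1
  funext t
  exact hu t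

variable (R N) in
/-- The basis of the affine Sergeev superalgebra consisting of the monomials `x^α w c^β`. -/
noncomputable def affBasis : Module.Basis
    ((Fin (N + 1) → ℕ) × Equiv.Perm (Fin (N + 1)) × (Fin (N + 1) → ZMod 2)) R
    (AffineSergeev R (N + 1)) :=
  Module.Basis.mk (linearIndependent_affMon R N) (by
    intro a _
    obtain ⟨m, hm⟩ := exists_mem_affLt a
    refine Submodule.span_mono ?_ hm
    rintro _ ⟨α, w, β, -, rfl⟩
    exact ⟨(α, w, β), rfl⟩)

theorem affBasis_apply (t : (Fin (N + 1) → ℕ) × Equiv.Perm (Fin (N + 1)) × (Fin (N + 1) → ZMod 2)) :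
    affBasis R N t = affMon t.1 t.2.1 t.2.2 := by
  rw [affBasis, Module.Basis.mk_apply]

end Affine

/-! ## Monomials in the cyclotomic quotient -/

section Cyclotomic

variable {R : Type*} [CommRing R] {N : ℕ}

/-- A permutation fixing the first index is a product of adjacent transpositions that avoid it, and
these commute with x_1 exactly. `decomposeFin` supplies the induction over the remaining indices. -/
theorem affW_mul_affX_zero {w : Equiv.Perm (Fin (N + 1))} (hw : w 0 = 0) :
    (affW w * affX 0 : AffineSergeev R (N + 1)) = affX 0 * affW w := by
  obtain ⟨⟨p, e⟩, rfl⟩ := Equiv.Perm.decomposeFin.symm.surjective w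
  rw [Equiv.Perm.decomposeFin_symm_apply_zero] at hw
  subst hw
  cases N with
  | zero =>
    have : Equiv.Perm.decomposeFin.symm ((0 : Fin 1), e) = 1 := Subsingleton.elim _ _
    rw [this, affW_one, one_mul, mul_one]
  | succ N =>
    induction e using perm_closure_adjSwap with
    | h1 =>
      have : Equiv.Perm.decomposeFin.symm ((0 : Fin (N + 1 + 1)), (1 : Equiv.Perm (Fin (N + 1)))) =
          1 := by
        ext x
        refine Fin.cases ?_ (fun j => ?_) x <;> simp
      rw [this, affW_one, one_mul, mul_one]
    | hmul i hi e ih =>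
      obtain ⟨a, b, hab, hne, -, he⟩ := exists_adjSwap_eq hi
      have h1 : Equiv.Perm.decomposeFin.symm ((0 : Fin (N + 1 + 1)), adjSwap N i * e) =
          Equiv.swap a.succ b.succ * Equiv.Perm.decomposeFin.symm ((0 : Fin (N + 1 + 1)), e) := by
        refine Equiv.ext fun x => ?_
        rw [he, Equiv.Perm.mul_apply]
        refine Fin.cases ?_ (fun j => ?_) x
        · rw [Equiv.Perm.decomposeFin_symm_apply_zero, Equiv.Perm.decomposeFin_symm_apply_zero,
            Equiv.swap_apply_of_ne_of_ne (Fin.succ_ne_zero _).symm (Fin.succ_ne_zero _).symm]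
        · rw [Equiv.Perm.decomposeFin_symm_apply_succ, Equiv.Perm.decomposeFin_symm_apply_succ,
            Equiv.swap_self, Equiv.refl_apply, Equiv.refl_apply, Equiv.Perm.mul_apply,
            (Fin.succ_injective _).swap_apply]
      have h2 : (affW (Equiv.swap a.succ b.succ) * affX 0 : AffineSergeev R (N + 1 + 1)) =
          affX 0 * affW (Equiv.swap a.succ b.succ) := by
        have := affMk_eq (SergeevRel.s_x_ne (R := R) a.succ b.succ 0 (by simp [hab])
          (Fin.succ_ne_zero _).symm (Fin.succ_ne_zero _).symm)
        simp only [map_mul] at this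
        exact this
      rw [h1, affW_mul, mul_assoc, ih, ← mul_assoc, h2, mul_assoc]

/-- The conjugate of `f(x_1)` attached to the index `i`. -/
noncomputable def affF (f : Polynomial R) (i : Fin (N + 1)) : AffineSergeev R (N + 1) :=
  affW (Equiv.swap 0 i) * Polynomial.aeval (affX 0) f * affW (Equiv.swap 0 i)

theorem affW_swap_sq (i j : Fin (N + 1)) :
    (affW (Equiv.swap i j) * affW (Equiv.swap i j) : AffineSergeev R (N + 1)) = 1 := by
  rw [← affW_mul, Equiv.swap_mul_self, affW_one]

theorem affF_zero (f : Polynomial R) :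
    (affF f 0 : AffineSergeev R (N + 1)) = Polynomial.aeval (affX 0) f := by
  rw [affF, Equiv.swap_self]
  change affW 1 * _ * affW 1 = _
  rw [affW_one, one_mul, mul_one]

theorem commute_aeval {A : Type*} [Ring A] [Algebra R A] {a x : A} (h : a * x = x * a)
    (f : Polynomial R) : a * Polynomial.aeval x f = Polynomial.aeval x f * a := by
  rw [Polynomial.aeval_eq_sum_range, Finset.mul_sum, Finset.sum_mul]
  refine Finset.sum_congr rfl fun k _ => ?_
  rw [mul_smul_comm, smul_mul_assoc, ((show Commute a x from h).pow_right k).eq]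

theorem anticommute_aeval {A : Type*} [Ring A] [Algebra R A] {a x : A} (h : a * x = -(x * a))
    {f : Polynomial R} (hf : ∀ k, f.coeff k ≠ 0 → Odd k) :
    a * Polynomial.aeval x f = -(Polynomial.aeval x f * a) := by
  rw [Polynomial.aeval_eq_sum_range, Finset.mul_sum, Finset.sum_mul, ← Finset.sum_neg_distrib]
  refine Finset.sum_congr rfl fun k _ => ?_
  by_cases hk : f.coeff k = 0
  · simp [hk]
  · have h1 : SemiconjBy a x (-x) := by rw [SemiconjBy, h, neg_mul]
    rw [mul_smul_comm, smul_mul_assoc, (h1.pow_right k).eq, (hf k hk).neg_pow, neg_mul, smul_neg]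

/-- Unlike the x_i, the conjugates of f(x_1) are permuted without correction: (0 w(i)) w (0 i) fixes
0, so it commutes with f(x_1). -/
theorem affW_mul_affF (f : Polynomial R) (w : Equiv.Perm (Fin (N + 1))) (i : Fin (N + 1)) :
    (affW w * affF f i : AffineSergeev R (N + 1)) = affF f (w i) * affW w := by
  have h0 : (Equiv.swap 0 (w i) * w * Equiv.swap 0 i) 0 = 0 := by simp
  have h1 := commute_aeval (affW_mul_affX_zero (R := R) h0) f
  rw [affW_mul, affW_mul] at h1
  calc (affW w * affF f i : AffineSergeev R (N + 1))
      = affW (Equiv.swap 0 (w i)) * (affW (Equiv.swap 0 (w i)) * affW w * affW (Equiv.swap 0 i) *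
          Polynomial.aeval (affX 0) f) * affW (Equiv.swap 0 i) := by
        rw [affF]
        simp only [← mul_assoc]
        rw [affW_swap_sq, one_mul]
    _ = _ := by
        rw [h1, affF]
        simp only [mul_assoc]
        rw [affW_swap_sq, mul_one]

/-- Since f has only odd exponents, f(x_1) anticommutes with c_1 and commutes with the other c_j;
conjugation carries this to every index. -/
theorem affC_mul_affF {f : Polynomial R} (hf : ∀ k, f.coeff k ≠ 0 → Odd k) (i j : Fin (N + 1)) :
    SgnEq (affC j * affF f i : AffineSergeev R (N + 1)) (affF f i * affC j) := by
  have h0 : ∀ j, SgnEq (affC j * Polynomial.aeval (affX 0) f : AffineSergeev R (N + 1))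
      (Polynomial.aeval (affX 0) f * affC j) := by
    intro j
    rcases eq_or_ne j 0 with rfl | h
    · exact Or.inr (anticommute_aeval (affC_mul_affX_self 0) hf)
    · exact Or.inl (commute_aeval (affC_mul_affX_ne h) f)
  have h1 : (affC j * affW (Equiv.swap 0 i) : AffineSergeev R (N + 1)) =
      affW (Equiv.swap 0 i) * affC (Equiv.swap 0 i j) := by
    rw [affW_mul_affC, Equiv.swap_apply_self]
  rw [affF, ← mul_assoc, ← mul_assoc, h1, mul_assoc (affW _)]
  refine (((h0 _).mul_left _).mul_right _).trans (SgnEq.of_eq ?_)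
  simp only [mul_assoc]
  rw [affW_mul_affC]

theorem affC_mon_mul_affF {f : Polynomial R} (hf : ∀ k, f.coeff k ≠ 0 → Odd k) (i : Fin (N + 1))
    (β : Fin (N + 1) → ZMod 2) :
    SgnEq (cMon affC β * affF f i : AffineSergeev R (N + 1)) (affF f i * cMon affC β) := by
  induction β using zmod_two_fun_induction with
  | h0 => rw [IsClifford.cMon_zero, one_mul, mul_one]; exact SgnEq.refl _
  | hs k β ih =>
    have h := (isClifford_affC (R := R)).mul_cMon_sgnEq k β
    refine (h.symm.mul_right _).trans ?_
    rw [mul_assoc]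
    refine (ih.mul_left _).trans (SgnEq.trans ?_ (h.mul_left _))
    rw [← mul_assoc, ← mul_assoc]
    exact (affC_mul_affF hf i k).mul_right _

theorem affX_pow_mem (i : Fin (N + 1)) (k : ℕ) :
    (affX i ^ k : AffineSergeev R (N + 1)) ∈ affLt R N (k + 1) := by
  induction k with
  | zero => simpa using one_mem_affLt
  | succ k ih =>
    rw [pow_succ]
    exact affLt_mul ih (affX_mem i)

theorem affX_conj_pow_sub_mem (i : Fin (N + 1)) (k : ℕ) :
    (affW (Equiv.swap 0 i) * affX 0 ^ k * affW (Equiv.swap 0 i) - affX i ^ k :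
      AffineSergeev R (N + 1)) ∈ affLt R N k := by
  set e : AffineSergeev R (N + 1) := affW (Equiv.swap 0 i) with he
  have hee : e * e = 1 := affW_swap_sq 0 i
  have hem : e ∈ affLt R N 1 := affW_mem _
  induction k with
  | zero => simp [hee]
  | succ k ih =>
    have h1 : e * affX 0 * e - affX i ∈ affLt R N 1 := by
      have h2 := affW_mul_affX_sub_mem (R := R) (Equiv.swap 0 i) 0
      rw [Equiv.swap_apply_left, ← he] at h2
      have h3 := affLt_one_mul_mem h2 hem
      rwa [sub_mul, mul_assoc (affX i), hee, mul_one] at h3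
    have h4 : e * affX 0 ^ (k + 1) * e - affX i ^ (k + 1) =
        e * affX 0 ^ k * e * (e * affX 0 * e - affX i) + (e * affX 0 ^ k * e - affX i ^ k) * affX i := by
      have h5 : e * affX 0 ^ k * e * (e * affX 0 * e) = e * affX 0 ^ (k + 1) * e := by
        calc e * affX 0 ^ k * e * (e * affX 0 * e) = e * affX 0 ^ k * (e * e) * affX 0 * e := by
              simp only [mul_assoc]
          _ = _ := by rw [hee, mul_one, mul_assoc e, ← pow_succ]
      rw [mul_sub, h5, sub_mul, pow_succ (affX i)]
      abel
    rw [h4]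
    refine add_mem ?_ (affLt_mul ih (affX_mem i))
    exact affLt_mul (n := 0) (affLt_mul (n := 0) (affLt_one_mul hem (affX_pow_mem 0 k)) hem) h1

/-- The leading term of the i-th conjugate is x_i^l: f is monic, and conjugating x_1^k gives x_i^k
up to smaller degree. -/
theorem affF_sub_mem {f : Polynomial R} {l : ℕ} (hm : f.Monic) (hl : f.natDegree = l)
    (i : Fin (N + 1)) : (affF f i - affX i ^ l : AffineSergeev R (N + 1)) ∈ affLt R N l := by
  have h1 : (affF f i : AffineSergeev R (N + 1)) = ∑ k ∈ Finset.range (l + 1),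
      f.coeff k • (affW (Equiv.swap 0 i) * affX 0 ^ k * affW (Equiv.swap 0 i)) := by
    rw [affF, Polynomial.aeval_eq_sum_range, hl, Finset.mul_sum, Finset.sum_mul]
    simp only [mul_smul_comm, smul_mul_assoc]
  have h2 : f.coeff l = 1 := by rw [← hl]; exact hm
  rw [h1, Finset.sum_range_succ, h2, one_smul, add_sub_assoc]
  refine add_mem (sum_mem fun k hk => Submodule.smul_mem _ _ ?_) (affX_conj_pow_sub_mem i l)
  exact affLt_mono (Finset.mem_range.1 hk)
    (affLt_mul (n := 0) (affLt_one_mul (affW_mem _) (affX_pow_mem 0 k)) (affW_mem _))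

/-- The sum of the right submodules generated by the conjugates of `f(x_1)` over the degree zero
part. -/
noncomputable def affFSpan (N : ℕ) (f : Polynomial R) : Submodule R (AffineSergeev R (N + 1)) :=
  Submodule.span R {y | ∃ i w β, y = affF f i * (affW w * cMon affC β)}

theorem affF_mul_mem (f : Polynomial R) (i : Fin (N + 1)) {ψ : AffineSergeev R (N + 1)}
    (hψ : ψ ∈ affLt R N 1) : affF f i * ψ ∈ affFSpan N f := by
  have : affLt R N 1 ≤ Submodule.comap (LinearMap.mulLeft R (affF f i)) (affFSpan N f) :=
    mem_affLt_one fun w β => Submodule.subset_span ⟨i, w, β, rfl⟩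
  exact this hψ

theorem affFSpan_mul_mem {f : Polynomial R} {a ψ : AffineSergeev R (N + 1)}
    (ha : a ∈ affFSpan N f) (hψ : ψ ∈ affLt R N 1) : a * ψ ∈ affFSpan N f := by
  have : affFSpan N f ≤ Submodule.comap (LinearMap.mulRight R ψ) (affFSpan N f) := by
    conv_lhs => rw [affFSpan]
    rw [Submodule.span_le]
    rintro _ ⟨i, w, β, rfl⟩
    change affF f i * (affW w * cMon affC β) * ψ ∈ affFSpan N f
    rw [mul_assoc]
    exact affF_mul_mem f i (affLt_one_mul_mem (affW_mul_cMon_mem w β) hψ)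
  exact this ha

theorem mul_affFSpan_mem {f : Polynomial R} (hf : ∀ k, f.coeff k ≠ 0 → Odd k)
    {φ a : AffineSergeev R (N + 1)} (hφ : φ ∈ affLt R N 1) (ha : a ∈ affFSpan N f) :
    φ * a ∈ affFSpan N f := by
  refine mul_mem_of_span_right ?_ ha
  rintro _ ⟨i, w, β, rfl⟩
  have : affLt R N 1 ≤ Submodule.comap (LinearMap.mulRight R (affF f i * (affW w * cMon affC β)))
      (affFSpan N f) := by
    refine mem_affLt_one fun v γ => ?_
    change affW v * cMon affC γ * (affF f i * (affW w * cMon affC β)) ∈ affFSpan N f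
    have e : SgnEq (affW v * cMon affC γ * (affF f i * (affW w * cMon affC β)) :
        AffineSergeev R (N + 1))
        (affF f (v i) * (affW v * cMon affC γ * (affW w * cMon affC β))) := by
      have h1 := ((affC_mon_mul_affF hf i γ).mul_left (affW v)).mul_right (affW w * cMon affC β)
      rw [← mul_assoc (affW v) (affF f i), affW_mul_affF] at h1
      simpa only [mul_assoc] using h1
    exact e.mem (affF_mul_mem f _
      (affLt_one_mul_mem (affW_mul_cMon_mem v γ) (affW_mul_cMon_mem w β)))
  exact this hφ

/-- The elements of degree less than `m + l` of the ideal generated by `f(x_1)`. -/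
noncomputable def affJ (N : ℕ) (f : Polynomial R) (m : ℕ) : Submodule R (AffineSergeev R (N + 1)) :=
  Submodule.span R {y | ∃ α, ∑ j, α j < m ∧ ∃ ψ ∈ affFSpan N f, y = xMon affX α * ψ}

theorem affJ_mono (f : Polynomial R) {m n : ℕ} (h : m ≤ n) : affJ N f m ≤ affJ N f n := by
  apply Submodule.span_mono
  rintro y ⟨α, hα, hy⟩
  exact ⟨α, hα.trans_le h, hy⟩

theorem affLt_mul_affFSpan_mem {f : Polynomial R} (hf : ∀ k, f.coeff k ≠ 0 → Odd k) {m : ℕ}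
    {a b : AffineSergeev R (N + 1)} (ha : a ∈ affLt R N m) (hb : b ∈ affFSpan N f) :
    a * b ∈ affJ N f m := by
  have : affLt R N m ≤ Submodule.comap (LinearMap.mulRight R b) (affJ N f m) := by
    rw [affLt, Submodule.span_le]
    rintro _ ⟨α, w, β, h, rfl⟩
    change affMon α w β * b ∈ affJ N f m
    rw [affMon_eq, mul_assoc]
    exact Submodule.subset_span ⟨α, h, _, mul_affFSpan_mem hf (affW_mul_cMon_mem w β) hb, rfl⟩
  exact this ha

theorem xMon_mem (α : Fin (N + 1) → ℕ) :
    (xMon affX α : AffineSergeev R (N + 1)) ∈ affLt R N (∑ j, α j + 1) := by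
  simpa using xMon_mul_mem α (one_mem_affLt (R := R))

theorem affLt_mul_affJ_mem {f : Polynomial R} (hf : ∀ k, f.coeff k ≠ 0 → Odd k) {m n : ℕ}
    {a b : AffineSergeev R (N + 1)} (ha : a ∈ affLt R N m) (hb : b ∈ affJ N f (n + 1)) :
    a * b ∈ affJ N f (m + n) := by
  refine mul_mem_of_span_right ?_ hb
  rintro _ ⟨α, h, ψ, hψ, rfl⟩
  rw [← mul_assoc]
  exact affJ_mono f (by omega) (affLt_mul_affFSpan_mem hf (affLt_mul ha (xMon_mem α)) hψ)

theorem affJ_mul_mem {f : Polynomial R} {m : ℕ} {a ψ : AffineSergeev R (N + 1)}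
    (ha : a ∈ affJ N f m) (hψ : ψ ∈ affLt R N 1) : a * ψ ∈ affJ N f m := by
  have : affJ N f m ≤ Submodule.comap (LinearMap.mulRight R ψ) (affJ N f m) := by
    conv_lhs => rw [affJ]
    rw [Submodule.span_le]
    rintro _ ⟨α, h, χ, hχ, rfl⟩
    change xMon affX α * χ * ψ ∈ affJ N f m
    rw [mul_assoc]
    exact Submodule.subset_span ⟨α, h, _, affFSpan_mul_mem hχ hψ, rfl⟩
  exact this ha

/-- As f(x_1) commutes with all the x_j, it can be moved to the right of x^α. Thus f(x_1) times any
element lies in some `affJ`. -/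
theorem affF_zero_mul_mem (f : Polynomial R) {m : ℕ} {a : AffineSergeev R (N + 1)}
    (ha : a ∈ affLt R N m) : affF f 0 * a ∈ affJ N f m := by
  refine mul_mem_of_span_right ?_ ha
  rintro _ ⟨α, w, β, h, rfl⟩
  have h1 : (xMon affX α * affF f 0 : AffineSergeev R (N + 1)) = affF f 0 * xMon affX α := by
    rw [affF_zero]
    refine commute_aeval ?_ f
    rw [← pow_one (affX 0), ← xMon_single affX_comm, xMon_mul_xMon affX_comm,
      xMon_mul_xMon affX_comm, add_comm α]
  rw [affMon_eq, ← mul_assoc, ← h1, mul_assoc]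
  exact Submodule.subset_span ⟨α, h, _, affF_mul_mem f 0 (affW_mul_cMon_mem w β), rfl⟩

/-- Conjugation reduces to i = 0. There f(x_1) commutes with x_j^l, so only the lower terms of the
other factor enter the commutator. -/
theorem affF_commutator_mem {f : Polynomial R} {l : ℕ} (hm : f.Monic) (hl : f.natDegree = l)
    (hf : ∀ k, f.coeff k ≠ 0 → Odd k) (hl1 : 1 ≤ l) (i j : Fin (N + 1)) :
    (affF f j * affF f i - affF f i * affF f j : AffineSergeev R (N + 1)) ∈ affJ N f l := by
  have h0 : ∀ j, (affF f j * affF f 0 - affF f 0 * affF f j : AffineSergeev R (N + 1)) ∈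
      affJ N f l := by
    intro j
    have hu := affF_sub_mem hm hl j
    have hc : (affX j ^ l * affF f 0 : AffineSergeev R (N + 1)) = affF f 0 * affX j ^ l := by
      rw [affF_zero]
      exact commute_aeval ((show Commute _ _ from affX_comm j 0).pow_left l).eq f
    have e : (affF f j * affF f 0 - affF f 0 * affF f j : AffineSergeev R (N + 1)) =
        (affF f j - affX j ^ l) * affF f 0 - affF f 0 * (affF f j - affX j ^ l) := by
      rw [sub_mul, mul_sub, hc]
      abel
    rw [e]
    refine sub_mem (affLt_mul_affFSpan_mem hf hu ?_) (affF_zero_mul_mem f hu)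
    have h1 := affF_mul_mem (N := N) f 0 (one_mem_affLt (R := R))
    rwa [mul_one] at h1
  have hi : ∀ k, (affF f k : AffineSergeev R (N + 1)) = affW (Equiv.swap 0 i) *
      affF f (Equiv.swap 0 i k) * affW (Equiv.swap 0 i) := by
    intro k
    rw [affW_mul_affF, Equiv.swap_apply_self, mul_assoc, affW_swap_sq, mul_one]
  have e : (affF f j * affF f i - affF f i * affF f j : AffineSergeev R (N + 1)) =
      affW (Equiv.swap 0 i) * (affF f (Equiv.swap 0 i j) * affF f 0 -
        affF f 0 * affF f (Equiv.swap 0 i j)) * affW (Equiv.swap 0 i) := by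
    have key : ∀ a b : AffineSergeev R (N + 1),
        affW (Equiv.swap 0 i) * a * affW (Equiv.swap 0 i) *
          (affW (Equiv.swap 0 i) * b * affW (Equiv.swap 0 i)) =
        affW (Equiv.swap 0 i) * (a * b) * affW (Equiv.swap 0 i) := by
      intro a b
      calc _ = affW (Equiv.swap 0 i) * a * (affW (Equiv.swap 0 i) *
          affW (Equiv.swap 0 i)) * b * affW (Equiv.swap 0 i) := by simp only [mul_assoc]
        _ = _ := by rw [affW_swap_sq, mul_one, mul_assoc (affW _) a b]
    rw [hi j, hi i, Equiv.swap_apply_right, key, key, mul_sub, sub_mul]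
  rw [e]
  refine affJ_mul_mem ?_ (affW_mem _)
  obtain ⟨n, rfl⟩ : ∃ n, l = n + 1 := ⟨l - 1, by omega⟩
  exact affJ_mono f (by omega) (affLt_mul_affJ_mem hf (affW_mem _) (h0 _))

/-- The S-polynomial condition. Both products have leading term x_i^l x_j^l; their difference is the
commutator plus terms with lower polynomial cofactor, hence lies in `affJ N f l`, where cofactors
have degree below l. -/
theorem affX_pow_mul_affF_sub_mem {f : Polynomial R} {l : ℕ} (hm : f.Monic) (hl : f.natDegree = l)
    (hf : ∀ k, f.coeff k ≠ 0 → Odd k) (hl1 : 1 ≤ l) (i j : Fin (N + 1)) :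
    (affX j ^ l * affF f i - affX i ^ l * affF f j : AffineSergeev R (N + 1)) ∈ affJ N f l := by
  have e : (affX j ^ l * affF f i - affX i ^ l * affF f j : AffineSergeev R (N + 1)) =
      (affF f j * affF f i - affF f i * affF f j) - (affF f j - affX j ^ l) * affF f i +
        (affF f i - affX i ^ l) * affF f j := by
    noncomm_ring
  have hF : ∀ i, (affF f i : AffineSergeev R (N + 1)) ∈ affFSpan N f := fun i => by
    simpa using affF_mul_mem f i (one_mem_affLt (R := R))
  rw [e]
  exact add_mem (sub_mem (affF_commutator_mem hm hl hf hl1 i j)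
    (affLt_mul_affFSpan_mem hf (affF_sub_mem hm hl j) (hF i)))
    (affLt_mul_affFSpan_mem hf (affF_sub_mem hm hl i) (hF j))

/-- The left ideal spanned by all `affJ f m`. -/
noncomputable def affIdeal {f : Polynomial R} (hf : ∀ k, f.coeff k ≠ 0 → Odd k) :
    Submodule (AffineSergeev R (N + 1)) (AffineSergeev R (N + 1)) where
  carrier := {a | ∃ m, a ∈ affJ N f m}
  add_mem' := by
    rintro a b ⟨m, hm⟩ ⟨n, hn⟩
    exact ⟨m + n, add_mem (affJ_mono f (by omega) hm) (affJ_mono f (by omega) hn)⟩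
  zero_mem' := ⟨0, zero_mem _⟩
  smul_mem' := by
    rintro a b ⟨n, hn⟩
    obtain ⟨m, hm⟩ := exists_mem_affLt a
    exact ⟨_, affLt_mul_affJ_mem hf hm (affJ_mono f (Nat.le_succ n) hn)⟩

/-- Only a left ideal is needed. On the quotient of the affine algebra by `affIdeal` the element
f(x_1) acts as zero, so the action factors through the cyclotomic algebra; applying an element of
the kernel to the class of 1 places it in `affIdeal`. -/
theorem exists_mem_affJ_of_cycMk_eq_zero {f : Polynomial R} (hf : ∀ k, f.coeff k ≠ 0 → Odd k)
    {a : AffineSergeev R (N + 1)} (ha : cycMk f a = 0) : ∃ m, a ∈ affJ N f m := by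
  let L : AffineSergeev R (N + 1) →ₐ[R] Module.End R (AffineSergeev R (N + 1) ⧸ affIdeal hf) :=
    Algebra.lsmul R R _
  have hL : ∀ ⦃x y⦄, CyclotomicRel (N + 1) f x y → L x = L y := by
    rintro _ _ ⟨i, hi⟩
    obtain rfl : i = 0 := Fin.ext hi
    rw [map_zero]
    refine LinearMap.ext fun b => ?_
    obtain ⟨b, rfl⟩ := Submodule.Quotient.mk_surjective _ b
    obtain ⟨m, hm⟩ := exists_mem_affLt b
    refine (Submodule.Quotient.mk_eq_zero _).2 ⟨m, ?_⟩
    have := affF_zero_mul_mem f hm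
    rwa [affF_zero] at this
  let L' : CycSergeev (N + 1) f →ₐ[R] Module.End R (AffineSergeev R (N + 1) ⧸ affIdeal hf) :=
    RingQuot.liftAlgHom R ⟨L, hL⟩
  have h1 : L' (cycMk f a) = L a := RingQuot.liftAlgHom_mkAlgHom_apply R L hL a
  rw [ha, map_zero] at h1
  have h2 := LinearMap.congr_fun h1 (Submodule.Quotient.mk 1)
  have h3 : (Submodule.Quotient.mk (a * 1) : AffineSergeev R (N + 1) ⧸ affIdeal hf) = 0 := h2.symm
  rw [mul_one, Submodule.Quotient.mk_eq_zero] at h3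
  exact h3

end Cyclotomic

/-! ### Straightening modulo the ideal. -/

section Cyclotomic

variable {R : Type*} [CommRing R] {N : ℕ}

theorem exists_first {l : ℕ} {α : Fin (N + 1) → ℕ} (h : ∃ i, l ≤ α i) :
    ∃ i, l ≤ α i ∧ ∀ j < i, α j < l := by
  obtain ⟨i, hi, hmin⟩ := WellFounded.has_min (wellFounded_lt (α := Fin (N + 1))) {i | l ≤ α i} h
  exact ⟨i, hi, fun j hj => not_le.1 fun hl => hmin j hl hj⟩

open Classical in
/-- The element of the ideal, or the reduced monomial, with leading monomial `x^α`. -/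
noncomputable def affLead (f : Polynomial R) (l : ℕ) (α : Fin (N + 1) → ℕ) :
    AffineSergeev R (N + 1) :=
  if h : ∃ i, l ≤ α i then
    xMon affX (α - Pi.single (exists_first h).choose l) * affF f (exists_first h).choose
  else xMon affX α

theorem affLead_of_first (f : Polynomial R) {l : ℕ} {α : Fin (N + 1) → ℕ} {i : Fin (N + 1)}
    (hi : l ≤ α i) (hmin : ∀ j < i, α j < l) :
    affLead f l α = xMon affX (α - Pi.single i l) * affF f i := by
  have h : ∃ i, l ≤ α i := ⟨i, hi⟩
  have e : (exists_first h).choose = i := by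
    obtain ⟨h1, h2⟩ := (exists_first h).choose_spec
    rcases lt_trichotomy (exists_first h).choose i with h3 | h3 | h3
    · exact absurd h1 (not_le.2 (hmin _ h3))
    · exact h3
    · exact absurd hi (not_le.2 (h2 _ h3))
  rw [affLead, dif_pos h, e]

theorem affLead_of_lt (f : Polynomial R) {l : ℕ} {α : Fin (N + 1) → ℕ} (h : ∀ i, α i < l) :
    affLead f l α = xMon affX α := by
  rw [affLead, dif_neg]
  push Not
  exact h

theorem sub_single_add_single {α : Fin (N + 1) → ℕ} {i : Fin (N + 1)} {l : ℕ} (h : l ≤ α i) :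
    α - Pi.single i l + Pi.single i l = α := by
  apply tsub_add_cancel_of_le
  intro k
  rcases eq_or_ne k i with rfl | hk
  · simpa using h
  · simp [hk]

theorem sum_sub_single {α : Fin (N + 1) → ℕ} {i : Fin (N + 1)} {l : ℕ} (h : l ≤ α i) :
    ∑ j, (α - Pi.single i l : Fin (N + 1) → ℕ) j + l = ∑ j, α j := by
  conv_rhs => rw [← sub_single_add_single h]
  simp only [Pi.add_apply, Finset.sum_add_distrib, Finset.sum_pi_single',
    Finset.mem_univ, if_true]

theorem xMon_affX_eq {α : Fin (N + 1) → ℕ} {i : Fin (N + 1)} {l : ℕ} (h : l ≤ α i) :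
    (xMon affX α : AffineSergeev R (N + 1)) = xMon affX (α - Pi.single i l) * affX i ^ l := by
  rw [← xMon_single affX_comm, xMon_mul_xMon affX_comm, sub_single_add_single h]

section

variable {f : Polynomial R} {l : ℕ}

theorem affLead_sub_mem (hm : f.Monic) (hl : f.natDegree = l) (α : Fin (N + 1) → ℕ) :
    (affLead f l α - xMon affX α : AffineSergeev R (N + 1)) ∈ affLt R N (∑ j, α j) := by
  by_cases h : ∃ i, l ≤ α i
  · obtain ⟨i, hi, hmin⟩ := exists_first h
    rw [affLead_of_first f hi hmin, xMon_affX_eq hi, ← mul_sub, ← sum_sub_single hi]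
    exact xMon_mul_mem _ (affF_sub_mem hm hl i)
  · rw [affLead_of_lt f (by push Not at h; exact h), sub_self]
    exact zero_mem _

/-- The unitriangular map sending each monomial to the corresponding leading element. -/
noncomputable def affPhi (f : Polynomial R) (l : ℕ) :
    AffineSergeev R (N + 1) →ₗ[R] AffineSergeev R (N + 1) :=
  (affBasis R N).constr R fun t => affLead f l t.1 * (affW t.2.1 * cMon affC t.2.2)

theorem affPhi_affMon (α : Fin (N + 1) → ℕ) (w : Equiv.Perm (Fin (N + 1)))
    (β : Fin (N + 1) → ZMod 2) : affPhi f l (affMon α w β) =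
      affLead f l α * (affW w * cMon affC β) := by
  have h := (affBasis R N).constr_basis R
    (fun t => affLead f l t.1 * (affW t.2.1 * cMon affC t.2.2)) (α, w, β)
  rwa [affBasis_apply] at h

theorem affPhi_sub_mem (hm : f.Monic) (hl : f.natDegree = l) {m : ℕ}
    {a : AffineSergeev R (N + 1)} (ha : a ∈ affLt R N (m + 1)) : affPhi f l a - a ∈ affLt R N m := by
  have : affLt R N (m + 1) ≤ Submodule.comap (affPhi f l - LinearMap.id) (affLt R N m) := by
    conv_lhs => rw [affLt]
    rw [Submodule.span_le]
    rintro _ ⟨α, w, β, h, rfl⟩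
    change affPhi f l (affMon α w β) - affMon α w β ∈ affLt R N m
    rw [affPhi_affMon, affMon_eq, ← sub_mul]
    exact affLt_mono (by omega) (affLt_mul (n := 0) (affLead_sub_mem hm hl α)
      (affW_mul_cMon_mem w β))
  exact this ha

/-- The map is the identity plus terms of smaller degree, so an element of its kernel has ever
smaller degree. -/
theorem affPhi_injective (hm : f.Monic) (hl : f.natDegree = l) :
    Function.Injective (affPhi f l : AffineSergeev R (N + 1) →ₗ[R] AffineSergeev R (N + 1)) := by
  have key : ∀ m, ∀ a ∈ affLt R N m, affPhi f l a = 0 → a = 0 := by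
    intro m
    induction m with
    | zero =>
      intro a ha _
      simpa [affLt] using ha
    | succ m ih =>
      intro a ha h0
      refine ih a ?_ h0
      have := affPhi_sub_mem hm hl ha
      rwa [h0, zero_sub, neg_mem_iff] at this
  rw [injective_iff_map_eq_zero]
  intro a h0
  obtain ⟨m, hm⟩ := exists_mem_affLt a
  exact key m a hm h0

/-- The span of the monomials whose polynomial exponents satisfy `p`. -/
noncomputable def affSpan (R : Type*) [CommRing R] (p : (Fin (N + 1) → ℕ) → Prop) :
    Submodule R (AffineSergeev R (N + 1)) :=
  Submodule.span R {y | ∃ α w β, p α ∧ y = affMon α w β}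

theorem affSpan_mono {p q : (Fin (N + 1) → ℕ) → Prop} (h : ∀ α, p α → q α) :
    affSpan R p ≤ affSpan R q := by
  apply Submodule.span_mono
  rintro _ ⟨α, w, β, hα, rfl⟩
  exact ⟨α, w, β, h α hα, rfl⟩

theorem eq_zero_of_mem_affSpan {p q : (Fin (N + 1) → ℕ) → Prop} (h : ∀ α, p α → ¬q α)
    {a : AffineSergeev R (N + 1)} (hp : a ∈ affSpan R p) (hq : a ∈ affSpan R q) : a = 0 := by
  have e : ∀ p : (Fin (N + 1) → ℕ) → Prop, affSpan R p =
      Submodule.span R ((fun t => affMon t.1 t.2.1 t.2.2) '' {t : (Fin (N + 1) → ℕ) ×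
        Equiv.Perm (Fin (N + 1)) × (Fin (N + 1) → ZMod 2) | p t.1}) := by
    intro p
    rw [affSpan]
    congr 1
    ext y
    constructor
    · rintro ⟨α, w, β, hα, rfl⟩
      exact ⟨(α, w, β), hα, rfl⟩
    · rintro ⟨⟨α, w, β⟩, hα, rfl⟩
      exact ⟨α, w, β, hα, rfl⟩
  have hd := (linearIndependent_affMon R N).disjoint_span_image
    (s := {t | p t.1}) (t := {t | q t.1})
    (Set.disjoint_left.2 fun t ht => h t.1 ht)
  rw [e] at hp hq
  exact Submodule.disjoint_def.1 hd a hp hq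

/-- The ideal is spanned by the images of monomials having some exponent at least l. A product x^α
F_i is such an image if no earlier variable has exponent at least l; otherwise the S-polynomial
exchanges F_i for F_j with j the first such index, modulo a smaller stage. -/
theorem affJ_le_map_affPhi (hm : f.Monic) (hl : f.natDegree = l)
    (hf : ∀ k, f.coeff k ≠ 0 → Odd k) (hl1 : 1 ≤ l) :
    ∀ m, affJ N f m ≤ (affSpan R fun α => ∃ i, l ≤ α i).map (affPhi f l)
  | 0 => by
    refine Submodule.span_le.2 ?_
    rintro _ ⟨α, h, -⟩
    omega
  | m + 1 => by
    have ih := affJ_le_map_affPhi hm hl hf hl1 m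
    have hPhi : ∀ (α : Fin (N + 1) → ℕ) (i : Fin (N + 1)), (∀ j < i, α j < l) → ∀ w β,
        (xMon affX α * affF f i * (affW w * cMon affC β) : AffineSergeev R (N + 1)) ∈
          (affSpan R fun α => ∃ i, l ≤ α i).map (affPhi f l) := by
      intro α i hi w β
      refine ⟨affMon (α + Pi.single i l) w β, Submodule.subset_span ⟨_, w, β, ⟨i, by simp⟩, rfl⟩, ?_⟩
      rw [affPhi_affMon, affLead_of_first f (i := i) (by simp), add_tsub_cancel_right]
      intro j hj
      simpa [hj.ne] using hi j hj
    refine Submodule.span_le.2 ?_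
    rintro _ ⟨α, h, ψ, hψ, rfl⟩
    have h1 : affFSpan N f ≤ Submodule.comap (LinearMap.mulLeft R (xMon affX α))
        ((affSpan R fun α => ∃ i, l ≤ α i).map (affPhi f l)) := by
      refine Submodule.span_le.2 ?_
      rintro _ ⟨i, w, β, rfl⟩
      change xMon affX α * (affF f i * (affW w * cMon affC β)) ∈ (affSpan R fun α => ∃ i, l ≤ α i).map (affPhi f l)
      rw [← mul_assoc]
      by_cases hfirst : ∀ j < i, α j < l
      · exact hPhi α i hfirst w β
      · push Not at hfirst
        obtain ⟨k, hk, hkl⟩ := hfirst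
        obtain ⟨j, hj, hjmin⟩ := exists_first ⟨k, hkl⟩
        have hji : j < i := lt_of_le_of_lt (not_lt.1 fun hlt => not_le.2 (hjmin k hlt) hkl) hk
        have hB := affX_pow_mul_affF_sub_mem (N := N) hm hl hf hl1 i j
        -- The power x_j^l is split off from x^α and exchanged for x_i^l. In the second summand the
        -- first exponent at least l, after restoring l at j, occurs at j; the first summand belongs
        -- to the induction hypothesis.
        have e : (xMon affX α * affF f i * (affW w * cMon affC β) : AffineSergeev R (N + 1)) =
            xMon affX (α - Pi.single j l) * (affX j ^ l * affF f i - affX i ^ l * affF f j) *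
              (affW w * cMon affC β) +
            xMon affX (α - Pi.single j l + Pi.single i l) * affF f j *
              (affW w * cMon affC β) := by
          rw [← xMon_mul_xMon affX_comm, xMon_single affX_comm, xMon_affX_eq hj]
          noncomm_ring
        rw [e]
        refine add_mem (ih ?_) (hPhi _ j ?_ w β)
        · refine affJ_mul_mem ?_ (affW_mul_cMon_mem w β)
          obtain ⟨l', rfl⟩ : ∃ l', l = l' + 1 := ⟨l - 1, by omega⟩
          refine affJ_mono f ?_ (affLt_mul_affJ_mem hf (xMon_mem _) hB)
          have := sum_sub_single hj
          omega
        · intro k hk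
          have := hjmin k hk
          simpa [hk.ne, (hk.trans hji).ne] using this
    exact h1 hψ

theorem affPhi_eq_self {a : AffineSergeev R (N + 1)}
    (ha : a ∈ affSpan R fun α => ∀ i, α i < l) : affPhi f l a = a := by
  have : (affSpan R fun α : Fin (N + 1) → ℕ => ∀ i, α i < l) ≤
      LinearMap.ker (affPhi f l - LinearMap.id) := by
    refine Submodule.span_le.2 ?_
    rintro _ ⟨α, w, β, h, rfl⟩
    rw [SetLike.mem_coe, LinearMap.mem_ker, LinearMap.sub_apply, affPhi_affMon,
      affLead_of_lt f h, ← affMon_eq]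
    exact sub_self _
  exact sub_eq_zero.1 (this ha)

theorem mem_affIdeal (hf : ∀ k, f.coeff k ≠ 0 → Odd k) {a : AffineSergeev R (N + 1)} :
    a ∈ affIdeal hf ↔ ∃ m, a ∈ affJ N f m := Iff.rfl

theorem xMon_mul_mem_affJ (α : Fin (N + 1) → ℕ) {ψ : AffineSergeev R (N + 1)}
    (hψ : ψ ∈ affFSpan N f) : xMon affX α * ψ ∈ affJ N f (∑ j, α j + 1) :=
  Submodule.subset_span ⟨α, Nat.lt_succ_self _, ψ, hψ, rfl⟩

/-- A factor x_i^l is replaced by F_i minus lower terms, and the product with F_i lies in the ideal.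
-/
theorem affMon_reduce (hf : ∀ k, f.coeff k ≠ 0 → Odd k) (hm : f.Monic) (hl : f.natDegree = l)
    {α : Fin (N + 1) → ℕ} {i : Fin (N + 1)} (hi : l ≤ α i) (w : Equiv.Perm (Fin (N + 1)))
    (β : Fin (N + 1) → ZMod 2) :
    affMon α w β ∈ affLt R N (∑ j, α j) ⊔ (affIdeal hf).restrictScalars R := by
  have h1 : xMon affX (α - Pi.single i l) * (affF f i - affX i ^ l) *
      (affW w * cMon affC β) ∈ affLt R N (∑ j, α j) := by
    have h0 := xMon_mul_mem (α - Pi.single i l) (affF_sub_mem (N := N) hm hl i)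
    rw [sum_sub_single hi] at h0
    exact affLt_mul (n := 0) h0 (affW_mul_cMon_mem w β)
  have h2 : xMon affX (α - Pi.single i l) * (affF f i * (affW w * cMon affC β)) ∈
      (affIdeal hf).restrictScalars R := by
    have h3 : xMon affX (α - Pi.single i l) * (affF f i * (affW w * cMon affC β)) ∈
        affJ N f (∑ j, (α - Pi.single i l : Fin (N + 1) → ℕ) j + 1) :=
      xMon_mul_mem_affJ _ (affF_mul_mem f i (affW_mul_cMon_mem w β))
    rw [Submodule.restrictScalars_mem, mem_affIdeal]
    exact ⟨_, h3⟩
  have e : (affMon α w β : AffineSergeev R (N + 1)) =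
      -(xMon affX (α - Pi.single i l) * (affF f i - affX i ^ l) * (affW w * cMon affC β)) +
      xMon affX (α - Pi.single i l) * (affF f i * (affW w * cMon affC β)) := by
    rw [affMon_eq, xMon_affX_eq hi]
    noncomm_ring
  rw [e]
  exact add_mem (Submodule.mem_sup_left (neg_mem h1)) (Submodule.mem_sup_right h2)

theorem affLt_le_reduced (hf : ∀ k, f.coeff k ≠ 0 → Odd k) (hm : f.Monic) (hl : f.natDegree = l)
    (m : ℕ) : affLt R N m ≤ (affSpan R fun α => (∀ i, α i < l) ∧ ∑ i, α i < m) ⊔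
      (affIdeal hf).restrictScalars R := by
  induction m with
  | zero =>
    refine Submodule.span_le.2 ?_
    rintro _ ⟨α, w, β, h, -⟩
    omega
  | succ m ih =>
    refine Submodule.span_le.2 ?_
    rintro _ ⟨α, w, β, h, rfl⟩
    by_cases hα : ∀ i, α i < l
    · exact Submodule.mem_sup_left (Submodule.subset_span ⟨α, w, β, ⟨hα, h⟩, rfl⟩)
    · push Not at hα
      obtain ⟨i, hi⟩ := hα
      have hmono : (affSpan R fun α : Fin (N + 1) → ℕ => (∀ i, α i < l) ∧ ∑ i, α i < m) ≤
          affSpan R fun α => (∀ i, α i < l) ∧ ∑ i, α i < m + 1 :=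
        affSpan_mono fun α h => ⟨h.1, h.2.trans (Nat.lt_succ_self m)⟩
      have h1 := (affLt_mono (R := R) (N := N) (Nat.lt_succ_iff.1 h)).trans ih
      exact sup_le (h1.trans (sup_le_sup_right hmono _)) le_sup_right
        (affMon_reduce hf hm hl hi w β)

/-- The monomials with all exponents less than `l` are independent modulo the ideal, even with
respect to the filtration. -/
theorem reduced_independent (hm : f.Monic) (hl : f.natDegree = l)
    (hf : ∀ k, f.coeff k ≠ 0 → Odd k) (hl1 : 1 ≤ l) {k : ℕ} {b u : AffineSergeev R (N + 1)}
    (hb : b ∈ affSpan R fun α => (∀ i, α i < l) ∧ ∑ i, α i = k)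
    (hu : u ∈ affLt R N k) (hbu : cycMk f b = cycMk f u) : b = 0 := by
  obtain ⟨b', hb', c', ⟨n, hn⟩, hc'⟩ := Submodule.mem_sup.1 (affLt_le_reduced hf hm hl k hu)
  obtain rfl : c' = u - b' := by rw [← hc']; abel
  obtain ⟨n', hn'⟩ := exists_mem_affJ_of_cycMk_eq_zero hf (a := b - u)
    (by rw [map_sub, hbu, sub_self])
  have h1 : b - b' ∈ affJ N f (n + n') := by
    rw [← sub_add_sub_cancel b u b']
    exact add_mem (affJ_mono f (by omega) hn') (affJ_mono f (by omega) hn)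
  -- The element b - b' is reduced, hence fixed by `affPhi`, but it is also the image of a
  -- combination of non-reduced monomials. Injectivity and independence give b = b', and b has
  -- degree exactly k while b' has degree below k.
  obtain ⟨c, hc, hcb⟩ := affJ_le_map_affPhi hm hl hf hl1 _ h1
  have h2 : b - b' ∈ affSpan R fun α => ∀ i, α i < l :=
    sub_mem (affSpan_mono (fun _ h => h.1) hb) (affSpan_mono (fun _ h => h.1) hb')
  rw [← affPhi_eq_self (f := f) h2] at hcb
  have h3 := affPhi_injective hm hl hcb
  have h4 : b - b' = 0 := eq_zero_of_mem_affSpan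
    (fun α h ⟨i, hi⟩ => absurd (h i) (not_lt.2 hi)) h2 (h3 ▸ hc)
  rw [← sub_eq_zero.1 h4] at hb'
  exact eq_zero_of_mem_affSpan (fun α h h' => absurd h.2 h'.2.ne) hb hb'

end

end Cyclotomic

/-! ## Monomial basis of the associated graded algebra -/

namespace AlgFiltration

variable {R S : Type*} [CommRing R] [Ring S] [Algebra R S] (W : AlgFiltration R S)

/-- `z` is the symbol in degree `k` of `a`. -/
def IsSymb (k : ℕ) (a : S) (z : W.Gr) : Prop := ∃ h : a ∈ W.F k, z = W.symb k a h

namespace IsSymb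

variable {W} {k m : ℕ} {a b : S} {z y : W.Gr}

theorem mul (ha : W.IsSymb k a z) (hb : W.IsSymb m b y) : W.IsSymb (k + m) (a * b) (z * y) := by
  obtain ⟨h, rfl⟩ := ha
  obtain ⟨h', rfl⟩ := hb
  refine ⟨W.mul_mem h h', ?_⟩
  rw [symb, symb, DirectSum.of_mul_of]
  rfl

theorem one : W.IsSymb 0 1 (1 : W.Gr) := ⟨W.one_mem, rfl⟩

theorem add (ha : W.IsSymb k a z) (hb : W.IsSymb k b y) : W.IsSymb k (a + b) (z + y) := by
  obtain ⟨h, rfl⟩ := ha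
  obtain ⟨h', rfl⟩ := hb
  refine ⟨add_mem h h', ?_⟩
  rw [symb, symb, symb, ← map_add]
  rfl

theorem smul (r : R) (ha : W.IsSymb k a z) : W.IsSymb k (r • a) (r • z) := by
  obtain ⟨h, rfl⟩ := ha
  refine ⟨Submodule.smul_mem _ r h, ?_⟩
  rw [symb, symb, toPiece_smul]
  exact ((DirectSum.lof R ℕ W.Piece k).map_smul r (W.toPiece k a h)).symm

theorem zero (k : ℕ) : W.IsSymb k 0 (0 : W.Gr) :=
  ⟨zero_mem _, ((DirectSum.of W.Piece k).map_zero).symm⟩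

theorem neg (ha : W.IsSymb k a z) : W.IsSymb k (-a) (-z) := by
  simpa using ha.smul (-1 : R)

theorem sum {ι : Type*} {s : Finset ι} {a : ι → S} {z : ι → W.Gr}
    (h : ∀ i ∈ s, W.IsSymb k (a i) (z i)) : W.IsSymb k (∑ i ∈ s, a i) (∑ i ∈ s, z i) := by
  classical
  induction s using Finset.induction_on with
  | empty => simpa using zero k
  | insert i s hi ih =>
    rw [Finset.sum_insert hi, Finset.sum_insert hi]
    exact (h i (Finset.mem_insert_self i s)).add
      (ih fun j hj => h j (Finset.mem_insert_of_mem hj))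

theorem pow_zero (ha : W.IsSymb 0 a z) (n : ℕ) : W.IsSymb 0 (a ^ n) (z ^ n) := by
  induction n with
  | zero => simpa using one
  | succ n ih => 
    rw [pow_succ, pow_succ]
    exact ih.mul ha

theorem prod_ofFn {n : ℕ} {a : Fin n → S} {z : Fin n → W.Gr} (h : ∀ i, W.IsSymb 0 (a i) (z i)) :
    W.IsSymb 0 (List.ofFn a).prod (List.ofFn z).prod := by
  induction n with
  | zero => simpa using one
  | succ n ih =>
    rw [List.ofFn_succ, List.ofFn_succ, List.prod_cons, List.prod_cons]
    exact (h 0).mul (ih fun i => h i.succ)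

theorem eq_of_sub_mem (ha : W.IsSymb k a z) (hb : W.IsSymb k b y) (h : a - b ∈ W.prev k) :
    z = y := by
  obtain ⟨ha, rfl⟩ := ha
  obtain ⟨hb, rfl⟩ := hb
  rw [symb, symb]
  congr 1
  refine (Submodule.Quotient.eq _).2 ?_
  exact h

theorem eq_of_eq (ha : W.IsSymb k a z) (hb : W.IsSymb m b y) (hk : k = m) (h : a = b) : z = y := by
  subst hk
  refine ha.eq_of_sub_mem hb ?_
  rw [h, sub_self]
  exact zero_mem _

theorem mem_prev (ha : W.IsSymb k a z) (h : DirectSum.component R ℕ W.Piece k z = 0) :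
    a ∈ W.prev k := by
  obtain ⟨ha, rfl⟩ := ha
  have h1 : W.toPiece k a ha = 0 := by
    rw [← h]
    exact (DirectSum.component.lof_self R k (W.toPiece k a ha)).symm
  have h2 : (Submodule.Quotient.mk ⟨a, ha⟩ : W.F k ⧸ (W.prev k).submoduleOf (W.F k)) = 0 := h1
  have h3 := (Submodule.Quotient.mk_eq_zero ((W.prev k).submoduleOf (W.F k))).1 h2
  exact h3

theorem eq_of_sub_mem_F {n : ℕ} (ha : W.IsSymb m a z) (hb : W.IsSymb n b y)
    (hm : m = k + 1) (hn : n = k + 1) (h : a - b ∈ W.F k) : z = y := by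
  subst hm
  subst hn
  exact ha.eq_of_sub_mem hb h

theorem component_ne (ha : W.IsSymb k a z) (h : k ≠ m) :
    DirectSum.component R ℕ W.Piece m z = 0 := by
  obtain ⟨ha, rfl⟩ := ha
  exact DirectSum.of_eq_of_ne _ _ _ h.symm

end IsSymb

end AlgFiltration

/-! ### Relations in the associated graded algebra. -/

section Graded

open AlgFiltration

variable {R : Type*} [CommRing R] {N : ℕ} {f : Polynomial R}

theorem isSymb_grGen {d : ℕ} (f : Polynomial R) (g : SergeevGen d) :
    (cycFiltration d f).IsSymb g.deg (cycGen f g) (grGen f g) := ⟨cycGen_mem f g, rfl⟩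

theorem isSymb_grX (f : Polynomial R) (i : Fin (N + 1)) :
    (cycFiltration (N + 1) f).IsSymb 1 (cycMk f (affX i)) (grX f i) := isSymb_grGen f (.x i)

theorem isSymb_grC (f : Polynomial R) (i : Fin (N + 1)) :
    (cycFiltration (N + 1) f).IsSymb 0 (cycMk f (affC i)) (grC f i) := isSymb_grGen f (.c i)

theorem isSymb_grPerm (f : Polynomial R) (w : Equiv.Perm (Fin (N + 1))) :
    (cycFiltration (N + 1) f).IsSymb 0 (cycMk f (affW w)) (grPerm f w) := isSymb_grGen f (.perm w)

theorem grPerm_one (f : Polynomial R) : grPerm f (1 : Equiv.Perm (Fin (N + 1))) = 1 :=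
  (isSymb_grPerm f 1).eq_of_eq IsSymb.one rfl (by rw [affW_one, map_one])

theorem grPerm_mul (f : Polynomial R) (v w : Equiv.Perm (Fin (N + 1))) :
    grPerm f (v * w) = grPerm f v * grPerm f w :=
  (isSymb_grPerm f _).eq_of_eq ((isSymb_grPerm f v).mul (isSymb_grPerm f w)) rfl
    (by rw [affW_mul, map_mul])

theorem grX_comm (f : Polynomial R) (i j : Fin (N + 1)) : grX f i * grX f j = grX f j * grX f i :=
  ((isSymb_grX f i).mul (isSymb_grX f j)).eq_of_eq ((isSymb_grX f j).mul (isSymb_grX f i)) rfl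
    (by rw [← map_mul, affX_comm, map_mul])

theorem isClifford_grC (f : Polynomial R) : IsClifford (grC f (d := N + 1)) where
  sq i := ((isSymb_grC f i).mul (isSymb_grC f i)).eq_of_eq IsSymb.one rfl
    (by rw [← map_mul, isClifford_affC.sq, map_one])
  anti i j h := ((isSymb_grC f i).mul (isSymb_grC f j)).eq_of_eq
    ((isSymb_grC f j).mul (isSymb_grC f i)).neg rfl
    (by rw [← map_mul, isClifford_affC.anti i j h, map_neg, map_mul])

theorem grC_mul_grX_self (f : Polynomial R) (i : Fin (N + 1)) :
    grC f i * grX f i = -(grX f i * grC f i) :=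
  ((isSymb_grC f i).mul (isSymb_grX f i)).eq_of_eq
    ((isSymb_grX f i).mul (isSymb_grC f i)).neg rfl
    (by rw [← map_mul, affC_mul_affX_self, map_neg, map_mul])

theorem grC_mul_grX_ne (f : Polynomial R) {i j : Fin (N + 1)} (h : j ≠ i) :
    grC f j * grX f i = grX f i * grC f j :=
  ((isSymb_grC f j).mul (isSymb_grX f i)).eq_of_eq
    ((isSymb_grX f i).mul (isSymb_grC f j)) rfl
    (by rw [← map_mul, affC_mul_affX_ne h, map_mul])

theorem grPerm_mul_grC (f : Polynomial R) (w : Equiv.Perm (Fin (N + 1))) (i : Fin (N + 1)) :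
    grPerm f w * grC f i = grC f (w i) * grPerm f w :=
  ((isSymb_grPerm f w).mul (isSymb_grC f i)).eq_of_eq
    ((isSymb_grC f (w i)).mul (isSymb_grPerm f w)) rfl
    (by rw [← map_mul, affW_mul_affC, map_mul])

theorem cycMk_word (f : Polynomial R) (v : List (SergeevGen (N + 1))) :
    cycMk f (v.map affGen).prod = (v.map (cycGen f)).prod := by
  rw [map_list_prod, List.map_map]
  rfl

theorem cycFiltration_le (f : Polynomial R) (k : ℕ) :
    (cycFiltration (N + 1) f).F k ≤ (affLt R N (k + 1)).map (cycMk f).toLinearMap := by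
  refine Submodule.span_le.2 ?_
  rintro _ ⟨v, hv, rfl⟩
  exact ⟨_, affLt_mono (by omega) (affGen_list_prod_mem v), cycMk_word f v⟩

theorem cycFiltration_prev_le (f : Polynomial R) (k : ℕ) :
    (cycFiltration (N + 1) f).prev k ≤ (affLt R N k).map (cycMk f).toLinearMap := by
  cases k with
  | zero => exact bot_le
  | succ k => exact cycFiltration_le f k

/-- The monomial `x^α w c^β` of the associated graded algebra. -/
noncomputable def grMon (f : Polynomial R) (α : Fin (N + 1) → ℕ) (w : Equiv.Perm (Fin (N + 1)))
    (β : Fin (N + 1) → ZMod 2) : GrSergeev (N + 1) f :=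
  xMon (grX f) α * grPerm f w * cMon (grC f) β

theorem isSymb_xMon (f : Polynomial R) (α : Fin (N + 1) → ℕ) :
    (cycFiltration (N + 1) f).IsSymb (∑ j, α j) (cycMk f (xMon affX α)) (xMon (grX f) α) := by
  induction α using nat_fun_induction with
  | h0 =>
    have e : ∑ j, (0 : Fin (N + 1) → ℕ) j = 0 := by simp
    rw [xMon_zero, xMon_zero, map_one, e]
    exact IsSymb.one
  | hs j α ih =>
    have e : ∑ k, (α + Pi.single j 1 : Fin (N + 1) → ℕ) k = 1 + ∑ k, α k := by
      simp [Finset.sum_add_distrib, add_comm]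
    rw [← mul_xMon affX_comm, ← mul_xMon (grX_comm f), map_mul, e]
    exact (isSymb_grX f j).mul ih

theorem isSymb_cMon (f : Polynomial R) (β : Fin (N + 1) → ZMod 2) :
    (cycFiltration (N + 1) f).IsSymb 0 (cycMk f (cMon affC β)) (cMon (grC f) β) := by
  have e : cycMk f (cMon affC β) =
      (List.ofFn fun j => cycMk f (affC j) ^ (β j).val).prod := by
    rw [cMon, map_list_prod, List.map_ofFn]
    simp only [Function.comp_def, map_pow]
  rw [e, cMon]
  exact IsSymb.prod_ofFn fun i => (isSymb_grC f i).pow_zero (β i).val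

theorem isSymb_grMon (f : Polynomial R) (α : Fin (N + 1) → ℕ) (w : Equiv.Perm (Fin (N + 1)))
    (β : Fin (N + 1) → ZMod 2) : (cycFiltration (N + 1) f).IsSymb (∑ j, α j)
      (cycMk f (affMon α w β)) (grMon f α w β) := by
  have h := ((isSymb_xMon f α).mul (isSymb_grPerm f w)).mul (isSymb_cMon f β)
  rw [add_zero, add_zero, ← map_mul, ← map_mul] at h
  exact h

/-- The elements of degree less than `m` are combinations of words. -/
theorem cycMk_affLt_mem (f : Polynomial R) {k : ℕ} {a : AffineSergeev R (N + 1)}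
    (ha : a ∈ affLt R N (k + 1)) : cycMk f a ∈ (cycFiltration (N + 1) f).F k := by
  have : affLt R N (k + 1) ≤
      ((cycFiltration (N + 1) f).F k).comap (cycMk f).toLinearMap := by
    refine Submodule.span_le.2 ?_
    rintro _ ⟨α, w, β, h, rfl⟩
    change cycMk f (affMon α w β) ∈ (cycFiltration (N + 1) f).F k
    exact (cycFiltration (N + 1) f).mono (Nat.lt_succ_iff.1 h) (isSymb_grMon f α w β).1
  exact this ha

theorem cycMk_affW_mul_affX_sub_mem (f : Polynomial R) (w : Equiv.Perm (Fin (N + 1)))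
    (i : Fin (N + 1)) :
    cycMk f (affW w) * cycMk f (affX i) - cycMk f (affX (w i)) * cycMk f (affW w) ∈
      (cycFiltration (N + 1) f).F 0 := by
  have e : cycMk f (affW w) * cycMk f (affX i) - cycMk f (affX (w i)) * cycMk f (affW w) =
      cycMk f (affW w * affX i - affX (w i) * affW w) := by
    rw [map_sub (cycMk f), map_mul (cycMk f), map_mul (cycMk f)]
  rw [e]
  have h : affW w * affX i - affX (w i) * affW w ∈ affLt R N (0 + 1) := by
    rw [zero_add]
    exact affW_mul_affX_sub_mem w i
  exact cycMk_affLt_mem f h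

/-- The correction has degree zero while both products have degree one, so the symbols agree. -/
theorem grPerm_mul_grX (f : Polynomial R) (w : Equiv.Perm (Fin (N + 1))) (i : Fin (N + 1)) :
    grPerm f w * grX f i = grX f (w i) * grPerm f w :=
  IsSymb.eq_of_sub_mem_F ((isSymb_grPerm f w).mul (isSymb_grX f i))
    ((isSymb_grX f (w i)).mul (isSymb_grPerm f w)) (Nat.zero_add 1) (Nat.add_zero 1)
    (cycMk_affW_mul_affX_sub_mem f w i)

theorem isSymb_grX_pow (f : Polynomial R) (i : Fin (N + 1)) (k : ℕ) :
    (cycFiltration (N + 1) f).IsSymb k (cycMk f (affX i ^ k)) (grX f i ^ k) := by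
  induction k with
  | zero => simpa using IsSymb.one
  | succ k ih =>
    rw [pow_succ, pow_succ, map_mul]
    exact ih.mul (isSymb_grX f i)

theorem grPerm_swap_sq (f : Polynomial R) (i j : Fin (N + 1)) :
    grPerm f (Equiv.swap i j) * grPerm f (Equiv.swap i j) = 1 := by
  rw [← grPerm_mul, Equiv.swap_mul_self, grPerm_one]

theorem grPerm_inv_mul (f : Polynomial R) (w : Equiv.Perm (Fin (N + 1))) :
    grPerm f w⁻¹ * grPerm f w = 1 := by
  rw [← grPerm_mul, inv_mul_cancel, grPerm_one]

/-- The symbol of f(x_1) = 0 in degree l is x_1^l, since f is monic of degree l; transpositions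
carry this to every index. -/
theorem grX_pow_eq_zero {l : ℕ} (hm : f.Monic) (hl : f.natDegree = l) (hl1 : 1 ≤ l)
    (i : Fin (N + 1)) : grX f i ^ l = 0 := by
  have h0 : grX f (0 : Fin (N + 1)) ^ l = 0 := by
    refine (isSymb_grX_pow f 0 l).eq_of_sub_mem (IsSymb.zero l) ?_
    obtain ⟨m, rfl⟩ : ∃ m, l = m + 1 := ⟨l - 1, by omega⟩
    have h1 : cycMk f (Polynomial.aeval (affX (0 : Fin (N + 1))) f) = 0 := by
      have := RingQuot.mkAlgHom_rel R (CyclotomicRel.mk (R := R) (d := N + 1) (f := f) 0 rfl)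
      exact this.trans (map_zero _)
    have h2 := affF_sub_mem hm hl (0 : Fin (N + 1))
    rw [affF_zero] at h2
    have h3 := cycMk_affLt_mem f h2
    rw [map_sub, h1, zero_sub] at h3
    rw [sub_zero]
    exact neg_mem_iff.1 h3
  have h1 : grX f i = grPerm f (Equiv.swap 0 i) * grX f 0 * grPerm f (Equiv.swap 0 i) := by
    rw [grPerm_mul_grX, Equiv.swap_apply_left, mul_assoc, grPerm_swap_sq, mul_one]
  have h2 : ∀ k, grX f i ^ k =
      grPerm f (Equiv.swap 0 i) * grX f 0 ^ k * grPerm f (Equiv.swap 0 i) := by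
    intro k
    induction k with
    | zero => rw [pow_zero, pow_zero, mul_one, grPerm_swap_sq]
    | succ k ih =>
      rw [pow_succ, ih, h1, pow_succ]
      calc _ = grPerm f (Equiv.swap 0 i) * grX f 0 ^ k * (grPerm f (Equiv.swap 0 i) *
            grPerm f (Equiv.swap 0 i)) * grX f 0 * grPerm f (Equiv.swap 0 i) := by
            simp only [mul_assoc]
        _ = _ := by rw [grPerm_swap_sq, mul_one]; simp only [mul_assoc]
  rw [h2, h0, mul_zero, zero_mul]

theorem grX_mul_grMon (f : Polynomial R) (j : Fin (N + 1)) (α : Fin (N + 1) → ℕ)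
    (w : Equiv.Perm (Fin (N + 1))) (β : Fin (N + 1) → ZMod 2) :
    grX f j * grMon f α w β = grMon f (α + Pi.single j 1) w β := by
  rw [grMon, grMon, ← mul_xMon (grX_comm f)]
  simp only [mul_assoc]

theorem grMon_eq_zero {l : ℕ} (hm : f.Monic) (hl : f.natDegree = l) (hl1 : 1 ≤ l)
    {α : Fin (N + 1) → ℕ} {i : Fin (N + 1)} (h : l ≤ α i) (w : Equiv.Perm (Fin (N + 1)))
    (β : Fin (N + 1) → ZMod 2) : grMon f α w β = 0 := by
  rw [grMon, xMon_eq_zero α i (pow_eq_zero_of_le h (grX_pow_eq_zero hm hl hl1 i)), zero_mul,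
    zero_mul]

theorem grPerm_mul_xMon (f : Polynomial R) (v : Equiv.Perm (Fin (N + 1))) (α : Fin (N + 1) → ℕ) :
    grPerm f v * xMon (grX f) α = xMon (grX f) (fun i => α (v⁻¹ i)) * grPerm f v := by
  have := mul_xMon_of_sign (X := grX f) (Y := fun i => grX f (v i)) (y := grPerm f v) (fun _ => 0)
    (fun j => by rw [pow_zero, one_mul, grPerm_mul_grX]) α
  rw [this, xMon_comp_perm (grX_comm f)]
  simp

theorem grPerm_mul_cMon (f : Polynomial R) (v : Equiv.Perm (Fin (N + 1)))
    (β : Fin (N + 1) → ZMod 2) :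
    SgnEq (grPerm f v * cMon (grC f) β) (cMon (grC f) (fun i => β (v⁻¹ i)) * grPerm f v) :=
  (isClifford_grC f).mul_cMon_of_perm (grPerm_mul_grC f v) β

theorem grPerm_mul_grMon (f : Polynomial R) (v : Equiv.Perm (Fin (N + 1))) (α : Fin (N + 1) → ℕ)
    (w : Equiv.Perm (Fin (N + 1))) (β : Fin (N + 1) → ZMod 2) :
    grPerm f v * grMon f α w β = grMon f (fun i => α (v⁻¹ i)) (v * w) β := by
  rw [grMon, ← mul_assoc, ← mul_assoc, grPerm_mul_xMon, grMon, grPerm_mul]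
  simp only [mul_assoc]

theorem grMon_mul_grPerm (f : Polynomial R) (v : Equiv.Perm (Fin (N + 1))) (α : Fin (N + 1) → ℕ)
    (w : Equiv.Perm (Fin (N + 1))) (β : Fin (N + 1) → ZMod 2) :
    SgnEq (grMon f α w β * grPerm f v) (grMon f α (w * v) (fun i => β (v i))) := by
  have h := (grPerm_mul_cMon f v fun i => β (v i)).symm.mul_left (xMon (grX f) α * grPerm f w)
  have e : (fun i => β (v (v⁻¹ i))) = β := by funext i; simp
  rw [e] at h
  rw [grMon, grMon, grPerm_mul]
  simpa only [mul_assoc] using h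

theorem grC_mul_xMon (f : Polynomial R) (j : Fin (N + 1)) (α : Fin (N + 1) → ℕ) :
    grC f j * xMon (grX f) α = (-1) ^ α j * xMon (grX f) α * grC f j := by
  have := mul_xMon_of_sign (X := grX f) (Y := grX f) (y := grC f j)
    (fun k => if k = j then 1 else 0) (fun k => by
      split_ifs with h
      · subst h; rw [grC_mul_grX_self]; simp
      · rw [grC_mul_grX_ne f fun e => h e.symm]; simp) α
  rw [this]
  simp

theorem grC_mul_grMon (f : Polynomial R) (j : Fin (N + 1)) (α : Fin (N + 1) → ℕ)
    (w : Equiv.Perm (Fin (N + 1))) (β : Fin (N + 1) → ZMod 2) :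
    SgnEq (grC f j * grMon f α w β) (grMon f α w (β + Pi.single (w⁻¹ j) 1)) := by
  have h1 : grC f j * grPerm f w = grPerm f w * grC f (w⁻¹ j) := by
    rw [grPerm_mul_grC]; simp
  have h2 : grC f j * grMon f α w β =
      (-1) ^ α j * (xMon (grX f) α * grPerm f w * (grC f (w⁻¹ j) * cMon (grC f) β)) := by
    rw [grMon, ← mul_assoc, ← mul_assoc, grC_mul_xMon]
    simp only [mul_assoc]
    rw [← mul_assoc (grC f j), h1, mul_assoc]
  rw [h2]
  exact (SgnEq.pow_neg_one _ _).trans (((isClifford_grC f).mul_cMon_sgnEq _ _).mul_left _)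

theorem grMon_mul_grC (f : Polynomial R) (j : Fin (N + 1)) (α : Fin (N + 1) → ℕ)
    (w : Equiv.Perm (Fin (N + 1))) (β : Fin (N + 1) → ZMod 2) :
    SgnEq (grMon f α w β * grC f j) (grMon f α w (β + Pi.single j 1)) := by
  rw [grMon, mul_assoc]
  exact ((isClifford_grC f).cMon_mul_sgnEq _ _).mul_left _

theorem cMon_mul_grX (f : Polynomial R) (β : Fin (N + 1) → ZMod 2) (j : Fin (N + 1)) :
    cMon (grC f) β * grX f j = (-1) ^ (β j).val * grX f j * cMon (grC f) β := by
  have := mul_xMon_of_sign (X := grC f) (Y := grC f) (y := grX f j)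
    (fun k => if k = j then 1 else 0) (fun k => by
      split_ifs with h
      · subst h; rw [pow_one, neg_one_mul, neg_mul, grC_mul_grX_self, neg_neg]
      · rw [pow_zero, one_mul, grC_mul_grX_ne f h]) fun k => (β k).val
  simp only [ite_mul, one_mul, zero_mul, Finset.sum_ite_eq', Finset.mem_univ, if_true] at this
  change grX f j * cMon (grC f) β = (-1) ^ (β j).val * cMon (grC f) β * grX f j at this
  rw [mul_assoc, this, ← mul_assoc, ← mul_assoc, ← pow_add, ← two_mul, pow_mul]
  simp

/-- The sign is exact here, because it has to be accumulated along the cycles of w. -/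
theorem grMon_mul_grX (f : Polynomial R) (j : Fin (N + 1)) (α : Fin (N + 1) → ℕ)
    (w : Equiv.Perm (Fin (N + 1))) (β : Fin (N + 1) → ZMod 2) :
    grMon f α w β * grX f j = (-1) ^ (β j).val * grMon f (α + Pi.single (w j) 1) w β := by
  have hc : ∀ (k : ℕ) (a : GrSergeev (N + 1) f), (-1) ^ k * a = a * (-1) ^ k := fun k a =>
    ((Commute.neg_one_left a).pow_left k).eq
  rw [grMon, mul_assoc, cMon_mul_grX, grMon, ← xMon_mul_xMon (grX_comm f), xMon_single (grX_comm f), pow_one, mul_assoc ((-1) ^ _),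
    ← mul_assoc _ ((-1) ^ _), ← hc]
  simp only [mul_assoc]
  rw [← mul_assoc (grPerm f w), grPerm_mul_grX]
  simp only [mul_assoc]

end Graded

namespace AlgFiltration.IsSymb

variable {R S : Type*} [CommRing R] [Ring S] [Algebra R S] {W : AlgFiltration R S} {k : ℕ} {a : S}

theorem of_mem_prev (h : a ∈ W.prev k) (ha : a ∈ W.F k) : W.IsSymb k a 0 := by
  refine ⟨ha, Eq.symm ?_⟩
  have h1 : W.toPiece k a ha = 0 :=
    (Submodule.Quotient.mk_eq_zero ((W.prev k).submoduleOf (W.F k))).2 h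
  rw [symb, h1, map_zero]

end AlgFiltration.IsSymb

/-! ### The basis of reduced monomials. -/

section GradedBasis

open AlgFiltration

variable {R : Type*} [CommRing R] {N : ℕ} {f : Polynomial R} {l : ℕ}

/-- The polynomial `f` is monic of odd degree `l` and contains only odd powers. -/
structure IsOddMonic (f : Polynomial R) (l : ℕ) : Prop where
  monic : f.Monic
  natDegree_eq : f.natDegree = l
  odd_of_coeff : ∀ k, f.coeff k ≠ 0 → Odd k
  odd : Odd l

theorem IsOddMonic.one_le (h : IsOddMonic f l) : 1 ≤ l := h.odd.pos

theorem isSymb_word {d : ℕ} (f : Polynomial R) (v : List (SergeevGen d)) :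
    (cycFiltration d f).IsSymb (v.map SergeevGen.deg).sum (v.map (cycGen f)).prod
      (v.map (grGen f)).prod := by
  induction v with
  | nil => exact IsSymb.one
  | cons g v ih =>
    rw [List.map_cons, List.map_cons, List.map_cons, List.sum_cons, List.prod_cons,
      List.prod_cons]
    exact (isSymb_grGen f g).mul ih

/-- The span of the monomials `x^α w c^β` with prescribed `α`, `w` and `β`. -/
noncomputable def grSpan (f : Polynomial R)
    (p : (Fin (N + 1) → ℕ) → Equiv.Perm (Fin (N + 1)) → (Fin (N + 1) → ZMod 2) → Prop) :
    Submodule R (GrSergeev (N + 1) f) :=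
  Submodule.span R {y | ∃ α w β, p α w β ∧ y = grMon f α w β}

variable {p q : (Fin (N + 1) → ℕ) → Equiv.Perm (Fin (N + 1)) → (Fin (N + 1) → ZMod 2) → Prop}

theorem grMon_mem_grSpan {α : Fin (N + 1) → ℕ} {w : Equiv.Perm (Fin (N + 1))}
    {β : Fin (N + 1) → ZMod 2} (h : p α w β) : grMon f α w β ∈ grSpan f p :=
  Submodule.subset_span ⟨α, w, β, h, rfl⟩

theorem grSpan_mono (h : ∀ α w β, p α w β → q α w β) : grSpan f p ≤ grSpan f q := by
  apply Submodule.span_mono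
  rintro _ ⟨α, w, β, h', rfl⟩
  exact ⟨α, w, β, h α w β h', rfl⟩

/-- A linear map sends `grSpan f p` into a submodule if it does so on monomials. -/
theorem map_mem_of_grSpan {M : Type*} [AddCommGroup M] [Module R M]
    {φ : GrSergeev (N + 1) f →ₗ[R] M} {T : Submodule R M}
    (h : ∀ α w β, p α w β → φ (grMon f α w β) ∈ T) {z : GrSergeev (N + 1) f}
    (hz : z ∈ grSpan f p) : φ z ∈ T := by
  have : grSpan f p ≤ T.comap φ := by
    refine Submodule.span_le.2 ?_
    rintro _ ⟨α, w, β, h', rfl⟩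
    exact h α w β h'
  exact this hz

theorem grMon_zero_one_zero (f : Polynomial R) :
    grMon f (0 : Fin (N + 1) → ℕ) (1 : Equiv.Perm (Fin (N + 1))) 0 = 1 := by
  rw [grMon, xMon_zero, grPerm_one, IsClifford.cMon_zero, mul_one, mul_one]

/-- Multiplying a reduced monomial by a generator gives a reduced monomial up to sign, or zero by
x_i^l = 0. The parity of β counts the Clifford letters, which identifies the even and odd parts. -/
theorem grWord_mem (h : IsOddMonic f l) (v : List (SergeevGen (N + 1))) :
    (v.map (grGen f)).prod ∈ grSpan f fun α _ β =>
      (∀ i, α i < l) ∧ ∑ i, β i = ((v.map SergeevGen.par).sum : ℕ) := by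
  induction v with
  | nil =>
    rw [List.map_nil, List.map_nil, List.prod_nil, ← grMon_zero_one_zero f]
    exact grMon_mem_grSpan ⟨fun i => h.one_le, by simp⟩
  | cons g v ih =>
    rw [List.map_cons, List.map_cons, List.prod_cons, List.sum_cons]
    refine map_mem_of_grSpan (φ := LinearMap.mulLeft R (grGen f g)) ?_ ih
    rintro α w β ⟨hα, hβ⟩
    rw [LinearMap.mulLeft_apply]
    cases g with
    | perm u =>
      change grPerm f u * _ ∈ _
      rw [grPerm_mul_grMon]
      exact grMon_mem_grSpan ⟨fun i => hα _, by simpa [SergeevGen.par] using hβ⟩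
    | x i =>
      change grX f i * _ ∈ _
      rw [grX_mul_grMon]
      by_cases hi : l ≤ α i + 1
      · rw [grMon_eq_zero h.monic h.natDegree_eq h.one_le (i := i) (by simpa using hi)]
        exact zero_mem _
      · refine grMon_mem_grSpan ⟨fun j => ?_, by simpa [SergeevGen.par] using hβ⟩
        by_cases hj : j = i
        · subst hj; simpa using hi
        · simpa [hj] using hα j
    | c i =>
      refine (grC_mul_grMon f i α w β).mem (grMon_mem_grSpan ⟨hα, ?_⟩)
      simp only [Pi.add_apply, Finset.sum_add_distrib, hβ, Finset.sum_pi_single',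
        Finset.mem_univ, if_true, SergeevGen.par]
      push_cast
      rw [add_comm]

theorem grEven_le (h : IsOddMonic f l) :
    grEven (N + 1) f ≤ grSpan f fun α _ β => (∀ i, α i < l) ∧ ∑ i, β i = 0 := by
  refine Submodule.span_le.2 ?_
  rintro _ ⟨v, hv, rfl⟩
  refine grSpan_mono ?_ (grWord_mem h v)
  rintro α w β ⟨hα, hβ⟩
  exact ⟨hα, by rw [hβ, ZMod.natCast_eq_zero_iff_even]; exact hv⟩

theorem grOdd_le (h : IsOddMonic f l) :
    grOdd (N + 1) f ≤ grSpan f fun α _ β => (∀ i, α i < l) ∧ ∑ i, β i = 1 := by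
  refine Submodule.span_le.2 ?_
  rintro _ ⟨v, hv, rfl⟩
  refine grSpan_mono ?_ (grWord_mem h v)
  rintro α w β ⟨hα, hβ⟩
  exact ⟨hα, by rw [hβ, ZMod.natCast_eq_one_iff_odd]; exact hv⟩

theorem exists_isSymb (h : IsOddMonic f l) {k : ℕ} {a : CycSergeev (N + 1) f}
    (ha : a ∈ (cycFiltration (N + 1) f).F k) :
    ∃ z ∈ grSpan (N := N) f (fun α _ _ => ∀ i, α i < l),
      (cycFiltration (N + 1) f).IsSymb k a z := by
  change a ∈ Submodule.span R _ at ha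
  induction ha using Submodule.span_induction with
  | mem a ha' =>
    obtain ⟨v, hv, rfl⟩ := ha'
    rcases hv.lt_or_eq with hv | rfl
    -- A word with fewer than k polynomial generators lies in the previous filtration step, so its
    -- symbol in degree k is zero.
    · obtain ⟨m, rfl⟩ : ∃ m, k = m + 1 := ⟨k - 1, by omega⟩
      have h1 : (v.map (cycGen f)).prod ∈ (cycFiltration (N + 1) f).F m :=
        Submodule.subset_span ⟨v, Nat.lt_succ_iff.1 hv, rfl⟩
      exact ⟨0, zero_mem _, IsSymb.of_mem_prev h1
        ((cycFiltration (N + 1) f).mono (Nat.le_succ m) h1)⟩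
    · exact ⟨_, grSpan_mono (fun α _ β h => h.1) (grWord_mem h v), isSymb_word f v⟩
  | zero => exact ⟨0, zero_mem _, IsSymb.zero k⟩
  | add a b ha' hb' iha ihb =>
    obtain ⟨z, hz, hz'⟩ := iha
    obtain ⟨y, hy, hy'⟩ := ihb
    exact ⟨z + y, add_mem hz hy, hz'.add hy'⟩
  | smul r a ha' iha =>
    obtain ⟨z, hz, hz'⟩ := iha
    exact ⟨r • z, Submodule.smul_mem _ r hz, hz'.smul r⟩

theorem grSpan_eq_top (h : IsOddMonic f l) :
    grSpan (N := N) f (fun α _ _ => ∀ i, α i < l) = ⊤ := by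
  rw [eq_top_iff]
  intro z _
  induction z using DirectSum.induction_on with
  | zero => exact zero_mem _
  | add x y hx hy => exact add_mem (hx trivial) (hy trivial)
  | of k s =>
    obtain ⟨a, ha, rfl⟩ := (cycFiltration (N + 1) f).exists_toPiece s
    obtain ⟨z, hz, hz'⟩ := exists_isSymb h ha
    have e : DirectSum.of (cycFiltration (N + 1) f).Piece k
        ((cycFiltration (N + 1) f).toPiece k a ha) = z :=
      IsSymb.eq_of_eq ⟨ha, rfl⟩ hz' rfl rfl
    rw [e]
    exact hz

/-- A relation splits into its homogeneous parts. If the part of degree k vanishes, the lifted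
combination agrees in the cyclotomic algebra with an element of degree below k, and
`reduced_independent` applies. -/
theorem linearIndependent_grMon (h : IsOddMonic f l) : LinearIndependent R
    (fun t : (Fin (N + 1) → Fin l) × Equiv.Perm (Fin (N + 1)) × (Fin (N + 1) → ZMod 2) =>
      grMon f (fun i => (t.1 i : ℕ)) t.2.1 t.2.2) := by
  classical
  rw [Fintype.linearIndependent_iff]
  intro g hg t0
  set k := ∑ i, (t0.1 i : ℕ) with hk
  set s := Finset.univ.filter fun t : (Fin (N + 1) → Fin l) × Equiv.Perm (Fin (N + 1)) ×
    (Fin (N + 1) → ZMod 2) => ∑ i, (t.1 i : ℕ) = k with hs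
  let b : AffineSergeev R (N + 1) := ∑ t ∈ s, g t • affMon (fun i => (t.1 i : ℕ)) t.2.1 t.2.2
  have hsymb : ∀ t ∈ s, (cycFiltration (N + 1) f).IsSymb k
      (g t • cycMk f (affMon (fun i => (t.1 i : ℕ)) t.2.1 t.2.2))
      (g t • grMon f (fun i => (t.1 i : ℕ)) t.2.1 t.2.2) := by
    intro t ht
    have h1 := isSymb_grMon f (fun i => (t.1 i : ℕ)) t.2.1 t.2.2
    rw [(Finset.mem_filter.1 ht).2] at h1
    exact h1.smul (g t)
  have h1 : (cycFiltration (N + 1) f).IsSymb k (cycMk f b)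
      (∑ t ∈ s, g t • grMon f (fun i => (t.1 i : ℕ)) t.2.1 t.2.2) := by
    have e : cycMk f b = ∑ t ∈ s, g t • cycMk f (affMon (fun i => (t.1 i : ℕ)) t.2.1 t.2.2) := by
      simp only [b, map_sum, map_smul]
    rw [e]
    exact IsSymb.sum hsymb
  have h2 : DirectSum.component R ℕ (cycFiltration (N + 1) f).Piece k
      (∑ t ∈ s, g t • grMon f (fun i => (t.1 i : ℕ)) t.2.1 t.2.2) = 0 := by
    have h3 := congrArg (DirectSum.component R ℕ (cycFiltration (N + 1) f).Piece k) hg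
    rw [map_zero] at h3
    rw [← h3, map_sum, map_sum, hs, Finset.sum_filter]
    refine Finset.sum_congr rfl fun t _ => ?_
    split_ifs with ht
    · rfl
    · rw [map_smul, (isSymb_grMon f _ _ _).component_ne ht, smul_zero]
  have h3 := cycFiltration_prev_le f k (h1.mem_prev h2)
  obtain ⟨u, hu, hbu⟩ := h3
  have hb : b ∈ affSpan R fun α : Fin (N + 1) → ℕ => (∀ i, α i < l) ∧ ∑ i, α i = k := by
    refine Submodule.sum_mem _ fun t ht => Submodule.smul_mem _ _ (Submodule.subset_span ?_)
    exact ⟨_, _, _, ⟨fun i => (t.1 i).2, (Finset.mem_filter.1 ht).2⟩, rfl⟩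
  have hb0 : b = 0 :=
    reduced_independent h.monic h.natDegree_eq h.odd_of_coeff h.one_le hb hu hbu.symm
  have hinj : Function.Injective fun t : (Fin (N + 1) → Fin l) × Equiv.Perm (Fin (N + 1)) ×
      (Fin (N + 1) → ZMod 2) => ((fun i => (t.1 i : ℕ)), t.2.1, t.2.2) := by
    rintro ⟨α, w, β⟩ ⟨α', w', β'⟩ hh
    simp only [Prod.mk.injEq] at hh
    obtain ⟨h4, rfl, rfl⟩ := hh
    congr 1
    funext i
    exact Fin.ext (congrFun h4 i)
  have h5 := (linearIndependent_affMon R N).comp _ hinj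
  exact linearIndependent_iff'.1 h5 s g hb0 t0 (by simp [hs, hk])

/-- The monomial basis of the associated graded algebra. -/
noncomputable def grBasis (h : IsOddMonic f l) : Module.Basis
    ((Fin (N + 1) → Fin l) × Equiv.Perm (Fin (N + 1)) × (Fin (N + 1) → ZMod 2)) R
    (GrSergeev (N + 1) f) :=
  Module.Basis.mk (linearIndependent_grMon h) (by
    rw [← grSpan_eq_top h]
    refine Submodule.span_mono ?_
    rintro _ ⟨α, w, β, hα, rfl⟩
    exact ⟨(fun i => ⟨α i, hα i⟩, w, β), rfl⟩)

theorem grBasis_apply (h : IsOddMonic f l)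
    (t : (Fin (N + 1) → Fin l) × Equiv.Perm (Fin (N + 1)) × (Fin (N + 1) → ZMod 2)) :
    grBasis h t = grMon f (fun i => (t.1 i : ℕ)) t.2.1 t.2.2 := by
  rw [grBasis, Module.Basis.mk_apply]

open Classical in
/-- The coefficient of `x^α w c^β`. -/
noncomputable def grCoef (h : IsOddMonic f l) (α : Fin (N + 1) → ℕ) (w : Equiv.Perm (Fin (N + 1)))
    (β : Fin (N + 1) → ZMod 2) : GrSergeev (N + 1) f →ₗ[R] R :=
  if hα : ∀ i, α i < l then (grBasis h).coord (fun i => ⟨α i, hα i⟩, w, β) else 0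

theorem grCoef_grMon (h : IsOddMonic f l) {α : Fin (N + 1) → ℕ} (hα : ∀ i, α i < l)
    (w : Equiv.Perm (Fin (N + 1))) (β : Fin (N + 1) → ZMod 2) (α' : Fin (N + 1) → ℕ)
    (w' : Equiv.Perm (Fin (N + 1))) (β' : Fin (N + 1) → ZMod 2) :
    grCoef h α w β (grMon f α' w' β') = if α' = α ∧ w' = w ∧ β' = β then 1 else 0 := by
  by_cases hα' : ∀ i, α' i < l
  · have e := grBasis_apply h (fun i => ⟨α' i, hα' i⟩, w', β')
    change _ = grMon f α' w' β' at e
    rw [← e, grCoef, dif_pos hα, Module.Basis.coord_apply, Module.Basis.repr_self,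
      Finsupp.single_apply]
    refine if_congr ?_ rfl rfl
    simp only [Prod.mk.injEq, funext_iff, Fin.ext_iff]
  · push Not at hα'
    obtain ⟨i, hi⟩ := hα'
    rw [grMon_eq_zero h.monic h.natDegree_eq h.one_le hi, map_zero, if_neg]
    rintro ⟨rfl, -, -⟩
    exact absurd (hα i) (not_lt.2 hi)

theorem grCoef_of_le (h : IsOddMonic f l) {α : Fin (N + 1) → ℕ} {i : Fin (N + 1)} (hi : l ≤ α i)
    (w : Equiv.Perm (Fin (N + 1))) (β : Fin (N + 1) → ZMod 2) : grCoef h α w β = 0 := by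
  rw [grCoef, dif_neg fun hh => absurd (hh i) (not_lt.2 hi)]

theorem gr_ext (h : IsOddMonic f l) {z y : GrSergeev (N + 1) f}
    (hzy : ∀ α w β, (∀ i, α i < l) → grCoef h α w β z = grCoef h α w β y) : z = y := by
  refine (grBasis h).ext_elem fun t => ?_
  have := hzy (fun i => (t.1 i : ℕ)) t.2.1 t.2.2 fun i => (t.1 i).2
  rwa [grCoef, dif_pos fun i => (t.1 i).2] at this

/-- Linear maps that agree on reduced monomials are equal. -/
theorem gr_hom_ext (h : IsOddMonic f l) {M : Type*} [AddCommGroup M] [Module R M]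
    {φ ψ : GrSergeev (N + 1) f →ₗ[R] M}
    (hφ : ∀ α w β, (∀ i, α i < l) → φ (grMon f α w β) = ψ (grMon f α w β)) : φ = ψ := by
  refine (grBasis h).ext fun t => ?_
  rw [grBasis_apply]
  exact hφ _ _ _ fun i => (t.1 i).2

theorem grCoef_eq_zero (h : IsOddMonic f l) {z : GrSergeev (N + 1) f} (hz : z ∈ grSpan f p)
    {α : Fin (N + 1) → ℕ} {w : Equiv.Perm (Fin (N + 1))} {β : Fin (N + 1) → ZMod 2}
    (hp : ¬p α w β) : grCoef h α w β z = 0 := by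
  by_cases hα : ∀ i, α i < l
  · refine (Submodule.mem_bot R).1 (map_mem_of_grSpan (T := ⊥) ?_ hz)
    intro α' w' β' h'
    rw [grCoef_grMon h hα, if_neg]
    · exact zero_mem _
    · rintro ⟨rfl, rfl, rfl⟩
      exact hp h'
  · push Not at hα
    obtain ⟨i, hi⟩ := hα
    rw [grCoef_of_le h hi, LinearMap.zero_apply]

theorem gr_two_torsion_free (h : IsOddMonic f l) (h2 : ∀ a : R, 2 * a = 0 → a = 0)
    {z : GrSergeev (N + 1) f} (hz : z = -z) : z = 0 := by
  refine gr_ext h fun α w β _ => ?_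
  rw [map_zero]
  apply h2
  have := congrArg (grCoef h α w β) hz
  rw [map_neg] at this
  linear_combination this

end GradedBasis

/-! ### Transport of signs around a cycle. -/

section CycleSigns

variable {ι A : Type*} [DecidableEq ι] [Ring A]

/-- The relations between successive entries telescope from the first entry of the list. -/
theorem apply_getElem_zero_of_formPerm {L : List ι} (hn : L.Nodup) {g : ι → A} {s : ι → ℕ}
    (hg : ∀ i ∈ L, g i = (-1) ^ s i * g (L.formPerm i)) (k : ℕ) (hk : k < L.length) :
    g (L[0]'(by omega)) = (-1) ^ ((L.take k).map s).sum * g L[k] := by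
  induction k with
  | zero => simp
  | succ k ih =>
    rw [ih (by omega), hg L[k] (List.getElem_mem _), List.formPerm_apply_lt_getElem L hn k hk,
      ← List.take_concat_get' L k (by omega), List.map_append, List.sum_append, pow_add]
    simp [mul_assoc]

theorem apply_getElem_zero_eq_of_formPerm {L : List ι} (hn : L.Nodup) {g : ι → A} {s : ι → ℕ}
    (hg : ∀ i ∈ L, g i = (-1) ^ s i * g (L.formPerm i)) (h0 : 0 < L.length) :
    g L[0] = (-1 : A) ^ (L.map s).sum * g L[0] := by
  obtain ⟨k, hk⟩ : ∃ k, L.length = k + 1 := ⟨L.length - 1, by omega⟩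
  have h1 := hg L[k] (List.getElem_mem (by omega))
  rw [List.formPerm_apply_getElem L hn k (by omega)] at h1
  simp only [hk, Nat.mod_self] at h1
  have h2 := apply_getElem_zero_of_formPerm hn hg k (by omega)
  rw [h1, ← mul_assoc, ← pow_add] at h2
  have h3 : (L.map s).sum = ((L.take k).map s).sum + s L[k] := by
    have h4 : L = L.take k ++ [L[k]] := by
      rw [List.take_concat_get' L k (by omega), ← hk, List.take_length]
    conv_lhs => rw [h4]
    rw [List.map_append, List.sum_append, List.map_singleton, List.sum_singleton]
  rw [h3]
  exact h2

theorem eq_of_formPerm {L : List ι} (hn : L.Nodup) {g : ι → A}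
    (hg : ∀ i ∈ L, g i = g (L.formPerm i)) {i j : ι} (hi : i ∈ L) (hj : j ∈ L) : g i = g j := by
  have h1 : ∀ i ∈ L, g i = (-1) ^ (fun _ => 0 : ι → ℕ) i * g (L.formPerm i) := by
    simpa using hg
  obtain ⟨k, hk, rfl⟩ := List.getElem_of_mem hi
  obtain ⟨m, hm, rfl⟩ := List.getElem_of_mem hj
  have h2 := apply_getElem_zero_of_formPerm hn h1 k hk
  rw [apply_getElem_zero_of_formPerm hn h1 m hm] at h2
  simpa using h2.symm

/-- Going once around the cycle returns to the same value with the total sign, which is -1. -/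
theorem eq_neg_of_formPerm {L : List ι} (hn : L.Nodup) {g : ι → A} {s : ι → ℕ}
    (hg : ∀ i ∈ L, g i = (-1) ^ s i * g (L.formPerm i)) (hs : Odd (L.map s).sum) {i : ι}
    (hi : i ∈ L) : g i = -g i := by
  obtain ⟨k, hk, rfl⟩ := List.getElem_of_mem hi
  have h1 := apply_getElem_zero_of_formPerm hn hg k hk
  have h2 := apply_getElem_zero_eq_of_formPerm hn hg (by omega)
  rw [hs.neg_one_pow, h1] at h2
  rcases neg_one_pow_eq_or A ((L.take k).map s).sum with h | h <;> rw [h] at h2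
  · simpa using h2
  · rw [neg_one_mul, neg_one_mul, neg_neg] at h2
    exact h2.symm

end CycleSigns

/-! ### Coefficients of products with generators. -/

section Coefficients

variable {R : Type*} [CommRing R] {N : ℕ} {f : Polynomial R} {l : ℕ}

theorem cMon_mul_xMon (f : Polynomial R) (γ : Fin (N + 1) → ZMod 2) (α : Fin (N + 1) → ℕ) :
    cMon (grC f) γ * xMon (grX f) α =
      (-1) ^ (∑ j, (γ j).val * α j) * xMon (grX f) α * cMon (grC f) γ :=
  mul_xMon_of_sign _ (fun j => cMon_mul_grX f γ j) α

theorem cMon_mul_grPerm (f : Polynomial R) (γ : Fin (N + 1) → ZMod 2)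
    (w : Equiv.Perm (Fin (N + 1))) :
    SgnEq (cMon (grC f) γ * grPerm f w) (grPerm f w * cMon (grC f) fun i => γ (w i)) := by
  have h := grPerm_mul_cMon f w fun i => γ (w i)
  have e : (fun i => γ (w (w⁻¹ i))) = γ := by funext i; simp
  rw [e] at h
  exact h.symm

theorem grMon_mul_grMon (f : Polynomial R) (α α' : Fin (N + 1) → ℕ)
    (w w' : Equiv.Perm (Fin (N + 1))) (β β' : Fin (N + 1) → ZMod 2) :
    SgnEq (grMon f α w β * grMon f α' w' β')
      (grMon f (α + fun i => α' (w⁻¹ i)) (w * w') ((fun i => β (w' i)) + β')) := by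
  have h1 : SgnEq (cMon (grC f) β * xMon (grX f) α') (xMon (grX f) α' * cMon (grC f) β) := by
    rw [cMon_mul_xMon, mul_assoc]
    exact SgnEq.pow_neg_one _ _
  have h2 : SgnEq (cMon (grC f) β * grMon f α' w' β')
      (grMon f α' w' ((fun i => β (w' i)) + β')) := by
    rw [grMon, ← mul_assoc, ← mul_assoc]
    refine ((h1.mul_right _).mul_right _).trans ?_
    rw [mul_assoc (xMon (grX f) α')]
    refine (((cMon_mul_grPerm f β w').mul_left _).mul_right _).trans ?_
    rw [grMon, ← mul_assoc, mul_assoc _ (cMon _ _)]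
    exact ((isClifford_grC f).cMon_mul_cMon_sgnEq _ _).mul_left _
  rw [grMon, mul_assoc]
  refine (h2.mul_left _).trans (SgnEq.of_eq ?_)
  rw [mul_assoc, grPerm_mul_grMon, grMon, grMon, ← xMon_mul_xMon (grX_comm f)]
  simp only [mul_assoc]

theorem grMon_zero_mul_grMon (f : Polynomial R) (α α' : Fin (N + 1) → ℕ)
    (w w' : Equiv.Perm (Fin (N + 1))) (β' : Fin (N + 1) → ZMod 2) :
    grMon f α w 0 * grMon f α' w' β' = grMon f (α + fun i => α' (w⁻¹ i)) (w * w') β' := by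
  rw [grMon, IsClifford.cMon_zero, mul_one, mul_assoc, grPerm_mul_grMon, grMon, grMon,
    ← xMon_mul_xMon (grX_comm f)]
  simp only [mul_assoc]

theorem grMon_zero_one (f : Polynomial R) (γ : Fin (N + 1) → ZMod 2) :
    grMon f 0 1 γ = cMon (grC f) γ := by
  rw [grMon, xMon_zero, grPerm_one, one_mul, one_mul]

theorem cMon_mul_grMon (f : Polynomial R) (γ : Fin (N + 1) → ZMod 2) (α : Fin (N + 1) → ℕ)
    (w : Equiv.Perm (Fin (N + 1))) (β : Fin (N + 1) → ZMod 2) :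
    SgnEq (cMon (grC f) γ * grMon f α w β) (grMon f α w ((fun i => γ (w i)) + β)) := by
  have h := grMon_mul_grMon f 0 α 1 w γ β
  rw [grMon_zero_one, one_mul] at h
  simpa using h

theorem grMon_mul_cMon (f : Polynomial R) (γ : Fin (N + 1) → ZMod 2) (α : Fin (N + 1) → ℕ)
    (w : Equiv.Perm (Fin (N + 1))) (β : Fin (N + 1) → ZMod 2) :
    SgnEq (grMon f α w β * cMon (grC f) γ) (grMon f α w (β + γ)) := by
  rw [grMon, mul_assoc]
  exact ((isClifford_grC f).cMon_mul_cMon_sgnEq _ _).mul_left _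

theorem smul_grMon_eq_zero (h : IsOddMonic f l) {α : Fin (N + 1) → ℕ} (hα : ∀ i, α i < l)
    {w : Equiv.Perm (Fin (N + 1))} {β : Fin (N + 1) → ZMod 2} {r : R} {y : GrSergeev (N + 1) f}
    (hy : SgnEq y (grMon f α w β)) (hr : r • y = 0) : r = 0 := by
  have h1 : r • grMon f α w β = 0 := by
    rcases hy with rfl | rfl
    · exact hr
    · rwa [smul_neg, neg_eq_zero] at hr
  have := congrArg (grCoef h α w β) h1
  rwa [map_smul, grCoef_grMon h hα, if_pos ⟨rfl, rfl, rfl⟩, map_zero, smul_eq_mul, mul_one] at this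

/-- The coefficients of the image of an element under a linear map that permutes monomials up to
sign. -/
theorem grCoef_smul_of_monomial_map (h : IsOddMonic f l)
    {φ : GrSergeev (N + 1) f →ₗ[R] GrSergeev (N + 1) f}
    {π : (Fin (N + 1) → ℕ) × Equiv.Perm (Fin (N + 1)) × (Fin (N + 1) → ZMod 2) →
      (Fin (N + 1) → ℕ) × Equiv.Perm (Fin (N + 1)) × (Fin (N + 1) → ZMod 2)}
    (hinj : Function.Injective π) (hred : ∀ t, (∀ i, t.1 i < l) → ∀ i, (π t).1 i < l)
    (hφ : ∀ t, SgnEq (φ (grMon f t.1 t.2.1 t.2.2)) (grMon f (π t).1 (π t).2.1 (π t).2.2))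
    (t : (Fin (N + 1) → ℕ) × Equiv.Perm (Fin (N + 1)) × (Fin (N + 1) → ZMod 2))
    (ht : ∀ i, t.1 i < l) (z : GrSergeev (N + 1) f) :
    grCoef h (π t).1 (π t).2.1 (π t).2.2 (φ z) • grMon f (π t).1 (π t).2.1 (π t).2.2 =
      grCoef h t.1 t.2.1 t.2.2 z • φ (grMon f t.1 t.2.1 t.2.2) := by
  have key : ((grCoef h (π t).1 (π t).2.1 (π t).2.2).smulRight
      (grMon f (π t).1 (π t).2.1 (π t).2.2)) ∘ₗ φ =
      (grCoef h t.1 t.2.1 t.2.2).smulRight (φ (grMon f t.1 t.2.1 t.2.2)) := by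
    refine gr_hom_ext h fun α w β hα => ?_
    simp only [LinearMap.comp_apply, LinearMap.smulRight_apply]
    have h1 := hφ (α, w, β)
    rw [grCoef_grMon h ht]
    by_cases e : (α, w, β) = t
    · subst e
      rw [if_pos ⟨rfl, rfl, rfl⟩, one_smul]
      rcases h1 with h1 | h1
      · rw [h1, grCoef_grMon h (hred _ ht), if_pos ⟨rfl, rfl, rfl⟩, one_smul]
      · rw [h1, map_neg, grCoef_grMon h (hred _ ht), if_pos ⟨rfl, rfl, rfl⟩, neg_smul, one_smul]
    · have e1 : ¬(α = t.1 ∧ w = t.2.1 ∧ β = t.2.2) := by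
        rintro ⟨rfl, rfl, rfl⟩
        exact e rfl
      have e2 : ¬((π (α, w, β)).1 = (π t).1 ∧ (π (α, w, β)).2.1 = (π t).2.1 ∧
          (π (α, w, β)).2.2 = (π t).2.2) := by
        rintro ⟨h3, h4, h5⟩
        exact e (hinj (Prod.ext h3 (Prod.ext h4 h5)))
      have h6 : grCoef h (π t).1 (π t).2.1 (π t).2.2 (φ (grMon f α w β)) = 0 := by
        rcases h1 with h1 | h1
        · rw [h1, grCoef_grMon h (hred _ ht), if_neg e2]
        · rw [h1, map_neg, grCoef_grMon h (hred _ ht), if_neg e2, neg_zero]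
      rw [h6, if_neg e1, zero_smul, zero_smul]
  exact LinearMap.congr_fun key z

/-- The unknown sign stays inside the product of monomials on the right. Equating multiples of
monomials is enough, since vanishing and comparison of coefficients do not require the sign. -/
theorem cMon_mul_grCoef (h : IsOddMonic f l) (γ : Fin (N + 1) → ZMod 2) {α : Fin (N + 1) → ℕ}
    (hα : ∀ i, α i < l) (w : Equiv.Perm (Fin (N + 1))) (β : Fin (N + 1) → ZMod 2)
    (z : GrSergeev (N + 1) f) :
    grCoef h α w ((fun i => γ (w i)) + β) (cMon (grC f) γ * z) •
        grMon f α w ((fun i => γ (w i)) + β) =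
      grCoef h α w β z • (cMon (grC f) γ * grMon f α w β) := by
  refine grCoef_smul_of_monomial_map h (φ := LinearMap.mulLeft R (cMon (grC f) γ))
    (π := fun t => (t.1, t.2.1, (fun i => γ (t.2.1 i)) + t.2.2)) ?_ (fun t ht => ht)
    (fun t => cMon_mul_grMon f γ _ _ _) (α, w, β) hα z
  rintro ⟨α, w, β⟩ ⟨α', w', β'⟩ hh
  simp only [Prod.mk.injEq] at hh
  obtain ⟨rfl, rfl, h3⟩ := hh
  rw [add_left_cancel h3]

theorem grCoef_mul_cMon (h : IsOddMonic f l) (γ : Fin (N + 1) → ZMod 2) {α : Fin (N + 1) → ℕ}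
    (hα : ∀ i, α i < l) (w : Equiv.Perm (Fin (N + 1))) (β : Fin (N + 1) → ZMod 2)
    (z : GrSergeev (N + 1) f) :
    grCoef h α w (β + γ) (z * cMon (grC f) γ) • grMon f α w (β + γ) =
      grCoef h α w β z • (grMon f α w β * cMon (grC f) γ) := by
  refine grCoef_smul_of_monomial_map h (φ := LinearMap.mulRight R (cMon (grC f) γ))
    (π := fun t => (t.1, t.2.1, t.2.2 + γ)) ?_ (fun t ht => ht)
    (fun t => grMon_mul_cMon f γ _ _ _) (α, w, β) hα z
  rintro ⟨α, w, β⟩ ⟨α', w', β'⟩ hh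
  simp only [Prod.mk.injEq] at hh
  obtain ⟨rfl, rfl, h3⟩ := hh
  rw [add_right_cancel h3]

theorem grPerm_conj_grMon (f : Polynomial R) (σ : Equiv.Perm (Fin (N + 1))) (α : Fin (N + 1) → ℕ)
    (w : Equiv.Perm (Fin (N + 1))) (β : Fin (N + 1) → ZMod 2) :
    SgnEq (grPerm f σ⁻¹ * grMon f α w β * grPerm f σ)
      (grMon f (fun i => α (σ i)) (σ⁻¹ * w * σ) fun i => β (σ i)) := by
  rw [grPerm_mul_grMon, inv_inv]
  exact grMon_mul_grPerm f σ _ _ _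

theorem grCoef_conj (h : IsOddMonic f l) (σ : Equiv.Perm (Fin (N + 1))) {α : Fin (N + 1) → ℕ}
    (hα : ∀ i, α i < l) (w : Equiv.Perm (Fin (N + 1))) (β : Fin (N + 1) → ZMod 2)
    (z : GrSergeev (N + 1) f) :
    grCoef h (fun i => α (σ i)) (σ⁻¹ * w * σ) (fun i => β (σ i))
        (grPerm f σ⁻¹ * z * grPerm f σ) •
        grMon f (fun i => α (σ i)) (σ⁻¹ * w * σ) (fun i => β (σ i)) =
      grCoef h α w β z • (grPerm f σ⁻¹ * grMon f α w β * grPerm f σ) := by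
  refine grCoef_smul_of_monomial_map h
    (φ := LinearMap.mulRight R (grPerm f σ) ∘ₗ LinearMap.mulLeft R (grPerm f σ⁻¹))
    (π := fun t => ((fun i => t.1 (σ i)), σ⁻¹ * t.2.1 * σ, fun i => t.2.2 (σ i))) ?_
    (fun t ht i => ht _) (fun t => grPerm_conj_grMon f σ _ _ _) (α, w, β) hα z
  have hs : ∀ {X : Type} {a b : Fin (N + 1) → X},
      (fun i => a (σ i)) = (fun i => b (σ i)) → a = b := by
    intro X a b hab
    funext i
    simpa using congrFun hab (σ⁻¹ i)
  rintro ⟨α, w, β⟩ ⟨α', w', β'⟩ hh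
  simp only [Prod.mk.injEq] at hh
  obtain ⟨h1, h2, h3⟩ := hh
  rw [hs h1, hs h3, mul_left_cancel (mul_right_cancel h2)]

/-- The part of an element spanned by the monomials `x^α w c^β` with fixed `w` and `β`. -/
noncomputable def grPart (h : IsOddMonic f l) (w : Equiv.Perm (Fin (N + 1)))
    (β : Fin (N + 1) → ZMod 2) : GrSergeev (N + 1) f →ₗ[R] GrSergeev (N + 1) f :=
  (grBasis h).constr R fun t => if t.2.1 = w ∧ t.2.2 = β then grBasis h t else 0

theorem grPart_grMon (h : IsOddMonic f l) (w : Equiv.Perm (Fin (N + 1)))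
    (β : Fin (N + 1) → ZMod 2) (α' : Fin (N + 1) → ℕ) (w' : Equiv.Perm (Fin (N + 1)))
    (β' : Fin (N + 1) → ZMod 2) :
    grPart h w β (grMon f α' w' β') = if w' = w ∧ β' = β then grMon f α' w' β' else 0 := by
  by_cases hα : ∀ i, α' i < l
  · have e := grBasis_apply h (fun i => ⟨α' i, hα i⟩, w', β')
    change _ = grMon f α' w' β' at e
    rw [← e, grPart, Module.Basis.constr_basis]
  · push Not at hα
    obtain ⟨i, hi⟩ := hα
    rw [grMon_eq_zero h.monic h.natDegree_eq h.one_le hi, map_zero, ite_self]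

theorem grCoef_grPart (h : IsOddMonic f l) {α : Fin (N + 1) → ℕ} (hα : ∀ i, α i < l)
    (w : Equiv.Perm (Fin (N + 1))) (β : Fin (N + 1) → ZMod 2) (z : GrSergeev (N + 1) f) :
    grCoef h α w β (grPart h w β z) = grCoef h α w β z := by
  have key : grCoef h α w β ∘ₗ grPart h w β = grCoef h α w β := by
    refine gr_hom_ext h fun α' w' β' _ => ?_
    rw [LinearMap.comp_apply, grPart_grMon]
    split_ifs with h1
    · rfl
    · rw [map_zero, grCoef_grMon h hα, if_neg fun h2 => h1 h2.2]
  exact LinearMap.congr_fun key z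

theorem grPart_grX_mul (h : IsOddMonic f l) (w : Equiv.Perm (Fin (N + 1)))
    (β : Fin (N + 1) → ZMod 2) (j : Fin (N + 1)) (z : GrSergeev (N + 1) f) :
    grPart h w β (grX f j * z) = grX f j * grPart h w β z := by
  have key : grPart h w β ∘ₗ LinearMap.mulLeft R (grX f j) =
      LinearMap.mulLeft R (grX f j) ∘ₗ grPart h w β := by
    refine gr_hom_ext h fun α' w' β' _ => ?_
    simp only [LinearMap.comp_apply, LinearMap.mulLeft_apply, grX_mul_grMon, grPart_grMon]
    split_ifs
    · rw [grX_mul_grMon]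
    · rw [mul_zero]
  exact LinearMap.congr_fun key z

theorem grPart_mul_grX (h : IsOddMonic f l) (w : Equiv.Perm (Fin (N + 1)))
    (β : Fin (N + 1) → ZMod 2) (j : Fin (N + 1)) (z : GrSergeev (N + 1) f) :
    grPart h w β (z * grX f j) = (-1) ^ (β j).val * (grX f (w j) * grPart h w β z) := by
  have key : grPart h w β ∘ₗ LinearMap.mulRight R (grX f j) =
      LinearMap.mulLeft R ((-1) ^ (β j).val * grX f (w j)) ∘ₗ grPart h w β := by
    refine gr_hom_ext h fun α' w' β' _ => ?_
    have hs : ∀ (k : ℕ) (y : GrSergeev (N + 1) f),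
        grPart h w β ((-1) ^ k * y) = (-1) ^ k * grPart h w β y := by
      intro k y
      rcases neg_one_pow_eq_or (GrSergeev (N + 1) f) k with e | e <;> simp [e]
    simp only [LinearMap.comp_apply, LinearMap.mulLeft_apply, LinearMap.mulRight_apply,
      grMon_mul_grX, hs, grPart_grMon]
    split_ifs with h1
    · obtain ⟨rfl, rfl⟩ := h1
      rw [mul_assoc, grX_mul_grMon]
    · rw [mul_zero, mul_zero]
  rw [← mul_assoc]
  exact LinearMap.congr_fun key z

theorem grCoef_grX_mul (h : IsOddMonic f l) {α : Fin (N + 1) → ℕ} {j : Fin (N + 1)}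
    (hα : ∀ i, (α + Pi.single j 1 : Fin (N + 1) → ℕ) i < l) (w : Equiv.Perm (Fin (N + 1)))
    (β : Fin (N + 1) → ZMod 2) (z : GrSergeev (N + 1) f) :
    grCoef h (α + Pi.single j 1) w β (grX f j * z) = grCoef h α w β z := by
  have hα' : ∀ i, α i < l := fun i => lt_of_le_of_lt (Nat.le_add_right _ _) (hα i)
  have key : grCoef h (α + Pi.single j 1) w β ∘ₗ LinearMap.mulLeft R (grX f j) =
      grCoef h α w β := by
    refine gr_hom_ext h fun α' w' β' _ => ?_
    rw [LinearMap.comp_apply, LinearMap.mulLeft_apply, grX_mul_grMon, grCoef_grMon h hα,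
      grCoef_grMon h hα']
    refine if_congr ?_ rfl rfl
    rw [add_left_inj]
  exact LinearMap.congr_fun key z

theorem grCoef_grX_mul_eq_zero (h : IsOddMonic f l) {α : Fin (N + 1) → ℕ} {j : Fin (N + 1)}
    (hα : ∀ i, α i < l) (hj : α j = 0) (w : Equiv.Perm (Fin (N + 1)))
    (β : Fin (N + 1) → ZMod 2) (z : GrSergeev (N + 1) f) :
    grCoef h α w β (grX f j * z) = 0 := by
  have key : grCoef h α w β ∘ₗ LinearMap.mulLeft R (grX f j) = 0 := by
    refine gr_hom_ext h fun α' w' β' _ => ?_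
    rw [LinearMap.comp_apply, LinearMap.mulLeft_apply, grX_mul_grMon, grCoef_grMon h hα, if_neg]
    · rfl
    · rintro ⟨rfl, -, -⟩
      simp at hj
  exact LinearMap.congr_fun key z

end Coefficients

/-! ### Elements commuting with the polynomial generators. -/

section Centralizer

variable {R : Type*} [CommRing R] {N : ℕ} {f : Polynomial R} {l : ℕ}

/-- Left and right multiplication by x_j both preserve the part with fixed w and β, so commutation
can be read on this part alone. -/
theorem grX_mul_grPart (h : IsOddMonic f l) {z : GrSergeev (N + 1) f}
    (hx : ∀ j, grX f j * z = z * grX f j) (w : Equiv.Perm (Fin (N + 1)))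
    (β : Fin (N + 1) → ZMod 2) (j : Fin (N + 1)) :
    grX f j * grPart h w β z = (-1) ^ (β j).val * (grX f (w j) * grPart h w β z) := by
  rw [← grPart_grX_mul, hx, grPart_mul_grX]

theorem list_sum_zmod_val (A : List (Fin (N + 1))) (β : Fin (N + 1) → ZMod 2) :
    (((A.map fun i => (β i).val).sum : ℕ) : ZMod 2) = (A.map β).sum := by
  induction A with
  | nil => simp
  | cons a A ih => simp [ih]

section Cycle

variable {A : List (Fin (N + 1))} {w : Equiv.Perm (Fin (N + 1))} {z : GrSergeev (N + 1) f}

/-- Transporting x_i times the (w, β)-part around a cycle on which β is odd gives its own negative,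
hence zero. If α_i < l - 1, the coefficient at α is a coefficient of this product. -/
theorem grCoef_eq_zero_of_odd (h : IsOddMonic f l) (h2 : ∀ a : R, 2 * a = 0 → a = 0)
    (hn : A.Nodup) (hw : ∀ i ∈ A, w i = A.formPerm i) (hx : ∀ j, grX f j * z = z * grX f j)
    {β : Fin (N + 1) → ZMod 2} (hβ : (A.map β).sum = 1) {α : Fin (N + 1) → ℕ}
    (hα : ∀ i, α i < l) {i : Fin (N + 1)} (hi : i ∈ A) (hil : α i ≠ l - 1) :
    grCoef h α w β z = 0 := by
  have h1 : grX f i * grPart h w β z = 0 := by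
    refine gr_two_torsion_free h h2 (eq_neg_of_formPerm hn (g := fun j => grX f j * grPart h w β z)
      (s := fun j => (β j).val) (fun j hj => ?_) ?_ hi)
    · rw [← hw j hj]
      exact grX_mul_grPart h hx w β j
    · rw [← ZMod.natCast_eq_one_iff_odd, list_sum_zmod_val, hβ]
  have h3 : ∀ k, (α + Pi.single i 1 : Fin (N + 1) → ℕ) k < l := by
    intro k
    have := hα k
    by_cases hk : k = i
    · subst hk
      simp only [Pi.add_apply, Pi.single_eq_same]
      omega
    · simpa [hk] using this
  rw [← grCoef_grPart h hα, ← grCoef_grX_mul h h3, h1, map_zero]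

theorem grX_mul_grPart_eq (h : IsOddMonic f l) (hn : A.Nodup)
    (hw : ∀ i ∈ A, w i = A.formPerm i) (hx : ∀ j, grX f j * z = z * grX f j)
    {i j : Fin (N + 1)} (hi : i ∈ A) (hj : j ∈ A) :
    grX f i * grPart h w 0 z = grX f j * grPart h w 0 z := by
  refine eq_of_formPerm hn (g := fun j => grX f j * grPart h w 0 z) (fun k hk => ?_) hi hj
  rw [← hw k hk]
  simpa using grX_mul_grPart h hx w 0 k

/-- All x_i with i in one cycle act alike on the part with β = 0. Comparing coefficients at δ + e_i
+ e_j moves one unit of exponent from i to j; this exponent must still be reduced. -/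
theorem grCoef_add_single_eq (h : IsOddMonic f l) (hn : A.Nodup)
    (hw : ∀ i ∈ A, w i = A.formPerm i) (hx : ∀ j, grX f j * z = z * grX f j)
    {i j : Fin (N + 1)} (hi : i ∈ A) (hj : j ∈ A) {δ : Fin (N + 1) → ℕ}
    (hδ : ∀ k, (δ + Pi.single i 1 + Pi.single j 1 : Fin (N + 1) → ℕ) k < l) :
    grCoef h (δ + Pi.single i 1) w 0 z = grCoef h (δ + Pi.single j 1) w 0 z := by
  have e : δ + Pi.single i 1 + Pi.single j 1 = δ + Pi.single j 1 + Pi.single i 1 :=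
    add_right_comm _ _ _
  have h1 : ∀ k, (δ + Pi.single i 1 : Fin (N + 1) → ℕ) k < l := fun k =>
    lt_of_le_of_lt (Nat.le_add_right _ _) (hδ k)
  rw [e] at hδ
  have h2 : ∀ k, (δ + Pi.single j 1 : Fin (N + 1) → ℕ) k < l := fun k =>
    lt_of_le_of_lt (Nat.le_add_right _ _) (hδ k)
  rw [← grCoef_grPart h h1, ← grCoef_grPart h h2, ← grCoef_grX_mul h hδ,
    grX_mul_grPart_eq h hn hw hx hi hj, ← e, grCoef_grX_mul]
  rwa [e]

theorem exists_lt_of_sum_lt {α : Fin (N + 1) → ℕ} {m : ℕ} (hn : A.Nodup) {i : Fin (N + 1)}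
    (hi : i ∈ A) (hs : ∑ i ∈ A.toFinset, α i < (A.length - 1) * m) :
    ∃ j ∈ A, j ≠ i ∧ α j < m := by
  by_contra hcon
  push Not at hcon
  have h1 : ∑ k ∈ A.toFinset.erase i, m ≤ ∑ k ∈ A.toFinset.erase i, α k :=
    Finset.sum_le_sum fun k hk => hcon k (by simpa using (Finset.mem_erase.1 hk).2)
      (Finset.mem_erase.1 hk).1
  rw [Finset.sum_const, smul_eq_mul, Finset.card_erase_of_mem (by simpa using hi),
    List.toFinset_card_of_nodup hn] at h1
  have h2 := Finset.sum_le_sum_of_subset (f := α) (Finset.erase_subset i A.toFinset)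
  omega

/-- Below degree (a-1)(l-1) there is always room at some j ≠ i of the cycle. Units of exponent are
moved away from i until its exponent is zero. -/
theorem grCoef_eq_zero_of_lt (h : IsOddMonic f l) (hn : A.Nodup)
    (hw : ∀ i ∈ A, w i = A.formPerm i) (hx : ∀ j, grX f j * z = z * grX f j)
    {α : Fin (N + 1) → ℕ} (hα : ∀ i, α i < l)
    (hs : ∑ i ∈ A.toFinset, α i < (A.length - 1) * (l - 1)) : grCoef h α w 0 z = 0 := by
  classical
  obtain ⟨i, hi⟩ : ∃ i, i ∈ A := by
    rcases A with _ | ⟨a, A⟩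
    · simp at hs
    · exact ⟨a, by simp⟩
  induction hk : α i generalizing α with
  | zero =>
    -- The coefficient of z at α is that of x_j z, and so of x_i z, at α + e_j. Every term of x_i z
    -- contains x_i, but this exponent vanishes at i.
    obtain ⟨j, hj, hji, hjl⟩ := exists_lt_of_sum_lt hn hi hs
    have h3 : ∀ k, (α + Pi.single j 1 : Fin (N + 1) → ℕ) k < l := by
      intro k
      have := hα k
      by_cases hk : k = j
      · subst hk
        simp only [Pi.add_apply, Pi.single_eq_same]
        omega
      · simpa [hk] using this
    rw [← grCoef_grPart h hα, ← grCoef_grX_mul h h3, grX_mul_grPart_eq h hn hw hx hj hi]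
    exact grCoef_grX_mul_eq_zero h h3 (by simp [hji.symm, hk]) _ _ _
  | succ m ih =>
    obtain ⟨j, hj, hji, hjl⟩ := exists_lt_of_sum_lt hn hi hs
    obtain ⟨δ, rfl⟩ : ∃ δ : Fin (N + 1) → ℕ, α = δ + Pi.single i 1 :=
      ⟨α - Pi.single i 1, by
        funext k
        by_cases hk' : k = i
        · subst hk'; simp [hk]
        · simp [hk']⟩
    have h3 : ∀ k, (δ + Pi.single i 1 + Pi.single j 1 : Fin (N + 1) → ℕ) k < l := by
      intro k
      have := hα k
      by_cases hk : k = j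
      · subst hk
        simp only [Pi.add_apply, Pi.single_eq_same] at hjl ⊢
        omega
      · simpa [hk] using this
    have h4 : ∀ k, (δ + Pi.single j 1 : Fin (N + 1) → ℕ) k < l := fun k => by
      have := h3 k
      simp only [Pi.add_apply] at this ⊢
      omega
    rw [grCoef_add_single_eq h hn hw hx hi hj h3]
    refine ih h4 (lt_of_eq_of_lt ?_ hs) (by simpa [hji.symm] using hk)
    simp only [Pi.add_apply, Finset.sum_add_distrib, Finset.sum_pi_single',
      List.mem_toFinset, hi, hj, if_true]

end Cycle

theorem eq_of_mem_of_nodup_flatten {ι : Type*} {Ls : List (List ι)} (h : Ls.flatten.Nodup)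
    {A B : List ι} (hA : A ∈ Ls) (hB : B ∈ Ls) {i : ι} (hiA : i ∈ A) (hiB : i ∈ B) : A = B := by
  have : Std.Symm (List.Disjoint (α := ι)) := ⟨fun _ _ h => h.symm⟩
  by_contra hAB
  exact (List.nodup_flatten.1 h).2.forall hA hB hAB hiA hiB

/-- The lists in `Ls` are the cycles of `w`. -/
structure IsCycleFamily {n : ℕ} (Ls : List (List (Fin n))) (w : Equiv.Perm (Fin n)) : Prop where
  nodup : Ls.flatten.Nodup
  cover : ∀ i, i ∈ Ls.flatten
  apply_eq : ∀ A ∈ Ls, ∀ i ∈ A, w i = A.formPerm i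

/-- Units moved within cycles connect any two reduced exponents with equal degree on each cycle. So
the part with β = 0 is a combination of truncated complete homogeneous polynomials in the variables
of the cycles. -/
theorem grCoef_eq_of_sum_eq (h : IsOddMonic f l) {Ls : List (List (Fin (N + 1)))}
    {w : Equiv.Perm (Fin (N + 1))} (hL : IsCycleFamily Ls w) {z : GrSergeev (N + 1) f}
    (hx : ∀ j, grX f j * z = z * grX f j) {α α' : Fin (N + 1) → ℕ} (hα : ∀ i, α i < l)
    (hα' : ∀ i, α' i < l) (hs : ∀ A ∈ Ls, ∑ i ∈ A.toFinset, α i = ∑ i ∈ A.toFinset, α' i) :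
    grCoef h α w 0 z = grCoef h α' w 0 z := by
  -- The truncated differences measure the excess of α over α'; a move from an index with excess to
  -- one with deficit in the same cycle lowers it.
  induction hk : ∑ i, (α i - α' i) using Nat.strong_induction_on generalizing α with
  | _ m ih =>
    subst hk
    have hcov : ∀ i, ∃ A ∈ Ls, i ∈ A := fun i => by simpa using hL.cover i
    by_cases hle : ∃ i, α' i < α i
    · obtain ⟨i, hi⟩ := hle
      obtain ⟨A, hA, hiA⟩ := hcov i
      have hn : A.Nodup := (List.nodup_flatten.1 hL.nodup).1 A hA
      obtain ⟨j, hjA, hj⟩ : ∃ j ∈ A, α j < α' j := by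
        by_contra hcon
        push Not at hcon
        have : ∑ k ∈ A.toFinset, α' k < ∑ k ∈ A.toFinset, α k :=
          Finset.sum_lt_sum (fun k hk => hcon k (by simpa using hk)) ⟨i, by simpa using hiA, hi⟩
        exact absurd (hs A hA) this.ne'
      have hji : j ≠ i := by
        rintro rfl
        omega
      obtain ⟨δ, rfl⟩ : ∃ δ : Fin (N + 1) → ℕ, α = δ + Pi.single i 1 :=
        ⟨α - Pi.single i 1, by
          funext k
          by_cases hk' : k = i
          · subst hk'; simp only [Pi.add_apply, Pi.sub_apply, Pi.single_eq_same]; omega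
          · simp [hk']⟩
      have h3 : ∀ k, (δ + Pi.single i 1 + Pi.single j 1 : Fin (N + 1) → ℕ) k < l := by
        intro k
        have := hα k
        by_cases hk : k = j
        · subst hk
          have := hα' k
          simp only [Pi.add_apply, Pi.single_eq_same] at hj ⊢
          omega
        · simpa [hk] using this
      have h4 : ∀ k, (δ + Pi.single j 1 : Fin (N + 1) → ℕ) k < l := fun k => by
        have := h3 k
        simp only [Pi.add_apply] at this ⊢
        omega
      rw [grCoef_add_single_eq h hn (hL.apply_eq A hA) hx hiA hjA h3]
      refine ih _ ?_ h4 (fun B hB => ?_) rfl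
      · refine Finset.sum_lt_sum (fun k _ => ?_) ⟨i, Finset.mem_univ i, ?_⟩
        · by_cases hk : k = j
          · subst hk
            simp only [Pi.add_apply, Pi.single_eq_same, Pi.single_eq_of_ne hji] at hj ⊢
            omega
          · simp only [Pi.add_apply, Pi.single_eq_of_ne hk]
            omega
        · simp only [Pi.add_apply, Pi.single_eq_same, Pi.single_eq_of_ne hji.symm] at hi ⊢
          omega
      · rw [← hs B hB]
        have hij : i ∈ B ↔ j ∈ B := by
          by_cases hAB : A = B
          · subst hAB
            exact ⟨fun _ => hjA, fun _ => hiA⟩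
          · exact ⟨fun h' => (hAB (eq_of_mem_of_nodup_flatten hL.nodup hA hB hiA h')).elim,
              fun h' => (hAB (eq_of_mem_of_nodup_flatten hL.nodup hA hB hjA h')).elim⟩
        simp only [Pi.add_apply, Finset.sum_add_distrib, Finset.sum_pi_single',
          List.mem_toFinset, hij]
    · push Not at hle
      have : α = α' := by
        funext i
        obtain ⟨A, hA, hiA⟩ := hcov i
        exact (Finset.sum_eq_sum_iff_of_le fun k _ => hle k).1 (hs A hA) i (by simpa using hiA)
      rw [this]

end Centralizer

/-! ### Products of Clifford generators over a cycle. -/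

namespace IsClifford

variable {A : Type*} [Ring A] {n : ℕ} {C : Fin n → A}

theorem mul_list_prod (hC : IsClifford C) {j : Fin n} {L : List (Fin n)} (hj : j ∉ L) :
    C j * (L.map C).prod = (-1) ^ L.length * ((L.map C).prod * C j) := by
  induction L with
  | nil => simp
  | cons a L ih =>
    simp only [List.mem_cons, not_or] at hj
    rw [List.map_cons, List.prod_cons, ← mul_assoc, hC.anti j a hj.1, neg_mul, mul_assoc, ih hj.2,
      List.length_cons, pow_succ', ← mul_assoc (C a),
      ((Commute.neg_one_right (C a)).pow_right L.length).eq]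
    simp only [mul_assoc, neg_mul, one_mul]

/-- The first generator passes each of the others once. -/
theorem list_prod_rotate (hC : IsClifford C) {L : List (Fin n)} (hn : L.Nodup) :
    ((L.rotate 1).map C).prod = (-1) ^ (L.length - 1) * (L.map C).prod := by
  rcases L with _ | ⟨a, L⟩
  · simp
  · rw [List.rotate_cons_succ, List.rotate_zero, List.map_append, List.prod_append, List.map_singleton,
      List.prod_singleton, List.map_cons, List.prod_cons, hC.mul_list_prod (List.nodup_cons.1 hn).1, ← mul_assoc, ← pow_add]
    simp [← two_mul]

theorem list_prod_sgnEq (hC : IsClifford C) {L : List (Fin n)} (hn : L.Nodup) :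
    SgnEq (L.map C).prod (cMon C fun i => if i ∈ L then 1 else 0) := by
  induction L with
  | nil =>
    refine SgnEq.of_eq ?_
    rw [List.map_nil, List.prod_nil, ← cMon_zero C]
    simp only [List.not_mem_nil, if_false]
    rfl
  | cons a L ih =>
    rw [List.map_cons, List.prod_cons]
    refine ((ih (List.nodup_cons.1 hn).2).mul_left _).trans ((hC.mul_cMon_sgnEq a _).trans ?_)
    refine SgnEq.of_eq (congrArg (cMon C) ?_)
    funext i
    by_cases hi : i = a
    · subst hi
      simp [(List.nodup_cons.1 hn).1]
    · simp [hi]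

theorem mul_cMon_of_ne (hC : IsClifford C) (j : Fin n) (γ : Fin n → ZMod 2) :
    C j * cMon C γ = (-1) ^ (∑ k, (if k = j then 0 else 1) * (γ k).val) * cMon C γ * C j :=
  mul_xMon_of_sign (X := C) (Y := C) (y := C j) (fun k => if k = j then 0 else 1) (fun k => by
    split_ifs with h
    · rw [h, pow_zero, one_mul]
    · rw [pow_one, neg_one_mul, neg_mul, hC.anti j k fun e => h e.symm]) fun k => (γ k).val

theorem cMon_mul_cMon_of_disjoint (hC : IsClifford C) {γ ρ : Fin n → ZMod 2}
    (hd : ∀ i, γ i = 0 ∨ ρ i = 0) :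
    cMon C ρ * cMon C γ =
      (-1) ^ ((∑ i, (γ i).val) * ∑ i, (ρ i).val) * (cMon C γ * cMon C ρ) := by
  have h1 : ∀ j, ρ j ≠ 0 → C j * cMon C γ = (-1) ^ (∑ i, (γ i).val) * cMon C γ * C j := by
    intro j hj
    rw [hC.mul_cMon_of_ne]
    congr 3
    refine Finset.sum_congr rfl fun k _ => ?_
    split_ifs with hk
    · subst hk
      rw [(hd k).resolve_right hj]
      simp
    · rw [one_mul]
  have h2 : ∀ j, ((-1 : A) ^ (∑ i, (γ i).val) * C j) ^ (ρ j).val * cMon C γ =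
      cMon C γ * C j ^ (ρ j).val := by
    intro j
    by_cases hj : ρ j = 0
    · simp [hj]
    · have : (ρ j).val = 1 := by
        have := ZMod.val_lt (ρ j)
        have := (ZMod.val_ne_zero (ρ j)).2 hj
        omega
      rw [this, pow_one, pow_one, mul_assoc, h1 j hj, ← mul_assoc, ← mul_assoc, ← pow_add,
        ← two_mul, pow_mul]
      simp
  have h3 := mul_prod_ofFn (y := cMon C γ) (Z := fun j => C j ^ (ρ j).val)
    (Z' := fun j => ((-1 : A) ^ (∑ i, (γ i).val) * C j) ^ (ρ j).val) fun j => (h2 j).symm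
  have h4 := xMon_neg_one_pow_mul (fun _ => ∑ i, (γ i).val) C fun j => (ρ j).val
  rw [← Finset.mul_sum] at h4
  change cMon C γ * cMon C ρ = xMon (fun j => (-1 : A) ^ (∑ i, (γ i).val) * C j)
    (fun j => (ρ j).val) * cMon C γ at h3
  rw [h3, h4, ← mul_assoc, ← mul_assoc, ← pow_add, ← two_mul, pow_mul]
  simp only [even_two, Even.neg_pow, one_pow, one_mul]
  rfl

end IsClifford

theorem List.map_formPerm_eq_rotate {ι : Type*} [DecidableEq ι] {L : List ι} (hn : L.Nodup) :
    L.map L.formPerm = L.rotate 1 := by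
  refine List.ext_getElem (by simp) fun k h1 h2 => ?_
  rw [List.getElem_map, List.getElem_rotate, List.formPerm_apply_getElem L hn]

theorem List.formPerm_inv_mem {ι : Type*} [DecidableEq ι] {L : List ι} {i : ι} (hi : i ∈ L) :
    L.formPerm⁻¹ i ∈ L := by
  rw [← List.formPerm_reverse]
  exact List.mem_reverse.1 (List.formPerm_apply_mem_of_mem (List.mem_reverse.2 hi))

theorem apply_mem_iff_of_formPerm {ι : Type*} [DecidableEq ι] {L : List ι} {w : Equiv.Perm ι}
    (hw : ∀ i ∈ L, w i = L.formPerm i) (i : ι) : w i ∈ L ↔ i ∈ L := by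
  refine ⟨fun hi => ?_, fun hi => by
    rw [hw i hi]
    exact List.formPerm_apply_mem_of_mem hi⟩
  have h3 := List.formPerm_inv_mem hi
  have h4 : w (L.formPerm⁻¹ (w i)) = w i := by
    rw [hw _ h3]
    simp
  rwa [w.injective h4] at h3

/-! ### Elements commuting with the Clifford generators. -/

section Centralizer

variable {R : Type*} [CommRing R] {N : ℕ} {f : Polynomial R} {l : ℕ}

theorem grC_list_prod_mul_grX (f : Polynomial R) {A : List (Fin (N + 1))} (hn : A.Nodup)
    (j : Fin (N + 1)) :
    (A.map (grC f)).prod * grX f j =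
      (-1) ^ (if j ∈ A then 1 else 0) * grX f j * (A.map (grC f)).prod := by
  induction A with
  | nil => simp
  | cons a A ih =>
    rw [List.map_cons, List.prod_cons, mul_assoc, ih (List.nodup_cons.1 hn).2]
    by_cases hj : j = a
    · subst hj
      rw [if_neg (List.nodup_cons.1 hn).1, if_pos (by simp), pow_zero, one_mul, ← mul_assoc,
        grC_mul_grX_self, pow_one]
      simp only [neg_mul, one_mul, mul_assoc]
    · have hja : grC f a * grX f j = grX f j * grC f a := grC_mul_grX_ne f fun e => hj e.symm
      have hs : ∀ k, grC f a * (-1) ^ k = (-1) ^ k * grC f a := fun k =>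
        ((Commute.neg_one_right (grC f a)).pow_right k).eq
      simp only [List.mem_cons, hj, false_or]
      rw [← mul_assoc, ← mul_assoc, hs, mul_assoc _ (grC f a), hja]
      simp only [mul_assoc]

theorem grC_list_prod_mul_xMon (f : Polynomial R) {A : List (Fin (N + 1))} (hn : A.Nodup)
    (α : Fin (N + 1) → ℕ) :
    (A.map (grC f)).prod * xMon (grX f) α =
      (-1) ^ (∑ i ∈ A.toFinset, α i) * xMon (grX f) α * (A.map (grC f)).prod := by
  rw [mul_xMon_of_sign _ (grC_list_prod_mul_grX f hn)]
  congr 3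
  simp [Finset.sum_ite_mem, ← List.mem_toFinset]

theorem grPerm_mul_list_prod (f : Polynomial R) (w : Equiv.Perm (Fin (N + 1)))
    (A : List (Fin (N + 1))) :
    grPerm f w * (A.map (grC f)).prod = ((A.map w).map (grC f)).prod * grPerm f w := by
  induction A with
  | nil => simp
  | cons a A ih =>
    rw [List.map_cons, List.map_cons, List.map_cons, List.prod_cons, List.prod_cons, ← mul_assoc,
      grPerm_mul_grC, mul_assoc, ih, mul_assoc]

theorem grC_list_prod_mul_grPerm (f : Polynomial R) {A : List (Fin (N + 1))} (hn : A.Nodup)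
    {w : Equiv.Perm (Fin (N + 1))} (hw : ∀ i ∈ A, w i = A.formPerm i) :
    (A.map (grC f)).prod * grPerm f w =
      (-1) ^ (A.length - 1) * (grPerm f w * (A.map (grC f)).prod) := by
  have h : A.map w = A.rotate 1 := by
    rw [← List.map_formPerm_eq_rotate hn]
    exact List.map_congr_left hw
  rw [grPerm_mul_list_prod, h, (isClifford_grC f).list_prod_rotate hn, ← mul_assoc, ← mul_assoc,
    ← pow_add, ← two_mul, pow_mul]
  simp

/-- Every variable of the cycle contributes one sign per exponent. The permutation rotates the list
of generators, which contributes the sign of a cycle of length a. -/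
theorem grC_list_prod_mul_grMon (f : Polynomial R) {A : List (Fin (N + 1))} (hn : A.Nodup)
    {w : Equiv.Perm (Fin (N + 1))} (hw : ∀ i ∈ A, w i = A.formPerm i) (α : Fin (N + 1) → ℕ) :
    (A.map (grC f)).prod * grMon f α w 0 =
      (-1) ^ (∑ i ∈ A.toFinset, α i + (A.length - 1)) *
        (grMon f α w 0 * (A.map (grC f)).prod) := by
  have hs : ∀ k, xMon (grX f) α * (-1) ^ k = (-1) ^ k * xMon (grX f) α := fun k =>
    ((Commute.neg_one_right (xMon (grX f) α)).pow_right k).eq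
  rw [grMon, IsClifford.cMon_zero, mul_one, ← mul_assoc, grC_list_prod_mul_xMon f hn, mul_assoc,
    grC_list_prod_mul_grPerm f hn hw, mul_assoc, ← mul_assoc (xMon _ _), hs, pow_add]
  simp only [mul_assoc]

theorem mul_cMon_of_sign {z : GrSergeev (N + 1) f} {m : ℕ}
    (hc : ∀ j, z * grC f j = (-1) ^ m * grC f j * z) (γ : Fin (N + 1) → ZMod 2) :
    z * cMon (grC f) γ = (-1) ^ (∑ j, m * (γ j).val) * cMon (grC f) γ * z :=
  mul_xMon_of_sign _ hc fun j => (γ j).val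

theorem cMon_mul_comm {z : GrSergeev (N + 1) f} (hc : ∀ j, grC f j * z = z * grC f j)
    (γ : Fin (N + 1) → ZMod 2) : cMon (grC f) γ * z = z * cMon (grC f) γ := by
  rw [mul_cMon_of_sign (m := 0) (fun j => by rw [pow_zero, one_mul, hc]) γ]
  simp

/-- The product of the c_i over the cycle commutes with z but anticommutes with this monomial, so
the coefficient is its own negative. This is the origin of the parity condition on CX-cycles. -/
theorem grCoef_eq_zero_of_odd_add (h : IsOddMonic f l) (h2 : ∀ a : R, 2 * a = 0 → a = 0)
    {A : List (Fin (N + 1))} (hn : A.Nodup) {w : Equiv.Perm (Fin (N + 1))}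
    (hw : ∀ i ∈ A, w i = A.formPerm i) {z : GrSergeev (N + 1) f}
    (hc : ∀ j, grC f j * z = z * grC f j) {α : Fin (N + 1) → ℕ} (hα : ∀ i, α i < l)
    (hodd : Odd (∑ i ∈ A.toFinset, α i + (A.length - 1))) : grCoef h α w 0 z = 0 := by
  classical
  set γ : Fin (N + 1) → ZMod 2 := fun i => if i ∈ A then 1 else 0 with hγ
  have hγw : (fun i => γ (w i)) = γ := by
    funext i
    simp only [hγ, apply_mem_iff_of_formPerm hw]
  have e1 := cMon_mul_grCoef h γ hα w 0 z
  have e2 := grCoef_mul_cMon h γ hα w 0 z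
  rw [hγw, add_zero, cMon_mul_comm hc] at e1
  rw [zero_add, e1] at e2
  have h3 : cMon (grC f) γ * grMon f α w 0 = -(grMon f α w 0 * cMon (grC f) γ) := by
    have h4 := grC_list_prod_mul_grMon f hn hw α
    rw [hodd.neg_one_pow, neg_one_mul] at h4
    rcases (isClifford_grC f).list_prod_sgnEq hn with h5 | h5 <;> rw [h5] at h4
    · exact h4
    · rw [neg_mul, mul_neg, neg_neg] at h4
      rw [← h4, neg_neg]
  rw [h3, smul_neg] at e2
  have h5 : grCoef h α w 0 z • (grMon f α w 0 * cMon (grC f) γ) = 0 :=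
    gr_two_torsion_free h h2 e2.symm
  exact smul_grMon_eq_zero h hα (grMon_mul_cMon f γ α w 0) h5

/-- Conjugating a monomial by a cycle amounts to conjugating it by the Clifford generators
supported on that cycle. -/
theorem cMon_mul_grMon_eq_conj (f : Polynomial R) {A : List (Fin (N + 1))}
    {w : Equiv.Perm (Fin (N + 1))} (hw : ∀ i ∈ A, w i = A.formPerm i) {α : Fin (N + 1) → ℕ}
    (hαe : ∀ i ∈ A, Even (α i)) (hαc : ∀ i, α (A.formPerm i) = α i)
    {γ ρ : Fin (N + 1) → ZMod 2} (hγ : ∀ i, i ∉ A → γ i = 0) (hρ : ∀ i ∈ A, ρ i = 0) :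
    cMon (grC f) γ * grMon f α w (γ + ρ) = (-1) ^ ((∑ i, (γ i).val) * ∑ i, (ρ i).val) *
      (grPerm f A.formPerm⁻¹ * grMon f α w (γ + ρ) * grPerm f A.formPerm * cMon (grC f) γ) := by
  set σ := A.formPerm with hσ
  have hcomm : ∀ (v : Equiv.Perm (Fin (N + 1))) (δ : Fin (N + 1) → ZMod 2),
      (∀ i, δ i ≠ 0 → v i = i) → grPerm f v * cMon (grC f) δ = cMon (grC f) δ * grPerm f v := by
    intro v δ hv
    refine mul_prod_ofFn fun j => ?_
    by_cases hj : δ j = 0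
    · simp [hj]
    · have : SemiconjBy (grPerm f v) (grC f j) (grC f j) := by
        have := grPerm_mul_grC f v j
        rwa [hv j hj] at this
      exact (this.pow_right _).eq
  have hfix : ∀ i, i ∉ A → σ i = i := fun i hi => List.formPerm_apply_of_notMem hi
  have hGX : cMon (grC f) γ * xMon (grX f) α = xMon (grX f) α * cMon (grC f) γ := by
    rw [cMon_mul_xMon]
    have : Even (∑ j, (γ j).val * α j) := by
      refine Finset.even_sum _ fun j _ => ?_
      by_cases hj : j ∈ A
      · exact (hαe j hj).mul_left _
      · simp [hγ j hj]
    rw [this.neg_one_pow, one_mul]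
  have hSX : grPerm f σ⁻¹ * xMon (grX f) α = xMon (grX f) α * grPerm f σ⁻¹ := by
    rw [grPerm_mul_xMon]
    congr 2
    funext i
    rw [inv_inv, hαc]
  have hSP : grPerm f σ * cMon (grC f) ρ = cMon (grC f) ρ * grPerm f σ :=
    hcomm σ ρ fun i hi => hfix i fun hiA => hi (hρ i hiA)
  have hPG := (isClifford_grC f).cMon_mul_cMon_of_disjoint (γ := γ) (ρ := ρ) fun i => by
    by_cases hi : i ∈ A
    · exact Or.inr (hρ i hi)
    · exact Or.inl (hγ i hi)
  -- The permutation w σ⁻¹ fixes A pointwise, so it commutes with the Clifford monomial supported on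
  -- A; also w and σ commute.
  have hGW : cMon (grC f) γ * grPerm f w =
      grPerm f σ⁻¹ * grPerm f w * cMon (grC f) γ * grPerm f σ := by
    have h1 : grPerm f (w * σ⁻¹) * cMon (grC f) γ = cMon (grC f) γ * grPerm f (w * σ⁻¹) := by
      refine hcomm _ γ fun i hi => ?_
      have hiA : i ∈ A := by
        by_contra hiA
        exact hi (hγ i hiA)
      have h3 : σ⁻¹ i ∈ A := List.formPerm_inv_mem hiA
      rw [Equiv.Perm.mul_apply, hw _ h3]
      simp [hσ]
    have hWS : w * σ⁻¹ = σ⁻¹ * w := by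
      have : w * σ = σ * w := by
        ext i
        rw [Equiv.Perm.mul_apply, Equiv.Perm.mul_apply]
        by_cases hi : i ∈ A
        · rw [hw i hi, hw _ (List.formPerm_apply_mem_of_mem hi)]
        · rw [hfix i hi, hfix _ fun hwi => hi ((apply_mem_iff_of_formPerm hw i).1 hwi)]
      rw [mul_inv_eq_iff_eq_mul, mul_assoc, this, inv_mul_cancel_left]
    rw [← grPerm_mul, ← hWS, h1, mul_assoc, ← grPerm_mul, inv_mul_cancel_right]
  have key : cMon (grC f) γ * (xMon (grX f) α * grPerm f w *
      (cMon (grC f) γ * cMon (grC f) ρ)) = (-1) ^ ((∑ i, (γ i).val) * ∑ i, (ρ i).val) *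
      (grPerm f σ⁻¹ * (xMon (grX f) α * grPerm f w * (cMon (grC f) γ * cMon (grC f) ρ)) *
        grPerm f σ * cMon (grC f) γ) := by
    have hs : ∀ (k : ℕ) (y : GrSergeev (N + 1) f), y * (-1) ^ k = (-1) ^ k * y := fun k y =>
      ((Commute.neg_one_right y).pow_right k).eq
    have e1 : cMon (grC f) γ * (xMon (grX f) α * grPerm f w *
        (cMon (grC f) γ * cMon (grC f) ρ)) = xMon (grX f) α * (grPerm f σ⁻¹ * grPerm f w *
        cMon (grC f) γ * grPerm f σ) * (cMon (grC f) γ * cMon (grC f) ρ) := by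
      rw [← hGW, ← mul_assoc, ← mul_assoc, ← mul_assoc, hGX]
      simp only [mul_assoc]
    have e2 : grPerm f σ⁻¹ * (xMon (grX f) α * grPerm f w * (cMon (grC f) γ * cMon (grC f) ρ)) *
        grPerm f σ * cMon (grC f) γ = xMon (grX f) α * (grPerm f σ⁻¹ * grPerm f w *
        cMon (grC f) γ * grPerm f σ) * (cMon (grC f) ρ * cMon (grC f) γ) := by
      calc _ = (grPerm f σ⁻¹ * xMon (grX f) α) * grPerm f w * cMon (grC f) γ *
            (cMon (grC f) ρ * grPerm f σ) * cMon (grC f) γ := by simp only [mul_assoc]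
        _ = _ := by
          rw [← hSP, hSX]
          simp only [mul_assoc]
    have hsq : ∀ (k : ℕ) (y : GrSergeev (N + 1) f), y = (-1) ^ k * ((-1) ^ k * y) := fun k y => by
      rw [← mul_assoc, ← pow_add, ← two_mul, pow_mul]
      simp
    rw [e1, e2, hPG, ← mul_assoc (_ * _) ((-1) ^ _), hs, mul_assoc ((-1) ^ _)]
    exact hsq _ _
  have hb : SgnEq (xMon (grX f) α * grPerm f w * (cMon (grC f) γ * cMon (grC f) ρ))
      (grMon f α w (γ + ρ)) := ((isClifford_grC f).cMon_mul_cMon_sgnEq γ ρ).mul_left _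
  rcases hb with hb | hb <;> rw [hb] at key
  · exact key
  · simpa using key

end Centralizer

/-! ### Cycle decompositions as lists. -/

section CycleFamily

open Equiv.Perm

/-- Induction over disjoint products of cycles; a single cycle is listed from a point that it moves.
-/
theorem exists_cycles {n : ℕ} (w : Equiv.Perm (Fin n)) : ∃ Ls : List (List (Fin n)),
    (∀ A ∈ Ls, A ≠ []) ∧ Ls.flatten.Nodup ∧ (∀ i, i ∈ Ls.flatten ↔ i ∈ w.support) ∧
      ∀ A ∈ Ls, ∀ i ∈ A, w i = A.formPerm i := by
  induction w using Equiv.Perm.cycle_induction_on with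
  | base_one => exact ⟨[], by simp⟩
  | base_cycles σ hσ =>
    obtain ⟨x, hx, -⟩ := id hσ
    have hx' : x ∈ σ.support := mem_support.2 hx
    refine ⟨[σ.toList x], ?_, ?_, fun i => ?_, ?_⟩
    · simpa [toList_eq_nil_iff] using hx
    · simpa using nodup_toList σ x
    · rw [List.flatten_singleton, mem_toList_iff]
      refine ⟨fun h => h.1.mem_support_iff.1 h.2, fun hi => ⟨?_, hx'⟩⟩
      exact hσ.sameCycle hx (mem_support.1 hi)
    · intro A hA i hi
      rw [List.mem_singleton.1 hA, formPerm_toList, hσ.cycleOf_eq hx]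
  | induction_disjoint σ τ hd hσ ih1 ih2 =>
    obtain ⟨L1, h1, h2, h3, h4⟩ := ih1
    obtain ⟨L2, h1', h2', h3', h4'⟩ := ih2
    refine ⟨L1 ++ L2, ?_, ?_, fun i => ?_, ?_⟩
    · intro A hA
      rcases List.mem_append.1 hA with hA | hA
      · exact h1 A hA
      · exact h1' A hA
    · rw [List.flatten_append, List.nodup_append']
      refine ⟨h2, h2', fun i hi hi' => ?_⟩
      exact Finset.disjoint_left.1 hd.disjoint_support ((h3 i).1 hi) ((h3' i).1 hi')
    · rw [List.flatten_append, List.mem_append, h3, h3', hd.support_mul, Finset.mem_union]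
    · intro A hA i hi
      rw [Equiv.Perm.mul_apply]
      rcases List.mem_append.1 hA with hA | hA
      · have hi' : i ∈ σ.support := (h3 i).1 (List.mem_flatten.2 ⟨A, hA, hi⟩)
        rw [notMem_support.1 (Finset.disjoint_left.1 hd.disjoint_support hi'), h4 A hA i hi]
      · have hi' : i ∈ τ.support := (h3' i).1 (List.mem_flatten.2 ⟨A, hA, hi⟩)
        rw [notMem_support.1 (Finset.disjoint_right.1 hd.disjoint_support
          (apply_mem_support.2 hi')), h4' A hA i hi]

/-- Fixed points are added as lists of length one, so that the lists cover all indices. -/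
theorem exists_isCycleFamily {n : ℕ} (w : Equiv.Perm (Fin n)) :
    ∃ Ls : List (List (Fin n)), (∀ A ∈ Ls, A ≠ []) ∧ IsCycleFamily Ls w := by
  obtain ⟨Ls, h1, h2, h3, h4⟩ := exists_cycles w
  have hfl : ((w.supportᶜ.toList).map fun i => [i]).flatten = w.supportᶜ.toList := by
    induction w.supportᶜ.toList with
    | nil => rfl
    | cons a L ih => simp [ih]
  refine ⟨Ls ++ (w.supportᶜ.toList).map fun i => [i], ?_, ?_, ?_, ?_⟩
  · intro A hA
    rcases List.mem_append.1 hA with hA | hA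
    · exact h1 A hA
    · obtain ⟨i, -, rfl⟩ := List.mem_map.1 hA
      simp
  · rw [List.flatten_append, hfl, List.nodup_append']
    refine ⟨h2, Finset.nodup_toList _, fun i hi hi' => ?_⟩
    exact (Finset.mem_compl.1 (Finset.mem_toList.1 hi')) ((h3 i).1 hi)
  · intro i
    rw [List.flatten_append, hfl, List.mem_append, h3, Finset.mem_toList, Finset.mem_compl]
    exact em _
  · intro A hA i hi
    rcases List.mem_append.1 hA with hA | hA
    · exact h4 A hA i hi
    · obtain ⟨j, hj, rfl⟩ := List.mem_map.1 hA
      rw [List.mem_singleton.1 hi, List.formPerm_singleton]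
      exact notMem_support.1 (Finset.mem_compl.1 (Finset.mem_toList.1 hj))

/-- A function to `ZMod 2` with vanishing sums over all cycles is a coboundary. -/
theorem IsCycleFamily.exists_eq_add {n : ℕ} {Ls : List (List (Fin n))} {w : Equiv.Perm (Fin n)}
    (hL : IsCycleFamily Ls w) {β : Fin n → ZMod 2} (hβ : ∀ A ∈ Ls, (A.map β).sum = 0) :
    ∃ K : Fin n → ZMod 2, β = fun i => K i + K (w i) := by
  have hcov : ∀ i, ∃ A ∈ Ls, i ∈ A := fun i => by simpa using hL.cover i
  choose A hA hiA using hcov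
  -- K(i) is the partial sum of β along the cycle up to the entry before i. One step adds β(i); at
  -- the return to the first entry the vanishing total sum closes the cycle.
  refine ⟨fun i => (((A i).take ((A i).idxOf i)).map β).sum, funext fun i => ?_⟩
  have hn : (A i).Nodup := (List.nodup_flatten.1 hL.nodup).1 _ (hA i)
  have hwi : w i = (A i).formPerm i := hL.apply_eq _ (hA i) i (hiA i)
  have hAw : A (w i) = A i := by
    refine eq_of_mem_of_nodup_flatten hL.nodup (hA _) (hA i) (hiA _) ?_
    rw [hwi]
    exact List.formPerm_apply_mem_of_mem (hiA i)
  beta_reduce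
  rw [hAw]
  obtain ⟨k, hk, hki⟩ := List.getElem_of_mem (hiA i)
  have hidx : (A i).idxOf i = k := by
    have := hn.idxOf_getElem k hk
    rwa [hki] at this
  have hidx' : (A i).idxOf (w i) = (k + 1) % (A i).length := by
    have : w i = (A i)[(k + 1) % (A i).length]'(Nat.mod_lt _ (by omega)) := by
      rw [hwi, ← List.formPerm_apply_getElem _ hn k hk, hki]
    rw [this]
    exact hn.idxOf_getElem _ _
  have hs : ((A i).take (k + 1)).map β = ((A i).take k).map β ++ [β i] := by
    rw [← List.take_concat_get' _ k hk, List.map_append, List.map_singleton, hki]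
  rw [hidx, hidx']
  rcases Nat.lt_or_ge (k + 1) (A i).length with h | h
  · rw [Nat.mod_eq_of_lt h, hs, List.sum_append, List.sum_singleton, ← add_assoc,
      CharTwo.add_self_eq_zero, zero_add]
  · have hk1 : k + 1 = (A i).length := by omega
    have h0 := hβ _ (hA i)
    rw [← List.take_length (l := A i), ← hk1, hs, List.sum_append, List.sum_singleton] at h0
    rw [← hk1, Nat.mod_self, List.take_zero, List.map_nil, List.sum_nil, add_zero]
    exact (CharTwo.add_eq_zero.1 h0).symm

end CycleFamily

/-! ### Clifford coefficients of central and skew elements. -/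

section Centralizer

variable {R : Type*} [CommRing R] {N : ℕ} {f : Polynomial R} {l : ℕ}

/-- Let c be the Clifford monomial of β on A. Comparing c z with ± z c relates the coefficients at β
and at β∘σ, and `cMon_mul_grMon_eq_conj` turns multiplication by c into conjugation by σ. The parity
n of β outside A enters because c is odd and must cross the outer generators. -/
theorem grCoef_conj_eq (h : IsOddMonic f l) {A : List (Fin (N + 1))} (hn : A.Nodup)
    {w : Equiv.Perm (Fin (N + 1))} (hw : ∀ i ∈ A, w i = A.formPerm i) {z : GrSergeev (N + 1) f}
    {m : ℕ} (hc : ∀ j, z * grC f j = (-1) ^ m * grC f j * z) {α : Fin (N + 1) → ℕ}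
    (hα : ∀ i, α i < l) (hαA : ∀ i ∈ A, α i = l - 1) {β : Fin (N + 1) → ZMod 2}
    (hβ : (A.map β).sum = 1) {n : ℕ} (hn' : ∑ i, (if i ∈ A then 0 else β i) = (n : ZMod 2)) :
    grCoef h α w β z • ((-1) ^ n *
        (grPerm f A.formPerm⁻¹ * grMon f α w β * grPerm f A.formPerm)) =
      grCoef h α w (fun i => β (A.formPerm i)) z •
        ((-1) ^ m * grMon f α w fun i => β (A.formPerm i)) := by
  classical
  set σ := A.formPerm with hσ
  set γ : Fin (N + 1) → ZMod 2 := fun i => if i ∈ A then β i else 0 with hγ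
  set ρ : Fin (N + 1) → ZMod 2 := fun i => if i ∈ A then 0 else β i with hρ
  have hγρ : γ + ρ = β := by
    funext i
    by_cases hi : i ∈ A <;> simp [hγ, hρ, hi]
  have hfix : ∀ i, i ∉ A → σ i = i := fun i hi => List.formPerm_apply_of_notMem hi
  have hσA : ∀ i, σ i ∈ A ↔ i ∈ A := apply_mem_iff_of_formPerm fun i _ => rfl
  have hγodd : Odd (∑ i, (γ i).val) := by
    rw [← ZMod.natCast_eq_one_iff_odd, ← hβ]
    push_cast
    simp only [ZMod.natCast_zmod_val]
    rw [← List.sum_toFinset β hn, hγ, Finset.sum_ite, Finset.sum_const_zero, add_zero]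
    congr 1
    ext i
    simp
  have hρn : (-1 : GrSergeev (N + 1) f) ^ (∑ i, (ρ i).val) = (-1) ^ n := by
    apply neg_one_pow_eq_of_cast
    push_cast
    simp only [ZMod.natCast_zmod_val]
    exact hn'
  have hαc : ∀ i, α (σ i) = α i := by
    intro i
    by_cases hi : i ∈ A
    · rw [hαA i hi, hαA _ ((hσA i).2 hi)]
    · rw [hfix i hi]
  -- Since l is odd, the maximal exponent is even and the Clifford generators of A commute with x^α.
  have hle : Even (l - 1) := by
    obtain ⟨k, hk⟩ := h.odd
    exact ⟨k, by omega⟩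
  have hG := cMon_mul_grMon_eq_conj f hw (α := α) (fun i hi => by rw [hαA i hi]; exact hle) hαc
    (γ := γ) (ρ := ρ) (fun i hi => by simp [hγ, hi]) (fun i hi => by simp [hρ, hi])
  rw [hγρ, pow_mul, hγodd.neg_one_pow, hρn] at hG
  have e1 := cMon_mul_grCoef h γ hα w β z
  have e2 := grCoef_mul_cMon h γ hα w (fun i => β (σ i)) z
  have hidx : (fun i => γ (w i)) + β = (fun i => β (σ i)) + γ := by
    funext i
    simp only [Pi.add_apply, hγ, apply_mem_iff_of_formPerm hw]
    by_cases hi : i ∈ A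
    · simp [hi, hw i hi, hσ]
    · simp [hi, hfix i hi]
  have hz : z * cMon (grC f) γ = (-1) ^ m * (cMon (grC f) γ * z) := by
    rw [mul_cMon_of_sign hc, ← Finset.mul_sum, mul_comm m, pow_mul, hγodd.neg_one_pow, mul_assoc]
  have hsm : ∀ (r : R) (k : ℕ) (a : GrSergeev (N + 1) f),
      r • ((-1) ^ k * a) = (-1) ^ k * (r • a) := fun r k a => by rw [mul_smul_comm]
  have hco : grCoef h α w ((fun i => β (σ i)) + γ) (z * cMon (grC f) γ) •
      grMon f α w ((fun i => β (σ i)) + γ) = (-1) ^ m *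
      (grCoef h α w ((fun i => β (σ i)) + γ) (cMon (grC f) γ * z) •
        grMon f α w ((fun i => β (σ i)) + γ)) := by
    rw [hz]
    rcases neg_one_pow_eq_or (GrSergeev (N + 1) f) m with e | e <;> simp [e]
  -- The Clifford monomial squares to a sign, so it can be cancelled on the right.
  have hcancel : ∀ a b : GrSergeev (N + 1) f,
      a * cMon (grC f) γ = b * cMon (grC f) γ → a = b := by
    intro a b hab
    obtain ⟨k, hk⟩ : ∃ k : ℕ, cMon (grC f) γ * cMon (grC f) γ = (-1) ^ k := by
      have := (isClifford_grC f).cMon_mul_cMon_sgnEq γ γ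
      have e0 : γ + γ = 0 := funext fun i => CharTwo.add_self_eq_zero _
      rw [e0, IsClifford.cMon_zero] at this
      rcases this with e | e
      · exact ⟨0, by rw [e, pow_zero]⟩
      · exact ⟨1, by rw [e, pow_one]⟩
    have h1 : a * cMon (grC f) γ * (cMon (grC f) γ * (-1) ^ k) =
        b * cMon (grC f) γ * (cMon (grC f) γ * (-1) ^ k) := by rw [hab]
    rw [mul_assoc, mul_assoc, ← mul_assoc (cMon _ _), hk, ← pow_add, ← two_mul, pow_mul] at h1
    simpa using h1
  apply hcancel
  have h3 : grCoef h α w (fun i => β (σ i)) z • ((-1) ^ m * grMon f α w fun i => β (σ i)) *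
      cMon (grC f) γ = grCoef h α w β z • (cMon (grC f) γ * grMon f α w β) := by
    rw [← e1, hidx, smul_mul_assoc, mul_assoc, hsm, ← e2, hco, ← mul_assoc, ← pow_add, ← two_mul,
      pow_mul]
    simp
  rw [h3, hG, smul_mul_assoc, mul_assoc]

/-- In the centre the coefficients of monomials that are odd on some cycle vanish. -/
theorem grCoef_eq_zero_of_odd_cycle (h : IsOddMonic f l) (h2 : ∀ a : R, 2 * a = 0 → a = 0)
    {A : List (Fin (N + 1))} (hn : A.Nodup) {w : Equiv.Perm (Fin (N + 1))}
    (hw : ∀ i ∈ A, w i = A.formPerm i) {z : GrSergeev (N + 1) f}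
    (hx : ∀ j, grX f j * z = z * grX f j) (hc : ∀ j, grC f j * z = z * grC f j)
    (hp : grPerm f A.formPerm * z = z * grPerm f A.formPerm) {α : Fin (N + 1) → ℕ}
    (hα : ∀ i, α i < l) {β : Fin (N + 1) → ZMod 2} (hβ : (A.map β).sum = 1)
    (hβ' : ∑ i, β i = 0) : grCoef h α w β z = 0 := by
  classical
  by_cases hαA : ∀ i ∈ A, α i = l - 1
  -- The total parity is even and the parity on A is odd, so the parity outside A is odd and
  -- `grCoef_conj_eq` contributes the sign -1. Conjugation by the cycle fixes z, hence the
  -- coefficient equals its negative.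
  · have hn' : ∑ i, (if i ∈ A then 0 else β i) = ((1 : ℕ) : ZMod 2) := by
      have h1 : ∑ i, β i = (A.map β).sum + ∑ i, (if i ∈ A then 0 else β i) := by
        rw [← List.sum_toFinset β hn, Finset.sum_ite, Finset.sum_const_zero, zero_add,
          ← Finset.sum_filter_add_sum_filter_not Finset.univ (· ∈ A)]
        congr 2
        ext i
        simp
      rw [hβ', hβ] at h1
      rw [Nat.cast_one]
      exact (CharTwo.add_eq_zero.1 h1.symm).symm
    have e1 := grCoef_conj_eq h hn hw (z := z) (m := 0)
      (fun j => by rw [pow_zero, one_mul, hc]) hα hαA hβ hn'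
    have e2 := grCoef_conj h A.formPerm hα w β z
    have hαc : (fun i => α (A.formPerm i)) = α := by
      funext i
      by_cases hi : i ∈ A
      · rw [hαA i hi, hαA _ (List.formPerm_apply_mem_of_mem hi)]
      · rw [List.formPerm_apply_of_notMem hi]
    have hwc : A.formPerm⁻¹ * w * A.formPerm = w := by
      rw [mul_assoc, inv_mul_eq_iff_eq_mul]
      ext i
      rw [Equiv.Perm.mul_apply, Equiv.Perm.mul_apply]
      by_cases hi : i ∈ A
      · rw [hw i hi, hw _ (List.formPerm_apply_mem_of_mem hi)]
      · rw [List.formPerm_apply_of_notMem hi, List.formPerm_apply_of_notMem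
          fun hwi => hi ((apply_mem_iff_of_formPerm hw i).1 hwi)]
    have hzc : grPerm f A.formPerm⁻¹ * z * grPerm f A.formPerm = z := by
      rw [mul_assoc, ← hp, ← mul_assoc, grPerm_inv_mul, one_mul]
    rw [hαc, hwc, hzc] at e2
    rw [pow_one, pow_zero, one_mul, e2, neg_one_mul, smul_neg] at e1
    have hs := grPerm_conj_grMon f A.formPerm α w β
    rw [hαc, hwc] at hs
    exact smul_grMon_eq_zero h hα hs (gr_two_torsion_free h h2 e1.symm)
  · push Not at hαA
    obtain ⟨i, hi, hil⟩ := hαA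
    exact grCoef_eq_zero_of_odd h h2 hn hw hx hβ hα hi hil

/-- Such a β has the form K + K∘w. Commuting with c^K carries the coefficient at 0 to the one at β
up to sign. -/
theorem grCoef_eq_zero_of_even (h : IsOddMonic f l) {Ls : List (List (Fin (N + 1)))}
    {w : Equiv.Perm (Fin (N + 1))} (hL : IsCycleFamily Ls w) {z : GrSergeev (N + 1) f}
    (hc : ∀ j, grC f j * z = z * grC f j) {α : Fin (N + 1) → ℕ} (hα : ∀ i, α i < l)
    {β : Fin (N + 1) → ZMod 2} (hβ : ∀ A ∈ Ls, (A.map β).sum = 0)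
    (h0 : grCoef h α w 0 z = 0) : grCoef h α w β z = 0 := by
  obtain ⟨K, hK⟩ := hL.exists_eq_add hβ
  have e1 := cMon_mul_grCoef h K hα w 0 z
  have e2 := grCoef_mul_cMon h K hα w β z
  have hidx : β + K = (fun i => K (w i)) + 0 := by
    funext i
    have : K i + K (w i) + K i = K (w i) := by
      rw [add_right_comm, CharTwo.add_self_eq_zero, zero_add]
    simpa [hK] using this
  rw [hidx, ← cMon_mul_comm hc, e1, h0, zero_smul] at e2
  exact smul_grMon_eq_zero h hα (grMon_mul_cMon f K α w β) e2.symm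

/-- An even central element is determined by its coefficients at monomials without Clifford
generators. -/
theorem eq_zero_of_mem_grCenter (h : IsOddMonic f l) (h2 : ∀ a : R, 2 * a = 0 → a = 0)
    {z : GrSergeev (N + 1) f} (hx : ∀ j, grX f j * z = z * grX f j)
    (hc : ∀ j, grC f j * z = z * grC f j) (hp : ∀ σ, grPerm f σ * z = z * grPerm f σ)
    (he : z ∈ grEven (N + 1) f)
    (h0 : ∀ α w, (∀ i, α i < l) → grCoef h α w 0 z = 0) : z = 0 := by
  refine gr_ext h fun α w β hα => ?_
  rw [map_zero]
  by_cases hβ : ∑ i, β i = 0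
  · obtain ⟨Ls, -, hL⟩ := exists_isCycleFamily w
    by_cases hβ' : ∀ A ∈ Ls, (A.map β).sum = 0
    · exact grCoef_eq_zero_of_even h hL hc hα hβ' (h0 α w hα)
    · push Not at hβ'
      obtain ⟨A, hA, hAβ⟩ := hβ'
      have h1 : (A.map β).sum = 1 := by
        revert hAβ
        generalize (A.map β).sum = b
        revert b
        decide
      exact grCoef_eq_zero_of_odd_cycle h h2 ((List.nodup_flatten.1 hL.nodup).1 A hA)
        (hL.apply_eq A hA) hx hc (hp _) hα h1 hβ
  · exact grCoef_eq_zero h (grEven_le h he) fun hh => hβ hh.2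

/-- Together with `adjoin_grX_mul_mem` this turns the form of a skew cycle into a condition on w and
on the support of β; the exponents are left free. -/
theorem adjoin_grC_mul_mem (f : Polynomial R) {A : List (Fin (N + 1))}
    {σ : Equiv.Perm (Fin (N + 1))} {c : GrSergeev (N + 1) f}
    (hc : c ∈ Algebra.adjoin R {y | ∃ i ∈ A, y = grC f i}) :
    ∀ y ∈ grSpan f (fun _ w β => w = σ ∧ ∀ i, i ∉ A → β i = 0),
      y * c ∈ grSpan f (fun _ w β => w = σ ∧ ∀ i, i ∉ A → β i = 0) := by
  induction hc using Algebra.adjoin_induction with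
  | mem c hc =>
    obtain ⟨i, hi, rfl⟩ := hc
    intro y hy
    refine map_mem_of_grSpan (φ := LinearMap.mulRight R (grC f i)) ?_ hy
    rintro α w β ⟨rfl, hβ⟩
    refine (grMon_mul_grC f i α w β).mem (grMon_mem_grSpan ⟨rfl, fun j hj => ?_⟩)
    have hji : j ≠ i := fun e => hj (e ▸ hi)
    simp [hβ j hj, hji]
  | algebraMap r =>
    intro y hy
    rw [← Algebra.commutes, ← Algebra.smul_def]
    exact Submodule.smul_mem _ r hy
  | add a b _ _ iha ihb => intro y hy; rw [mul_add]; exact add_mem (iha y hy) (ihb y hy)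
  | mul a b _ _ iha ihb => intro y hy; rw [← mul_assoc]; exact ihb _ (iha y hy)

theorem adjoin_grX_mul_mem (f : Polynomial R) {A : List (Fin (N + 1))}
    {q : Equiv.Perm (Fin (N + 1)) → (Fin (N + 1) → ZMod 2) → Prop} {p : GrSergeev (N + 1) f}
    (hp : p ∈ Algebra.adjoin R {y | ∃ i ∈ A, y = grX f i}) :
    ∀ y ∈ grSpan f (fun _ w β => q w β), p * y ∈ grSpan f (fun _ w β => q w β) := by
  induction hp using Algebra.adjoin_induction with
  | mem c hc =>
    obtain ⟨i, hi, rfl⟩ := hc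
    intro y hy
    refine map_mem_of_grSpan (φ := LinearMap.mulLeft R (grX f i)) ?_ hy
    intro α w β h
    rw [LinearMap.mulLeft_apply, grX_mul_grMon]
    exact grMon_mem_grSpan h
  | algebraMap r =>
    intro y hy
    rw [← Algebra.smul_def]
    exact Submodule.smul_mem _ r hy
  | add a b _ _ iha ihb => intro y hy; rw [add_mul]; exact add_mem (iha y hy) (ihb y hy)
  | mul a b _ _ iha ihb => intro y hy; rw [mul_assoc]; exact iha _ (ihb y hy)

/-- An odd skew cycle is negated by conjugation with its cycle. -/
theorem IsOddSkewCycle.conj_eq_neg (h : IsOddMonic f l) (h2 : ∀ a : R, 2 * a = 0 → a = 0)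
    {A : List (Fin (N + 1))} {z : GrSergeev (N + 1) f} (hz : IsOddSkewCycle f A z) :
    grPerm f A.formPerm⁻¹ * z * grPerm f A.formPerm = -z := by
  classical
  set σ := A.formPerm with hσ
  have hshape : z ∈ grSpan f (fun _ w β => w = σ ∧ ∀ i, i ∉ A → β i = 0) := by
    obtain ⟨p, hp, c, hc, rfl⟩ := hz.form
    rw [mul_assoc]
    refine adjoin_grX_mul_mem f hp _ (adjoin_grC_mul_mem f hc _ ?_)
    have e : grPerm f σ = grMon f 0 σ 0 := by
      rw [grMon, xMon_zero, IsClifford.cMon_zero, one_mul, mul_one]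
    rw [e]
    exact grMon_mem_grSpan ⟨rfl, fun _ _ => rfl⟩
  have hsk : ∀ j, z * grC f j = (-1) ^ 1 * grC f j * z := fun j => by
    rw [pow_one, neg_one_mul, neg_mul, hz.skew_c, neg_neg]
  have hσA : ∀ i, σ i ∈ A ↔ i ∈ A := apply_mem_iff_of_formPerm fun i _ => rfl
  have hsum : ∀ β : Fin (N + 1) → ZMod 2, (∀ i, i ∉ A → β i = 0) → (A.map β).sum = ∑ i, β i := by
    intro β hβ
    rw [← List.sum_toFinset β hz.nodup]
    exact Finset.sum_subset (Finset.subset_univ _) fun i _ hi => hβ i (by simpa using hi)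
  -- These are the only monomials that can occur in z: the shape gives w and the support of β,
  -- oddness gives the sum, and `grCoef_eq_zero_of_odd` forces the maximal exponents on A.
  let P : (Fin (N + 1) → ℕ) → Equiv.Perm (Fin (N + 1)) → (Fin (N + 1) → ZMod 2) → Prop :=
    fun α w β => w = σ ∧ (∀ i, i ∉ A → β i = 0) ∧ ∑ i, β i = 1 ∧ ∀ i ∈ A, α i = l - 1
  have hP : ∀ α w β, (∀ i, α i < l) → ¬P α w β → grCoef h α w β z = 0 := by
    intro α w β hα hnP
    by_cases h1 : w = σ ∧ ∀ i, i ∉ A → β i = 0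
    · by_cases h3 : ∑ i, β i = 1
      · have h4 : ∃ i ∈ A, α i ≠ l - 1 := by
          by_contra hcon
          push Not at hcon
          exact hnP ⟨h1.1, h1.2, h3, hcon⟩
        obtain ⟨i, hi, hil⟩ := h4
        exact grCoef_eq_zero_of_odd h h2 hz.nodup (fun i _ => by rw [h1.1]) hz.comm_x
          (by rw [hsum β h1.2, h3]) hα hi hil
      · exact grCoef_eq_zero h (grOdd_le h hz.odd) fun hh => h3 hh.2
    · exact grCoef_eq_zero h hshape h1
  have key : ∀ (α : Fin (N + 1) → ℕ) (w : Equiv.Perm (Fin (N + 1)))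
      (β : Fin (N + 1) → ZMod 2), (∀ i, α i < l) → grCoef h (fun i => α (σ i)) (σ⁻¹ * w * σ) (fun i => β (σ i))
        (grPerm f σ⁻¹ * z * grPerm f σ) =
      -grCoef h (fun i => α (σ i)) (σ⁻¹ * w * σ) (fun i => β (σ i)) z := by
    intro α w β hα
    have e2 := grCoef_conj h σ hα w β z
    rw [← add_eq_zero_iff_eq_neg]
    refine smul_grMon_eq_zero h (fun i => hα (σ i)) (SgnEq.refl (grMon f (fun i => α (σ i))
      (σ⁻¹ * w * σ) fun i => β (σ i))) ?_
    rw [add_smul, e2]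
    by_cases hPt : P α w β
    · obtain ⟨rfl, hβ, hβ1, hαA⟩ := hPt
      -- No Clifford generator lies outside A, so n = 0, and the sign -1 comes from
      -- skew-commutation, m = 1.
      have hn' : ∑ i, (if i ∈ A then 0 else β i) = ((0 : ℕ) : ZMod 2) := by
        rw [Nat.cast_zero]
        refine Finset.sum_eq_zero fun i _ => ?_
        split_ifs with hi
        · rfl
        · exact hβ i hi
      have e1 := grCoef_conj_eq h hz.nodup (fun i _ => rfl) hsk hα hαA
        (by rw [hsum β hβ, hβ1]) hn'
      rw [pow_zero, one_mul, pow_one, neg_one_mul, smul_neg] at e1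
      have hαc : (fun i => α (σ i)) = α := by
        funext i
        by_cases hi : i ∈ A
        · rw [hαA i hi, hαA _ ((hσA i).2 hi)]
        · rw [hσ, List.formPerm_apply_of_notMem hi]
      rw [hαc, inv_mul_cancel, one_mul, e1, neg_add_cancel]
    · have hPt' : ¬P (fun i => α (σ i)) (σ⁻¹ * w * σ) (fun i => β (σ i)) := by
        rintro ⟨h1, h3, h4, h5⟩
        refine hPt ⟨?_, fun i hi => ?_, ?_, fun i hi => ?_⟩
        · rw [mul_assoc, inv_mul_eq_iff_eq_mul] at h1
          exact mul_right_cancel h1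
        · have := h3 (σ⁻¹ i) fun hh => hi (by simpa using (hσA _).2 hh)
          simpa using this
        · rwa [Equiv.sum_comp σ β] at h4
        · have := h5 (σ⁻¹ i) (List.formPerm_inv_mem hi)
          simpa using this
      rw [hP _ _ _ hα hPt, hP _ _ _ (fun i => hα _) hPt', zero_smul, zero_smul, add_zero]
  refine gr_ext h fun α w β hα => ?_
  have := key (fun i => α (σ⁻¹ i)) (σ * w * σ⁻¹) (fun i => β (σ⁻¹ i)) fun i => hα _
  rw [map_neg]
  simpa [mul_assoc] using this

/-- Replacing τ by τ σ⁻¹ turns the sum into its negative, and there is no 2-torsion. -/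
theorem sum_conj_eq_zero (h : IsOddMonic f l) (h2 : ∀ a : R, 2 * a = 0 → a = 0)
    {z : GrSergeev (N + 1) f} {σ : Equiv.Perm (Fin (N + 1))}
    (hz : grPerm f σ⁻¹ * z * grPerm f σ = -z) (s : Finset (Equiv.Perm (Fin (N + 1))))
    (hs : ∀ τ, τ ∈ s ↔ τ * σ⁻¹ ∈ s) : ∑ τ ∈ s, grPerm f τ * z * grPerm f τ⁻¹ = 0 := by
  refine gr_two_torsion_free h h2 ?_
  conv_rhs => rw [← Finset.sum_neg_distrib]
  symm
  refine Finset.sum_equiv (Equiv.mulRight σ⁻¹) hs fun τ _ => ?_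
  rw [Equiv.coe_mulRight, mul_inv_rev, inv_inv, grPerm_mul, grPerm_mul]
  calc _ = grPerm f τ * (-z) * grPerm f τ⁻¹ := by rw [mul_neg, neg_mul]
    _ = _ := by
      rw [← hz]
      simp only [mul_assoc]

theorem IsOddSkewCycle.sum_conj_eq_zero (h : IsOddMonic f l) (h2 : ∀ a : R, 2 * a = 0 → a = 0)
    {A : List (Fin (N + 1))} {z : GrSergeev (N + 1) f} (hz : IsOddSkewCycle f A z) :
    (∑ τ : Equiv.Perm (Fin (N + 1)) with ∀ i, i ∉ A → τ i = i,
        grPerm f τ * z * grPerm f τ⁻¹) = 0 ∧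
      (∑ τ : Equiv.Perm (Fin (N + 1)), grPerm f τ * z * grPerm f τ⁻¹) = 0 := by
  refine ⟨_root_.sum_conj_eq_zero h h2 (hz.conj_eq_neg h h2) _ fun τ => ?_,
    _root_.sum_conj_eq_zero h h2 (hz.conj_eq_neg h h2) _ fun τ => by simp⟩
  have hfix : ∀ i, i ∉ A → A.formPerm⁻¹ i = i := fun i hi => by
    rw [Equiv.Perm.inv_eq_iff_eq, List.formPerm_apply_of_notMem hi]
  simp only [Finset.mem_filter, Finset.mem_univ, true_and]
  refine forall₂_congr fun i hi => ?_
  rw [Equiv.Perm.mul_apply, hfix i hi]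

end Centralizer

/-! ### The signs in CX-cycles. -/

section CXSigns

theorem leftExp_add_rightExp {n : ℕ} (β : Fin n → ZMod 2) (j : Fin n) :
    leftExp β j + (β j).val + rightExp β j = wt β := by
  have h : ∀ k, (β k).val = (if k < j then (β k).val else 0) + (if k = j then (β k).val else 0) +
      if j < k then (β k).val else 0 := by
    intro k
    rcases lt_trichotomy k j with h | h | h
    · simp [h, h.ne, h.not_gt]
    · simp [h]
    · simp [h, h.ne', h.not_gt]
  rw [wt, Finset.sum_congr rfl fun k _ => h k, Finset.sum_add_distrib, Finset.sum_add_distrib,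
    leftExp_eq, rightExp_eq, Finset.sum_ite_eq' Finset.univ j, if_pos (Finset.mem_univ j)]

theorem leftExp_add_one {m : ℕ} (β : Fin (m + 1) → ZMod 2) {p : Fin (m + 1)}
    (hp : p ≠ Fin.last m) : leftExp β (p + 1) = leftExp β p + (β p).val := by
  have h : Finset.Iio (p + 1) = insert p (Finset.Iio p) := by
    ext k
    have h1 : ((p + 1 : Fin (m + 1)) : ℕ) = p + 1 := by
      rw [Fin.val_add_one, if_neg hp]
    simp only [Finset.mem_Iio, Finset.mem_insert, Fin.lt_def, Fin.ext_iff, h1]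
    omega
  rw [leftExp, h, Finset.sum_insert (by simp), leftExp, add_comm]

theorem rightExp_last {m : ℕ} (β : Fin (m + 1) → ZMod 2) : rightExp β (Fin.last m) = 0 := by
  rw [rightExp_eq]
  exact Finset.sum_eq_zero fun k _ => if_neg (not_lt.2 (Fin.le_last k))

theorem zmod_two_val_add_one (b : ZMod 2) : (b + 1).val = 1 - b.val := by
  revert b
  decide

/-- The sign identity behind centrality. Moving the Clifford generator at position p + 1 through a
CX-cycle flips α at the positions p and p + 1. The terms in D and `leftExp` come from crossing the
polynomial and the Clifford monomial on one side, `rightExp` from the other side. The term in D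
occurs only at the last position, where p + 1 wraps around to the first. -/
theorem cx_parity {m : ℕ} {γ γ' : Fin (m + 1) → ZMod 2} (hγ : Even (wt γ)) (p : Fin (m + 1))
    (hγ' : γ' = γ + Pi.single p 1 + Pi.single (p + 1) 1) {D : ℕ} (hD : D % 2 = m % 2) :
    Even (wt γ') ∧ (tauExp γ + (if p = Fin.last m then 1 else 0) * D + leftExp γ p) % 2 =
      (tauExp γ' + rightExp γ' (p + 1)) % 2 := by
  -- For a cycle of length one the positions p and p + 1 coincide and the two flips cancel.
  rcases Nat.eq_zero_or_pos m with rfl | hm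
  · have hp : p = 0 := Subsingleton.elim (α := Fin 1) _ _
    have hp1 : p + 1 = 0 := Subsingleton.elim (α := Fin 1) _ _
    have e : γ' = γ := by
      rw [hγ', hp1, hp, add_assoc, ← Pi.single_add, CharTwo.add_self_eq_zero, Pi.single_zero,
        add_zero]
    subst e
    refine ⟨hγ, ?_⟩
    rw [hp1, hp, leftExp_zero, show (0 : Fin 1) = Fin.last 0 from rfl, rightExp_last, if_pos rfl]
    omega
  · set q := p + 1 with hq
    have hpq : q ≠ p := by
      intro e
      have h1 := congrArg Fin.val e
      rw [hq, Fin.val_add_one] at h1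
      split_ifs at h1 with h2
      · rw [h2, Fin.val_last] at h1
        omega
      · omega
    have hp' : (γ' p).val = 1 - (γ p).val := by
      rw [hγ', ← zmod_two_val_add_one]
      simp [hpq.symm]
    have hq' : (γ' q).val = 1 - (γ q).val := by
      rw [hγ', ← zmod_two_val_add_one]
      simp [hpq]
    -- The weight c = 1 gives the change of `wt`, and c j = j + 1 gives the change of the second
    -- summand of `tauExp`. The flipped terms stay on both sides of the equation.
    have hsum : ∀ c : Fin (m + 1) → ℕ, ∑ j, c j * (γ' j).val + c p * (γ p).val + c q * (γ q).val =
        ∑ j, c j * (γ j).val + c p * (1 - (γ p).val) + c q * (1 - (γ q).val) := by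
      intro c
      have h1 : ∀ g : Fin (m + 1) → ℕ,
          ∑ j, g j = g p + (g q + ∑ j ∈ (Finset.univ.erase p).erase q, g j) := by
        intro g
        rw [Finset.add_sum_erase _ _ (by simp [hpq]), Finset.add_sum_erase _ _ (by simp)]
      have h2 : ∑ j ∈ (Finset.univ.erase p).erase q, c j * (γ' j).val =
          ∑ j ∈ (Finset.univ.erase p).erase q, c j * (γ j).val := by
        refine Finset.sum_congr rfl fun j hj => ?_
        simp only [Finset.mem_erase, Finset.mem_univ, and_true] at hj
        rw [hγ']
        simp [hj.1, hj.2]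
      rw [h1 fun j => c j * (γ' j).val, h1 fun j => c j * (γ j).val, h2, hp', hq']
      ring
    have hw := hsum fun _ => 1
    have ht := hsum fun j => (j : ℕ) + 1
    simp only [one_mul] at hw
    change wt γ' + _ + _ = wt γ + _ + _ at hw
    have hl := leftExp_add_rightExp γ' q
    have hx := ZMod.val_lt (γ p)
    have hy := ZMod.val_lt (γ q)
    rw [hq'] at hl
    have hl' : (p ≠ Fin.last m → leftExp γ' q = leftExp γ p + (1 - (γ p).val)) ∧
        (p = Fin.last m → leftExp γ' q = 0) := by
      refine ⟨fun hp => ?_, fun hp => ?_⟩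
      · rw [hq, leftExp_add_one _ hp, hp']
        congr 1
        refine Finset.sum_congr rfl fun k hk => ?_
        have h1 : ((p + 1 : Fin (m + 1)) : ℕ) = p + 1 := by
          rw [Fin.val_add_one, if_neg hp]
        have h2 : k ≠ p := (Finset.mem_Iio.1 hk).ne
        have h3 : k ≠ q := by
          intro e
          have := Fin.lt_def.1 (Finset.mem_Iio.1 hk)
          rw [e, hq, h1] at this
          omega
        rw [hγ']
        simp [h2, h3]
      · rw [hq, hp, Fin.last_add_one, leftExp_zero]
    obtain ⟨w0, hw0⟩ := hγ
    rw [Nat.even_iff, tauExp, tauExp]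
    have hqv : (q : ℕ) = if p = Fin.last m then 0 else (p : ℕ) + 1 := by
      rw [hq, Fin.val_add_one]
    by_cases hp : p = Fin.last m
    · have h1 := hl'.2 hp
      have h2 := leftExp_add_rightExp γ p
      have h3 : rightExp γ p = 0 := by rw [hp, rightExp_last]
      have h4 : (p : ℕ) = m := by rw [hp, Fin.val_last]
      rw [if_pos hp] at hqv ⊢
      rcases (show (γ p).val = 0 ∨ (γ p).val = 1 by omega) with hx | hx <;>
      rcases (show (γ q).val = 0 ∨ (γ q).val = 1 by omega) with hy | hy <;>
      simp only [hx, hy, hqv, h4] at * <;> omega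
    · have h1 := hl'.1 hp
      rw [if_neg hp] at hqv ⊢
      rcases (show (γ p).val = 0 ∨ (γ p).val = 1 by omega) with hx | hx <;>
      rcases (show (γ q).val = 0 ∨ (γ q).val = 1 by omega) with hy | hy <;>
      simp only [hx, hy, hqv] at * <;> omega

end CXSigns

/-! ### Truncated complete homogeneous polynomials. -/

section CompleteSymmetric

variable {B : Type*} [Ring B] {m : ℕ}

/-- The complete homogeneous symmetric polynomial of degree `M`. -/
noncomputable def hSum {n : ℕ} (U : Fin n → B) (M : ℕ) : B :=
  ∑ e ∈ Finset.piAntidiag Finset.univ M, xMon U e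

/-- In degree at least m(l-1) all m + 1 variables act alike: the missing monomials of degree M + 1
do not contain `U j`, and then another variable has exponent at least l. This accounts for the
degree (a-1)(l-1) + r in CX-cycles. -/
theorem mul_hSum {U : Fin (m + 1) → B} (hU : ∀ i j, U i * U j = U j * U i) {l : ℕ}
    (h0 : ∀ i, U i ^ l = 0) {M : ℕ} (hM : m * (l - 1) ≤ M) (j : Fin (m + 1)) :
    U j * hSum U M = hSum U (M + 1) := by
  classical
  rw [hSum, hSum, Finset.mul_sum]
  simp only [mul_xMon hU]
  rw [← Finset.sum_image (s := Finset.piAntidiag Finset.univ M)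
    (g := fun e : Fin (m + 1) → ℕ => e + Pi.single j 1) (f := fun e => xMon U e)
    fun e _ e' _ h => add_right_cancel h]
  refine Finset.sum_subset (fun e he => ?_) fun e he hne => ?_
  · obtain ⟨e', he', rfl⟩ := Finset.mem_image.1 he
    rw [Finset.mem_piAntidiag] at he' ⊢
    refine ⟨?_, fun i _ => Finset.mem_univ i⟩
    change ∑ i, (e' + Pi.single j 1 : Fin (m + 1) → ℕ) i = M + 1
    have := he'.1
    simp only [Pi.add_apply, Finset.sum_add_distrib, Finset.sum_pi_single', Finset.mem_univ,
      if_true]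
    change ∑ i, e' i = M at this
    rw [this]
  · have hs : ∑ i, e i = M + 1 := (Finset.mem_piAntidiag.1 he).1
    have hj : e j = 0 := by
      by_contra hj
      refine hne (Finset.mem_image.2 ⟨e - Pi.single j 1, ?_, ?_⟩)
      · have e1 : e = (e - Pi.single j 1) + Pi.single j 1 := by
          funext i
          by_cases hi : i = j
          · subst hi
            simp only [Pi.add_apply, Pi.sub_apply, Pi.single_eq_same]
            omega
          · simp [hi]
        refine Finset.mem_piAntidiag.2 ⟨?_, fun i _ => Finset.mem_univ i⟩
        rw [e1] at hs
        simp only [Pi.add_apply, Finset.sum_add_distrib, Finset.sum_pi_single', Finset.mem_univ,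
          if_true] at hs
        change ∑ i, (e - Pi.single j 1 : Fin (m + 1) → ℕ) i = M
        omega
      · funext i
        by_cases hi : i = j
        · subst hi
          simp only [Pi.add_apply, Pi.sub_apply, Pi.single_eq_same]
          omega
        · simp [hi]
    -- Otherwise the m variables other than j would give degree at most m(l-1), which is less than M
    -- + 1.
    obtain ⟨i, hi⟩ : ∃ i, l ≤ e i := by
      by_contra hcon
      push Not at hcon
      have h1 : ∑ i ∈ Finset.univ.erase j, e i ≤ ∑ i ∈ Finset.univ.erase j, (l - 1) :=
        Finset.sum_le_sum fun i _ => by have := hcon i; omega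
      rw [Finset.sum_const, smul_eq_mul, Finset.card_erase_of_mem (Finset.mem_univ j),
        Finset.card_univ, Fintype.card_fin, Nat.add_sub_cancel] at h1
      have h2 := Finset.add_sum_erase Finset.univ e (Finset.mem_univ j)
      omega
    exact xMon_eq_zero e i (pow_eq_zero_of_le hi (h0 i))

/-- Moving an element across a complete symmetric polynomial. -/
theorem mul_hSum_of_sign {n : ℕ} {U V : Fin n → B} {y : B} {s : ℕ}
    (h : ∀ j, y * U j = (-1) ^ s * V j * y) (M : ℕ) :
    y * hSum U M = (-1) ^ (s * M) * hSum V M * y := by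
  rw [hSum, hSum, Finset.mul_sum, Finset.mul_sum, Finset.sum_mul]
  refine Finset.sum_congr rfl fun e he => ?_
  rw [mul_xMon_of_sign (fun _ => s) h, ← Finset.mul_sum]
  have : ∑ i, e i = M := (Finset.mem_piAntidiag.1 he).1
  rw [this]

end CompleteSymmetric

/-! ### Commutation of CX-cycles with the generators. -/

section CXElements

variable {R : Type*} [CommRing R] {N : ℕ} {f : Polynomial R} {l : ℕ}

/-- The signed variables that enter the polynomial of an X-cycle. -/
noncomputable def cxVar (f : Polynomial R) {n : ℕ} (a : Fin n → Fin (N + 1))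
    (γ : Fin n → ZMod 2) (j : Fin n) : GrSergeev (N + 1) f := (-1) ^ epsExp γ j * grX f (a j)

/-- The X-cycle on the entries of a tuple. -/
noncomputable def cxTerm (f : Polynomial R) (l : ℕ) {n : ℕ} (a : Fin n → Fin (N + 1)) (r : ℕ)
    (γ : Fin n → ZMod 2) : GrSergeev (N + 1) f :=
  hSum (cxVar f a γ) ((n - 1) * (l - 1) + r) * grPerm f (List.ofFn a).formPerm *
    cMon (fun j => grC f (a j)) γ

/-- The CX-cycle on the entries of a tuple. -/
noncomputable def cxTuple (f : Polynomial R) (l : ℕ) {n : ℕ} (a : Fin n → Fin (N + 1)) (r : ℕ) :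
    GrSergeev (N + 1) f :=
  ∑ γ : Fin n → ZMod 2 with Even (wt γ), (-1) ^ tauExp γ * cxTerm f l a r γ

/-- Indexing by `Fin n` instead of `Fin A.length` makes the cyclic successor p + 1 available and
allows relabelling of the entries with a fixed index type. -/
theorem cxElt_eq_cxTuple (f : Polynomial R) (l r : ℕ) {A : List (Fin (N + 1))} {n : ℕ}
    (a : Fin n → Fin (N + 1)) (hA : A = List.ofFn a) : cxElt f l A r = cxTuple f l a r := by
  have key : ∀ (hn : A.length = n), (∀ j : Fin n, a j = A.get (j.cast hn.symm)) →
      cxElt f l A r = cxTuple f l a r := by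
    rintro rfl ha
    have ha' : a = A.get := funext ha
    subst ha'
    rw [cxElt, cxTuple]
    refine Finset.sum_congr rfl fun γ _ => ?_
    rw [xCycle, cxTerm, List.ofFn_get]
    rfl
  subst hA
  exact key (List.length_ofFn) fun j => by simp

theorem formPerm_ofFn_apply {ι : Type*} [DecidableEq ι] {m : ℕ} {a : Fin (m + 1) → ι}
    (ha : Function.Injective a) (j : Fin (m + 1)) : (List.ofFn a).formPerm (a j) = a (j + 1) := by
  have hn : (List.ofFn a).Nodup := List.nodup_ofFn.2 ha
  have h := List.formPerm_apply_getElem _ hn j (by rw [List.length_ofFn]; exact j.2)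
  simp only [List.getElem_ofFn, List.length_ofFn] at h
  rw [Fin.eta] at h
  rw [h]
  congr 1
  ext
  rw [Fin.val_add_eq_ite, Fin.val_one']
  rcases Nat.eq_zero_or_pos m with rfl | hm
  · simp
  · have := j.2
    rw [Nat.mod_eq_of_lt (by omega : 1 < m + 1)]
    split_ifs with h1
    · have : (j : ℕ) + 1 = m + 1 := by omega
      simp [this]
    · exact Nat.mod_eq_of_lt (by omega)

theorem cxVar_comm (f : Polynomial R) {n : ℕ} (a : Fin n → Fin (N + 1)) (γ : Fin n → ZMod 2)
    (i j : Fin n) : cxVar f a γ i * cxVar f a γ j = cxVar f a γ j * cxVar f a γ i := by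
  have h : ∀ (k : ℕ) (y : GrSergeev (N + 1) f), Commute ((-1) ^ k) y := fun k y =>
    (Commute.neg_one_left y).pow_left k
  have h1 : Commute (grX f (a i)) (cxVar f a γ j) :=
    (h _ _).symm.mul_right (grX_comm f (a i) (a j))
  exact (h _ _).mul_left h1

theorem grX_mul_hSum_comm (f : Polynomial R) {n : ℕ} (a : Fin n → Fin (N + 1))
    (γ : Fin n → ZMod 2) (i : Fin (N + 1)) (M : ℕ) :
    grX f i * hSum (cxVar f a γ) M = hSum (cxVar f a γ) M * grX f i := by
  have := mul_hSum_of_sign (U := cxVar f a γ) (V := cxVar f a γ) (y := grX f i) (s := 0)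
    (fun j => by
      rw [pow_zero, one_mul, cxVar, ← mul_assoc,
        ((Commute.neg_one_right (grX f i)).pow_right _).eq, mul_assoc, grX_comm, mul_assoc]) M
  rw [this]
  simp

theorem cxVar_pow_eq_zero (h : IsOddMonic f l) {n : ℕ} (a : Fin n → Fin (N + 1))
    (γ : Fin n → ZMod 2) (j : Fin n) : cxVar f a γ j ^ l = 0 := by
  rw [cxVar, ((Commute.neg_one_left (grX f (a j))).pow_left _).mul_pow,
    grX_pow_eq_zero h.monic h.natDegree_eq h.one_le, mul_zero]

/-- The rule also holds at the last position, where p + 1 is the first one, because the weight is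
even. -/
theorem epsExp_add_one {m : ℕ} {γ : Fin (m + 1) → ZMod 2} (hγ : Even (wt γ)) (j : Fin (m + 1)) :
    (epsExp γ (j + 1) : ZMod 2) = epsExp γ j + γ j := by
  by_cases hj : j = Fin.last m
  · have h1 : epsExp γ (j + 1) = 0 := by
      rw [hj, Fin.last_add_one]
      exact leftExp_zero γ
    have h2 := leftExp_add_rightExp γ j
    rw [hj, rightExp_last, ← hj, add_zero] at h2
    have h3 := (ZMod.natCast_eq_zero_iff_even (n := wt γ)).2 hγ
    rw [← h2] at h3
    push_cast at h3
    rw [ZMod.natCast_zmod_val] at h3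
    rw [h1, Nat.cast_zero]
    exact h3.symm
  · have h1 := leftExp_add_one γ hj
    change epsExp γ (j + 1) = epsExp γ j + _ at h1
    rw [h1]
    push_cast
    rw [ZMod.natCast_zmod_val]

/-- By `mul_hSum` the signed variables at positions j and j + 1 act alike on the polynomial. The
quotient of their signs is (-1)^{γ_j}, which is the sign for passing x_j through the Clifford
monomial. -/
theorem grX_mul_cxTerm (h : IsOddMonic f l) {m : ℕ} {a : Fin (m + 1) → Fin (N + 1)}
    (ha : Function.Injective a) (r : ℕ) {γ : Fin (m + 1) → ZMod 2} (hγ : Even (wt γ))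
    (j : Fin (m + 1)) : grX f (a j) * cxTerm f l a r γ = cxTerm f l a r γ * grX f (a j) := by
  set M := (m + 1 - 1) * (l - 1) + r with hM
  have hs : ∀ (k : ℕ) (y : GrSergeev (N + 1) f), y * (-1) ^ k = (-1) ^ k * y := fun k y =>
    ((Commute.neg_one_right y).pow_right k).eq
  have h1 : cMon (fun j => grC f (a j)) γ * grX f (a j) =
      (-1) ^ (γ j).val * grX f (a j) * cMon (fun j => grC f (a j)) γ := by
    have := mul_xMon_of_sign (X := fun k => grC f (a k)) (Y := fun k => grC f (a k))
      (y := grX f (a j)) (fun k => if k = j then 1 else 0) (fun k => by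
        split_ifs with h
        · subst h; rw [pow_one, neg_one_mul, neg_mul, grC_mul_grX_self, neg_neg]
        · rw [pow_zero, one_mul, grC_mul_grX_ne f fun e => h (ha e)]) fun k => (γ k).val
    simp only [ite_mul, one_mul, zero_mul, Finset.sum_ite_eq', Finset.mem_univ, if_true] at this
    change grX f (a j) * cMon (fun j => grC f (a j)) γ =
      (-1) ^ (γ j).val * cMon (fun j => grC f (a j)) γ * grX f (a j) at this
    rw [mul_assoc, this, ← mul_assoc, ← mul_assoc, ← pow_add, ← two_mul, pow_mul]
    simp
  have h2 : grX f (a j) * hSum (cxVar f a γ) M =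
      (-1) ^ (γ j).val * grX f (a (j + 1)) * hSum (cxVar f a γ) M := by
    have e1 := mul_hSum (cxVar_comm f a γ) (cxVar_pow_eq_zero h a γ) (M := M)
      (by rw [hM]; exact Nat.le_add_right _ _) j
    rw [← mul_hSum (cxVar_comm f a γ) (cxVar_pow_eq_zero h a γ) (M := M)
      (by rw [hM]; exact Nat.le_add_right _ _) (j + 1)] at e1
    have e2 : (-1 : GrSergeev (N + 1) f) ^ epsExp γ (j + 1) =
        (-1) ^ (epsExp γ j + (γ j).val) := by
      apply neg_one_pow_eq_of_cast
      rw [epsExp_add_one hγ]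
      push_cast
      rw [ZMod.natCast_zmod_val]
    rw [cxVar, cxVar, e2, pow_add] at e1
    have e3 := congrArg (fun y => (-1) ^ epsExp γ j * y) e1
    simp only [mul_assoc] at e3
    rw [← mul_assoc, ← mul_assoc ((-1) ^ epsExp γ j), ← pow_add, ← two_mul, pow_mul] at e3
    simpa [mul_assoc] using e3
  rw [cxTerm, ← hM, ← mul_assoc, ← mul_assoc, h2, mul_assoc _ _ (grX f (a j)), h1]
  have h3 := grPerm_mul_grX f (List.ofFn a).formPerm (a j)
  rw [formPerm_ofFn_apply ha] at h3
  calc _ = (-1) ^ (γ j).val * (grX f (a (j + 1)) * hSum (cxVar f a γ) M) *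
        grPerm f (List.ofFn a).formPerm * cMon (fun j => grC f (a j)) γ := by
        simp only [mul_assoc]
    _ = (-1) ^ (γ j).val * (hSum (cxVar f a γ) M * (grX f (a (j + 1)) *
        grPerm f (List.ofFn a).formPerm)) * cMon (fun j => grC f (a j)) γ := by
        rw [grX_mul_hSum_comm]; simp only [mul_assoc]
    _ = _ := by
      rw [← h3, ← hs]
      simp only [mul_assoc]
      rw [← mul_assoc ((-1) ^ _) (grX f (a j)), ← hs]
      simp only [mul_assoc]
      congr 2
      rw [← mul_assoc (grX f (a j)), ← hs]

/-- Without wrap-around, the two flips change only the sign of the variable at p + 1, the one that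
anticommutes with this generator. With wrap-around they change all signs except that of the first
variable, which leaves a common factor -1. -/
theorem grC_mul_cxVar (f : Polynomial R) {m : ℕ} {a : Fin (m + 1) → Fin (N + 1)}
    (ha : Function.Injective a) {γ γ' : Fin (m + 1) → ZMod 2} (p : Fin (m + 1))
    (hγ' : γ' = γ + Pi.single p 1 + Pi.single (p + 1) 1) (k : Fin (m + 1)) :
    grC f (a (p + 1)) * cxVar f a γ k =
      (-1) ^ (if p = Fin.last m then 1 else 0) * cxVar f a γ' k * grC f (a (p + 1)) := by
  have h1 : grC f (a (p + 1)) * grX f (a k) =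
      (-1) ^ (if k = p + 1 then 1 else 0) * (grX f (a k) * grC f (a (p + 1))) := by
    split_ifs with hk
    · rw [hk, grC_mul_grX_self, pow_one, neg_one_mul]
    · rw [pow_zero, one_mul, grC_mul_grX_ne f fun e => hk (ha e.symm)]
  have h2 : (-1 : GrSergeev (N + 1) f) ^ (epsExp γ k + if k = p + 1 then 1 else 0) =
      (-1) ^ ((if p = Fin.last m then 1 else 0) + epsExp γ' k) := by
    apply neg_one_pow_eq_of_cast
    have e1 : (epsExp γ' k : ZMod 2) =
        epsExp γ k + (if p < k then 1 else 0) + if p + 1 < k then 1 else 0 := by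
      rw [hγ']
      exact (leftExp_add_single _ _ _).trans (congrArg (· + _) (leftExp_add_single _ _ _))
    push_cast
    rw [e1]
    have hv : ((p + 1 : Fin (m + 1)) : ℕ) = if p = Fin.last m then 0 else (p : ℕ) + 1 :=
      Fin.val_add_one p
    have hk := k.2
    have h11 : (1 + 1 : ZMod 2) = 0 := rfl
    simp only [Fin.lt_def, Fin.ext_iff, Fin.val_last] at hv ⊢
    rw [hv]
    split_ifs <;> first | omega | ring1 |
      linear_combination h11 | linear_combination -h11
  have hs : grC f (a (p + 1)) * (-1) ^ epsExp γ k = (-1) ^ epsExp γ k * grC f (a (p + 1)) :=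
    ((Commute.neg_one_right _).pow_right _).eq
  rw [cxVar, cxVar, ← mul_assoc, hs, mul_assoc, h1, ← mul_assoc, ← pow_add, h2, pow_add]
  simp only [mul_assoc]

theorem isClifford_grC_comp (f : Polynomial R) {n : ℕ} {a : Fin n → Fin (N + 1)}
    (ha : Function.Injective a) : IsClifford fun j => grC f (a j) where
  sq _ := (isClifford_grC f).sq _
  anti _ _ h := (isClifford_grC f).anti _ _ fun e => h (ha e)

theorem grC_mul_cxTerm (h : IsOddMonic f l) {m : ℕ} {a : Fin (m + 1) → Fin (N + 1)}
    (ha : Function.Injective a) {r : ℕ} (hr : Even (m * l + r)) {γ γ' : Fin (m + 1) → ZMod 2}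
    (hγ : Even (wt γ)) (p : Fin (m + 1)) (hγ' : γ' = γ + Pi.single p 1 + Pi.single (p + 1) 1) :
    grC f (a (p + 1)) * ((-1) ^ tauExp γ * cxTerm f l a r γ) =
      (-1) ^ tauExp γ' * cxTerm f l a r γ' * grC f (a (p + 1)) := by
  set D := (m + 1 - 1) * (l - 1) + r with hD
  -- As l is odd, m(l-1) is even, and the CX-condition makes r congruent to m.
  have hD2 : D % 2 = m % 2 := by
    obtain ⟨k, hk⟩ := h.odd
    obtain ⟨q, hq⟩ := hr
    have e1 : m * l = 2 * (m * k) + m := by rw [hk]; ring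
    have e2 : (m + 1 - 1) * (l - 1) = 2 * (m * k) := by
      rw [hk, Nat.add_sub_cancel, Nat.add_sub_cancel]; ring
    omega
  have hpar := (cx_parity hγ p hγ' hD2).2
  have hs : ∀ (k : ℕ) (y : GrSergeev (N + 1) f), y * (-1) ^ k = (-1) ^ k * y := fun k y =>
    ((Commute.neg_one_right y).pow_right k).eq
  have h1 := mul_hSum_of_sign (grC_mul_cxVar f ha p hγ') D
  have h2 : grC f (a (p + 1)) * grPerm f (List.ofFn a).formPerm =
      grPerm f (List.ofFn a).formPerm * grC f (a p) := by
    rw [grPerm_mul_grC, formPerm_ofFn_apply ha]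
  have h3 := (isClifford_grC_comp f ha).mul_cMon p γ
  have h4 := (isClifford_grC_comp f ha).cMon_mul (p + 1) γ'
  have h5 : γ' + Pi.single (p + 1) 1 = γ + Pi.single p 1 := by
    rw [hγ', add_assoc, ← Pi.single_add, CharTwo.add_self_eq_zero, Pi.single_zero, add_zero]
  rw [h5] at h4
  have hpow : (-1 : GrSergeev (N + 1) f) ^ (tauExp γ + (if p = Fin.last m then 1 else 0) * D +
      leftExp γ p) = (-1) ^ (tauExp γ' + rightExp γ' (p + 1)) := by
    rw [neg_one_pow_eq_pow_mod_two, hpar, ← neg_one_pow_eq_pow_mod_two]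
  have hL : grC f (a (p + 1)) * ((-1) ^ tauExp γ * cxTerm f l a r γ) =
      (-1) ^ (tauExp γ + (if p = Fin.last m then 1 else 0) * D + leftExp γ p) *
        (hSum (cxVar f a γ') D * grPerm f (List.ofFn a).formPerm *
          cMon (fun j => grC f (a j)) (γ + Pi.single p 1)) := by
    rw [cxTerm, ← hD]
    calc _ = (-1) ^ tauExp γ * ((grC f (a (p + 1)) * hSum (cxVar f a γ) D) *
          grPerm f (List.ofFn a).formPerm * cMon (fun j => grC f (a j)) γ) := by
          rw [← mul_assoc, hs]; simp only [mul_assoc]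
      _ = (-1) ^ tauExp γ * ((-1) ^ ((if p = Fin.last m then 1 else 0) * D) *
          hSum (cxVar f a γ') D * (grC f (a (p + 1)) * grPerm f (List.ofFn a).formPerm) *
          cMon (fun j => grC f (a j)) γ) := by
          rw [h1]; simp only [mul_assoc]
      _ = (-1) ^ tauExp γ * ((-1) ^ ((if p = Fin.last m then 1 else 0) * D) *
          hSum (cxVar f a γ') D * grPerm f (List.ofFn a).formPerm *
          (grC f (a p) * cMon (fun j => grC f (a j)) γ)) := by
          rw [h2]; simp only [mul_assoc]
      _ = _ := by
          rw [h3, ← mul_assoc (_ * _ * _) ((-1) ^ leftExp γ p), mul_assoc ((-1) ^ (_ * D)),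
            mul_assoc ((-1) ^ (_ * D)), hs (leftExp γ p), pow_add, pow_add]
          simp only [mul_assoc]
  have hR : (-1) ^ tauExp γ' * cxTerm f l a r γ' * grC f (a (p + 1)) =
      (-1) ^ (tauExp γ' + rightExp γ' (p + 1)) *
        (hSum (cxVar f a γ') D * grPerm f (List.ofFn a).formPerm *
          cMon (fun j => grC f (a j)) (γ + Pi.single p 1)) := by
    rw [cxTerm, ← hD, mul_assoc, mul_assoc (_ * _) _ (grC f _), h4, ← mul_assoc _ ((-1) ^ _),
      hs, pow_add]
    simp only [mul_assoc]
  rw [hL, hR, hpow]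

/-- The generator carries the term of γ to the term of γ with the positions p and p + 1 flipped.
This is an involution on even vectors, so the sum is preserved. -/
theorem grC_mul_cxTuple (h : IsOddMonic f l) {m : ℕ} {a : Fin (m + 1) → Fin (N + 1)}
    (ha : Function.Injective a) {r : ℕ} (hr : Even (m * l + r)) (j : Fin (m + 1)) :
    grC f (a j) * cxTuple f l a r = cxTuple f l a r * grC f (a j) := by
  obtain ⟨p, rfl⟩ : ∃ p, j = p + 1 := ⟨j - 1, (sub_add_cancel j 1).symm⟩
  rw [cxTuple, Finset.mul_sum, Finset.sum_mul]
  have hev : ∀ γ : Fin (m + 1) → ZMod 2, Even (wt γ) →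
      Even (wt (γ + Pi.single p 1 + Pi.single (p + 1) 1)) := fun γ hγ =>
    (cx_parity hγ p rfl (D := m) rfl).1
  have hinv : ∀ γ : Fin (m + 1) → ZMod 2, γ + Pi.single p 1 + Pi.single (p + 1) 1 +
      Pi.single p 1 + Pi.single (p + 1) 1 = γ := by
    intro γ
    funext i
    simp only [Pi.add_apply]
    have := CharTwo.add_self_eq_zero ((Pi.single p 1 : Fin (m + 1) → ZMod 2) i)
    have := CharTwo.add_self_eq_zero ((Pi.single (p + 1) 1 : Fin (m + 1) → ZMod 2) i)
    linear_combination (‹(Pi.single p 1 : Fin (m + 1) → ZMod 2) i + _ = 0›) + this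
  refine Finset.sum_bij' (fun γ _ => γ + Pi.single p 1 + Pi.single (p + 1) 1)
    (fun γ _ => γ + Pi.single p 1 + Pi.single (p + 1) 1) (fun γ hγ => ?_) (fun γ hγ => ?_)
    (fun γ _ => hinv γ) (fun γ _ => hinv γ) fun γ hγ => ?_
  · exact Finset.mem_filter.2 ⟨Finset.mem_univ _, hev γ (Finset.mem_filter.1 hγ).2⟩
  · exact Finset.mem_filter.2 ⟨Finset.mem_univ _, hev γ (Finset.mem_filter.1 hγ).2⟩
  · exact grC_mul_cxTerm h ha hr (Finset.mem_filter.1 hγ).2 p rfl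

theorem grX_mul_cxTuple (h : IsOddMonic f l) {m : ℕ} {a : Fin (m + 1) → Fin (N + 1)}
    (ha : Function.Injective a) (r : ℕ) (j : Fin (m + 1)) :
    grX f (a j) * cxTuple f l a r = cxTuple f l a r * grX f (a j) := by
  rw [cxTuple, Finset.mul_sum, Finset.sum_mul]
  refine Finset.sum_congr rfl fun γ hγ => ?_
  rw [← mul_assoc, ((Commute.neg_one_right (grX f (a j))).pow_right _).eq, mul_assoc,
    grX_mul_cxTerm h ha r (Finset.mem_filter.1 hγ).2, mul_assoc]

/-- An element that intertwines the generators indexed by `a` and `b` intertwines the CX-cycles. -/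
theorem semiconjBy_cxTuple (f : Polynomial R) (l : ℕ) {n : ℕ} {a b : Fin n → Fin (N + 1)}
    (r : ℕ) {y : GrSergeev (N + 1) f} (hX : ∀ j, SemiconjBy y (grX f (a j)) (grX f (b j)))
    (hσ : SemiconjBy y (grPerm f (List.ofFn a).formPerm) (grPerm f (List.ofFn b).formPerm))
    (hC : ∀ γ : Fin n → ZMod 2, Even (wt γ) →
      SemiconjBy y (cMon (fun j => grC f (a j)) γ) (cMon (fun j => grC f (b j)) γ)) :
    SemiconjBy y (cxTuple f l a r) (cxTuple f l b r) := by
  have hs : ∀ k, SemiconjBy y ((-1) ^ k) ((-1) ^ k) := fun k =>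
    (Commute.neg_one_right y).pow_right k
  rw [SemiconjBy, cxTuple, cxTuple, Finset.mul_sum, Finset.sum_mul]
  refine Finset.sum_congr rfl fun γ hγ => ?_
  have h3 : ∀ M, SemiconjBy y (hSum (cxVar f a γ) M) (hSum (cxVar f b γ) M) := by
    intro M
    have := mul_hSum_of_sign (U := cxVar f a γ) (V := cxVar f b γ) (y := y) (s := 0)
      (fun k => by
        rw [pow_zero, one_mul]
        exact (hs _).mul_right (hX k)) M
    rwa [zero_mul, pow_zero, one_mul] at this
  exact (hs _).mul_right (((h3 _).mul_right hσ).mul_right (hC γ (Finset.mem_filter.1 hγ).2))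

theorem formPerm_ofFn_apply_of_ne {n : ℕ} {a : Fin n → Fin (N + 1)}
    {i : Fin (N + 1)} (hi : ∀ j, a j ≠ i) : (List.ofFn a).formPerm i = i := by
  rw [List.formPerm_apply_of_notMem]
  rw [List.mem_ofFn]
  rintro ⟨j, hj⟩
  exact hi j hj

theorem grX_mul_cxTuple_of_ne (f : Polynomial R) (l : ℕ) {n : ℕ} {a : Fin n → Fin (N + 1)}
    (r : ℕ) {i : Fin (N + 1)} (hi : ∀ j, a j ≠ i) :
    grX f i * cxTuple f l a r = cxTuple f l a r * grX f i := by
  refine semiconjBy_cxTuple f l r (fun j => grX_comm f _ _) ?_ fun γ _ => ?_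
  · have := grPerm_mul_grX f (List.ofFn a).formPerm i
    rw [formPerm_ofFn_apply_of_ne hi] at this
    exact this.symm
  · have := mul_xMon_of_sign (X := fun k => grC f (a k)) (Y := fun k => grC f (a k))
      (y := grX f i) (fun _ => 0) (fun k => by
        rw [pow_zero, one_mul, grC_mul_grX_ne f (hi k)]) fun k => (γ k).val
    simp only [zero_mul, Finset.sum_const_zero, pow_zero, one_mul] at this
    exact this

/-- An outside generator commutes with Clifford monomials of even weight, the only ones that occur.
-/
theorem grC_mul_cxTuple_of_ne (f : Polynomial R) (l : ℕ) {n : ℕ} {a : Fin n → Fin (N + 1)}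
    (r : ℕ) {i : Fin (N + 1)} (hi : ∀ j, a j ≠ i) :
    grC f i * cxTuple f l a r = cxTuple f l a r * grC f i := by
  refine semiconjBy_cxTuple f l r (fun j => grC_mul_grX_ne f (hi j).symm) ?_ fun γ hγ => ?_
  · have := grPerm_mul_grC f (List.ofFn a).formPerm i
    rw [formPerm_ofFn_apply_of_ne hi] at this
    exact this.symm
  · have := mul_xMon_of_sign (X := fun k => grC f (a k)) (Y := fun k => grC f (a k))
      (y := grC f i) (fun _ => 1) (fun k => by
        rw [pow_one, neg_one_mul, neg_mul, (isClifford_grC f).anti i (a k) (hi k).symm])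
      fun k => (γ k).val
    simp only [one_mul] at this
    change grC f i * cMon (fun j => grC f (a j)) γ =
      (-1) ^ wt γ * cMon (fun j => grC f (a j)) γ * grC f i at this
    rw [hγ.neg_one_pow, one_mul] at this
    exact this

theorem List.formPerm_map_mul {ι : Type*} [DecidableEq ι] (τ : Equiv.Perm ι) (L : List ι) :
    τ * L.formPerm = (L.map τ).formPerm * τ := by
  induction L with
  | nil => simp
  | cons x L ih =>
    rcases L with _ | ⟨y, L⟩
    · simp
    · rw [List.map_cons, List.map_cons, List.formPerm_cons_cons, List.formPerm_cons_cons,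
        ← mul_assoc, Equiv.mul_swap_eq_swap_mul, mul_assoc, ih, mul_assoc, List.map_cons]

theorem grPerm_mul_cxTuple (f : Polynomial R) (l : ℕ) {n : ℕ} (a : Fin n → Fin (N + 1))
    (r : ℕ) (τ : Equiv.Perm (Fin (N + 1))) :
    grPerm f τ * cxTuple f l a r = cxTuple f l (fun j => τ (a j)) r * grPerm f τ := by
  refine semiconjBy_cxTuple f l r (fun j => grPerm_mul_grX f τ _) ?_ fun γ _ => ?_
  · have e : List.ofFn (fun j => τ (a j)) = (List.ofFn a).map τ := by
      rw [List.map_ofFn]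
      rfl
    rw [SemiconjBy, ← grPerm_mul, ← grPerm_mul, e, List.formPerm_map_mul]
  · have := mul_xMon_of_sign (X := fun k => grC f (a k)) (Y := fun k => grC f (τ (a k)))
      (y := grPerm f τ) (fun _ => 0) (fun k => by
        rw [pow_zero, one_mul, grPerm_mul_grC]) fun k => (γ k).val
    simp only [zero_mul, Finset.sum_const_zero, pow_zero, one_mul] at this
    exact this

theorem List.exists_eq_ofFn {ι : Type*} {A : List ι} {n : ℕ} (hn : A.length = n) :
    ∃ a : Fin n → ι, A = List.ofFn a := by
  subst hn
  exact ⟨A.get, (List.ofFn_get A).symm⟩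

theorem grX_mul_cxElt (h : IsOddMonic f l) {A : List (Fin (N + 1))} (hA : A.Nodup) (r : ℕ)
    (i : Fin (N + 1)) : grX f i * cxElt f l A r = cxElt f l A r * grX f i := by
  by_cases hi : i ∈ A
  · obtain ⟨m, hm⟩ : ∃ m, A.length = m + 1 :=
      ⟨A.length - 1, by have := List.length_pos_of_mem hi; omega⟩
    obtain ⟨a, rfl⟩ := List.exists_eq_ofFn hm
    obtain ⟨j, rfl⟩ := List.mem_ofFn.1 hi
    rw [cxElt_eq_cxTuple f l r a rfl]
    exact grX_mul_cxTuple h (List.nodup_ofFn.1 hA) r j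
  · rw [cxElt_eq_cxTuple f l r A.get (List.ofFn_get A).symm]
    exact grX_mul_cxTuple_of_ne f l r fun j e => hi (e ▸ A.get_mem j)

theorem grC_mul_cxElt (h : IsOddMonic f l) {A : List (Fin (N + 1))} (hA : A.Nodup) {r : ℕ}
    (hr : Even ((A.length - 1) * l + r)) (i : Fin (N + 1)) :
    grC f i * cxElt f l A r = cxElt f l A r * grC f i := by
  by_cases hi : i ∈ A
  · obtain ⟨m, hm⟩ : ∃ m, A.length = m + 1 :=
      ⟨A.length - 1, by have := List.length_pos_of_mem hi; omega⟩
    obtain ⟨a, rfl⟩ := List.exists_eq_ofFn hm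
    obtain ⟨j, rfl⟩ := List.mem_ofFn.1 hi
    rw [cxElt_eq_cxTuple f l r a rfl]
    refine grC_mul_cxTuple h (List.nodup_ofFn.1 hA) ?_ j
    simpa using hr
  · rw [cxElt_eq_cxTuple f l r A.get (List.ofFn_get A).symm]
    exact grC_mul_cxTuple_of_ne f l r fun j e => hi (e ▸ A.get_mem j)

theorem grPerm_mul_cxElt (f : Polynomial R) (l : ℕ) (A : List (Fin (N + 1))) (r : ℕ)
    (τ : Equiv.Perm (Fin (N + 1))) :
    grPerm f τ * cxElt f l A r = cxElt f l (A.map τ) r * grPerm f τ := by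
  rw [cxElt_eq_cxTuple f l r A.get (List.ofFn_get A).symm, grPerm_mul_cxTuple,
    cxElt_eq_cxTuple f l r (fun j => τ (A.get j))]
  conv_lhs => rw [← List.ofFn_get A]
  rw [List.map_ofFn]
  rfl

end CXElements

/-! ### Leading forms: the part of a CX-product without Clifford generators. -/

section LeadingForm

/-- Extension of a family indexed by the entries of a tuple. -/
def spread {n m : ℕ} {M : Type*} [AddCommMonoid M] (a : Fin n → Fin m) (v : Fin n → M) :
    Fin m → M := ∑ j, Pi.single (a j) (v j)

section Spread

variable {n m : ℕ} {M : Type*} [AddCommMonoid M] {a : Fin n → Fin m}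

theorem spread_apply (ha : Function.Injective a) (v : Fin n → M) (j : Fin n) :
    spread a v (a j) = v j := by
  rw [spread, Finset.sum_apply, Finset.sum_eq_single j]
  · simp
  · intro k _ hk
    rw [Pi.single_eq_of_ne]
    exact fun e => hk (ha e).symm
  · simp

theorem spread_apply_of_ne (v : Fin n → M) {i : Fin m} (hi : ∀ j, a j ≠ i) :
    spread a v i = 0 := by
  rw [spread, Finset.sum_apply]
  exact Finset.sum_eq_zero fun j _ => Pi.single_eq_of_ne (hi j).symm _

theorem xMon_comp {A : Type*} [Monoid A] {X : Fin m → A} (hX : ∀ i j, X i * X j = X j * X i)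
    (a : Fin n → Fin m) (e : Fin n → ℕ) : xMon (fun j => X (a j)) e = xMon X (spread a e) := by
  induction n with
  | zero => simp [spread, xMon]
  | succ n ih =>
    rw [spread, Fin.sum_univ_succ, ← xMon_mul_xMon hX, xMon_single hX]
    have := ih (fun j => a j.succ) fun j => e j.succ
    rw [spread] at this
    rw [← this, xMon, List.ofFn_succ, List.prod_cons, xMon]

theorem IsClifford.cMon_single {A : Type*} [Ring A] {C : Fin m → A} (hC : IsClifford C)
    (i : Fin m) (b : ZMod 2) : cMon C (Pi.single i b) = C i ^ b.val := by
  have h1 := hC.mul_cMon i 0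
  have h2 : leftExp (0 : Fin m → ZMod 2) i = 0 := by simp [leftExp]
  rw [h2, pow_zero, one_mul, cMon_zero, mul_one, zero_add] at h1
  fin_cases b
  · change cMon C (Pi.single i 0) = C i ^ 0
    rw [Pi.single_zero, cMon_zero, pow_zero]
  · change cMon C (Pi.single i 1) = C i ^ 1
    rw [← h1, pow_one]

theorem IsClifford.cMon_comp {A : Type*} [Ring A] {C : Fin m → A} (hC : IsClifford C)
    (a : Fin n → Fin m) (γ : Fin n → ZMod 2) :
    SgnEq (cMon (fun j => C (a j)) γ) (cMon C (spread a γ)) := by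
  induction n with
  | zero => simpa [spread, cMon] using SgnEq.refl _
  | succ n ih =>
    rw [spread, Fin.sum_univ_succ]
    refine SgnEq.trans ?_ (hC.cMon_mul_cMon_sgnEq _ _)
    have := ih (fun j => a j.succ) fun j => γ j.succ
    rw [spread] at this
    rw [hC.cMon_single, cMon, List.ofFn_succ, List.prod_cons]
    exact this.mul_left _

end Spread

variable {R : Type*} [CommRing R] {N : ℕ} {f : Polynomial R} {l : ℕ}
  {p q s : (Fin (N + 1) → ℕ) → Equiv.Perm (Fin (N + 1)) → (Fin (N + 1) → ZMod 2) → Prop}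

theorem mul_mem_grSpan
    (h : ∀ α w β α' w' β', p α w β → q α' w' β' →
      s (α + fun i => α' (w⁻¹ i)) (w * w') ((fun i => β (w' i)) + β'))
    {y z : GrSergeev (N + 1) f} (hy : y ∈ grSpan f p) (hz : z ∈ grSpan f q) :
    y * z ∈ grSpan f s := by
  refine map_mem_of_grSpan (φ := LinearMap.mulRight R z) (fun α w β h1 => ?_) hy
  refine map_mem_of_grSpan (φ := LinearMap.mulLeft R (grMon f α w β)) (fun α' w' β' h2 => ?_) hz
  exact (grMon_mul_grMon f α α' w w' β β').mem (grMon_mem_grSpan (h _ _ _ _ _ _ h1 h2))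

/-- The term γ = 0 has trivial signs and gives the leading form; every other term has a nonzero
Clifford exponent because the entries are distinct. -/
theorem cxTuple_sub_mem (f : Polynomial R) (l : ℕ) {n : ℕ} {a : Fin n → Fin (N + 1)}
    (ha : Function.Injective a) (r : ℕ) :
    cxTuple f l a r - ∑ e ∈ Finset.piAntidiag Finset.univ ((n - 1) * (l - 1) + r),
      grMon f (spread a e) (List.ofFn a).formPerm 0 ∈
    grSpan f fun _ w β => w = (List.ofFn a).formPerm ∧ β ≠ 0 ∧
      ∃ γ : Fin n → ZMod 2, Even (wt γ) ∧ β = spread a γ := by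
  classical
  have h0 : (0 : Fin n → ZMod 2) ∈ Finset.univ.filter fun γ : Fin n → ZMod 2 => Even (wt γ) :=
    Finset.mem_filter.2 ⟨Finset.mem_univ _, by simp [wt]⟩
  have h1 : (-1) ^ tauExp (0 : Fin n → ZMod 2) * cxTerm f l a r 0 =
      ∑ e ∈ Finset.piAntidiag Finset.univ ((n - 1) * (l - 1) + r),
        grMon f (spread a e) (List.ofFn a).formPerm 0 := by
    have e1 : tauExp (0 : Fin n → ZMod 2) = 0 := by simp [tauExp, wt]
    have e2 : cxVar f a 0 = fun j => grX f (a j) := by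
      funext j
      simp [cxVar, epsExp]
    rw [e1, pow_zero, one_mul, cxTerm, IsClifford.cMon_zero, mul_one, hSum, e2, Finset.sum_mul]
    refine Finset.sum_congr rfl fun e _ => ?_
    rw [xMon_comp (grX_comm f), grMon, IsClifford.cMon_zero, mul_one]
  rw [cxTuple, ← Finset.add_sum_erase _ _ h0, h1, add_sub_cancel_left]
  refine Submodule.sum_mem _ fun γ hγ => ?_
  obtain ⟨hγ0, hγ⟩ := Finset.mem_erase.1 hγ
  refine (SgnEq.pow_neg_one _ _).mem ?_
  rw [cxTerm, hSum, Finset.sum_mul, Finset.sum_mul]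
  refine Submodule.sum_mem _ fun e _ => ?_
  have h3 : SgnEq (xMon (cxVar f a γ) e * grPerm f (List.ofFn a).formPerm *
      cMon (fun j => grC f (a j)) γ) (grMon f (spread a e) (List.ofFn a).formPerm (spread a γ)) := by
    rw [grMon]
    refine SgnEq.mul (SgnEq.mul_right ?_ _) ((isClifford_grC f).cMon_comp a γ)
    have : cxVar f a γ = fun j => (-1) ^ epsExp γ j * grX f (a j) := rfl
    rw [this, xMon_neg_one_pow_mul (epsExp γ) (fun j => grX f (a j)), xMon_comp (grX_comm f)]
    exact SgnEq.pow_neg_one _ _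
  refine h3.mem (grMon_mem_grSpan ⟨rfl, fun h4 => hγ0 ?_, γ, (Finset.mem_filter.1 hγ).2, rfl⟩)
  funext j
  rw [← spread_apply ha γ j, h4]
  rfl

/-- Non-reduced exponents are included in S; their monomials are zero in the graded algebra, so they
do no harm. -/
theorem cxElt_leading_form (f : Polynomial R) (l : ℕ) {A : List (Fin (N + 1))} (hA : A.Nodup)
    (r : ℕ) : ∃ S : Finset (Fin (N + 1) → ℕ),
    (∀ α, α ∈ S ↔ ∑ i ∈ A.toFinset, α i = (A.length - 1) * (l - 1) + r ∧ ∀ i ∉ A, α i = 0) ∧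
    cxElt f l A r - ∑ α ∈ S, grMon f α A.formPerm 0 ∈
      grSpan f fun _ w β => w = A.formPerm ∧ β ≠ 0 ∧ (∀ i ∉ A, β i = 0) ∧ (A.map β).sum = 0 := by
  classical
  obtain ⟨a, hAa⟩ := List.exists_eq_ofFn (A := A) rfl
  have ha : Function.Injective a := by
    rw [hAa] at hA
    exact List.nodup_ofFn.1 hA
  have hmem : ∀ i, i ∈ A ↔ ∃ j, a j = i := fun i => by
    conv_lhs => rw [hAa]
    exact List.mem_ofFn
  have hfin : A.toFinset = Finset.univ.image a := by
    ext i
    simp [hmem]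
  have hsum : ∀ α : Fin (N + 1) → ℕ, ∑ i ∈ A.toFinset, α i = ∑ j, α (a j) := fun α => by
    rw [hfin, Finset.sum_image fun _ _ _ _ e => ha e]
  have hlead := cxTuple_sub_mem f l ha r
  rw [← cxElt_eq_cxTuple f l r a hAa, ← hAa] at hlead
  refine ⟨(Finset.piAntidiag Finset.univ ((A.length - 1) * (l - 1) + r)).image (spread a),
    fun α => ?_, ?_⟩
  · rw [Finset.mem_image, hsum]
    constructor
    · rintro ⟨e, he, rfl⟩
      refine ⟨?_, fun i hi => spread_apply_of_ne e fun j hj => hi ((hmem i).2 ⟨j, hj⟩)⟩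
      simp only [spread_apply ha]
      exact (Finset.mem_piAntidiag.1 he).1
    · rintro ⟨h1, h2⟩
      refine ⟨fun j => α (a j), Finset.mem_piAntidiag.2 ⟨h1, fun _ _ => Finset.mem_univ _⟩, ?_⟩
      funext i
      by_cases hi : i ∈ A
      · obtain ⟨j, rfl⟩ := (hmem i).1 hi
        rw [spread_apply ha]
      · rw [h2 i hi, spread_apply_of_ne _ fun j hj => hi ((hmem i).2 ⟨j, hj⟩)]
  · rw [Finset.sum_image]
    · refine grSpan_mono ?_ hlead
      rintro _ w β ⟨hw, hβ, γ, hγ, rfl⟩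
      refine ⟨hw, hβ, fun i hi => spread_apply_of_ne γ fun j hj => hi ((hmem i).2 ⟨j, hj⟩), ?_⟩
      have e1 : (A.map (spread a γ)).sum = ∑ j, γ j := by
        have e2 : A.map (spread a γ) = List.ofFn γ := by
          refine (congrArg (List.map (spread a γ)) hAa).trans ?_
          rw [List.map_ofFn]
          exact congrArg _ (funext fun j => spread_apply ha γ j)
        rw [e2, List.sum_ofFn]
      rw [e1]
      have e3 := (ZMod.natCast_eq_zero_iff_even (n := wt γ)).2 hγ
      rw [wt] at e3
      push_cast at e3
      simpa using e3
    · intro e _ e' _ h1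
      funext j
      rw [← spread_apply ha e j, ← spread_apply ha e' j, h1]

/-- The permutation underlying a product of CX-cycles. -/
def cxPerm {n : ℕ} (L : List (List (Fin n) × ℕ)) : Equiv.Perm (Fin n) :=
  (L.map fun p => p.1.formPerm).prod

theorem cxPerm_apply_of_notMem {n : ℕ} {L : List (List (Fin n) × ℕ)} {i : Fin n}
    (hi : i ∉ (L.map Prod.fst).flatten) : cxPerm L i = i := by
  induction L with
  | nil => rfl
  | cons p L ih =>
    rw [List.map_cons, List.flatten_cons, List.mem_append, not_or] at hi
    rw [cxPerm, List.map_cons, List.prod_cons, Equiv.Perm.mul_apply]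
    change p.1.formPerm (cxPerm L i) = i
    rw [ih hi.2, List.formPerm_apply_of_notMem hi.1]

/-- The factors live on disjoint index sets, so their leading forms multiply without overlap and
every exponent occurs once. -/
theorem cxProd_leading_form (f : Polynomial R) (l : ℕ) {L : List (List (Fin (N + 1)) × ℕ)}
    (hL : (L.map Prod.fst).flatten.Nodup) : ∃ S : Finset (Fin (N + 1) → ℕ),
    (∀ α, α ∈ S ↔ (∀ p ∈ L, ∑ i ∈ p.1.toFinset, α i = (p.1.length - 1) * (l - 1) + p.2) ∧
      ∀ i ∉ (L.map Prod.fst).flatten, α i = 0) ∧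
    (L.map fun p => cxElt f l p.1 p.2).prod - ∑ α ∈ S, grMon f α (cxPerm L) 0 ∈
      grSpan f fun _ w β => w = cxPerm L ∧ β ≠ 0 ∧
        (∀ i ∉ (L.map Prod.fst).flatten, β i = 0) ∧ ∀ p ∈ L, (p.1.map β).sum = 0 := by
  classical
  induction L with
  | nil =>
    refine ⟨{0}, fun α => ?_, ?_⟩
    · simp [funext_iff]
    · have : cxPerm ([] : List (List (Fin (N + 1)) × ℕ)) = 1 := rfl
      rw [this, Finset.sum_singleton, grMon_zero_one_zero]
      change (1 : GrSergeev (N + 1) f) - 1 ∈ _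
      rw [sub_self]
      exact zero_mem _
  | cons p L ih =>
    obtain ⟨A, r⟩ := p
    rw [List.map_cons, List.flatten_cons, List.nodup_append'] at hL
    obtain ⟨hA, hL, hd⟩ := hL
    obtain ⟨S₂, hS₂, hm₂⟩ := ih hL
    obtain ⟨S₁, hS₁, hm₁⟩ := cxElt_leading_form f l hA r
    set B := (L.map Prod.fst).flatten with hB
    have hpB : ∀ p ∈ L, ∀ i ∈ p.1, i ∈ B := fun p hp i hi =>
      List.mem_flatten.2 ⟨p.1, List.mem_map_of_mem hp, hi⟩
    have hperm : cxPerm ((A, r) :: L) = A.formPerm * cxPerm L := rfl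
    have hfixB : ∀ β : Fin (N + 1) → ZMod 2, (∀ i ∉ A, β i = 0) →
        (fun i => β (cxPerm L i)) = β := by
      intro β hβ
      funext i
      by_cases hi : i ∈ B
      · have hi' : cxPerm L i ∈ B := by
          by_contra hcon
          have := cxPerm_apply_of_notMem hcon
          exact hcon (by rwa [(cxPerm L).injective this])
        rw [hβ _ fun h => hd h hi', hβ _ fun h => hd h hi]
      · rw [cxPerm_apply_of_notMem hi]
    have hfixA : ∀ α : Fin (N + 1) → ℕ, (∀ i ∉ B, α i = 0) →
        (fun i => α (A.formPerm⁻¹ i)) = α := by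
      intro α hα
      funext i
      by_cases hi : i ∈ A
      · rw [hα _ fun h => hd (List.formPerm_inv_mem hi) h, hα _ fun h => hd hi h]
      · have : A.formPerm⁻¹ i = i := by
          rw [Equiv.Perm.inv_eq_iff_eq, List.formPerm_apply_of_notMem hi]
        rw [this]
    have hmapA : ∀ β : Fin (N + 1) → ZMod 2, (∀ i ∉ B, β i = 0) → (A.map β).sum = 0 := by
      intro β hβ
      refine List.sum_eq_zero fun b hb => ?_
      obtain ⟨i, hi, rfl⟩ := List.mem_map.1 hb
      exact hβ i fun h => hd hi h
    have hmapL : ∀ β : Fin (N + 1) → ZMod 2, (∀ i ∉ A, β i = 0) →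
        ∀ p ∈ L, (p.1.map β).sum = 0 := by
      intro β hβ p hp
      refine List.sum_eq_zero fun b hb => ?_
      obtain ⟨i, hi, rfl⟩ := List.mem_map.1 hb
      exact hβ i fun h => hd h (hpB p hp i hi)
    have hadd : ∀ (C : List (Fin (N + 1))) (β β' : Fin (N + 1) → ZMod 2),
        (C.map (β + β')).sum = (C.map β).sum + (C.map β').sum := fun C β β' => by
      rw [← List.sum_map_add]
      rfl
    -- The supports of β and β' lie in disjoint sets. Hence β is unchanged by the other permutation,
    -- and the sum is zero only if both summands are: mixed products never enter the leading form.
    have hcomb : ∀ {α α' : Fin (N + 1) → ℕ} {w w' : Equiv.Perm (Fin (N + 1))}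
        {β β' : Fin (N + 1) → ZMod 2}, w = A.formPerm → w' = cxPerm L → (∀ i ∉ A, β i = 0) →
        (A.map β).sum = 0 → (∀ i ∉ B, β' i = 0) → (∀ p ∈ L, (p.1.map β').sum = 0) →
        (β ≠ 0 ∨ β' ≠ 0) →
        w * w' = cxPerm ((A, r) :: L) ∧ (fun i => β (w' i)) + β' ≠ 0 ∧
          (∀ i ∉ (((A, r) :: L).map Prod.fst).flatten, ((fun i => β (w' i)) + β') i = 0) ∧
          ∀ p ∈ (A, r) :: L, (p.1.map ((fun i => β (w' i)) + β')).sum = 0 := by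
      rintro α α' w w' β β' rfl rfl h1 h2 h3 h4 h5
      rw [hfixB β h1]
      refine ⟨hperm.symm, fun h0 => ?_, fun i hi => ?_, fun p hp => ?_⟩
      · have hz : ∀ i, β i = 0 ∧ β' i = 0 := by
          intro i
          have h6 := congrFun h0 i
          rw [Pi.add_apply, Pi.zero_apply] at h6
          by_cases hi : i ∈ A
          · have := h3 i fun h => hd hi h
            rw [this, add_zero] at h6
            exact ⟨h6, this⟩
          · have := h1 i hi
            rw [this, zero_add] at h6
            exact ⟨this, h6⟩
        rcases h5 with h5 | h5
        · exact h5 (funext fun i => (hz i).1)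
        · exact h5 (funext fun i => (hz i).2)
      · rw [List.map_cons, List.flatten_cons, List.mem_append, not_or] at hi
        rw [Pi.add_apply, h1 i hi.1, h3 i hi.2, add_zero]
      · rw [hadd]
        rcases List.mem_cons.1 hp with rfl | hp
        · rw [h2, hmapA β' h3, add_zero]
        · rw [hmapL β h1 p hp, h4 p hp, add_zero]
    have hdec : ∀ q ∈ S₁ ×ˢ S₂, (∀ i ∉ A, q.1 i = 0) ∧ (∀ i ∉ B, q.2 i = 0) := fun q hq =>
      ⟨((hS₁ _).1 (Finset.mem_product.1 hq).1).2, ((hS₂ _).1 (Finset.mem_product.1 hq).2).2⟩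
    refine ⟨(S₁ ×ˢ S₂).image fun q => q.1 + q.2, fun α => ?_, ?_⟩
    · rw [Finset.mem_image]
      constructor
      · rintro ⟨q, hq, rfl⟩
        obtain ⟨h1, h2⟩ := hdec q hq
        obtain ⟨hq1, hq2⟩ := Finset.mem_product.1 hq
        refine ⟨fun p hp => ?_, fun i hi => ?_⟩
        · simp only [Pi.add_apply]
          rw [Finset.sum_add_distrib]
          rcases List.mem_cons.1 hp with rfl | hp
          · rw [((hS₁ _).1 hq1).1, Finset.sum_eq_zero fun i hi =>
              h2 i fun h => hd (List.mem_toFinset.1 hi) h, add_zero]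
          · rw [((hS₂ _).1 hq2).1 p hp, Finset.sum_eq_zero fun i hi =>
              h1 i fun h => hd h (hpB p hp i (List.mem_toFinset.1 hi)), zero_add]
        · rw [List.map_cons, List.flatten_cons, List.mem_append, not_or] at hi
          rw [Pi.add_apply, h1 i hi.1, h2 i hi.2]
      · rintro ⟨h1, h2⟩
        refine ⟨(fun i => if i ∈ A then α i else 0, fun i => if i ∈ B then α i else 0),
          Finset.mem_product.2 ⟨(hS₁ _).2 ⟨?_, fun i hi => if_neg hi⟩,
            (hS₂ _).2 ⟨fun p hp => ?_, fun i hi => if_neg hi⟩⟩, ?_⟩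
        · rw [← h1 (A, r) (by simp)]
          exact Finset.sum_congr rfl fun i hi => if_pos (List.mem_toFinset.1 hi)
        · rw [← h1 p (List.mem_cons_of_mem _ hp)]
          exact Finset.sum_congr rfl fun i hi => if_pos (hpB p hp i (List.mem_toFinset.1 hi))
        · funext i
          simp only [Pi.add_apply]
          by_cases hA' : i ∈ A
          · rw [if_pos hA', if_neg fun h => hd hA' h, add_zero]
          · by_cases hB' : i ∈ B
            · rw [if_neg hA', if_pos hB', zero_add]
            · rw [if_neg hA', if_neg hB', h2 i]
              rw [List.map_cons, List.flatten_cons, List.mem_append]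
              exact not_or.2 ⟨hA', hB'⟩
    · rw [Finset.sum_image]
      · have e1 : ∑ q ∈ S₁ ×ˢ S₂, grMon f (q.1 + q.2) (cxPerm ((A, r) :: L)) 0 =
            (∑ α ∈ S₁, grMon f α A.formPerm 0) * ∑ α ∈ S₂, grMon f α (cxPerm L) 0 := by
          rw [Finset.sum_mul_sum, ← Finset.sum_product']
          refine Finset.sum_congr rfl fun q hq => ?_
          rw [grMon_zero_mul_grMon, hfixA _ (hdec q hq).2, hperm]
        have hl₁ : ∑ α ∈ S₁, grMon f α A.formPerm 0 ∈
            grSpan f fun _ w β => w = A.formPerm ∧ β = 0 :=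
          Submodule.sum_mem _ fun α _ => grMon_mem_grSpan ⟨rfl, rfl⟩
        have hl₂ : ∑ α ∈ S₂, grMon f α (cxPerm L) 0 ∈
            grSpan f fun _ w β => w = cxPerm L ∧ β = 0 :=
          Submodule.sum_mem _ fun α _ => grMon_mem_grSpan ⟨rfl, rfl⟩
        have hz : ∀ C : List (Fin (N + 1)), (C.map (0 : Fin (N + 1) → ZMod 2)).sum = 0 :=
          fun C => List.sum_eq_zero fun b hb => by
            obtain ⟨i, -, rfl⟩ := List.mem_map.1 hb
            rfl
        rw [e1]
        set y₁ := ∑ α ∈ S₁, grMon f α A.formPerm 0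
        set y₂ := ∑ α ∈ S₂, grMon f α (cxPerm L) 0
        have e2 : cxElt f l A r * (L.map fun p => cxElt f l p.1 p.2).prod - y₁ * y₂ =
            y₁ * ((L.map fun p => cxElt f l p.1 p.2).prod - y₂) + ((cxElt f l A r - y₁) * y₂ +
              (cxElt f l A r - y₁) * ((L.map fun p => cxElt f l p.1 p.2).prod - y₂)) := by
          noncomm_ring
        change cxElt f l A r * (L.map fun p => cxElt f l p.1 p.2).prod - y₁ * y₂ ∈ _
        rw [e2]
        refine add_mem (mul_mem_grSpan ?_ hl₁ hm₂) (add_mem (mul_mem_grSpan ?_ hm₁ hl₂)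
          (mul_mem_grSpan ?_ hm₁ hm₂))
        · rintro α w β α' w' β' ⟨h1, rfl⟩ ⟨h2, h3, h4, h5⟩
          exact hcomb (α := α) (α' := α') h1 h2 (fun _ _ => rfl) (hz A) h4 h5 (Or.inr h3)
        · rintro α w β α' w' β' ⟨h2, h3, h4, h5⟩ ⟨h1, rfl⟩
          exact hcomb (α := α) (α' := α') h2 h1 h4 h5 (fun _ _ => rfl) (fun p _ => hz p.1)
            (Or.inl h3)
        · rintro α w β α' w' β' ⟨h2, h3, h4, h5⟩ ⟨h1, h6, h7, h8⟩
          exact hcomb (α := α) (α' := α') h2 h1 h4 h5 h7 h8 (Or.inl h3)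
      · intro q hq q' hq' h1
        have h1 : q.1 + q.2 = q'.1 + q'.2 := h1
        obtain ⟨hq1, hq2⟩ := hdec q hq
        obtain ⟨hq1', hq2'⟩ := hdec q' hq'
        have h3 : ∀ i, q.1 i = q'.1 i ∧ q.2 i = q'.2 i := by
          intro i
          have h2 := congrFun h1 i
          simp only [Pi.add_apply] at h2
          by_cases hi : i ∈ A
          · have hi' : i ∉ B := fun h => hd hi h
            rw [hq2 i hi', hq2' i hi'] at h2 ⊢
            exact ⟨h2, rfl⟩
          · rw [hq1 i hi, hq1' i hi, zero_add, zero_add] at h2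
            exact ⟨by rw [hq1 i hi, hq1' i hi], h2⟩
        exact Prod.ext (funext fun i => (h3 i).1) (funext fun i => (h3 i).2)

end LeadingForm

/-! ### Combinatorics of CX-families and cycle types. -/

section CycleData

variable {n l : ℕ} {L L' : List (List (Fin n) × ℕ)}

theorem cxPerm_apply (hL : (L.map Prod.fst).flatten.Nodup) {p : List (Fin n) × ℕ} (hp : p ∈ L)
    {i : Fin n} (hi : i ∈ p.1) : cxPerm L i = p.1.formPerm i := by
  induction L with
  | nil => simp at hp
  | cons q L ih =>
    rw [List.map_cons, List.flatten_cons, List.nodup_append'] at hL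
    obtain ⟨-, hL, hd⟩ := hL
    change q.1.formPerm (cxPerm L i) = _
    rcases List.mem_cons.1 hp with rfl | hp
    · rw [cxPerm_apply_of_notMem fun h => hd hi h]
    · rw [ih hL hp, List.formPerm_apply_of_notMem]
      exact fun h => hd h (List.mem_flatten.2 ⟨p.1, List.mem_map_of_mem hp,
        List.formPerm_apply_mem_of_mem hi⟩)

theorem IsCXFamily.isCycleFamily (hL : IsCXFamily l L) :
    IsCycleFamily (L.map Prod.fst) (cxPerm L) where
  nodup := hL.disjoint
  cover := hL.cover
  apply_eq A hA i hi := by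
    obtain ⟨p, hp, rfl⟩ := List.mem_map.1 hA
    exact cxPerm_apply hL.disjoint hp hi

theorem IsCycleFamily.eq {Ls : List (List (Fin n))} {w w' : Equiv.Perm (Fin n)}
    (h : IsCycleFamily Ls w) (h' : IsCycleFamily Ls w') : w = w' := by
  ext i
  obtain ⟨A, hA, hi⟩ := List.mem_flatten.1 (h.cover i)
  rw [h.apply_eq A hA i hi, h'.apply_eq A hA i hi]

theorem IsCXFamily.nodup (hL : IsCXFamily l L) {p : List (Fin n) × ℕ} (hp : p ∈ L) :
    p.1.Nodup := (List.nodup_flatten.1 hL.disjoint).1 _ (List.mem_map_of_mem hp)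

theorem IsCXFamily.exists_mem (hL : IsCXFamily l L) (i : Fin n) : ∃ p ∈ L, i ∈ p.1 := by
  obtain ⟨A, hA, hi⟩ := List.mem_flatten.1 (hL.cover i)
  obtain ⟨p, hp, rfl⟩ := List.mem_map.1 hA
  exact ⟨p, hp, hi⟩

/-- Two disjoint cycles of the same permutation that meet have the same entries. -/
theorem subset_of_formPerm {A B : List (Fin n)} {w : Equiv.Perm (Fin n)} (hA : A.Nodup)
    (hwA : ∀ i ∈ A, w i = A.formPerm i) (hwB : ∀ i ∈ B, w i = B.formPerm i) {i : Fin n}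
    (hiA : i ∈ A) (hiB : i ∈ B) : A ⊆ B := by
  intro j hj
  -- The indicator function of B is invariant under w, hence constant along the cycle A.
  have h1 := eq_of_formPerm (A := ℤ) (g := fun i => if i ∈ B then 1 else 0) hA (fun k hk => by
    simp only [← hwA k hk, apply_mem_iff_of_formPerm hwB]) hiA hj
  by_contra hjB
  simp [hiB, hjB] at h1

/-- The permutation determines the index sets of the cycles, and a common exponent then determines
the levels through the degrees. -/
theorem IsCXFamily.exists_match (hL : IsCXFamily l L) (hL' : IsCXFamily l L')
    (hw : cxPerm L = cxPerm L') {α : Fin n → ℕ}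
    (hα : ∀ p ∈ L, ∑ i ∈ p.1.toFinset, α i = (p.1.length - 1) * (l - 1) + p.2)
    (hα' : ∀ p ∈ L', ∑ i ∈ p.1.toFinset, α i = (p.1.length - 1) * (l - 1) + p.2)
    {p : List (Fin n) × ℕ} (hp : p ∈ L) :
    ∃ p' ∈ L', p'.1.toFinset = p.1.toFinset ∧ p'.1.length = p.1.length ∧ p'.2 = p.2 := by
  obtain ⟨i, hi⟩ := List.exists_mem_of_ne_nil _ (hL.ne_nil p hp)
  obtain ⟨p', hp', hi'⟩ := hL'.exists_mem i
  have h1 : ∀ i ∈ p.1, cxPerm L i = p.1.formPerm i := fun i hi => cxPerm_apply hL.disjoint hp hi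
  have h2 : ∀ i ∈ p'.1, cxPerm L i = p'.1.formPerm i := fun i hi => by
    rw [hw, cxPerm_apply hL'.disjoint hp' hi]
  have h3 : p'.1.toFinset = p.1.toFinset := by
    ext j
    rw [List.mem_toFinset, List.mem_toFinset]
    exact ⟨fun h => subset_of_formPerm (hL'.nodup hp') h2 h1 hi' hi h,
      fun h => subset_of_formPerm (hL.nodup hp) h1 h2 hi hi' h⟩
  have h4 : p'.1.length = p.1.length := by
    rw [← List.toFinset_card_of_nodup (hL.nodup hp), ← h3,
      List.toFinset_card_of_nodup (hL'.nodup hp')]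
  refine ⟨p', hp', h3, h4, ?_⟩
  have h5 := hα p hp
  rw [← h3, hα' p' hp', h4] at h5
  omega

/-- The lengths and levels of the factors of a product of CX-cycles. -/
def cxData (L : List (List (Fin n) × ℕ)) : List (ℕ × ℕ) := L.map fun p => (p.1.length, p.2)

theorem hasCycleType_iff {lam : Multipartition l n} : HasCycleType L lam ↔
    ∀ r : Fin l, lam.parts r =
      ((((cxData L).filter fun q => q.2 = (r : ℕ)).map Prod.fst : List ℕ) : Multiset ℕ) := by
  have : ∀ r : ℕ, ((cxData L).filter fun q => q.2 = r).map Prod.fst =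
      (L.filter fun p => p.2 = r).map fun p => p.1.length := fun r => by
    rw [cxData, List.filter_map, List.map_map]
    rfl
  simp only [HasCycleType, this]

theorem HasCycleType.of_perm {lam : Multipartition l n} (h : HasCycleType L lam)
    (hd : (cxData L).Perm (cxData L')) : HasCycleType L' lam := by
  rw [hasCycleType_iff] at h ⊢
  intro r
  rw [h r]
  exact Multiset.coe_eq_coe.2 ((hd.filter _).map _)

/-- The cycle type only records levels below l. The bound in `IsCXFamily` makes the counts at other
levels vanish on both sides. -/
theorem HasCycleType.perm {lam : Multipartition l n} (hL : IsCXFamily l L)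
    (hL' : IsCXFamily l L') (h : HasCycleType L lam) (h' : HasCycleType L' lam) :
    (cxData L).Perm (cxData L') := by
  rw [List.perm_iff_count]
  rintro ⟨a, r⟩
  by_cases hr : r < l
  · have key : ∀ D : List (ℕ × ℕ), D.count (a, r) =
        ((D.filter fun q => q.2 = r).map Prod.fst).count a := fun D => by
      rw [List.count, List.count, List.countP_map, List.countP_filter]
      refine List.countP_congr fun q _ => ?_
      simp [Prod.ext_iff]
    rw [key, key]
    refine List.Perm.count_eq ?_ a
    exact Multiset.coe_eq_coe.1 ((hasCycleType_iff.1 h ⟨r, hr⟩).symm.trans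
      (hasCycleType_iff.1 h' ⟨r, hr⟩))
  · have key : ∀ {L : List (List (Fin n) × ℕ)}, IsCXFamily l L → (cxData L).count (a, r) = 0 := by
      intro L hL
      rw [List.count_eq_zero]
      intro hm
      obtain ⟨p, hp, hpe⟩ := List.mem_map.1 hm
      have := hL.lt_level p hp
      rw [(Prod.ext_iff.1 hpe).2] at this
      exact hr this
    rw [key hL, key hL']

theorem HasCycleType.unique {lam mu : Multipartition l n} (h : HasCycleType L lam)
    (h' : HasCycleType L mu) : lam = mu := by
  have : lam.parts = mu.parts := funext fun r => (h r).trans (h' r).symm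
  cases lam
  cases mu
  simpa using this

theorem IsCXFamily.exists_hasCycleType (hL : IsCXFamily l L) :
    ∃ lam : Multipartition l n, HasCycleType L lam := by
  refine ⟨⟨fun r => (((L.filter fun p => p.2 = (r : ℕ)).map fun p => p.1.length : List ℕ) :
    Multiset ℕ), fun r a ha => ?_, ?_⟩, fun r => rfl⟩
  · obtain ⟨p, hp, rfl⟩ := List.mem_map.1 (Multiset.mem_coe.1 ha)
    exact List.length_pos_of_ne_nil (hL.ne_nil p (List.mem_filter.1 hp).1)
  · have h1 : ∀ L : List (List (Fin n) × ℕ), (∀ p ∈ L, p.2 < l) →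
        ∑ r : Fin l, ((L.filter fun p => p.2 = (r : ℕ)).map fun p => p.1.length).sum =
          (L.map fun p => p.1.length).sum := by
      intro L hL
      induction L with
      | nil => simp
      | cons p L ih =>
        rw [List.map_cons, List.sum_cons, ← ih fun q hq => hL q (List.mem_cons_of_mem _ hq)]
        have h2 : ∀ r : Fin l, (((p :: L).filter fun p => p.2 = (r : ℕ)).map
            fun p => p.1.length).sum = (if r = ⟨p.2, hL p (by simp)⟩ then p.1.length else 0) +
              ((L.filter fun p => p.2 = (r : ℕ)).map fun p => p.1.length).sum := by
          intro r
          by_cases hr : p.2 = r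
          · rw [List.filter_cons_of_pos (by simpa using hr), List.map_cons, List.sum_cons,
              if_pos (Fin.ext hr.symm)]
          · rw [List.filter_cons_of_neg (by simpa using hr), if_neg, zero_add]
            rintro rfl
            exact hr rfl
        simp only [h2, Finset.sum_add_distrib, Finset.sum_ite_eq', Finset.mem_univ, if_true]
    have h3 := h1 L hL.lt_level
    have h4 : (L.map fun p => p.1.length).sum = (L.map Prod.fst).flatten.length := by
      rw [List.length_flatten, List.map_map]
      rfl
    have h5 : (L.map Prod.fst).flatten.toFinset = Finset.univ :=
      Finset.eq_univ_of_forall fun i => List.mem_toFinset.2 (hL.cover i)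
    have h6 := List.toFinset_card_of_nodup hL.disjoint
    rw [h5, Finset.card_univ, Fintype.card_fin] at h6
    simp only [Multiset.sum_coe]
    rw [h3, h4, ← h6]

/-- The lists are compared through the pairs (index set, level). These are free of repetitions, as
the index sets are nonempty and disjoint. -/
theorem IsCXFamily.perm_of_match (hL : IsCXFamily l L) (hL' : IsCXFamily l L')
    (hw : cxPerm L = cxPerm L') {α : Fin n → ℕ}
    (hα : ∀ p ∈ L, ∑ i ∈ p.1.toFinset, α i = (p.1.length - 1) * (l - 1) + p.2)
    (hα' : ∀ p ∈ L', ∑ i ∈ p.1.toFinset, α i = (p.1.length - 1) * (l - 1) + p.2) :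
    (cxData L).Perm (cxData L') := by
  have hnd : ∀ {L : List (List (Fin n) × ℕ)}, IsCXFamily l L →
      (L.map fun p => (p.1.toFinset, p.2)).Nodup := by
    intro L hL
    have h1 : (L.map fun p => p.1.toFinset).Nodup := by
      have h2 := (List.nodup_flatten.1 hL.disjoint).2
      rw [List.pairwise_map] at h2
      rw [List.Nodup, List.pairwise_map]
      refine h2.imp_of_mem ?_
      intro p q hp hq hpq he
      obtain ⟨i, hi⟩ := List.exists_mem_of_ne_nil _ (hL.ne_nil p hp)
      exact hpq hi (List.mem_toFinset.1 (he ▸ List.mem_toFinset.2 hi))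
    refine List.Nodup.of_map Prod.fst ?_
    rw [List.map_map]
    exact h1
  have hdat : ∀ {L : List (List (Fin n) × ℕ)}, IsCXFamily l L →
      cxData L = (L.map fun p => (p.1.toFinset, p.2)).map fun q => (q.1.card, q.2) := by
    intro L hL
    rw [cxData, List.map_map]
    refine List.map_congr_left fun p hp => ?_
    simp [List.toFinset_card_of_nodup (hL.nodup hp)]
  rw [hdat hL, hdat hL']
  refine List.Perm.map _ ((List.perm_ext_iff_of_nodup (hnd hL) (hnd hL')).2 fun q => ?_)
  simp only [List.mem_map]
  constructor
  · rintro ⟨p, hp, rfl⟩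
    obtain ⟨p', hp', h1, -, h2⟩ := hL.exists_match hL' hw hα hα' hp
    exact ⟨p', hp', by rw [h1, h2]⟩
  · rintro ⟨p, hp, rfl⟩
    obtain ⟨p', hp', h1, -, h2⟩ := hL'.exists_match hL hw.symm hα' hα hp
    exact ⟨p', hp', by rw [h1, h2]⟩

theorem exists_perm_of_nodup_cover {F F' : List (Fin n)} (hF : F.Nodup) (hF' : F'.Nodup)
    (hc : ∀ i, i ∈ F) (hlen : F.length = F'.length) : ∃ τ : Equiv.Perm (Fin n), F.map τ = F' := by
  have hn : F.length = n := by
    have h5 : F.toFinset = Finset.univ :=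
      Finset.eq_univ_of_forall fun i => List.mem_toFinset.2 (hc i)
    rw [← List.toFinset_card_of_nodup hF, h5, Finset.card_univ, Fintype.card_fin]
  obtain ⟨a, rfl⟩ := List.exists_eq_ofFn hn
  obtain ⟨b, rfl⟩ := List.exists_eq_ofFn (hlen.symm.trans hn)
  have ha := Finite.injective_iff_bijective.1 (List.nodup_ofFn.1 hF)
  have hb := Finite.injective_iff_bijective.1 (List.nodup_ofFn.1 hF')
  refine ⟨(Equiv.ofBijective a ha).symm.trans (Equiv.ofBijective b hb), ?_⟩
  rw [List.map_ofFn]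
  congr 1
  funext j
  simp only [Function.comp_apply, Equiv.trans_apply, Equiv.ofBijective_apply]
  congr 1
  exact (Equiv.ofBijective a ha).symm_apply_apply j

/-- The action of permutations on products of CX-cycles. -/
def cxMap (τ : Equiv.Perm (Fin n)) (L : List (List (Fin n) × ℕ)) : List (List (Fin n) × ℕ) :=
  L.map fun p => (p.1.map τ, p.2)

theorem cxMap_flatten (τ : Equiv.Perm (Fin n)) (L : List (List (Fin n) × ℕ)) :
    ((cxMap τ L).map Prod.fst).flatten = (L.map Prod.fst).flatten.map τ := by
  rw [List.map_flatten, cxMap, List.map_map, List.map_map]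
  rfl

theorem cxData_cxMap (τ : Equiv.Perm (Fin n)) (L : List (List (Fin n) × ℕ)) :
    cxData (cxMap τ L) = cxData L := by
  rw [cxData, cxMap, List.map_map, cxData]
  simp

theorem IsCXFamily.map (hL : IsCXFamily l L) (τ : Equiv.Perm (Fin n)) :
    IsCXFamily l (cxMap τ L) where
  ne_nil p hp := by
    obtain ⟨q, hq, rfl⟩ := List.mem_map.1 hp
    simpa using hL.ne_nil q hq
  disjoint := by
    rw [cxMap_flatten]
    exact hL.disjoint.map τ.injective
  cover i := by
    rw [cxMap_flatten, List.mem_map]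
    exact ⟨τ⁻¹ i, hL.cover _, by simp⟩
  lt_level p hp := by
    obtain ⟨q, hq, rfl⟩ := List.mem_map.1 hp
    exact hL.lt_level q hq
  even p hp := by
    obtain ⟨q, hq, rfl⟩ := List.mem_map.1 hp
    simpa using hL.even q hq

/-- Once the factors are matched by length and level, sending one concatenated list of entries to
the other defines the relabelling. -/
theorem IsCXFamily.exists_cxMap_perm (hL : IsCXFamily l L) (hL' : IsCXFamily l L')
    (hd : (cxData L).Perm (cxData L')) : ∃ τ, (cxMap τ L).Perm L' := by
  -- M is a rearrangement of L' whose lengths and levels agree with those of L entry by entry.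
  obtain ⟨M, h1, hM⟩ : Relation.Comp (· = List.map (fun p : List (Fin n) × ℕ => (p.1.length, p.2)) ·)
      List.Perm (cxData L) L' := by
    rw [List.eq_map_comp_perm]
    exact hd
  have h2 : (L.map Prod.fst).map List.length = (M.map Prod.fst).map List.length := by
    have := congrArg (List.map Prod.fst) h1
    rw [cxData, List.map_map, List.map_map] at this
    rw [List.map_map, List.map_map]
    exact this
  have h3 : L.map Prod.snd = M.map Prod.snd := by
    have := congrArg (List.map Prod.snd) h1
    rw [cxData, List.map_map, List.map_map] at this
    exact this
  have h4 := (hM.map Prod.fst).flatten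
  obtain ⟨τ, hτ⟩ := exists_perm_of_nodup_cover hL.disjoint (h4.nodup_iff.2 hL'.disjoint) hL.cover
    (by rw [List.length_flatten, List.length_flatten, h2])
  refine ⟨τ, ?_⟩
  have h5 : (cxMap τ L).map Prod.fst = M.map Prod.fst := by
    rw [List.eq_iff_flatten_eq, cxMap_flatten, hτ, ← h2]
    refine ⟨rfl, ?_⟩
    rw [cxMap, List.map_map, List.map_map, List.map_map]
    simp [Function.comp_def]
  have h6 : (cxMap τ L).map Prod.snd = M.map Prod.snd := by
    rw [← h3, cxMap, List.map_map]
    rfl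
  have h7 : cxMap τ L = M := by
    have h8 : ∀ K : List (List (Fin n) × ℕ), K = (K.map Prod.fst).zip (K.map Prod.snd) := fun K => by
      simp [List.zip_map']
    rw [h8 (cxMap τ L), h5, h6, ← h8 M]
  rwa [h7]

theorem mul_cxPerm (τ : Equiv.Perm (Fin n)) (L : List (List (Fin n) × ℕ)) :
    τ * cxPerm L = cxPerm (cxMap τ L) * τ := by
  induction L with
  | nil => simp [cxPerm, cxMap]
  | cons p L ih =>
    have e1 : cxPerm (p :: L) = p.1.formPerm * cxPerm L := rfl
    have e2 : cxPerm (cxMap τ (p :: L)) = (p.1.map τ).formPerm * cxPerm (cxMap τ L) := rfl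
    rw [e1, e2, ← mul_assoc, List.formPerm_map_mul, mul_assoc, ih, mul_assoc]

/-- The level of a cycle is the excess of its degree over (a-1)(l-1). It is below l because each
exponent is at most l - 1, and the parity assumption is the CX-condition since l is odd. -/
theorem IsCycleFamily.exists_cxFamily {Ls : List (List (Fin n))} {w : Equiv.Perm (Fin n)}
    (hLs : IsCycleFamily Ls w) (hne : ∀ A ∈ Ls, A ≠ []) (hl : Odd l) {α : Fin n → ℕ}
    (hα : ∀ i, α i < l) (hle : ∀ A ∈ Ls, (A.length - 1) * (l - 1) ≤ ∑ i ∈ A.toFinset, α i)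
    (hev : ∀ A ∈ Ls, ¬Odd (∑ i ∈ A.toFinset, α i + (A.length - 1))) :
    ∃ L, IsCXFamily l L ∧ cxPerm L = w ∧
      ∀ p ∈ L, ∑ i ∈ p.1.toFinset, α i = (p.1.length - 1) * (l - 1) + p.2 := by
  set g : List (Fin n) → List (Fin n) × ℕ := fun A =>
    (A, ∑ i ∈ A.toFinset, α i - (A.length - 1) * (l - 1)) with hg
  have hfst : (Ls.map g).map Prod.fst = Ls := by
    rw [List.map_map]
    exact List.map_id _
  have hL : IsCXFamily l (Ls.map g) := by
    constructor
    · intro p hp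
      obtain ⟨A, hA, rfl⟩ := List.mem_map.1 hp
      exact hne A hA
    · rw [hfst]
      exact hLs.nodup
    · rw [hfst]
      exact hLs.cover
    · intro p hp
      obtain ⟨A, hA, rfl⟩ := List.mem_map.1 hp
      have h1 : ∑ i ∈ A.toFinset, α i ≤ A.length * (l - 1) := by
        refine (Finset.sum_le_card_nsmul _ _ (l - 1) fun i _ => by have := hα i; omega).trans ?_
        rw [smul_eq_mul]
        exact Nat.mul_le_mul_right _ (List.toFinset_card_le A)
      have h2 := List.length_pos_of_ne_nil (hne A hA)
      have h3 : A.length * (l - 1) = (A.length - 1) * (l - 1) + (l - 1) := by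
        obtain ⟨m, hm⟩ : ∃ m, A.length = m + 1 := ⟨A.length - 1, by omega⟩
        rw [hm, Nat.add_sub_cancel, Nat.add_mul, one_mul]
      have := hl.pos
      simp only [hg]
      omega
    · intro p hp
      obtain ⟨A, hA, rfl⟩ := List.mem_map.1 hp
      have h1 := Nat.not_odd_iff_even.1 (hev A hA)
      have h2 := hle A hA
      obtain ⟨k, hk⟩ := hl
      obtain ⟨q, hq⟩ := h1
      have h3 : (A.length - 1) * (l - 1) = 2 * ((A.length - 1) * k) := by
        rw [hk, Nat.add_sub_cancel]; ring
      have h4 : (A.length - 1) * l = 2 * ((A.length - 1) * k) + (A.length - 1) := by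
        rw [hk]; ring
      simp only [hg]
      rw [Nat.even_iff]
      omega
  refine ⟨Ls.map g, hL, ?_, fun p hp => ?_⟩
  · have := hL.isCycleFamily
    rw [hfst] at this
    exact this.eq hLs
  · obtain ⟨A, hA, rfl⟩ := List.mem_map.1 hp
    have := hle A hA
    simp only [hg]
    omega

theorem exists_exponents (hL : (L.map Prod.fst).flatten.Nodup) (hne : ∀ p ∈ L, p.1 ≠ [])
    (hlt : ∀ p ∈ L, p.2 < l) (hl : 1 ≤ l) : ∃ α : Fin n → ℕ, (∀ i, α i < l) ∧
    ∀ p ∈ L, ∑ i ∈ p.1.toFinset, α i = (p.1.length - 1) * (l - 1) + p.2 := by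
  induction L with
  | nil => exact ⟨fun _ => 0, fun _ => hl, by simp⟩
  | cons q L ih =>
    rw [List.map_cons, List.flatten_cons, List.nodup_append'] at hL
    obtain ⟨hA, hL, hd⟩ := hL
    obtain ⟨α, h1, h2⟩ := ih hL (fun p hp => hne p (List.mem_cons_of_mem _ hp))
      fun p hp => hlt p (List.mem_cons_of_mem _ hp)
    obtain ⟨A, r⟩ := q
    rcases A with _ | ⟨a, A⟩
    · exact absurd rfl (hne _ List.mem_cons_self)
    have hr : r < l := hlt _ List.mem_cons_self
    rw [List.nodup_cons] at hA
    -- The first entry of the cycle receives the level r and the others the maximal exponent l - 1.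
    refine ⟨fun i => if i = a then r else if i ∈ A then l - 1 else α i, fun i => ?_, fun p hp => ?_⟩
    · have := h1 i
      dsimp only
      split_ifs <;> omega
    · rcases List.mem_cons.1 hp with rfl | hp
      · rw [List.toFinset_cons, Finset.sum_insert (by simpa using hA.1), if_pos rfl,
          Finset.sum_congr rfl (g := fun _ => l - 1), Finset.sum_const,
          List.toFinset_card_of_nodup hA.2, smul_eq_mul, List.length_cons, Nat.add_sub_cancel,
          add_comm]
        intro i hi
        rw [List.mem_toFinset] at hi
        have hia : i ≠ a := by
          rintro rfl
          exact hA.1 hi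
        rw [if_neg hia, if_pos hi]
      · rw [← h2 p hp]
        refine Finset.sum_congr rfl fun i hi => ?_
        have hi' : i ∉ a :: A := fun h => hd h (List.mem_flatten.2
          ⟨p.1, List.mem_map_of_mem hp, List.mem_toFinset.1 hi⟩)
        rw [List.mem_cons, not_or] at hi'
        exact (if_neg hi'.1).trans (if_neg hi'.2)

/-- A family is a list without repetitions over the finite set of pairs of a repetition-free list
and a level below l. -/
theorem finite_cxFamilies (n l : ℕ) : {L : List (List (Fin n) × ℕ) | IsCXFamily l L}.Finite := by
  refine (Set.finite_range fun M : {M : List ({A : List (Fin n) // A.Nodup} × Fin l) // M.Nodup} =>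
    M.1.map fun q => (q.1.1, (q.2 : ℕ))).subset fun L hL => ?_
  set M := L.attach.map fun p : {p // p ∈ L} =>
    ((⟨p.1.1, hL.nodup p.2⟩ : {A : List (Fin n) // A.Nodup}), (⟨p.1.2, hL.lt_level _ p.2⟩ : Fin l))
    with hM
  have h1 : M.map (fun q => (q.1.1, (q.2 : ℕ))) = L := by
    rw [hM, List.map_map]
    exact List.attach_map_subtype_val L
  have h2 : L.Nodup := by
    refine List.Nodup.of_map (fun p => p.1) ?_
    have h3 := (List.nodup_flatten.1 hL.disjoint).2
    rw [List.pairwise_map] at h3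
    rw [List.Nodup, List.pairwise_map]
    refine h3.imp_of_mem ?_
    intro p q hp hq hpq he
    obtain ⟨i, hi⟩ := List.exists_mem_of_ne_nil _ (hL.ne_nil p hp)
    exact hpq hi (he ▸ hi)
  exact ⟨⟨M, List.Nodup.of_map _ (h1.symm ▸ h2)⟩, h1⟩

theorem finite_evMultipartitions (l n : ℕ) : (evMultipartitions l n).Finite := by
  refine ((finite_cxFamilies n l).biUnion (t := fun L => {lam : Multipartition l n |
    HasCycleType L lam}) fun L _ => Set.Subsingleton.finite fun lam h mu h' => h.unique h').subset ?_
  rintro lam ⟨L, hL, h⟩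
  exact Set.mem_biUnion hL h

end CycleData

/-! ### Products of CX-cycles and the basis of the centre. -/

section CXProducts

variable {R : Type*} [CommRing R] {N : ℕ} {f : Polynomial R} {l : ℕ}
  {L L' : List (List (Fin (N + 1)) × ℕ)}

/-- The product of the CX-cycles in a list. -/
noncomputable def cxProd (f : Polynomial R) (l : ℕ) (L : List (List (Fin (N + 1)) × ℕ)) :
    GrSergeev (N + 1) f := (L.map fun p => cxElt f l p.1 p.2).prod

/-- The exponents that occur in the leading form of a product of CX-cycles. -/
def IsCXExponent (l : ℕ) (L : List (List (Fin (N + 1)) × ℕ)) (α : Fin (N + 1) → ℕ) : Prop :=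
  ∀ p ∈ L, ∑ i ∈ p.1.toFinset, α i = (p.1.length - 1) * (l - 1) + p.2

theorem grX_mul_cxProd (h : IsOddMonic f l) (hL : IsCXFamily l L) (i : Fin (N + 1)) :
    grX f i * cxProd f l L = cxProd f l L * grX f i := by
  refine Commute.list_prod_right _ _ fun y hy => ?_
  obtain ⟨p, hp, rfl⟩ := List.mem_map.1 hy
  exact grX_mul_cxElt h (hL.nodup hp) p.2 i

theorem grC_mul_cxProd (h : IsOddMonic f l) (hL : IsCXFamily l L) (i : Fin (N + 1)) :
    grC f i * cxProd f l L = cxProd f l L * grC f i := by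
  refine Commute.list_prod_right _ _ fun y hy => ?_
  obtain ⟨p, hp, rfl⟩ := List.mem_map.1 hy
  exact grC_mul_cxElt h (hL.nodup hp) (hL.even p hp) i

theorem grPerm_mul_cxProd (f : Polynomial R) (l : ℕ) (L : List (List (Fin (N + 1)) × ℕ))
    (τ : Equiv.Perm (Fin (N + 1))) :
    grPerm f τ * cxProd f l L = cxProd f l (cxMap τ L) * grPerm f τ := by
  induction L with
  | nil => exact (mul_one _).trans (one_mul _).symm
  | cons p L ih =>
    have e1 : cxProd f l (p :: L) = cxElt f l p.1 p.2 * cxProd f l L := rfl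
    have e2 : cxProd f l (cxMap τ (p :: L)) =
      cxElt f l (p.1.map τ) p.2 * cxProd f l (cxMap τ L) := rfl
    rw [e1, e2, ← mul_assoc, grPerm_mul_cxElt, mul_assoc, ih, mul_assoc]

theorem cxProd_mem_grSpan (f : Polynomial R) (hL : IsCXFamily l L) :
    cxProd f l L ∈ grSpan f fun _ w β => w = cxPerm L ∧ ∀ p ∈ L, (p.1.map β).sum = 0 := by
  obtain ⟨S, -, h1⟩ := cxProd_leading_form f l hL.disjoint
  change cxProd f l L - _ ∈ _ at h1
  rw [← sub_add_cancel (cxProd f l L) (∑ α ∈ S, grMon f α (cxPerm L) 0)]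
  refine add_mem (grSpan_mono (fun α w β hh => ⟨hh.1, hh.2.2.2⟩) h1)
    (Submodule.sum_mem _ fun α _ => grMon_mem_grSpan ⟨rfl, fun p _ => ?_⟩)
  refine List.sum_eq_zero fun b hb => ?_
  obtain ⟨i, -, rfl⟩ := List.mem_map.1 hb
  rfl

-- The Clifford-free coefficients are those of the leading form, an indicator function; signs do not
-- appear.
open Classical in
theorem grCoef_cxProd (h : IsOddMonic f l) (hL : IsCXFamily l L) {α : Fin (N + 1) → ℕ}
    (hα : ∀ i, α i < l) (w : Equiv.Perm (Fin (N + 1))) :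
    grCoef h α w 0 (cxProd f l L) = if w = cxPerm L ∧ IsCXExponent l L α then 1 else 0 := by
  obtain ⟨S, hS, h1⟩ := cxProd_leading_form f l hL.disjoint
  change cxProd f l L - _ ∈ _ at h1
  have h2 := grCoef_eq_zero h h1 (α := α) (w := w) (β := 0) fun hh => hh.2.1 rfl
  rw [map_sub, sub_eq_zero] at h2
  rw [h2, map_sum]
  simp only [grCoef_grMon h hα]
  have hS' : α ∈ S ↔ IsCXExponent l L α := by
    rw [hS]
    exact ⟨fun hh => hh.1, fun hh => ⟨hh, fun i hi => absurd (hL.cover i) hi⟩⟩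
  by_cases hc : w = cxPerm L ∧ IsCXExponent l L α
  · obtain ⟨rfl, hc⟩ := hc
    simp [hS', hc]
  · rw [if_neg hc]
    refine Finset.sum_eq_zero fun α' hα' => if_neg ?_
    rintro ⟨rfl, rfl, -⟩
    exact hc ⟨rfl, hS'.1 hα'⟩

/-- One common exponent identifies the factors, so all admissible exponents are common. -/
theorem isCXExponent_of_match (hL : IsCXFamily l L) (hL' : IsCXFamily l L')
    (hw : cxPerm L = cxPerm L') {α α' : Fin (N + 1) → ℕ} (hα : IsCXExponent l L α)
    (hα' : IsCXExponent l L' α) (h : IsCXExponent l L' α') : IsCXExponent l L α' := by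
  intro p hp
  obtain ⟨p', hp', h1, h2, h3⟩ := hL.exists_match hL' hw hα hα' hp
  rw [← h1, ← h2, ← h3]
  exact h p' hp'

/-- Products of CX-cycles are determined by one common exponent in their leading forms. -/
theorem cxProd_eq_of_match (h : IsOddMonic f l) (hL : IsCXFamily l L) (hL' : IsCXFamily l L')
    (hw : cxPerm L = cxPerm L') {α : Fin (N + 1) → ℕ} (hα : IsCXExponent l L α)
    (hα' : IsCXExponent l L' α) : cxProd f l L = cxProd f l L' := by
  classical
  rw [← sub_eq_zero]
  refine gr_ext h fun α' w β hα'l => ?_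
  rw [map_zero]
  have key : ∀ {L L' : List (List (Fin (N + 1)) × ℕ)}, IsCXFamily l L → IsCXFamily l L' →
      cxPerm L = cxPerm L' → IsCXExponent l L α → IsCXExponent l L' α →
      ¬(w = cxPerm L ∧ ∀ p ∈ L, (p.1.map β).sum = 0) → grCoef h α' w β (cxProd f l L') = 0 := by
    intro L L' hL hL' hw hα hα' hn
    refine grCoef_eq_zero h (cxProd_mem_grSpan f hL') fun hh => hn ⟨hh.1.trans hw.symm, ?_⟩
    intro p hp
    obtain ⟨p', hp', h1, -, -⟩ := hL.exists_match hL' hw hα hα' hp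
    rw [← hh.2 p' hp', ← List.sum_toFinset β (hL.nodup hp), ← List.sum_toFinset β (hL'.nodup hp'),
      h1]
  by_cases hc : w = cxPerm L ∧ ∀ p ∈ L, (p.1.map β).sum = 0
  · obtain ⟨rfl, hβ⟩ := hc
    refine grCoef_eq_zero_of_even h hL.isCycleFamily (fun j => ?_) hα'l (fun A hA => ?_) ?_
    · rw [mul_sub, sub_mul, grC_mul_cxProd h hL, grC_mul_cxProd h hL']
    · obtain ⟨p, hp, rfl⟩ := List.mem_map.1 hA
      exact hβ p hp
    · rw [map_sub, grCoef_cxProd h hL hα'l, grCoef_cxProd h hL' hα'l, sub_eq_zero]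
      refine if_congr (and_congr (by rw [hw]) ⟨fun hh => ?_, fun hh => ?_⟩) rfl rfl
      · exact isCXExponent_of_match hL' hL hw.symm hα' hα hh
      · exact isCXExponent_of_match hL hL' hw hα hα' hh
  · rw [map_sub, key hL hL' hw hα hα' hc, key hL hL rfl hα hα hc, sub_zero]

theorem grMon_mem_grEven (f : Polynomial R) (α : Fin (N + 1) → ℕ) (w : Equiv.Perm (Fin (N + 1)))
    {β : Fin (N + 1) → ZMod 2} (hβ : ∑ i, β i = 0) : grMon f α w β ∈ grEven (N + 1) f := by
  set v : List (SergeevGen (N + 1)) :=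
    (List.ofFn fun j => List.replicate (α j) (SergeevGen.x j)).flatten ++ [SergeevGen.perm w] ++
      (List.ofFn fun j => List.replicate (β j).val (SergeevGen.c j)).flatten with hv
  refine Submodule.subset_span ⟨v, ?_, ?_⟩
  · have h1 : (v.map SergeevGen.par).sum = ∑ i, (β i).val := by
      simp [hv, List.map_flatten, List.map_ofFn, List.sum_flatten, Function.comp_def,
        SergeevGen.par, List.sum_ofFn, Fin.sum_univ_succ]
    rw [h1, ← ZMod.natCast_eq_zero_iff_even]
    push_cast
    simpa using hβ
  · simp [hv, List.map_flatten, List.map_ofFn, List.prod_flatten, Function.comp_def, grMon, xMon,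
      cMon, grX, grC, grPerm, mul_assoc]

theorem cxProd_mem_grEven (f : Polynomial R) (hL : IsCXFamily l L) :
    cxProd f l L ∈ grEven (N + 1) f := by
  have h1 := cxProd_mem_grSpan f hL
  refine map_mem_of_grSpan (φ := LinearMap.id) (fun α w β hh => ?_) h1
  refine grMon_mem_grEven f α w ?_
  have h2 : (L.map Prod.fst).flatten.toFinset = Finset.univ :=
    Finset.eq_univ_of_forall fun i => List.mem_toFinset.2 (hL.cover i)
  rw [← h2, List.sum_toFinset β hL.disjoint, List.map_flatten, List.sum_flatten, List.map_map,
    List.map_map]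
  refine List.sum_eq_zero fun b hb => ?_
  obtain ⟨p, hp, rfl⟩ := List.mem_map.1 hb
  exact hh.2 p hp

theorem mem_grCenter (h : IsOddMonic f l) {z : GrSergeev (N + 1) f}
    (hx : ∀ j, grX f j * z = z * grX f j) (hc : ∀ j, grC f j * z = z * grC f j)
    (hp : ∀ σ, grPerm f σ * z = z * grPerm f σ) (he : z ∈ grEven (N + 1) f) :
    z ∈ grCenter (N + 1) f := by
  refine ⟨(Subalgebra.mem_center_iff (R := R)).2 fun y => ?_, he⟩
  have hmon : ∀ α w β, Commute z (grMon f α w β) := fun α w β => by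
    refine ((Commute.list_prod_right _ _ fun y hy => ?_).mul_right (hp w).symm).mul_right
      (Commute.list_prod_right _ _ fun y hy => ?_)
    · obtain ⟨j, rfl⟩ := (List.mem_ofFn' _ _).1 hy
      exact (show Commute z _ from (hx j).symm).pow_right _
    · obtain ⟨j, rfl⟩ := (List.mem_ofFn' _ _).1 hy
      exact (show Commute z _ from (hc j).symm).pow_right _
  have : LinearMap.mulRight R z = LinearMap.mulLeft R z :=
    gr_hom_ext h fun α w β _ => (hmon α w β).eq.symm
  exact LinearMap.congr_fun this y

theorem commute_of_mem_grCenter {z : GrSergeev (N + 1) f} (hz : z ∈ grCenter (N + 1) f)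
    (y : GrSergeev (N + 1) f) : y * z = z * y :=
  (Subalgebra.mem_center_iff (R := R)).1 hz.1 y

/-- The leading coefficients of a central element only depend on the cycle type. -/
theorem grCoef_eq_of_perm (h : IsOddMonic f l) (hL : IsCXFamily l L) (hL' : IsCXFamily l L')
    (hd : (cxData L).Perm (cxData L')) {α α' : Fin (N + 1) → ℕ} (hα : ∀ i, α i < l)
    (hα' : ∀ i, α' i < l) (he : IsCXExponent l L α) (he' : IsCXExponent l L' α')
    {z : GrSergeev (N + 1) f} (hx : ∀ j, grX f j * z = z * grX f j)
    (hp : ∀ σ, grPerm f σ * z = z * grPerm f σ) :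
    grCoef h α (cxPerm L) 0 z = grCoef h α' (cxPerm L') 0 z := by
  -- Conjugation by τ carries one permutation to the other. The resulting exponents have the same
  -- degree on each cycle, and `grCoef_eq_of_sum_eq` compares them.
  obtain ⟨τ, hτ⟩ := hL.exists_cxMap_perm hL' hd
  have hw : cxPerm L' = cxPerm (cxMap τ L) := by
    have h1 := (hL.map τ).isCycleFamily
    refine IsCycleFamily.eq (Ls := L'.map Prod.fst) hL'.isCycleFamily ⟨hL'.disjoint, hL'.cover, ?_⟩
    exact fun A hA => h1.apply_eq A ((hτ.map Prod.fst).mem_iff.2 hA)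
  have hw' : τ⁻¹ * cxPerm L' * τ = cxPerm L := by
    rw [hw, mul_assoc, ← mul_cxPerm, inv_mul_cancel_left]
  have hα'' : ∀ i, (fun i => α (τ⁻¹ i)) i < l := fun i => hα _
  have h1 := grCoef_conj h τ hα'' (cxPerm L') 0 z
  have hz : grPerm f τ⁻¹ * z * grPerm f τ = z := by
    rw [mul_assoc, ← hp, ← mul_assoc, ← grPerm_mul, inv_mul_cancel, grPerm_one, one_mul]
  have hα0 : (fun i => (fun i => α (τ⁻¹ i)) (τ i)) = α := by
    funext i
    simp
  have h2 : grPerm f τ⁻¹ * grMon f (fun i => α (τ⁻¹ i)) (cxPerm L') 0 * grPerm f τ =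
      grMon f α (cxPerm L) 0 := by
    rw [grPerm_mul_grMon, inv_inv]
    have e : ∀ (α : Fin (N + 1) → ℕ) (w : Equiv.Perm (Fin (N + 1))),
        grMon f α w 0 = xMon (grX f) α * grPerm f w := fun α w => by
      rw [grMon, IsClifford.cMon_zero, mul_one]
    rw [e, e, mul_assoc, ← grPerm_mul, hw', hα0]
  rw [hz, h2, hw', hα0] at h1
  have h3 := congrArg (grCoef h α (cxPerm L) 0) h1
  have h4 : grCoef h α (cxPerm L) 0 (grMon f α (cxPerm L) 0) = 1 := by
    rw [grCoef_grMon h hα, if_pos ⟨rfl, rfl, rfl⟩]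
  have h5 : (fun i : Fin (N + 1) => (0 : Fin (N + 1) → ZMod 2) (τ i)) = 0 := rfl
  rw [h5, map_smul, map_smul, h4, smul_eq_mul, smul_eq_mul, mul_one, mul_one] at h3
  rw [h3]
  refine grCoef_eq_of_sum_eq h hL'.isCycleFamily hx hα'' hα' fun A hA => ?_
  obtain ⟨p, hp, rfl⟩ := List.mem_map.1 hA
  rw [he' p hp]
  obtain ⟨q, hq, rfl⟩ := List.mem_map.1 (hτ.mem_iff.2 hp)
  have h6 : (q.1.map τ).toFinset = q.1.toFinset.image τ := by
    ext i
    simp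
  change ∑ i ∈ (q.1.map τ).toFinset, α (τ⁻¹ i) = ((q.1.map τ).length - 1) * (l - 1) + q.2
  rw [h6, Finset.sum_image fun _ _ _ _ e => τ.injective e, List.length_map, ← he q hq]
  simp

/-- A nonzero coefficient excludes both vanishing criteria on every cycle, and what remains are the
degree and parity conditions of a CX-family. -/
theorem exists_cxFamily_of_grCoef_ne_zero (h : IsOddMonic f l)
    (h2 : ∀ a : R, 2 * a = 0 → a = 0) {z : GrSergeev (N + 1) f}
    (hx : ∀ j, grX f j * z = z * grX f j) (hc : ∀ j, grC f j * z = z * grC f j)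
    {α : Fin (N + 1) → ℕ} (hα : ∀ i, α i < l) {w : Equiv.Perm (Fin (N + 1))}
    (h0 : grCoef h α w 0 z ≠ 0) : ∃ L, IsCXFamily l L ∧ cxPerm L = w ∧ IsCXExponent l L α := by
  obtain ⟨Ls, hne, hLs⟩ := exists_isCycleFamily w
  refine hLs.exists_cxFamily hne h.odd hα (fun A hA => ?_) fun A hA hodd => ?_
  · by_contra hlt
    exact h0 (grCoef_eq_zero_of_lt h ((List.nodup_flatten.1 hLs.nodup).1 A hA) (hLs.apply_eq A hA)
      hx hα (not_le.1 hlt))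
  · exact h0 (grCoef_eq_zero_of_odd_add h h2 ((List.nodup_flatten.1 hLs.nodup).1 A hA)
      (hLs.apply_eq A hA) hc hα hodd)

theorem finite_cxProducts (f : Polynomial R) (lam : Multipartition l (N + 1)) :
    (cxProducts f lam).Finite := by
  refine ((finite_cxFamilies (N + 1) l).image (cxProd f l)).subset ?_
  rintro y ⟨L, hL, -, rfl⟩
  exact ⟨L, hL, rfl⟩

theorem zElt_eq_sum (f : Polynomial R) (lam : Multipartition l (N + 1)) :
    zElt f lam = ∑ y ∈ (finite_cxProducts f lam).toFinset, y :=
  finsum_mem_eq_finite_toFinset_sum _ _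

-- Distinct products have disjoint leading supports by `cxProd_eq_of_match`, so exactly one summand
-- contributes. Summing over distinct elements rather than lists is what makes the coefficient 1.
open Classical in
theorem grCoef_zElt (h : IsOddMonic f l) (lam : Multipartition l (N + 1)) {α : Fin (N + 1) → ℕ}
    (hα : ∀ i, α i < l) (w : Equiv.Perm (Fin (N + 1))) : grCoef h α w 0 (zElt f lam) =
      if ∃ L, IsCXFamily l L ∧ HasCycleType L lam ∧ w = cxPerm L ∧ IsCXExponent l L α
        then 1 else 0 := by
  rw [zElt_eq_sum, map_sum]
  split_ifs with hc
  · obtain ⟨L, hL, ht, rfl, he⟩ := hc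
    rw [Finset.sum_eq_single (cxProd f l L), grCoef_cxProd h hL hα, if_pos ⟨rfl, he⟩]
    · intro y hy hne
      obtain ⟨L', hL', -, rfl⟩ := (Set.Finite.mem_toFinset _).1 hy
      refine (grCoef_cxProd h hL' hα _).trans (if_neg ?_)
      rintro ⟨hw, he'⟩
      exact hne (cxProd_eq_of_match h hL' hL hw.symm he' he)
    · intro hn
      exact (hn ((Set.Finite.mem_toFinset _).2 ⟨L, hL, ht, rfl⟩)).elim
  · refine Finset.sum_eq_zero fun y hy => ?_
    obtain ⟨L, hL, ht, rfl⟩ := (Set.Finite.mem_toFinset _).1 hy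
    exact (grCoef_cxProd h hL hα _).trans (if_neg fun hh => hc ⟨L, hL, ht, hh⟩)

/-- Each product commutes with the x_i and c_i, and conjugation by a permutation permutes the
products of a given cycle type. -/
theorem zElt_mem_grCenter (h : IsOddMonic f l) (lam : Multipartition l (N + 1)) :
    zElt f lam ∈ grCenter (N + 1) f := by
  rw [zElt_eq_sum]
  refine mem_grCenter h (fun j => ?_) (fun j => ?_) (fun σ => ?_)
    (Submodule.sum_mem _ fun y hy => ?_)
  · rw [Finset.mul_sum, Finset.sum_mul]
    refine Finset.sum_congr rfl fun y hy => ?_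
    obtain ⟨L, hL, -, rfl⟩ := (Set.Finite.mem_toFinset _).1 hy
    exact grX_mul_cxProd h hL j
  · rw [Finset.mul_sum, Finset.sum_mul]
    refine Finset.sum_congr rfl fun y hy => ?_
    obtain ⟨L, hL, -, rfl⟩ := (Set.Finite.mem_toFinset _).1 hy
    exact grC_mul_cxProd h hL j
  · rw [Finset.mul_sum, Finset.sum_mul]
    have hinv : ∀ (σ : Equiv.Perm (Fin (N + 1))) (y : GrSergeev (N + 1) f),
        grPerm f σ⁻¹ * (grPerm f σ * y * grPerm f σ⁻¹) * grPerm f σ = y := fun σ y => by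
      have e : grPerm f σ⁻¹ * grPerm f σ = 1 := by rw [← grPerm_mul, inv_mul_cancel, grPerm_one]
      rw [mul_assoc, mul_assoc, e, mul_one, ← mul_assoc, e, one_mul]
    have hmem : ∀ (σ : Equiv.Perm (Fin (N + 1))), ∀ y ∈ (finite_cxProducts f lam).toFinset,
        grPerm f σ * y * grPerm f σ⁻¹ ∈ (finite_cxProducts f lam).toFinset := by
      intro σ y hy
      obtain ⟨L, hL, ht, rfl⟩ := (Set.Finite.mem_toFinset _).1 hy
      refine (Set.Finite.mem_toFinset _).2 ⟨cxMap σ L, hL.map σ, ht.of_perm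
        (by rw [cxData_cxMap]), ?_⟩
      change grPerm f σ * cxProd f l L * grPerm f σ⁻¹ = cxProd f l (cxMap σ L)
      rw [grPerm_mul_cxProd, mul_assoc, ← grPerm_mul, mul_inv_cancel, grPerm_one, mul_one]
    refine Finset.sum_bij' (fun y _ => grPerm f σ * y * grPerm f σ⁻¹)
      (fun y _ => grPerm f σ⁻¹ * y * grPerm f σ) (hmem σ) (fun y hy => ?_) (fun y _ => hinv σ y)
      (fun y _ => ?_) fun y _ => ?_
    · have := hmem σ⁻¹ y hy
      rwa [inv_inv] at this
    · have := hinv σ⁻¹ y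
      rwa [inv_inv] at this
    · rw [mul_assoc, ← grPerm_mul, inv_mul_cancel, grPerm_one, mul_one]
  · obtain ⟨L, hL, -, rfl⟩ := (Set.Finite.mem_toFinset _).1 hy
    exact cxProd_mem_grEven f hL

theorem exists_basis_grCenter (h : IsOddMonic f l) (h2 : ∀ a : R, 2 * a = 0 → a = 0) :
    ∃ b : Module.Basis (evMultipartitions l (N + 1)) R (grCenter (N + 1) f),
      ∀ lam : evMultipartitions l (N + 1), (b lam : GrSergeev (N + 1) f) = zElt f lam.1 := by
  classical
  have : Fintype (evMultipartitions l (N + 1)) := (finite_evMultipartitions l (N + 1)).fintype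
  -- One reduced leading exponent per multipartition is chosen; the coefficient functionals there
  -- are dual to the elements z_d(λ).
  have hex : ∀ lam : evMultipartitions l (N + 1), ∃ (L : List (List (Fin (N + 1)) × ℕ))
      (α : Fin (N + 1) → ℕ), IsCXFamily l L ∧ HasCycleType L lam.1 ∧ (∀ i, α i < l) ∧
        IsCXExponent l L α := by
    rintro ⟨lam, L, hL, ht⟩
    obtain ⟨α, h1, h3⟩ := exists_exponents hL.disjoint hL.ne_nil hL.lt_level h.one_le
    exact ⟨L, α, hL, ht, h1, h3⟩
  choose Λ a hΛ ht ha he using hex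
  have hcoef : ∀ (c : evMultipartitions l (N + 1) → R) (mu : evMultipartitions l (N + 1))
      {L : List (List (Fin (N + 1)) × ℕ)} {α : Fin (N + 1) → ℕ}, IsCXFamily l L →
      HasCycleType L mu.1 → (∀ i, α i < l) → IsCXExponent l L α →
      grCoef h α (cxPerm L) 0 (∑ lam, c lam • zElt f lam.1) = c mu := by
    intro c mu L α hL hLt hα hLe
    rw [map_sum, Finset.sum_eq_single mu]
    · rw [map_smul, grCoef_zElt h mu.1 hα, if_pos ⟨L, hL, hLt, rfl, hLe⟩, smul_eq_mul, mul_one]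
    · intro lam _ hne
      rw [map_smul, grCoef_zElt h lam.1 hα, if_neg, smul_zero]
      rintro ⟨L', hL', hLt', hw, hLe'⟩
      have hd := hL'.perm_of_match hL hw.symm hLe' hLe
      exact hne (Subtype.ext ((hLt'.of_perm hd).unique hLt))
    · exact fun hn => absurd (Finset.mem_univ _) hn
  have hli : LinearIndependent R fun lam : evMultipartitions l (N + 1) =>
      (⟨zElt f lam.1, zElt_mem_grCenter h lam.1⟩ : grCenter (N + 1) f) := by
    rw [Fintype.linearIndependent_iff]
    intro c hc mu
    have h3 := congrArg (fun z : grCenter (N + 1) f => (z : GrSergeev (N + 1) f)) hc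
    simp only [Submodule.coe_sum, Submodule.coe_smul, Submodule.coe_zero] at h3
    rw [← hcoef c mu (hΛ mu) (ht mu) (ha mu) (he mu), h3, map_zero]
  have hsp : ⊤ ≤ Submodule.span R (Set.range fun lam : evMultipartitions l (N + 1) =>
      (⟨zElt f lam.1, zElt_mem_grCenter h lam.1⟩ : grCenter (N + 1) f)) := by
    rintro ⟨z, hz⟩ -
    -- After subtracting the combination with these coefficients, every Clifford-free coefficient
    -- vanishes, since it depends only on the cycle type. `eq_zero_of_mem_grCenter` then gives zero.
    set c : evMultipartitions l (N + 1) → R := fun lam =>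
      grCoef h (a lam) (cxPerm (Λ lam)) 0 z with hc
    have hz' : z - ∑ lam, c lam • zElt f lam.1 ∈ grCenter (N + 1) f :=
      sub_mem hz (Submodule.sum_mem _ fun lam _ => Submodule.smul_mem _ _
        (zElt_mem_grCenter h lam.1))
    have hcomm := commute_of_mem_grCenter hz'
    have h0 := eq_zero_of_mem_grCenter h h2 (fun j => hcomm (grX f j)) (fun j => hcomm (grC f j))
      (fun σ => hcomm (grPerm f σ)) hz'.2 fun α w hα => by
        by_contra hne
        obtain ⟨L, hL, rfl, hLe⟩ := exists_cxFamily_of_grCoef_ne_zero h h2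
          (fun j => hcomm (grX f j)) (fun j => hcomm (grC f j)) hα hne
        obtain ⟨mu, hmu⟩ := hL.exists_hasCycleType
        refine hne ?_
        rw [map_sub, hcoef c ⟨mu, L, hL, hmu⟩ hL hmu hα hLe, sub_eq_zero]
        have hcz := commute_of_mem_grCenter hz
        exact grCoef_eq_of_perm h hL (hΛ _) (HasCycleType.perm hL (hΛ _) hmu (ht ⟨mu, L, hL, hmu⟩))
          hα (ha _) hLe (he _) (fun j => hcz (grX f j)) fun σ => hcz (grPerm f σ)
    have h3 : (⟨z, hz⟩ : grCenter (N + 1) f) = ∑ lam, c lam •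
        (⟨zElt f lam.1, zElt_mem_grCenter h lam.1⟩ : grCenter (N + 1) f) := by
      apply Subtype.ext
      simp only [Submodule.coe_sum, Submodule.coe_smul]
      exact sub_eq_zero.1 h0
    rw [h3]
    exact Submodule.sum_mem _ fun lam _ => Submodule.smul_mem _ _
      (Submodule.subset_span ⟨lam, rfl⟩)
  refine ⟨Module.Basis.mk hli hsp, fun lam => ?_⟩
  rw [Module.Basis.mk_apply]

end CXProducts

/-! ### The theorem. -/

theorem mainTheorem2 {R : Type*} [CommRing R] (h2 : ∀ a : R, 2 * a = 0 → a = 0)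
    (d l : ℕ) (hd : 1 ≤ d) (hl : Odd l)
    (f : Polynomial R) (hmonic : f.Monic) (hdeg : f.natDegree = l)
    (hpar : ∀ k, f.coeff k ≠ 0 → k % 2 = l % 2) :
    (∃ b : Module.Basis (evMultipartitions l d) R (grCenter d f),
        ∀ lam : evMultipartitions l d, (b lam : GrSergeev d f) = zElt f lam.1) ∧
      (∀ (A : List (Fin d)) (z : GrSergeev d f), IsOddSkewCycle f A z →
        (∑ τ : Equiv.Perm (Fin d) with ∀ i, i ∉ A → τ i = i,
            grPerm f τ * z * grPerm f τ⁻¹) = 0 ∧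
        (∑ τ : Equiv.Perm (Fin d), grPerm f τ * z * grPerm f τ⁻¹) = 0) := by
  obtain ⟨N, rfl⟩ : ∃ N, d = N + 1 := ⟨d - 1, by omega⟩
  have h : IsOddMonic f l := ⟨hmonic, hdeg, fun k hk => by
    rw [Nat.odd_iff, hpar k hk]
    exact Nat.odd_iff.1 hl, hl⟩
  exact ⟨exists_basis_grCenter h h2, fun A z hz => hz.sum_conj_eq_zero h h2⟩
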